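/- Let $(V,\otimes,I)$ be a cocomplete symmetric monoidal category (in particular, a bicomplete one) such that $X\otimes-$ preserves finite colimits and countable coproducts for every object $X$; this holds for instance if $V$ is closed. **$\Lambda$-sequences.** Let $\Lambda$ be the category whose objects are the based sets $\mathbf n=\{0,1,\dots,n\}$ ($n\ge 0$, basepoint $0$) and whose morphisms are the based injections, equivalently the injections $\{1,\dots,m\}\to\{1,\dots,n\}$; let $\Sigma\subset\Lambda$ be the subcategory of all objects and bijections. A *$\Lambda$-sequence* (with base map) is a functor $D:\Lambda^{op}\to V$ together with a morphism $I\to D(0)$, its base map; morphisms are natural transformations compatible with the base maps. It is *unital* if its base map is an isomorphism (so that $D(0)$ is identified with $I$). **Kelly product.** For a $\Lambda$-sequence $E$ let $E^{\boxtimes k}:\Lambda^{op}\to V$ be the $k$-fold Day power $$E^{\boxtimes k}(n)=\int^{(j_1,\dots,j_k)\in\Lambda^k}E(j_1)\otimes\cdots\otimes E(j_k)\otimes\Lambda(\mathbf n,\mathbf{j_1+\cdots+j_k}),$$ where $\otimes$ with a set denotes a copower. It is covariantly functorial in $\mathbf k\in\Lambda$: bijections permute the factors, and injections insert the base map of $E$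 in the factors outside the image. The Kelly product is $$(D\odot E)(n)=\int^{\mathbf k\in\Lambda}D(k)\otimes E^{\boxtimes k}(n),$$ with the base map $I\to D(0)\to D(0)\otimes E^{\boxtimes 0}(0)\to(D\odot E)(0)$. The unit is $I_1=I\otimes\Lambda(-,\mathbf 1)$, with base map the coprojection $I\to I_1(0)$ at the unique morphism $\mathbf 0\to\mathbf 1$. **Operads.** An *operad* in $V$ consists of objects $C(n)$ with right $\Sigma_n$-actions, structure maps $$\gamma: C(k)\otimes C(j_1)\otimes\cdots\otimes C(j_k)\to C(j_1+\cdots+j_k)\qquad(k,j_s\ge0)$$ and a unit $I\to C(1)$, subject to the usual associativity, unit and equivariance axioms. A *based operad* is an operad with a morphism $I\to C(0)$, its base map; morphisms of based operads are the morphisms of operads compatible with the base maps. A *unital operad* is a based operad whose base map is an isomorphism (so that $C(0)$ is identified with $I$). **Theorem.** 1. The category of $\Lambda$-sequences is monoidal under $\odot$, with unit object $I_1$ and with the canonical associativity and unit isomorphisms, that is, those given on the canonical maps $D(k)\otimes E(j_1)\otimes\cdots\otimes E(j_k)\to(D\odot E)(j_1+\cdots+j_k)$ by the associativity, unit and symmetry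 isomorphisms of $V$. 2. For a monoid $C$ in the monoidal category of $\Lambda$-sequences, the underlying $\Sigma$-sequence of $C$, the base map of $C$, the composites $C(k)\otimes C(j_1)\otimes\cdots\otimes C(j_k)\to(C\odot C)(j_1+\cdots+j_k)\to C(j_1+\cdots+j_k)$ and the composite $I\to I_1(1)\to C(1)$ form a based operad. The resulting functor is an isomorphism of categories from the category of monoids in $\Lambda$-sequences onto the category of based operads in $V$. 3. The full subcategory of unital $\Lambda$-sequences contains $I_1$ and is closed under $\odot$, hence is monoidal. The functor of part 2 restricts to an isomorphism of categories from the category of monoids in unital $\Lambda$-sequences onto the category of unital operads in $V$. -/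

import Mathlib

open CategoryTheory Limits MonoidalCategory Opposite

universe v u

noncomputable section

namespace LambdaOperad

/-! ### The categories `Λ` and `Σ` -/

/-- The category `Λ`.  The object `⟨n⟩` is the based set `{0, 1, …, n}`; a based injection
`{0, …, m} → {0, …, n}` is the same thing as an injection of the sets of non-base points. -/
structure Lam : Type where
  /-- The number of non-base points. -/
  n : ℕ

instance : SmallCategory Lam where
  Hom a b := Fin a.n ↪ Fin b.n
  id a := Function.Embedding.refl _
  comp f g := f.trans g

/-- The injection underlying a morphism of `Λ`. -/
abbrev Lam.emb {a b : Lam} (f : a ⟶ b) : Fin a.n ↪ Fin b.n := f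

/-- The category `Σ`, with the same objects as `Λ` and with the bijections as morphisms. -/
structure Sig : Type where
  /-- The number of non-base points. -/
  n : ℕ

instance : SmallCategory Sig where
  Hom a b := Fin a.n ≃ Fin b.n
  id a := Equiv.refl _
  comp f g := f.trans g

/-- The inclusion `Σ ⊂ Λ`. -/
def Sig.toLam : Sig ⥤ Lam where
  obj a := ⟨a.n⟩
  map f := Equiv.toEmbedding f

/-- Given `φ : {1, …, k} → {1, …, l}` injective and injections `f s : j s → j' (φ s)`, the injection
`j 1 + ⋯ + j k → j' 1 + ⋯ + j' l` that maps the `s`-th block to the `φ s`-th block by `f s`. -/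
def blockEmb {k l : ℕ} {j : Fin k → ℕ} {j' : Fin l → ℕ} (φ : Fin k ↪ Fin l)
    (f : ∀ s, Fin (j s) ↪ Fin (j' (φ s))) : Fin (∑ s, j s) ↪ Fin (∑ t, j' t) :=
  finSigmaFinEquiv.symm.toEmbedding.trans
    ((Function.Embedding.sigmaMap φ f).trans finSigmaFinEquiv.toEmbedding)

/-- The bijective version of `blockEmb`. -/
def blockEquiv {k l : ℕ} {j : Fin k → ℕ} {j' : Fin l → ℕ} (σ : Fin k ≃ Fin l)
    (f : ∀ s, Fin (j s) ≃ Fin (j' (σ s))) : Fin (∑ s, j s) ≃ Fin (∑ t, j' t) :=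
  finSigmaFinEquiv.symm.trans ((Equiv.sigmaCongr σ f).trans finSigmaFinEquiv)

lemma blockEmb_apply {k l : ℕ} {j : Fin k → ℕ} {j' : Fin l → ℕ} (φ : Fin k ↪ Fin l)
    (f : ∀ s, Fin (j s) ↪ Fin (j' (φ s))) (s : Fin k) (q : Fin (j s)) :
    blockEmb φ f (finSigmaFinEquiv ⟨s, q⟩) = finSigmaFinEquiv ⟨φ s, f s q⟩ := by
  simp only [blockEmb, Function.Embedding.trans_apply, Equiv.coe_toEmbedding,
    Equiv.symm_apply_apply]
  rfl

lemma blockEmb_ext {k n : ℕ} {j : Fin k → ℕ} {f g : Fin (∑ s, j s) ↪ Fin n}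
    (h : ∀ s q, f (finSigmaFinEquiv ⟨s, q⟩) = g (finSigmaFinEquiv ⟨s, q⟩)) : f = g := by
  refine Function.Embedding.ext fun x => ?_
  obtain ⟨⟨s, q⟩, rfl⟩ := finSigmaFinEquiv.surjective x
  exact h s q

/-- The `k`-fold wedge `Λ^k ⥤ Λ`, `(j 1, …, j k) ↦ j 1 + ⋯ + j k`. -/
def wedge (k : ℕ) : (Fin k → Lam) ⥤ Lam where
  obj j := ⟨∑ s, (j s).n⟩
  map {j j'} f := blockEmb (j := fun s => (j s).n) (j' := fun s => (j' s).n)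
    (Function.Embedding.refl _) f
  map_id j := blockEmb_ext (j := fun s => (j s).n) fun s q =>
    blockEmb_apply (j := fun s => (j s).n) (j' := fun s => (j s).n) _ _ s q
  map_comp {j j' j''} f g := blockEmb_ext (j := fun s => (j s).n) fun s q => by
    refine (blockEmb_apply (j := fun s => (j s).n) (j' := fun s => (j'' s).n) _ _ s q).trans ?_
    symm
    refine (congrArg (blockEmb (j := fun s => (j' s).n) (j' := fun s => (j'' s).n)
      (Function.Embedding.refl _) g)
      (blockEmb_apply (j := fun s => (j s).n) (j' := fun s => (j' s).n) _ _ s q)).trans ?_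
    exact blockEmb_apply (j := fun s => (j' s).n) (j' := fun s => (j'' s).n) _ _ s _

/-! ### Finite tensor products -/

section Tensor

variable {V : Type u} [Category.{v} V] [MonoidalCategory V] {ι κ : Type}

/-- `X a₁ ⊗ (X a₂ ⊗ ⋯ (X aₙ ⊗ 𝟙_ V))` for a list `[a₁, …, aₙ]` of labels. -/
@[reducible] def tens (X : ι → V) : List ι → V
  | [] => 𝟙_ V
  | a :: l => X a ⊗ tens X l

/-- Functoriality of `tens` in the factors. -/
def tensMap {X Y : ι → V} (f : ∀ i, X i ⟶ Y i) : ∀ l : List ι, tens X l ⟶ tens Y l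
  | [] => 𝟙 _
  | a :: l => f a ⊗ₘ tensMap f l

/-- The morphism `𝟙_ V ≅ 𝟙_ V ⊗ ⋯ ⊗ 𝟙_ V ⟶ X a₁ ⊗ ⋯ ⊗ X aₙ` given by morphisms
`𝟙_ V ⟶ X i`. -/
def tensUnits {X : ι → V} (f : ∀ i, 𝟙_ V ⟶ X i) : ∀ l : List ι, 𝟙_ V ⟶ tens X l
  | [] => 𝟙 _
  | a :: l => (λ_ _).inv ≫ (f a ⊗ₘ tensUnits f l)

/-- Relabelling of a tensor product. -/
def tensRelabel (X : ι → V) (e : κ → ι) : ∀ l : List κ, tens (fun i => X (e i)) l ≅ tens X (l.map e)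
  | [] => Iso.refl _
  | a :: l => whiskerLeftIso (X (e a)) (tensRelabel X e l)

lemma tensRelabel_naturality {X Y : ι → V} (g : ∀ i, X i ⟶ Y i) (e : κ → ι) : ∀ l : List κ,
    tensMap (fun i => g (e i)) l ≫ (tensRelabel Y e l).hom =
      (tensRelabel X e l).hom ≫ tensMap g (l.map e)
  | [] => rfl
  | a :: l => by
    change (g (e a) ⊗ₘ tensMap (fun i => g (e i)) l) ≫ (Y (e a) ◁ (tensRelabel Y e l).hom) =
      (X (e a) ◁ (tensRelabel X e l).hom) ≫ (g (e a) ⊗ₘ tensMap g (l.map e))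
    rw [← id_tensorHom, ← id_tensorHom, tensorHom_comp_tensorHom, tensorHom_comp_tensorHom,
      tensRelabel_naturality, Category.comp_id, Category.id_comp]

/-- Concatenation of tensor products. -/
def tensAppend (X : ι → V) (m : List ι) : ∀ l : List ι, tens X l ⊗ tens X m ≅ tens X (l ++ m)
  | [] => λ_ _
  | a :: l => α_ _ _ _ ≪≫ whiskerLeftIso (X a) (tensAppend X m l)

/-- An iterated tensor product is a tensor product over the (lexicographically ordered) list of
pairs. -/
def tensSigma {β : ι → Type} (X : (Σ i, β i) → V) (m : ∀ i, List (β i)) : ∀ l : List ι,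
    tens (fun i => tens (fun q => X ⟨i, q⟩) (m i)) l ≅ tens X (l.sigma m)
  | [] => Iso.refl _
  | a :: l => (tensRelabel X (Sigma.mk a) (m a) ⊗ᵢ tensSigma X m l) ≪≫ tensAppend X _ _

lemma tensMap_id (X : ι → V) : ∀ l : List ι, tensMap (fun i => 𝟙 (X i)) l = 𝟙 (tens X l)
  | [] => rfl
  | a :: l => by rw [tensMap, tensMap_id X l, id_tensorHom_id]

lemma tensMap_comp {X Y Z : ι → V} (f : ∀ i, X i ⟶ Y i) (g : ∀ i, Y i ⟶ Z i) :
    ∀ l : List ι, tensMap (fun i => f i ≫ g i) l = tensMap f l ≫ tensMap g l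
  | [] => (Category.comp_id _).symm
  | a :: l => by
    rw [tensMap, tensMap_comp f g l, tensMap, tensMap, tensorHom_comp_tensorHom]

lemma tensMap_eqToHom {X Y : ι → V} (g : ∀ i, X i ⟶ Y i) {l m : List ι} (h : l = m) :
    eqToHom (congrArg (tens X) h) ≫ tensMap g m = tensMap g l ≫ eqToHom (congrArg (tens Y) h) := by
  subst h
  simp

variable [SymmetricCategory V]

/-- `(⨂ A i) ⊗ (⨂ B i) ⟶ ⨂ (A i ⊗ B i)`, the shuffle of the factors. -/
def tensZip (A B : ι → V) : ∀ l : List ι, tens A l ⊗ tens B l ⟶ tens (fun i => A i ⊗ B i) l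
  | [] => (λ_ _).hom
  | a :: l => tensorμ (A a) (tens A l) (B a) (tens B l) ≫ ((A a ⊗ B a) ◁ tensZip A B l)

/-- `A ⊗ (B ⊗ C) ⟶ B ⊗ (A ⊗ C)` -/
def swapFront (A B C : V) : A ⊗ (B ⊗ C) ⟶ B ⊗ (A ⊗ C) :=
  (α_ A B C).inv ≫ ((β_ A B).hom ▷ C) ≫ (α_ B A C).hom

lemma swapFront_naturality {A A' B B' C C' : V} (f : A ⟶ A') (g : B ⟶ B') (h : C ⟶ C') :
    (f ⊗ₘ (g ⊗ₘ h)) ≫ swapFront A' B' C' = swapFront A B C ≫ (g ⊗ₘ (f ⊗ₘ h)) := by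
  simp only [swapFront, Category.assoc, associator_inv_naturality_assoc]
  rw [← associator_naturality, ← tensorHom_id, ← tensorHom_id, tensorHom_comp_tensorHom_assoc,
    tensorHom_comp_tensorHom_assoc, BraidedCategory.braiding_naturality, Category.id_comp,
    Category.comp_id]

variable [DecidableEq ι]

/-- Move the factor labelled by `a` to the front. -/
def pull (X : ι → V) (a : ι) : ∀ l : List ι, a ∈ l → (tens X l ⟶ X a ⊗ tens X (l.erase a))
  | [], h => absurd h List.not_mem_nil
  | b :: l, h =>
    if hb : b = a then eqToHom (by subst hb; simp [tens])
    else (X b ◁ pull X a l (List.mem_of_ne_of_mem (Ne.symm hb) h)) ≫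
      swapFront (X b) (X a) _ ≫ (X a ◁ eqToHom (by rw [List.erase_cons_tail (by simpa using hb)]))

lemma pull_naturality {X Y : ι → V} (g : ∀ i, X i ⟶ Y i) (a : ι) : ∀ (l : List ι) (h : a ∈ l),
    tensMap g l ≫ pull Y a l h = pull X a l h ≫ (g a ⊗ₘ tensMap g (l.erase a))
  | [], h => absurd h List.not_mem_nil
  | b :: l, h => by
    by_cases hb : b = a
    · subst hb
      simp only [pull, dif_pos]
      exact (tensMap_eqToHom g (l := b :: l) (m := b :: (b :: l).erase b) (by simp)).symm
    · have ih := pull_naturality g a l (List.mem_of_ne_of_mem (Ne.symm hb) h)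
      have hl : b :: l.erase a = (b :: l).erase a := by
        rw [List.erase_cons_tail (by simpa using hb)]
      have hg : eqToHom (congrArg (tens X) hl) ≫ tensMap g ((b :: l).erase a) =
          (g b ⊗ₘ tensMap g (l.erase a)) ≫ eqToHom (congrArg (tens Y) hl) := tensMap_eqToHom g hl
      simp only [pull, dif_neg hb, tensMap, Category.assoc]
      rw [← id_tensorHom (Y a), ← id_tensorHom (X a), ← id_tensorHom (Y b), ← id_tensorHom (X b),
        tensorHom_comp_tensorHom_assoc, ih, Category.comp_id, tensorHom_comp_tensorHom,
        Category.id_comp, hg, ← Category.id_comp (g b), ← tensorHom_comp_tensorHom_assoc,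
        ← Category.assoc (tensorHom _ _) (swapFront _ _ _), swapFront_naturality]
      simp only [Category.assoc, tensorHom_comp_tensorHom, Category.comp_id, Category.id_comp]

/-- The canonical morphism `⨂_{a ∈ l} X a ⟶ ⨂_{a ∈ m} X a` for duplicate-free lists `l ⊆ m`
of labels: it permutes the factors as prescribed by the labels, by means of the symmetry of `V`, and
inserts the morphisms `f a : 𝟙_ V ⟶ X a` at the labels `a` that do not occur in `l`. -/
def rearrange (X : ι → V) {P : ι → Prop} (f : ∀ a, P a → (𝟙_ V ⟶ X a)) : ∀ (m l : List ι),
    l.Nodup → m.Nodup → (∀ a ∈ l, a ∈ m) → (∀ a ∈ m, a ∉ l → P a) → (tens X l ⟶ tens X m)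
  | [], _, _, _, hs, _ => eqToHom (congrArg (tens X)
      (List.eq_nil_iff_forall_not_mem.2 fun a ha => List.not_mem_nil (hs a ha)))
  | a :: m, l, hl, hm, hs, hP =>
    if ha : a ∈ l then
      pull X a l ha ≫ (X a ◁ rearrange X f m (l.erase a) (hl.erase a) (List.nodup_cons.1 hm).2
        (fun b hb => by
          have h := (hl.mem_erase_iff).1 hb
          exact List.mem_of_ne_of_mem h.1 (hs _ h.2))
        (fun b hb hbl => hP b (List.mem_cons_of_mem _ hb) (fun hbl' => hbl
          ((hl.mem_erase_iff).2 ⟨fun e => (List.nodup_cons.1 hm).1 (e ▸ hb), hbl'⟩))))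
    else
      (λ_ _).inv ≫ (f a (hP a List.mem_cons_self ha) ⊗ₘ rearrange X f m l hl
        (List.nodup_cons.1 hm).2
        (fun b hb => List.mem_of_ne_of_mem (fun e => ha (by rwa [← e])) (hs b hb))
        (fun b hb hbl => hP b (List.mem_cons_of_mem _ hb) hbl))

lemma rearrange_naturality {X Y : ι → V} {P : ι → Prop} (f : ∀ a, P a → (𝟙_ V ⟶ X a))
    (f' : ∀ a, P a → (𝟙_ V ⟶ Y a)) (g : ∀ i, X i ⟶ Y i) (hf : ∀ a h, f a h ≫ g a = f' a h) :
    ∀ (m l : List ι) (hl : l.Nodup) (hm : m.Nodup) (hs : ∀ a ∈ l, a ∈ m) (hP : ∀ a ∈ m, a ∉ l → P a),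
    tensMap g l ≫ rearrange Y f' m l hl hm hs hP = rearrange X f m l hl hm hs hP ≫ tensMap g m
  | [], _, _, _, hs, _ => by
    obtain rfl := List.eq_nil_iff_forall_not_mem.2 fun a ha => List.not_mem_nil (hs a ha)
    simp [rearrange]
  | a :: m, l, hl, hm, hs, hP => by
    by_cases ha : a ∈ l
    · simp only [rearrange, dif_pos ha, Category.assoc]
      rw [← Category.assoc, pull_naturality, Category.assoc, ← id_tensorHom, ← id_tensorHom,
        tensorHom_comp_tensorHom, rearrange_naturality f f' g hf, tensMap, tensorHom_comp_tensorHom,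
        Category.comp_id, Category.id_comp]
    · simp only [rearrange, dif_neg ha, Category.assoc, tensMap, tensorHom_comp_tensorHom, hf]
      rw [← rearrange_naturality f f' g hf, ← Category.assoc, leftUnitor_inv_naturality,
        ← id_tensorHom, Category.assoc, tensorHom_comp_tensorHom, Category.id_comp]

end Tensor

section FinTensor

variable {V : Type u} [Category.{v} V] [MonoidalCategory V]

/-- `X 1 ⊗ ⋯ ⊗ X k` (which is `𝟙_ V` for `k = 0`). -/
abbrev finTensor {k : ℕ} (X : Fin k → V) : V := tens X (List.finRange k)

/-- `X 1 ⊗ ⋯ ⊗ X k ⟶ Y 1 ⊗ ⋯ ⊗ Y k`. -/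
abbrev finTensorMap {k : ℕ} {X Y : Fin k → V} (f : ∀ s, X s ⟶ Y s) : finTensor X ⟶ finTensor Y :=
  tensMap f (List.finRange k)

/-- `𝟙_ V ≅ 𝟙_ V ⊗ ⋯ ⊗ 𝟙_ V ⟶ X 1 ⊗ ⋯ ⊗ X k`. -/
abbrev finTensorUnits {k : ℕ} {X : Fin k → V} (f : ∀ s, 𝟙_ V ⟶ X s) : 𝟙_ V ⟶ finTensor X :=
  tensUnits f (List.finRange k)

/-- The one-fold tensor product is `X 1`. -/
def finTensorOne (X : Fin 1 → V) : finTensor X ≅ X 0 :=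
  eqToIso (congrArg (tens X) (List.finRange_succ (n := 0))) ≪≫ ρ_ (X 0)

variable [SymmetricCategory V]

/-- For an injection `φ`, the morphism `⨂ₛ X (φ s) ⟶ ⨂ₜ X t` that permutes the factors as prescribed
by `φ` and inserts `f t : 𝟙_ V ⟶ X t` at the places `t` that are not in the image of `φ`. -/
def spread {k l : ℕ} (φ : Fin k ↪ Fin l) (X : Fin l → V)
    (f : ∀ t, t ∉ Set.range φ → (𝟙_ V ⟶ X t)) : finTensor (fun s => X (φ s)) ⟶ finTensor X :=
  (tensRelabel X φ (List.finRange k)).hom ≫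
    rearrange X f (List.finRange l) ((List.finRange k).map φ)
      ((List.nodup_finRange k).map φ.injective) (List.nodup_finRange l)
      (fun _ _ => List.mem_finRange _) (fun _ _ ht ⟨s, hs⟩ => ht (List.mem_map.2 ⟨s, List.mem_finRange s, hs⟩))

lemma spread_naturality {k l : ℕ} (φ : Fin k ↪ Fin l) {X Y : Fin l → V}
    (f : ∀ t, t ∉ Set.range φ → (𝟙_ V ⟶ X t)) (f' : ∀ t, t ∉ Set.range φ → (𝟙_ V ⟶ Y t))
    (g : ∀ t, X t ⟶ Y t) (hf : ∀ t ht, f t ht ≫ g t = f' t ht) :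
    finTensorMap (fun s => g (φ s)) ≫ spread φ Y f' = spread φ X f ≫ finTensorMap g := by
  rw [spread, spread, ← Category.assoc, tensRelabel_naturality, Category.assoc,
    rearrange_naturality f f' g hf, Category.assoc]

/-- The permutation of factors `⨂ₛ X (σ s) ⟶ ⨂ₜ X t`. -/
def permute {k : ℕ} (σ : Equiv.Perm (Fin k)) (X : Fin k → V) :
    finTensor (fun s => X (σ s)) ⟶ finTensor X :=
  spread σ.toEmbedding X (fun t ht => absurd (σ.surjective t) ht)

/-- `⨂ᵣ X r ⟶ ⨂ₛ (⨂_q X (s, q))`, where `r` runs through `1, …, j 1 + ⋯ + j k`, identified with the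
lexicographically ordered set of pairs `(s, q)` with `1 ≤ q ≤ j s`. -/
def regroup {k : ℕ} {j : Fin k → ℕ} (X : Fin (∑ s, j s) → V) :
    finTensor X ⟶ finTensor (fun s => finTensor (fun q => X (finSigmaFinEquiv ⟨s, q⟩))) :=
  rearrange X (P := fun _ => False) (fun _ h => h.elim)
    (((List.finRange k).sigma (fun s => List.finRange (j s))).map finSigmaFinEquiv)
    (List.finRange _) (List.nodup_finRange _)
    (((List.nodup_finRange k).sigma (fun s => List.nodup_finRange (j s))).map
      finSigmaFinEquiv.injective)
    (fun r _ => List.mem_map.2 ⟨finSigmaFinEquiv.symm r, List.mem_sigma.2 ⟨List.mem_finRange _, List.mem_finRange _⟩,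
      finSigmaFinEquiv.apply_symm_apply r⟩)
    (fun r _ hr => hr (List.mem_finRange r)) ≫
  (tensRelabel X finSigmaFinEquiv _).inv ≫
  (tensSigma (fun p => X (finSigmaFinEquiv p)) (fun s => List.finRange (j s)) _).inv

/-- The shuffle
`(A ⊗ B 1 ⊗ ⋯ ⊗ B k) ⊗ (⨂ᵣ X r) ⟶ A ⊗ (B 1 ⊗ ⨂_q X (1, q)) ⊗ ⋯ ⊗ (B k ⊗ ⨂_q X (k, q))`. -/
def shuffle {k : ℕ} {j : Fin k → ℕ} (A : V) (B : Fin k → V) (X : Fin (∑ s, j s) → V) :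
    (A ⊗ finTensor B) ⊗ finTensor X ⟶
      A ⊗ finTensor (fun s => B s ⊗ finTensor (fun q => X (finSigmaFinEquiv ⟨s, q⟩))) :=
  (α_ _ _ _).hom ≫ (A ◁ ((finTensor B ◁ regroup X) ≫ tensZip _ _ _))

lemma sum_regroup {k : ℕ} {j : Fin k → ℕ} (i : Fin (∑ s, j s) → ℕ) :
    ∑ r, i r = ∑ s, ∑ q, i (finSigmaFinEquiv ⟨s, q⟩) := by
  rw [← finSigmaFinEquiv.sum_comp, Fintype.sum_sigma]

end FinTensor

/-! ### Operads in the classical sense -/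

section Operad

variable (V : Type u) [Category.{v} V] [MonoidalCategory V]

/-- The data of a based operad in `V`. -/
structure OperadData where
  /-- The underlying symmetric sequence `C`: objects `C n` with right actions of the symmetric
  groups. -/
  seq : Sigᵒᵖ ⥤ V
  /-- The structure maps. -/
  γ : ∀ {k : ℕ} (j : Fin k → ℕ), seq.obj (op ⟨k⟩) ⊗ finTensor (fun s => seq.obj (op ⟨j s⟩)) ⟶
    seq.obj (op ⟨∑ s, j s⟩)
  /-- The unit map. -/
  unit : 𝟙_ V ⟶ seq.obj (op ⟨1⟩)
  /-- The base map. -/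
  base : 𝟙_ V ⟶ seq.obj (op ⟨0⟩)

variable {V}

/-- The object `C n`. -/
abbrev OperadData.obj (C : OperadData V) (n : ℕ) : V := C.seq.obj (op ⟨n⟩)

/-- The action `C n ⟶ C m` of a bijection `{1, …, m} ≃ {1, …, n}`. -/
abbrev OperadData.act (C : OperadData V) {m n : ℕ} (e : Fin m ≃ Fin n) : C.obj n ⟶ C.obj m :=
  C.seq.map (Quiver.Hom.op (X := (⟨m⟩ : Sig)) (Y := ⟨n⟩) e)

/-- Morphisms are the families of equivariant maps that preserve the structure maps, the unit map
and the base map. -/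
@[ext]
structure OperadData.Hom (C D : OperadData V) where
  /-- The underlying map of symmetric sequences. -/
  hom : C.seq ⟶ D.seq
  γ_hom : ∀ {k : ℕ} (j : Fin k → ℕ), C.γ j ≫ hom.app _ =
    (hom.app _ ⊗ₘ finTensorMap (fun _ => hom.app _)) ≫ D.γ j
  unit_hom : C.unit ≫ hom.app _ = D.unit
  base_hom : C.base ≫ hom.app _ = D.base


instance : Category (OperadData V) where
  Hom := OperadData.Hom
  id C :=
    { hom := 𝟙 _
      γ_hom := fun j => by simp [tensMap_id]
      unit_hom := by simp
      base_hom := by simp }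
  comp f g :=
    { hom := f.hom ≫ g.hom
      γ_hom := fun j => by
        simp only [NatTrans.comp_app, finTensorMap, tensMap_comp, ← tensorHom_comp_tensorHom,
          Category.assoc]
        rw [← g.γ_hom j, ← Category.assoc, f.γ_hom, Category.assoc]
      unit_hom := by rw [NatTrans.comp_app, ← Category.assoc, f.unit_hom, g.unit_hom]
      base_hom := by rw [NatTrans.comp_app, ← Category.assoc, f.base_hom, g.base_hom] }

variable [SymmetricCategory V]

/-- The axioms of an operad. -/
structure IsOperad (C : OperadData V) : Prop where
  /-- Associativity. -/
  assoc : ∀ {k : ℕ} (j : Fin k → ℕ) (i : Fin (∑ s, j s) → ℕ),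
    (C.γ j ▷ finTensor (fun r => C.obj (i r))) ≫ C.γ i =
      shuffle (C.obj k) (fun s => C.obj (j s)) (fun r => C.obj (i r)) ≫
        (C.obj k ◁ finTensorMap (fun s => C.γ (fun q => i (finSigmaFinEquiv ⟨s, q⟩)))) ≫
        C.γ (fun s => ∑ q, i (finSigmaFinEquiv ⟨s, q⟩)) ≫
        eqToHom (congrArg C.obj (sum_regroup i).symm)
  /-- The first unit axiom. -/
  unit_right : ∀ k : ℕ,
    (C.obj k ◁ finTensorUnits (fun _ => C.unit)) ≫ C.γ (fun _ : Fin k => 1) =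
      (ρ_ (C.obj k)).hom ≫ eqToHom (congrArg C.obj (by simp))
  /-- The second unit axiom. -/
  unit_left : ∀ n : ℕ,
    (C.unit ▷ finTensor (fun _ => C.obj n)) ≫ C.γ (fun _ : Fin 1 => n) =
      (λ_ _).hom ≫ (finTensorOne (fun _ => C.obj n)).hom ≫ eqToHom (congrArg C.obj (by simp))
  /-- Equivariance with respect to the permutations of `{1, …, k}`. -/
  equivariant_left : ∀ {k : ℕ} (σ : Equiv.Perm (Fin k)) (j : Fin k → ℕ),
    (C.act σ ▷ finTensor (fun s => C.obj (j (σ s)))) ≫ C.γ (fun s => j (σ s)) =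
      (C.obj k ◁ permute σ (fun t => C.obj (j t))) ≫ C.γ j ≫
        C.act (blockEquiv σ fun _ => Equiv.refl _)
  /-- Equivariance with respect to the permutations of `{1, …, j s}` for `s = 1, …, k`. -/
  equivariant_right : ∀ {k : ℕ} (j : Fin k → ℕ) (τ : ∀ s, Equiv.Perm (Fin (j s))),
    (C.obj k ◁ finTensorMap (fun s => C.act (τ s))) ≫ C.γ j =
      C.γ j ≫ C.act (blockEquiv (Equiv.refl _) τ)

variable (V)

/-- The property of being a based operad. -/
def isBasedOperad : ObjectProperty (OperadData V) := IsOperad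

/-- The category of based operads in `V`: operads `C` with a base map `𝟙_ V ⟶ C 0`. -/
abbrev BasedOperad := (isBasedOperad V).FullSubcategory

/-- The property of being a unital operad: the base map identifies `C 0` with `𝟙_ V`. -/
def isUnitalOperad : ObjectProperty (OperadData V) := fun C => IsOperad C ∧ IsIso C.base

/-- The category of unital operads in `V`. -/
abbrev UnitalOperad := (isUnitalOperad V).FullSubcategory

end Operad

/-! ### `Λ`-sequences -/

section LambdaSeq

variable (V : Type u) [Category.{v} V] [MonoidalCategory V]

/-- A `Λ`-sequence: a contravariant functor on `Λ` with a base map. -/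
structure LambdaSeq where
  /-- The underlying contravariant functor. -/
  seq : Lamᵒᵖ ⥤ V
  /-- The base map. -/
  base : 𝟙_ V ⟶ seq.obj (op ⟨0⟩)

variable {V}

/-- Morphisms of `Λ`-sequences are the natural transformations under `𝟙_ V` at level `0`. -/
@[ext]
structure LambdaSeq.Hom (D E : LambdaSeq V) where
  /-- The underlying natural transformation. -/
  hom : D.seq ⟶ E.seq
  base_hom : D.base ≫ hom.app (op ⟨0⟩) = E.base := by cat_disch

@[simps id_hom comp_hom]
instance : Category (LambdaSeq V) where
  Hom := LambdaSeq.Hom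
  id D := { hom := 𝟙 _ }
  comp f g :=
    { hom := f.hom ≫ g.hom
      base_hom := by rw [NatTrans.comp_app, ← Category.assoc, f.base_hom, g.base_hom] }

@[ext]
lemma LambdaSeq.hom_ext {D E : LambdaSeq V} {f g : D ⟶ E} (h : f.hom = g.hom) : f = g :=
  LambdaSeq.Hom.ext h

/-- The object `D n`. -/
abbrev LambdaSeq.obj (D : LambdaSeq V) (n : ℕ) : V := D.seq.obj (op ⟨n⟩)

variable (V) in
/-- A `Λ`-sequence `D` is unital if the base map identifies `D 0` with `𝟙_ V`. -/
def isUnital : ObjectProperty (LambdaSeq V) := fun D => IsIso D.base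

/-- `(j 1, …, j k) ↦ E (j 1) ⊗ ⋯ ⊗ E (j k)` -/
def extTensor (E : Lamᵒᵖ ⥤ V) (k : ℕ) : (Fin k → Lam)ᵒᵖ ⥤ V where
  obj j := finTensor (fun s => E.obj (op (j.unop s)))
  map f := finTensorMap (fun s => E.map (f.unop s).op)
  map_id j := by simp [tensMap_id]
  map_comp f g := by simp [tensMap_comp]

/-- Functoriality of `extTensor` in `E`. -/
def extTensorMap {E F : Lamᵒᵖ ⥤ V} (g : E ⟶ F) (k : ℕ) : extTensor E k ⟶ extTensor F k where
  app j := finTensorMap (fun s => g.app (op (j.unop s)))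
  naturality i j f := by
    simp only [extTensor, finTensorMap, ← tensMap_comp, NatTrans.naturality]

/-- The family `(j 1, …, j k)`, distributed over the places `1, …, l` by an injection `φ`, with `0`
at the places that are not in the image. -/
def push {k l : ℕ} (φ : Fin k ↪ Fin l) (j : Fin k → Lam) (t : Fin l) : Lam :=
  if h : ∃ s, φ s = t then j h.choose else ⟨0⟩

lemma push_apply {k l : ℕ} (φ : Fin k ↪ Fin l) (j : Fin k → Lam) (s : Fin k) :
    push φ j (φ s) = j s := by
  have h : ∃ s', φ s' = φ s := ⟨s, rfl⟩
  rw [push, dif_pos h, φ.injective h.choose_spec]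

lemma push_of_notMem {k l : ℕ} (φ : Fin k ↪ Fin l) (j : Fin k → Lam) {t : Fin l}
    (ht : t ∉ Set.range φ) : push φ j t = ⟨0⟩ :=
  dif_neg ht

lemma push_of_exists {k l : ℕ} (φ : Fin k ↪ Fin l) (j : Fin k → Lam) {t : Fin l}
    (h : ∃ s, φ s = t) : push φ j t = j h.choose :=
  dif_pos h

/-- Functoriality of `push`. -/
def pushMap {k l : ℕ} (φ : Fin k ↪ Fin l) {i j : Fin k → Lam} (f : i ⟶ j) :
    push φ i ⟶ push φ j := fun t =>
  if h : ∃ s, φ s = t then 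
    eqToHom (push_of_exists φ i h) ≫ f h.choose ≫ eqToHom (push_of_exists φ j h).symm
  else eqToHom ((push_of_notMem φ i h).trans (push_of_notMem φ j h).symm)

lemma pushMap_apply {k l : ℕ} (φ : Fin k ↪ Fin l) {i j : Fin k → Lam} (f : i ⟶ j) (s : Fin k) :
    pushMap φ f (φ s) = eqToHom (push_apply φ i s) ≫ f s ≫ eqToHom (push_apply φ j s).symm := by
  have h : ∃ s', φ s' = φ s := ⟨s, rfl⟩
  have key : ∀ (s' : Fin k) (hs : s' = s), f s' = eqToHom (congrArg i hs) ≫ f s ≫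
      eqToHom (congrArg j hs.symm) := by
    rintro _ rfl
    simp
  refine (dif_pos h).trans ?_
  rw [key h.choose (φ.injective h.choose_spec)]
  simp only [Category.assoc, eqToHom_trans_assoc, eqToHom_trans]

/-- The block injection `j 1 + ⋯ + j k → push φ j 1 + ⋯ + push φ j l` (a bijection). -/
def pushBlock {k l : ℕ} (φ : Fin k ↪ Fin l) (j : Fin k → Lam) :
    (wedge k).obj j ⟶ (wedge l).obj (push φ j) :=
  blockEmb (j := fun s => (j s).n) (j' := fun t => (push φ j t).n) φ
    (fun s => eqToHom (push_apply φ j s).symm)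

/-- `E (j 1) ⊗ ⋯ ⊗ E (j k) ⟶ E (push φ j 1) ⊗ ⋯ ⊗ E (push φ j l)`, inserting the base map at the
places that are not in the image of `φ`. -/
def extTensorPush [SymmetricCategory V] (E : LambdaSeq V) {k l : ℕ} (φ : Fin k ↪ Fin l)
    (j : Fin k → Lam) :
    (extTensor E.seq k).obj (op j) ⟶ (extTensor E.seq l).obj (op (push φ j)) :=
  finTensorMap (fun s => eqToHom (by rw [push_apply])) ≫
    spread φ (fun t => E.seq.obj (op (push φ j t)))
      (fun _ ht => E.base ≫ eqToHom (by rw [push_of_notMem φ j ht]))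


lemma pushBlock_naturality {k l : ℕ} (φ : Fin k ↪ Fin l) {i j : Fin k → Lam} (f : i ⟶ j) :
    (wedge k).map f ≫ pushBlock φ j = pushBlock φ i ≫ (wedge l).map (pushMap φ f) := by
  refine blockEmb_ext (j := fun s => (i s).n) fun s q => ?_
  have h1 := blockEmb_apply (j := fun s => (i s).n) (j' := fun s => (j s).n)
    (Function.Embedding.refl _) f s q
  have h2 := blockEmb_apply (j := fun s => (j s).n) (j' := fun t => (push φ j t).n) φ
    (fun s => eqToHom (push_apply φ j s).symm) s (Lam.emb (f s) q)
  have h3 := blockEmb_apply (j := fun s => (i s).n) (j' := fun t => (push φ i t).n) φ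
    (fun s => eqToHom (push_apply φ i s).symm) s q
  have h4 := blockEmb_apply (j := fun s => (push φ i s).n) (j' := fun t => (push φ j t).n)
    (Function.Embedding.refl _) (pushMap φ f) (φ s)
      (Lam.emb (eqToHom (push_apply φ i s).symm) q)
  have h1' := congrArg (Lam.emb (pushBlock φ j)) h1
  have h3' := congrArg (Lam.emb ((wedge l).map (pushMap φ f))) h3
  refine (h1'.trans h2).trans ((h3'.trans h4).trans ?_).symm
  refine congrArg (fun x => finSigmaFinEquiv (n := fun t => (push φ j t).n) ⟨φ s, x⟩) ?_
  have h5 : (eqToHom (push_apply φ i s).symm : i s ⟶ push φ i (φ s)) ≫ pushMap φ f (φ s) =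
      f s ≫ eqToHom (push_apply φ j s).symm := by
    rw [pushMap_apply]
    simp only [eqToHom_trans_assoc, eqToHom_refl, Category.id_comp]
  exact DFunLike.congr_fun (F := _ ↪ _) h5 q

lemma extTensorPush_naturality [SymmetricCategory V] (E : LambdaSeq V) {k l : ℕ} (φ : Fin k ↪ Fin l)
    {i j : Fin k → Lam} (f : i ⟶ j) :
    (extTensor E.seq k).map f.op ≫ extTensorPush E φ i =
      extTensorPush E φ j ≫ (extTensor E.seq l).map (pushMap φ f).op := by
  have h := spread_naturality φ (X := fun t => E.seq.obj (op (push φ j t)))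
    (Y := fun t => E.seq.obj (op (push φ i t)))
    (fun _ ht => E.base ≫ eqToHom (by rw [push_of_notMem φ j ht]))
    (fun _ ht => E.base ≫ eqToHom (by rw [push_of_notMem φ i ht]))
    (fun t => E.seq.map (pushMap φ f t).op) (fun t ht => by
      have : pushMap φ f t = eqToHom ((push_of_notMem φ i ht).trans (push_of_notMem φ j ht).symm) :=
        dif_neg ht
      rw [this, eqToHom_op, eqToHom_map, Category.assoc, eqToHom_trans])
  refine Eq.trans ?_ (Category.assoc _ _ _).symm
  refine Eq.trans ?_ (congrArg (finTensorMap _ ≫ ·) h)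
  refine (Category.assoc _ _ _).symm.trans (Eq.trans ?_ (Category.assoc _ _ _))
  refine congrArg (· ≫ spread φ (fun t => E.seq.obj (op (push φ i t))) _) ?_
  refine (tensMap_comp _ _ _).symm.trans (Eq.trans ?_ (tensMap_comp _ _ _))
  refine congrArg (tensMap · _) ?_
  funext s
  simp only [pushMap_apply, op_comp, eqToHom_op, Functor.map_comp, eqToHom_map, eqToHom_trans_assoc,
    Category.assoc, eqToHom_refl, Category.id_comp]
  rfl

lemma extTensorPush_naturality' [SymmetricCategory V] {E F : LambdaSeq V} (g : E ⟶ F) {k l : ℕ}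
    (φ : Fin k ↪ Fin l) (j : Fin k → Lam) :
    (extTensorMap g.hom k).app (op j) ≫ extTensorPush F φ j =
      extTensorPush E φ j ≫ (extTensorMap g.hom l).app (op (push φ j)) := by
  have key : ∀ {a b : Lam} (h : a = b), g.hom.app (op a) ≫ eqToHom (by rw [h]) =
      eqToHom (by rw [h]) ≫ g.hom.app (op b) := by
    rintro a _ rfl
    simp
  have h := spread_naturality φ (X := fun t => E.seq.obj (op (push φ j t)))
    (Y := fun t => F.seq.obj (op (push φ j t)))
    (fun _ ht => E.base ≫ eqToHom (by rw [push_of_notMem φ j ht]))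
    (fun _ ht => F.base ≫ eqToHom (by rw [push_of_notMem φ j ht]))
    (fun t => g.hom.app (op (push φ j t))) (fun t ht => by
      rw [Category.assoc, ← key (push_of_notMem φ j ht).symm, ← Category.assoc, g.base_hom])
  refine Eq.trans ?_ (Category.assoc _ _ _).symm
  refine Eq.trans ?_ (congrArg (finTensorMap _ ≫ ·) h)
  refine (Category.assoc _ _ _).symm.trans (Eq.trans ?_ (Category.assoc _ _ _))
  refine congrArg (· ≫ spread φ (fun t => F.seq.obj (op (push φ j t))) _) ?_
  refine (tensMap_comp _ _ _).symm.trans (Eq.trans ?_ (tensMap_comp _ _ _))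
  refine congrArg (tensMap · _) ?_
  funext s
  exact key (push_apply φ j s).symm

variable [HasColimits V]

/-- The Day convolution power `E ⊠ ⋯ ⊠ E` (`k` factors): the left Kan extension of the external
tensor power along the wedge `(Λᵒᵖ)^k ⥤ Λᵒᵖ`. -/
def dayPow (E : Lamᵒᵖ ⥤ V) (k : ℕ) : Lamᵒᵖ ⥤ V :=
  (wedge k).op.leftKanExtension (extTensor E k)

/-- The universal map of the left Kan extension. -/
def dayUnit (E : Lamᵒᵖ ⥤ V) (k : ℕ) : extTensor E k ⟶ (wedge k).op ⋙ dayPow E k :=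
  (wedge k).op.leftKanExtensionUnit (extTensor E k)

instance (E : Lamᵒᵖ ⥤ V) (k : ℕ) : (dayPow E k).IsLeftKanExtension (dayUnit E k) :=
  inferInstanceAs (((wedge k).op.leftKanExtension (extTensor E k)).IsLeftKanExtension
    ((wedge k).op.leftKanExtensionUnit (extTensor E k)))

/-- Maps out of the Day convolution power. -/
def dayDesc {E : Lamᵒᵖ ⥤ V} {k : ℕ} {F : Lamᵒᵖ ⥤ V} (g : extTensor E k ⟶ (wedge k).op ⋙ F) :
    dayPow E k ⟶ F :=
  (dayPow E k).descOfIsLeftKanExtension (dayUnit E k) F g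


/-- Functoriality of the Day convolution power. -/
def dayPowMap {E F : Lamᵒᵖ ⥤ V} (g : E ⟶ F) (k : ℕ) : dayPow E k ⟶ dayPow F k :=
  dayDesc (extTensorMap g k ≫ dayUnit F k)

lemma dayUnit_dayDesc {E : Lamᵒᵖ ⥤ V} {k : ℕ} {F : Lamᵒᵖ ⥤ V}
    (g : extTensor E k ⟶ (wedge k).op ⋙ F) (j : (Fin k → Lam)ᵒᵖ) :
    (dayUnit E k).app j ≫ (dayDesc g).app (op ((wedge k).obj j.unop)) = g.app j :=
  (dayPow E k).descOfIsLeftKanExtension_fac_app (dayUnit E k) F g j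

lemma dayPow_hom_ext {E : Lamᵒᵖ ⥤ V} {k : ℕ} {F : Lamᵒᵖ ⥤ V} {f g : dayPow E k ⟶ F}
    (h : ∀ j : (Fin k → Lam)ᵒᵖ, (dayUnit E k).app j ≫ f.app (op ((wedge k).obj j.unop)) =
      (dayUnit E k).app j ≫ g.app (op ((wedge k).obj j.unop))) : f = g :=
  (dayPow E k).hom_ext_of_isLeftKanExtension (dayUnit E k) f g (by ext j; exact h j)

lemma dayUnit_dayPowMap {E F : Lamᵒᵖ ⥤ V} (g : E ⟶ F) (k : ℕ) (j : (Fin k → Lam)ᵒᵖ) :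
    (dayUnit E k).app j ≫ (dayPowMap g k).app (op ((wedge k).obj j.unop)) =
      (extTensorMap g k).app j ≫ (dayUnit F k).app j :=
  dayUnit_dayDesc _ j

lemma dayPowMap_id (E : Lamᵒᵖ ⥤ V) (k : ℕ) : dayPowMap (𝟙 E) k = 𝟙 _ :=
  dayPow_hom_ext fun j => by
    have h : (extTensorMap (𝟙 E) k).app j = 𝟙 _ := tensMap_id _ _
    rw [dayPowMap, dayUnit_dayDesc, NatTrans.comp_app, h, NatTrans.id_app, Category.id_comp]
    exact (Category.comp_id _).symm

lemma dayPowMap_comp {E F G : Lamᵒᵖ ⥤ V} (f : E ⟶ F) (g : F ⟶ G) (k : ℕ) :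
    dayPowMap (f ≫ g) k = dayPowMap f k ≫ dayPowMap g k :=
  dayPow_hom_ext fun j => by
    have h : (extTensorMap (f ≫ g) k).app j = (extTensorMap f k).app j ≫ (extTensorMap g k).app j :=
      tensMap_comp _ _ _
    simp only [dayPowMap, NatTrans.comp_app, dayUnit_dayDesc, reassoc_of% dayUnit_dayDesc, h,
      Category.assoc]

/-- The canonical maps `E (j 1) ⊗ ⋯ ⊗ E (j k) ⟶ E^{⊠ k} (j 1 + ⋯ + j k)`. -/
def dayGen (E : Lamᵒᵖ ⥤ V) {k : ℕ} (j : Fin k → ℕ) :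
    finTensor (fun s => E.obj (op ⟨j s⟩)) ⟶ (dayPow E k).obj (op ⟨∑ s, j s⟩) :=
  (dayUnit E k).app (op fun s => ⟨j s⟩)

lemma dayGen_naturality {E F : Lamᵒᵖ ⥤ V} (g : E ⟶ F) {k : ℕ} (j : Fin k → ℕ) :
    dayGen E j ≫ (dayPowMap g k).app (op ⟨∑ s, j s⟩) =
      finTensorMap (fun s => g.app (op ⟨j s⟩)) ≫ dayGen F j :=
  dayUnit_dayPowMap g k (op fun s => ⟨j s⟩)

variable [SymmetricCategory V]

/-- The covariant action of an injection `φ : {1, …, k} → {1, …, l}` on Day convolution powers: it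
permutes the factors and inserts base maps. -/
def dayAct (E : LambdaSeq V) {k l : ℕ} (φ : Fin k ↪ Fin l) :
    dayPow E.seq k ⟶ dayPow E.seq l :=
  dayDesc
    { app := fun j => extTensorPush E φ j.unop ≫ (dayUnit E.seq l).app (op (push φ j.unop)) ≫
        (dayPow E.seq l).map (pushBlock φ j.unop).op
      naturality := fun j i f => by
        have h1 := extTensorPush_naturality E φ f.unop
        have h2 := (dayUnit E.seq l).naturality (pushMap φ f.unop).op
        have h3 := pushBlock_naturality φ f.unop
        have h4 : (dayPow E.seq l).map ((wedge l).map (pushMap φ f.unop)).op ≫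
            (dayPow E.seq l).map (pushBlock φ i.unop).op =
            (dayPow E.seq l).map (pushBlock φ j.unop).op ≫
              (dayPow E.seq l).map ((wedge k).map f.unop).op := by
          rw [← Functor.map_comp, ← Functor.map_comp, ← op_comp, ← op_comp, h3]
        refine (Category.assoc _ _ _).symm.trans ((congrArg (· ≫ _) h1).trans ?_)
        refine (Category.assoc _ _ _).trans ?_
        refine (congrArg (extTensorPush E φ j.unop ≫ ·) ((Category.assoc _ _ _).symm.trans
          (congrArg (· ≫ _) h2))).trans ?_
        simp only [Functor.comp_map, Functor.op_map, Quiver.Hom.unop_op, Category.assoc, h4] }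

lemma dayUnit_dayAct (E : LambdaSeq V) {k l : ℕ} (φ : Fin k ↪ Fin l) (j : (Fin k → Lam)ᵒᵖ) :
    (dayUnit E.seq k).app j ≫ (dayAct E φ).app (op ((wedge k).obj j.unop)) =
      extTensorPush E φ j.unop ≫ (dayUnit E.seq l).app (op (push φ j.unop)) ≫
        (dayPow E.seq l).map (pushBlock φ j.unop).op :=
  dayUnit_dayDesc _ j

lemma dayAct_naturality {E F : LambdaSeq V} (g : E ⟶ F) {k l : ℕ} (φ : Fin k ↪ Fin l) :
    dayPowMap g.hom k ≫ dayAct F φ = dayAct E φ ≫ dayPowMap g.hom l :=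
  dayPow_hom_ext fun j => by
    have h1 := (dayPowMap g.hom l).naturality (pushBlock φ j.unop).op
    have h2 : (extTensorMap g.hom k).app j ≫ extTensorPush F φ j.unop =
        extTensorPush E φ j.unop ≫ (extTensorMap g.hom l).app (op (push φ j.unop)) :=
      extTensorPush_naturality' g φ j.unop
    have h3 := dayUnit_dayPowMap g.hom l (op (push φ j.unop))
    rw [NatTrans.comp_app, NatTrans.comp_app, reassoc_of% dayUnit_dayPowMap, dayUnit_dayAct,
      reassoc_of% dayUnit_dayAct, h1, reassoc_of% h2]
    exact congrArg (extTensorPush E φ j.unop ≫ ·) ((Category.assoc _ _ _).symm.trans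
      ((congrArg (· ≫ _) h3.symm).trans (Category.assoc _ _ _)))

/-! ### The Kelly product -/

/-- The functor `n ↦ D k ⊗ E^{⊠ l} n`. -/
abbrev kellyTerm (D E : LambdaSeq V) (k l : ℕ) : Lamᵒᵖ ⥤ V :=
  dayPow E.seq l ⋙ tensorLeft (D.obj k)

/-- The map `D l ⊗ E^{⊠ k} ⟶ D k ⊗ E^{⊠ k}` given by the contravariant action of `φ` on `D`. -/
def kellyActLeft (D E : LambdaSeq V) {k l : ℕ} (φ : Fin k ↪ Fin l) :
    kellyTerm D E l k ⟶ kellyTerm D E k k :=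
  Functor.whiskerLeft (dayPow E.seq k) ((curriedTensor V).map
    (D.seq.map (Quiver.Hom.op (X := (⟨k⟩ : Lam)) (Y := ⟨l⟩) φ)))

/-- The map `D l ⊗ E^{⊠ k} ⟶ D l ⊗ E^{⊠ l}` given by the covariant action of `φ` on the Day
convolution powers. -/
def kellyActRight (D E : LambdaSeq V) {k l : ℕ} (φ : Fin k ↪ Fin l) :
    kellyTerm D E l k ⟶ kellyTerm D E l l :=
  Functor.whiskerRight (dayAct E φ) (tensorLeft (D.obj l))

/-- The first of the two maps
`∐_{φ : {1, …, k} → {1, …, l}} D l ⊗ E^{⊠ k} ⟶ ∐_k D k ⊗ E^{⊠ k}`. -/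
def kellyLeft (D E : LambdaSeq V) :
    (∐ fun p : (Σ k l : ℕ, Fin k ↪ Fin l) => kellyTerm D E p.2.1 p.1) ⟶
      ∐ fun k : ℕ => kellyTerm D E k k :=
  Sigma.desc fun p => kellyActLeft D E p.2.2 ≫ Sigma.ι (fun k : ℕ => kellyTerm D E k k) p.1

/-- The second of the two maps. -/
def kellyRight (D E : LambdaSeq V) :
    (∐ fun p : (Σ k l : ℕ, Fin k ↪ Fin l) => kellyTerm D E p.2.1 p.1) ⟶
      ∐ fun k : ℕ => kellyTerm D E k k :=
  Sigma.desc fun p => kellyActRight D E p.2.2 ≫ Sigma.ι (fun k : ℕ => kellyTerm D E k k) p.2.1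

/-- The contravariant functor `n ↦ ∫^k D k ⊗ E^{⊠ k} n` underlying the Kelly product. -/
def kellySeq (D E : LambdaSeq V) : Lamᵒᵖ ⥤ V := coequalizer (kellyLeft D E) (kellyRight D E)

/-- The canonical maps `D k ⊗ E^{⊠ k} ⟶ D ⊙ E`. -/
def kellyι (D E : LambdaSeq V) (k : ℕ) : kellyTerm D E k k ⟶ kellySeq D E :=
  Sigma.ι (fun k : ℕ => kellyTerm D E k k) k ≫ coequalizer.π (kellyLeft D E) (kellyRight D E)

lemma kelly_condition (D E : LambdaSeq V) {k l : ℕ} (φ : Fin k ↪ Fin l) :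
    kellyActLeft D E φ ≫ kellyι D E k = kellyActRight D E φ ≫ kellyι D E l := by
  have h := congrArg (Sigma.ι (fun p : (Σ k l : ℕ, Fin k ↪ Fin l) => kellyTerm D E p.2.1 p.1)
    ⟨k, l, φ⟩ ≫ ·) (coequalizer.condition (kellyLeft D E) (kellyRight D E))
  simp only [kellyLeft, kellyRight, Sigma.ι_desc_assoc, Category.assoc] at h
  exact h

/-- Maps out of the Kelly product. -/
def kellyDesc {D E : LambdaSeq V} {F : Lamᵒᵖ ⥤ V} (h : ∀ k, kellyTerm D E k k ⟶ F)
    (w : ∀ {k l : ℕ} (φ : Fin k ↪ Fin l),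
      kellyActLeft D E φ ≫ h k = kellyActRight D E φ ≫ h l) : kellySeq D E ⟶ F :=
  coequalizer.desc (f := kellyLeft D E) (g := kellyRight D E) (Sigma.desc h)
    (Sigma.hom_ext _ _ fun p => by
      simp only [kellyLeft, kellyRight, Sigma.ι_desc_assoc, Category.assoc, Sigma.ι_desc, w])

lemma kellyι_kellyDesc {D E : LambdaSeq V} {F : Lamᵒᵖ ⥤ V} (h : ∀ k, kellyTerm D E k k ⟶ F)
    (w : ∀ {k l : ℕ} (φ : Fin k ↪ Fin l),
      kellyActLeft D E φ ≫ h k = kellyActRight D E φ ≫ h l) (k : ℕ) :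
    kellyι D E k ≫ kellyDesc h w = h k :=
  (Category.assoc _ _ _).trans ((congrArg (Sigma.ι (fun k : ℕ => kellyTerm D E k k) k ≫ ·)
    (coequalizer.π_desc _ _)).trans (Sigma.ι_desc _ _))

lemma kellySeq_hom_ext {D E : LambdaSeq V} {F : Lamᵒᵖ ⥤ V} {f g : kellySeq D E ⟶ F}
    (h : ∀ k, kellyι D E k ≫ f = kellyι D E k ≫ g) : f = g :=
  coequalizer.hom_ext (Sigma.hom_ext _ _ fun k =>
    (Category.assoc _ _ _).symm.trans ((h k).trans (Category.assoc _ _ _)))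

/-- `D k ⊗ E^{⊠ l} ⟶ D' k ⊗ E'^{⊠ l}` -/
def kellyTermMap {D D' E E' : LambdaSeq V} (f : D ⟶ D') (g : E ⟶ E') (k l : ℕ) :
    kellyTerm D E k l ⟶ kellyTerm D' E' k l where
  app n := f.hom.app (op ⟨k⟩) ⊗ₘ (dayPowMap g.hom l).app n
  naturality m n x := by
    change (_ ◁ _) ≫ (_ ⊗ₘ _) = (_ ⊗ₘ _) ≫ (_ ◁ _)
    rw [← id_tensorHom, ← id_tensorHom, tensorHom_comp_tensorHom, tensorHom_comp_tensorHom,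
      NatTrans.naturality, Category.id_comp, Category.comp_id]

lemma kellyTermMap_compat {D D' E E' : LambdaSeq V} (f : D ⟶ D') (g : E ⟶ E') {k l : ℕ}
    (φ : Fin k ↪ Fin l) :
    kellyActLeft D E φ ≫ kellyTermMap f g k k ≫ kellyι D' E' k =
      kellyActRight D E φ ≫ kellyTermMap f g l l ≫ kellyι D' E' l := by
  have h1 : kellyActLeft D E φ ≫ kellyTermMap f g k k =
      kellyTermMap f g l k ≫ kellyActLeft D' E' φ := by
    ext n
    change (_ ▷ _) ≫ (_ ⊗ₘ _) = (_ ⊗ₘ _) ≫ (_ ▷ _)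
    rw [← tensorHom_id, ← tensorHom_id, tensorHom_comp_tensorHom, tensorHom_comp_tensorHom,
      NatTrans.naturality, Category.id_comp, Category.comp_id]
  have h2 : kellyActRight D E φ ≫ kellyTermMap f g l l =
      kellyTermMap f g l k ≫ kellyActRight D' E' φ := by
    ext n
    have := NatTrans.congr_app (dayAct_naturality g φ) n
    rw [NatTrans.comp_app, NatTrans.comp_app] at this
    change (_ ◁ _) ≫ (_ ⊗ₘ _) = (_ ⊗ₘ _) ≫ (_ ◁ _)
    rw [← id_tensorHom, ← id_tensorHom, tensorHom_comp_tensorHom, tensorHom_comp_tensorHom,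
      this, Category.id_comp, Category.comp_id]
  rw [← Category.assoc, h1, Category.assoc, kelly_condition, ← Category.assoc, ← h2,
    Category.assoc]

/-- Functoriality of the functor underlying the Kelly product. -/
def kellySeqMap {D D' E E' : LambdaSeq V} (f : D ⟶ D') (g : E ⟶ E') :
    kellySeq D E ⟶ kellySeq D' E' :=
  kellyDesc (fun k => kellyTermMap f g k k ≫ kellyι D' E' k) (kellyTermMap_compat f g)

lemma kellyι_kellySeqMap {D D' E E' : LambdaSeq V} (f : D ⟶ D') (g : E ⟶ E') (k : ℕ) :
    kellyι D E k ≫ kellySeqMap f g = kellyTermMap f g k k ≫ kellyι D' E' k :=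
  kellyι_kellyDesc _ (kellyTermMap_compat f g) k

/-- The canonical maps `D k ⊗ E^{⊠ k} n ⟶ (D ⊙ E) n`. -/
def kellyInc (D E : LambdaSeq V) (k n : ℕ) :
    D.obj k ⊗ (dayPow E.seq k).obj (op ⟨n⟩) ⟶ (kellySeq D E).obj (op ⟨n⟩) :=
  (kellyι D E k).app (op ⟨n⟩)

lemma kellyInc_naturality {D D' E E' : LambdaSeq V} (f : D ⟶ D') (g : E ⟶ E') (k n : ℕ) :
    kellyInc D E k n ≫ (kellySeqMap f g).app (op ⟨n⟩) =
      (f.hom.app (op ⟨k⟩) ⊗ₘ (dayPowMap g.hom k).app (op ⟨n⟩)) ≫ kellyInc D' E' k n :=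
  NatTrans.congr_app (kellyι_kellySeqMap f g k) (op ⟨n⟩)

/-- The canonical maps `D k ⊗ E (j 1) ⊗ ⋯ ⊗ E (j k) ⟶ (D ⊙ E) (j 1 + ⋯ + j k)`. -/
def kellyGen (D E : LambdaSeq V) {k : ℕ} (j : Fin k → ℕ) :
    D.obj k ⊗ finTensor (fun s => E.obj (j s)) ⟶ (kellySeq D E).obj (op ⟨∑ s, j s⟩) :=
  (D.obj k ◁ dayGen E.seq j) ≫ kellyInc D E k (∑ s, j s)

lemma kellyGen_naturality {D D' E E' : LambdaSeq V} (f : D ⟶ D') (g : E ⟶ E') {k : ℕ}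
    (j : Fin k → ℕ) :
    kellyGen D E j ≫ (kellySeqMap f g).app (op ⟨∑ s, j s⟩) =
      (f.hom.app (op ⟨k⟩) ⊗ₘ finTensorMap (fun s => g.hom.app (op ⟨j s⟩))) ≫ kellyGen D' E' j := by
  rw [kellyGen, kellyGen, Category.assoc, kellyInc_naturality, ← Category.assoc, ← Category.assoc,
    ← id_tensorHom, ← id_tensorHom, tensorHom_comp_tensorHom, tensorHom_comp_tensorHom,
    dayGen_naturality, Category.id_comp, Category.comp_id]

/-- The base map `𝟙_ V ⟶ D 0 ≅ D 0 ⊗ 𝟙_ V ≅ D 0 ⊗ E^{⊠ 0} 0 ⟶ (D ⊙ E) 0` of the Kelly product. -/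
def kellyBase (D E : LambdaSeq V) : 𝟙_ V ⟶ (kellySeq D E).obj (op ⟨0⟩) :=
  D.base ≫ (ρ_ (D.obj 0)).inv ≫ (D.obj 0 ◁ finTensorUnits (k := 0) fun s => s.elim0) ≫
    kellyGen D E (k := 0) Fin.elim0 ≫
    eqToHom (congrArg (fun n => (kellySeq D E).obj (op ⟨n⟩)) (Fin.sum_univ_zero _))

/-- The Kelly product `D ⊙ E`. -/
def kelly (D E : LambdaSeq V) : LambdaSeq V where
  seq := kellySeq D E
  base := kellyBase D E

lemma kellyBase_naturality {D D' E E' : LambdaSeq V} (f : D ⟶ D') (g : E ⟶ E') :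
    kellyBase D E ≫ (kellySeqMap f g).app (op ⟨0⟩) = kellyBase D' E' := by
  have h1 : ∀ {F F' : Lamᵒᵖ ⥤ V} (x : F ⟶ F') {a b : ℕ} (h : a = b),
      eqToHom (congrArg (fun n => F.obj (op ⟨n⟩)) h) ≫ x.app (op ⟨b⟩) =
        x.app (op ⟨a⟩) ≫ eqToHom (congrArg (fun n => F'.obj (op ⟨n⟩)) h) := by
    rintro F F' x a _ rfl
    simp
  have h2 : ∀ (l : List (Fin 0)) (X Y : Fin 0 → V) (x : ∀ s, X s ⟶ Y s),
      tensUnits (X := X) (fun s => s.elim0) l ≫ tensMap x l =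
      tensUnits (X := Y) (fun s => s.elim0) l := by
    intro l X Y x
    cases l with
    | nil => exact Category.comp_id _
    | cons a l => exact a.elim0
  simp only [kellyBase, Category.assoc]
  rw [h1 (kellySeqMap f g) (Fin.sum_univ_zero _), reassoc_of% kellyGen_naturality f g,
    ← Category.assoc (D.obj 0 ◁ _), ← id_tensorHom, tensorHom_comp_tensorHom, h2, Category.id_comp,
    ← f.base_hom, MonoidalCategory.tensorHom_def, Category.assoc, ← Category.assoc (ρ_ _).inv,
    ← rightUnitor_inv_naturality]
  simp only [Category.assoc]

/-- Functoriality of the Kelly product. -/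
def kellyMap {D D' E E' : LambdaSeq V} (f : D ⟶ D') (g : E ⟶ E') : kelly D E ⟶ kelly D' E' where
  hom := kellySeqMap f g
  base_hom := kellyBase_naturality f g

lemma kellyMap_id (D E : LambdaSeq V) : kellyMap (𝟙 D) (𝟙 E) = 𝟙 (kelly D E) := by
  refine LambdaSeq.hom_ext (kellySeq_hom_ext fun k => ?_)
  refine (kellyι_kellySeqMap _ _ k).trans ?_
  have h : kellyTermMap (𝟙 D) (𝟙 E) k k = 𝟙 _ := by
    ext n
    change _ ⊗ₘ (dayPowMap (𝟙 E.seq) k).app n = 𝟙 _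
    rw [dayPowMap_id]
    exact id_tensorHom_id _ _
  rw [h, Category.id_comp]
  exact (Category.comp_id _).symm

lemma kellyMap_comp {D D' D'' E E' E'' : LambdaSeq V} (f : D ⟶ D') (f' : D' ⟶ D'') (g : E ⟶ E')
    (g' : E' ⟶ E'') : kellyMap (f ≫ f') (g ≫ g') = kellyMap f g ≫ kellyMap f' g' := by
  refine LambdaSeq.hom_ext (kellySeq_hom_ext fun k => ?_)
  refine (kellyι_kellySeqMap _ _ k).trans (Eq.trans ?_ (Category.assoc _ _ _))
  refine Eq.trans ?_ (congrArg (· ≫ _) (kellyι_kellySeqMap f g k).symm)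
  refine Eq.trans ?_ (Category.assoc _ _ _).symm
  refine Eq.trans ?_ (congrArg (_ ≫ ·) (kellyι_kellySeqMap f' g' k).symm)
  have h : kellyTermMap (f ≫ f') (g ≫ g') k k = kellyTermMap f g k k ≫ kellyTermMap f' g' k k := by
    ext n
    change _ ⊗ₘ (dayPowMap (g.hom ≫ g'.hom) k).app n = (_ ⊗ₘ _) ≫ (_ ⊗ₘ _)
    rw [dayPowMap_comp, tensorHom_comp_tensorHom]
    rfl
  rw [h, Category.assoc]

variable (V) in
/-- The unit `Λ`-sequence `Λ(-, 1) ⊗ 𝟙_ V`, with the values `𝟙_ V` at the levels `0` and `1` and the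
initial object at the other levels. -/
def kellyUnit : LambdaSeq V where
  seq := yoneda.obj (⟨1⟩ : Lam) ⋙ sigmaConst.obj (𝟙_ V)
  base := Sigma.ι (fun _ : (⟨0⟩ : Lam) ⟶ ⟨1⟩ => 𝟙_ V) (Function.Embedding.ofIsEmpty)

variable (V) in
/-- The canonical map `𝟙_ V ⟶ kellyUnit 1`. -/
def kellyUnitGen : 𝟙_ V ⟶ (kellyUnit V).obj 1 :=
  Sigma.ι (fun _ : (⟨1⟩ : Lam) ⟶ ⟨1⟩ => 𝟙_ V) (𝟙 _)

variable (V) in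
/-- The Kelly monoidal structure on `Λ`-sequences: the tensor product is `⊙`, the unit object is
`kellyUnit V`, and the associators and unitors are the canonical ones.  The latter means that they are
given on the canonical maps `D k ⊗ E (j 1) ⊗ ⋯ ⊗ E (j k) ⟶ (D ⊙ E) (j 1 + ⋯ + j k)` by the associators,
unitors and symmetries of `V`. -/
structure KellyMonoidal where
  /-- The associator. -/
  associator : ∀ D E F : LambdaSeq V, kelly (kelly D E) F ≅ kelly D (kelly E F)
  /-- The left unitor. -/
  leftUnitor : ∀ D : LambdaSeq V, kelly (kellyUnit V) D ≅ D
  /-- The right unitor. -/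
  rightUnitor : ∀ D : LambdaSeq V, kelly D (kellyUnit V) ≅ D
  associator_gen : ∀ (D E F : LambdaSeq V) {k : ℕ} (j : Fin k → ℕ) (i : Fin (∑ s, j s) → ℕ),
    (kellyGen D E j ▷ finTensor (fun r => F.obj (i r))) ≫ kellyGen (kelly D E) F i ≫
        (associator D E F).hom.hom.app (op ⟨∑ r, i r⟩) =
      shuffle (D.obj k) (fun s => E.obj (j s)) (fun r => F.obj (i r)) ≫
        (D.obj k ◁ finTensorMap (fun s => kellyGen E F (fun q => i (finSigmaFinEquiv ⟨s, q⟩)))) ≫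
        kellyGen D (kelly E F) (fun s => ∑ q, i (finSigmaFinEquiv ⟨s, q⟩)) ≫
        eqToHom (congrArg (kelly D (kelly E F)).obj (sum_regroup i).symm)
  leftUnitor_gen : ∀ (D : LambdaSeq V) (n : ℕ),
    (kellyUnitGen V ▷ finTensor (fun _ => D.obj n)) ≫ kellyGen (kellyUnit V) D (fun _ : Fin 1 => n) ≫
        (leftUnitor D).hom.hom.app (op ⟨∑ _ : Fin 1, n⟩) =
      (λ_ _).hom ≫ (finTensorOne (fun _ => D.obj n)).hom ≫ eqToHom (congrArg D.obj (by simp))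
  rightUnitor_gen : ∀ (D : LambdaSeq V) (k : ℕ),
    (D.obj k ◁ finTensorUnits (fun _ => kellyUnitGen V)) ≫
        kellyGen D (kellyUnit V) (fun _ : Fin k => 1) ≫
        (rightUnitor D).hom.hom.app (op ⟨∑ _ : Fin k, 1⟩) =
      (ρ_ (D.obj k)).hom ≫ eqToHom (congrArg D.obj (by simp))
  associator_naturality : ∀ {D D' E E' F F' : LambdaSeq V} (f : D ⟶ D') (g : E ⟶ E') (h : F ⟶ F'),
    kellyMap (kellyMap f g) h ≫ (associator D' E' F').hom =
      (associator D E F).hom ≫ kellyMap f (kellyMap g h)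
  leftUnitor_naturality : ∀ {D E : LambdaSeq V} (f : D ⟶ E),
    kellyMap (𝟙 (kellyUnit V)) f ≫ (leftUnitor E).hom = (leftUnitor D).hom ≫ f
  rightUnitor_naturality : ∀ {D E : LambdaSeq V} (f : D ⟶ E),
    kellyMap f (𝟙 (kellyUnit V)) ≫ (rightUnitor E).hom = (rightUnitor D).hom ≫ f
  pentagon : ∀ D E F G : LambdaSeq V,
    kellyMap (associator D E F).hom (𝟙 G) ≫ (associator D (kelly E F) G).hom ≫
        kellyMap (𝟙 D) (associator E F G).hom =
      (associator (kelly D E) F G).hom ≫ (associator D E (kelly F G)).hom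
  triangle : ∀ D E : LambdaSeq V,
    (associator D (kellyUnit V) E).hom ≫ kellyMap (𝟙 D) (leftUnitor E).hom =
      kellyMap (rightUnitor D).hom (𝟙 E)

/-- The monoidal category of `Λ`-sequences under the Kelly product. -/
@[reducible]
def KellyMonoidal.monoidalCategory (K : KellyMonoidal V) : MonoidalCategory (LambdaSeq V) :=
  letI : MonoidalCategoryStruct (LambdaSeq V) :=
    { tensorObj := kelly
      whiskerLeft := fun D _ _ g => kellyMap (𝟙 D) g
      whiskerRight := fun f E => kellyMap f (𝟙 E)
      tensorHom := kellyMap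
      tensorUnit := kellyUnit V
      associator := K.associator
      leftUnitor := K.leftUnitor
      rightUnitor := K.rightUnitor }
  MonoidalCategory.ofTensorHom
    (id_tensorHom_id := kellyMap_id)
    (id_tensorHom := fun _ _ _ _ => rfl)
    (tensorHom_id := fun _ _ => rfl)
    (tensorHom_comp_tensorHom := fun f g f' g' => (kellyMap_comp f f' g g').symm)
    (associator_naturality := K.associator_naturality)
    (leftUnitor_naturality := K.leftUnitor_naturality)
    (rightUnitor_naturality := K.rightUnitor_naturality)
    (pentagon := K.pentagon)
    (triangle := K.triangle)

/-- The operad data of a monoid `C` in `Λ`-sequences: the underlying symmetric sequence and base map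
are those of `C`, the structure maps are the restrictions of the product `C ⊙ C ⟶ C` to
`C k ⊗ C (j 1) ⊗ ⋯ ⊗ C (j k)`, and the unit map is the restriction of the unit of `C` to level `1`. -/
def KellyMonoidal.operadData (K : KellyMonoidal V) :
    letI := K.monoidalCategory
    Mon (LambdaSeq V) ⥤ OperadData V :=
  letI := K.monoidalCategory
  { obj := fun C =>
      { seq := Sig.toLam.op ⋙ C.X.seq
        γ := fun j => kellyGen C.X C.X j ≫ (MonObj.mul : kelly C.X C.X ⟶ C.X).hom.app (op ⟨∑ s, j s⟩)
        unit := kellyUnitGen V ≫ (MonObj.one : kellyUnit V ⟶ C.X).hom.app (op ⟨1⟩)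
        base := C.X.base }
    map := fun {C D} f =>
      { hom := Functor.whiskerLeft Sig.toLam.op f.hom.hom
        γ_hom := fun j => by
          have h : (MonObj.mul : kelly C.X C.X ⟶ C.X) ≫ f.hom =
              kellyMap f.hom f.hom ≫ (MonObj.mul : kelly D.X D.X ⟶ D.X) := IsMonHom.mul_hom f.hom
          have h1 := NatTrans.congr_app (congrArg LambdaSeq.Hom.hom h) (op ⟨∑ s, j s⟩)
          refine (Category.assoc _ _ _).trans ((congrArg (kellyGen C.X C.X j ≫ ·) h1).trans ?_)
          refine (Category.assoc _ _ _).symm.trans (Eq.trans ?_ (Category.assoc _ _ _))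
          exact congrArg (· ≫ (MonObj.mul : kelly D.X D.X ⟶ D.X).hom.app (op ⟨∑ s, j s⟩))
            (kellyGen_naturality f.hom f.hom j)
        unit_hom := by
          have h : (MonObj.one : kellyUnit V ⟶ C.X) ≫ f.hom = (MonObj.one : kellyUnit V ⟶ D.X) :=
            IsMonHom.one_hom f.hom
          have h1 := NatTrans.congr_app (congrArg LambdaSeq.Hom.hom h) (op ⟨1⟩)
          exact (Category.assoc _ _ _).trans (congrArg (kellyUnitGen V ≫ ·) h1)
        base_hom := f.hom.base_hom }
    map_id := fun C => rfl
    map_comp := fun f g => rfl }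

end LambdaSeq
end LambdaOperad
end

noncomputable section
namespace LambdaOperad
set_option linter.unusedVariables false
set_option linter.unusedSectionVars false
open Category (assoc comp_id id_comp)
open Function hiding comp_id id_comp
open Set (range)
attribute [local instance] Classical.decEq

variable {V : Type u} [Category.{v} V] [MonoidalCategory V]

/-- Tensoring preserves finite colimits and countable coproducts. -/
class TensorCocts (V : Type u) [Category.{v} V] [MonoidalCategory V] : Prop where
  fin : ∀ X : V, PreservesFiniteColimits (tensorLeft X)
  nat : ∀ X : V, PreservesColimitsOfShape (Discrete ℕ) (tensorLeft X)

attribute [instance] TensorCocts.fin TensorCocts.nat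

section Rearrange

variable {ι κ : Type}

/-- `l'` is obtained from `l` by deleting the first occurrence of `a`. -/
inductive Del (a : ι) : List ι → List ι → Prop
  | head (l : List ι) : Del a (a :: l) l
  | tail {b : ι} {l l' : List ι} : b ≠ a → Del a l l' → Del a (b :: l) (b :: l')

namespace Del

lemma mem {a : ι} {l l' : List ι} (h : Del a l l') : a ∈ l := by
  induction h <;> simp [*]

lemma erase_eq [DecidableEq ι] {a : ι} {l l' : List ι} (h : Del a l l') : l.erase a = l' := by
  induction h with
  | head l => simp
  | tail hb _ ih => rw [List.erase_cons_tail (by simpa using hb), ih]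

lemma eq_of {a : ι} {l l' l'' : List ι} (h : Del a l l') (h' : Del a l l'') : l' = l'' := by
  classical
  rw [← h.erase_eq, h'.erase_eq]

lemma exists_of_mem {a : ι} {l : List ι} (h : a ∈ l) : ∃ l', Del a l l' := by
  induction l with
  | nil => simp at h
  | cons b l ih =>
    by_cases hb : b = a
    · exact ⟨l, hb ▸ head l⟩
    · obtain ⟨l', h'⟩ := ih (List.mem_of_ne_of_mem (Ne.symm hb) h)
      exact ⟨_, tail hb h'⟩

lemma mem_iff {a : ι} {l l' : List ι} (h : Del a l l') (b : ι) : b ∈ l ↔ b = a ∨ b ∈ l' := by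
  induction h with
  | head l => simp
  | tail hb _ ih => simp only [List.mem_cons, ih]; tauto

lemma nodup {a : ι} {l l' : List ι} (h : Del a l l') (hl : l.Nodup) : l'.Nodup ∧ a ∉ l' := by
  induction h with
  | head l => exact ⟨(List.nodup_cons.1 hl).2, (List.nodup_cons.1 hl).1⟩
  | tail hb h ih =>
    have h1 := ih (List.nodup_cons.1 hl).2
    have h2 := (List.nodup_cons.1 hl).1
    rw [h.mem_iff] at h2
    refine ⟨List.nodup_cons.2 ⟨fun h3 => h2 (Or.inr h3), h1.1⟩, fun h3 => ?_⟩
    rcases List.mem_cons.1 h3 with h4 | h4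
    · exact hb h4.symm
    · exact h1.2 h4

lemma append_left {a : ι} {l l' : List ι} (h : Del a l l') (m : List ι) :
    Del a (l ++ m) (l' ++ m) := by
  induction h with
  | head l => exact head _
  | tail hb h ih => exact tail hb ih

lemma append_right (a : ι) (m : List ι) : ∀ {l : List ι}, a ∉ l → Del a (l ++ a :: m) (l ++ m)
  | [], _ => head _
  | b :: l, h => tail (fun e => h (e ▸ List.mem_cons_self))
      (append_right a m (fun h' => h (List.mem_cons_of_mem _ h')))

end Del

/-- `l` and `m` are duplicate-free, `l ⊆ m`, and the elements of `m` outside `l` satisfy `P`. -/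
structure Sub (P : ι → Prop) (l m : List ι) : Prop where
  nodup_left : l.Nodup
  nodup_right : m.Nodup
  mem : ∀ a ∈ l, a ∈ m
  prop : ∀ a ∈ m, a ∉ l → P a

namespace Sub

variable {P : ι → Prop}

lemma refl {l : List ι} (h : l.Nodup) : Sub P l l := ⟨h, h, fun _ h => h, fun _ h h' => (h' h).elim⟩

lemma of_iff {l m : List ι} (hl : l.Nodup) (hm : m.Nodup) (h : ∀ a, a ∈ l ↔ a ∈ m) : Sub P l m :=
  ⟨hl, hm, fun a => (h a).1, fun a ha hb => (hb ((h a).2 ha)).elim⟩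

lemma trans {l m n : List ι} (h : Sub P l m) (h' : Sub P m n) : Sub P l n :=
  ⟨h.1, h'.2, fun a ha => h'.3 a (h.3 a ha), fun a ha hb => by
    by_cases hm : a ∈ m
    · exact h.4 a hm hb
    · exact h'.4 a ha hm⟩

lemma del {a : ι} {l m l' m' : List ι} (h : Sub P l m) (hl : Del a l l') (hm : Del a m m') :
    Sub P l' m' := by
  refine ⟨(hl.nodup h.1).1, (hm.nodup h.2).1, fun b hb => ?_, fun b hb hb' => ?_⟩
  · have h1 := h.3 b ((hl.mem_iff b).2 (Or.inr hb))
    rcases (hm.mem_iff b).1 h1 with rfl | h2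
    · exact ((hl.nodup h.1).2 hb).elim
    · exact h2
  · refine h.4 b ((hm.mem_iff b).2 (Or.inr hb)) fun h1 => ?_
    rcases (hl.mem_iff b).1 h1 with rfl | h2
    · exact (hm.nodup h.2).2 hb
    · exact hb' h2

lemma del_right {a : ι} {l m m' : List ι} (h : Sub P l m) (hl : a ∉ l) (hm : Del a m m') :
    Sub P l m' := by
  refine ⟨h.1, (hm.nodup h.2).1, fun b hb => ?_, fun b hb hb' => ?_⟩
  · rcases (hm.mem_iff b).1 (h.3 b hb) with rfl | h2
    · exact (hl hb).elim
    · exact h2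
  · exact h.4 b ((hm.mem_iff b).2 (Or.inr hb)) hb'

lemma append {l m l' m' : List ι} (h : Sub P l m) (h' : Sub P l' m') (hd : m.Disjoint m') :
    Sub P (l ++ l') (m ++ m') where
  nodup_left := h.1.append h'.1 fun a ha hb => hd (h.3 a ha) (h'.3 a hb)
  nodup_right := h.2.append h'.2 hd
  mem a ha := by
    rcases List.mem_append.1 ha with h1 | h1
    · exact List.mem_append.2 (Or.inl (h.3 a h1))
    · exact List.mem_append.2 (Or.inr (h'.3 a h1))
  prop a ha hb := by
    rw [List.mem_append, not_or] at hb
    rcases List.mem_append.1 ha with h1 | h1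
    · exact h.4 a h1 hb.1
    · exact h'.4 a h1 hb.2

end Sub

variable [SymmetricCategory V]

lemma swapFront_swapFront (A B C : V) : swapFront A B C ≫ swapFront B A C = 𝟙 _ := by
  simp only [swapFront, assoc, Iso.hom_inv_id_assoc]
  rw [← comp_whiskerRight_assoc, SymmetricCategory.symmetry]
  simp

lemma swapFront_unit (A B : V) : (λ_ (A ⊗ B)).inv ≫ swapFront (𝟙_ V) A B = A ◁ (λ_ B).inv := by
  simp only [swapFront, braiding_tensorUnit_left]
  monoidal

lemma swapFront_whisker {A B C C' : V} (h : C ⟶ C') :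
    (A ◁ B ◁ h) ≫ swapFront A B C' = swapFront A B C ≫ (B ◁ A ◁ h) := by
  simpa using swapFront_naturality (𝟙 A) (𝟙 B) h

lemma swapFront_hexagon (A B C D : V) :
    (A ◁ swapFront B C D) ≫ swapFront A C (B ⊗ D) ≫ (C ◁ swapFront A B D) =
      swapFront A B (C ⊗ D) ≫ (B ◁ swapFront A C D) ≫ swapFront B C (A ⊗ D) := by
  have h := congrArg (fun f : A ⊗ B ⊗ C ⟶ C ⊗ B ⊗ A => (A ◁ (α_ B C D).inv) ≫
    (α_ A (B ⊗ C) D).inv ≫ (f ▷ D) ≫ (α_ C (B ⊗ A) D).hom ≫ (C ◁ (α_ B A D).hom))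
    (BraidedCategory.yang_baxter A B C)
  simp only [swapFront]
  refine Eq.trans ?_ (h.symm.trans ?_)
  · monoidal
  · monoidal

variable [DecidableEq ι] [DecidableEq κ]

/-- `pull` with an arbitrary name for the list of the remaining labels. -/
def pullTo (X : ι → V) {a : ι} {l l' : List ι} (h : Del a l l') : tens X l ⟶ X a ⊗ tens X l' :=
  pull X a l h.mem ≫ (X a ◁ eqToHom (by rw [h.erase_eq]))

lemma whiskerLeft_eqToHom' (A : V) {B C : V} (h : B = C) :
    A ◁ eqToHom h = eqToHom (by rw [h]) := by
  subst h; simp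

lemma pullTo_head (X : ι → V) (a : ι) (l : List ι) (h : Del a (a :: l) l) :
    pullTo X h = 𝟙 _ := by
  simp only [pullTo, pull, dif_pos, whiskerLeft_eqToHom', eqToHom_trans]
  exact eqToHom_refl _ _

lemma pullTo_tail (X : ι → V) {a b : ι} {l l' : List ι} (h : Del a l l') (hb : b ≠ a)
    (h' : Del a (b :: l) (b :: l')) :
    pullTo X h' = (X b ◁ pullTo X h) ≫ swapFront (X b) (X a) _ := by
  obtain rfl := h.erase_eq
  simp only [pullTo, pull, dif_neg hb, whiskerLeft_eqToHom', eqToHom_trans, assoc,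
    eqToHom_refl, comp_id, whiskerLeft_id]

lemma pullTo_comm (X : ι → V) {a b : ι} (hab : a ≠ b) {l la lb lab : List ι} (ha : Del a l la)
    (hb : Del b l lb) (hab' : Del b la lab) (hba : Del a lb lab) :
    pullTo X ha ≫ (X a ◁ pullTo X hab') =
      pullTo X hb ≫ (X b ◁ pullTo X hba) ≫ swapFront (X b) (X a) _ := by
  induction l generalizing la lb lab with
  | nil => exact absurd ha.mem List.not_mem_nil
  | cons c l ih =>
    cases ha with
    | head =>
      cases hb with
      | head => exact absurd rfl hab
      | tail hca h1 =>
        obtain rfl := h1.eq_of hab'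
        rw [pullTo_head, pullTo_tail X h1 hca, pullTo_head X _ _ hba]
        simp [swapFront_swapFront]
    | tail hca h1 =>
      cases hb with
      | head =>
        obtain rfl := h1.eq_of hba
        rw [pullTo_head X _ _ hab', pullTo_tail X h1 hca, pullTo_head X _ _ (Del.head _)]
        simp
      | tail hcb h2 =>
        obtain ⟨m, h3⟩ := Del.exists_of_mem (a := b) (l := _) (by
          rcases (h1.mem_iff b).1 h2.mem with h | h
          · exact absurd h.symm hab
          · exact h)
        have h4 := hab'.eq_of (Del.tail hcb h3)
        subst h4
        cases hba with
        | head => exact absurd rfl hca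
        | tail _ h5 =>
          rw [pullTo_tail X h1 hca, pullTo_tail X h2 hcb, pullTo_tail X h3 hcb,
            pullTo_tail X h5 hca]
          have := ih h1 h2 h3 h5
          simp only [whiskerLeft_comp, assoc]
          rw [← reassoc_of% (swapFront_whisker (A := X c) (B := X a) (pullTo X h3)),
            ← whiskerLeft_comp_assoc, this,
            ← reassoc_of% (swapFront_whisker (A := X c) (B := X b) (pullTo X h5))]
          simp only [whiskerLeft_comp, assoc]
          rw [swapFront_hexagon]

variable {X : ι → V} {P : ι → Prop} {f : ∀ a, P a → (𝟙_ V ⟶ X a)}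

/-- `rearrange` with bundled side conditions. -/
def rearr (X : ι → V) (f : ∀ a, P a → (𝟙_ V ⟶ X a)) {l m : List ι} (h : Sub P l m) :
    tens X l ⟶ tens X m :=
  rearrange X f m l h.1 h.2 h.3 h.4

lemma rearr_nil (h : Sub P [] []) : rearr X f h = 𝟙 _ := by
  simp [rearr, rearrange]

lemma rearr_cons_of_del {a : ι} {l l' m : List ι} (ha : Del a l l') (h : Sub P l (a :: m)) :
    rearr X f h = pullTo X ha ≫ (X a ◁ rearr X f (h.del ha (Del.head m))) := by
  obtain rfl := ha.erase_eq
  simp only [rearr, rearrange, dif_pos ha.mem, pullTo, eqToHom_refl, whiskerLeft_id,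
    comp_id]

lemma rearr_cons_of_notMem {a : ι} {l m : List ι} (ha : a ∉ l) (h : Sub P l (a :: m)) :
    rearr X f h = (λ_ _).inv ≫ (f a (h.4 a List.mem_cons_self ha) ⊗ₘ
      rearr X f (h.del_right ha (Del.head m))) := by
  simp only [rearr, rearrange, dif_neg ha]

lemma rearr_cons_cons {a : ι} {l m : List ι} (h : Sub P (a :: l) (a :: m)) :
    rearr X f h = X a ◁ rearr X f (h.del (Del.head l) (Del.head m)) := by
  rw [rearr_cons_of_del (Del.head l), pullTo_head, id_comp]

lemma rearr_self {l : List ι} (h : Sub P l l) : rearr X f h = 𝟙 _ := by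
  induction l with
  | nil => exact rearr_nil h
  | cons a l ih => rw [rearr_cons_cons, ih, whiskerLeft_id]

lemma insert_swapFront {Y B T T' M : V} (u : 𝟙_ V ⟶ Y) (p : T ⟶ B ⊗ T') (r : T' ⟶ M) :
    (λ_ T).inv ≫ (u ⊗ₘ (p ≫ (B ◁ r))) ≫ swapFront Y B M = p ≫ (B ◁ ((λ_ T').inv ≫ (u ⊗ₘ r))) := by
  have h := swapFront_naturality u (𝟙 B) r
  have h1 : (u ⊗ₘ (p ≫ (B ◁ r))) = (𝟙_ V ◁ p) ≫ (u ⊗ₘ (𝟙 B ⊗ₘ r)) := by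
    rw [← id_tensorHom, ← id_tensorHom, tensorHom_comp_tensorHom, id_comp]
  rw [h1, assoc, h, ← leftUnitor_inv_naturality_assoc, reassoc_of% swapFront_unit,
    id_tensorHom, ← whiskerLeft_comp]

lemma insert_swapFront' {Y B T T' M : V} (u : 𝟙_ V ⟶ Y) (p : T ⟶ B ⊗ T') (r : T' ⟶ M) :
    p ≫ (B ◁ ((λ_ T').inv ≫ (u ⊗ₘ r))) ≫ swapFront B Y M = (λ_ T).inv ≫ (u ⊗ₘ (p ≫ (B ◁ r))) := by
  rw [← assoc, ← insert_swapFront, assoc, assoc, swapFront_swapFront,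
    comp_id]

lemma insert_insert_swapFront {A B T M : V} (u : 𝟙_ V ⟶ A) (w : 𝟙_ V ⟶ B) (r : T ⟶ M) :
    (λ_ T).inv ≫ (w ⊗ₘ ((λ_ T).inv ≫ (u ⊗ₘ r))) ≫ swapFront B A M =
      (λ_ T).inv ≫ (u ⊗ₘ ((λ_ T).inv ≫ (w ⊗ₘ r))) := by
  have h := insert_swapFront w ((λ_ T).inv ≫ (u ▷ T)) r
  simp only [assoc, ← MonoidalCategory.tensorHom_def] at h
  exact h

lemma rearr_pullTo_of_del {a : ι} {l m l' m' : List ι} (h : Sub P l m) (hl : Del a l l')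
    (hm : Del a m m') :
    rearr X f h ≫ pullTo X hm = pullTo X hl ≫ (X a ◁ rearr X f (h.del hl hm)) := by
  induction m generalizing l l' m' with
  | nil => exact absurd hm.mem List.not_mem_nil
  | cons b m ih =>
    cases hm with
    | head => rw [rearr_cons_of_del hl, pullTo_head X _ _ (Del.head _), comp_id]
    | tail hb hm1 =>
      rw [pullTo_tail X hm1 hb]
      by_cases hbl : b ∈ l
      · obtain ⟨l2, hl2⟩ := Del.exists_of_mem hbl
        have hal2 : a ∈ l2 := by
          rcases (hl2.mem_iff a).1 hl.mem with h1 | h1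
          · exact absurd h1.symm hb
          · exact h1
        obtain ⟨l12, h12⟩ := Del.exists_of_mem hal2
        have hbl' : b ∈ l' := by
          rcases (hl.mem_iff b).1 hbl with h1 | h1
          · exact absurd h1 hb
          · exact h1
        obtain ⟨l21, h21⟩ := Del.exists_of_mem hbl'
        have h21e : l21 = l12 := by
          rw [← h21.erase_eq, ← h12.erase_eq, ← hl.erase_eq, ← hl2.erase_eq, List.erase_comm]
        subst h21e
        rw [rearr_cons_of_del hl2, rearr_cons_of_del h21, assoc,
          ← whiskerLeft_comp_assoc, ih _ h12 hm1, whiskerLeft_comp, whiskerLeft_comp]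
        rw [reassoc_of% pullTo_comm X (Ne.symm hb) hl hl2 h21 h12, assoc,
          swapFront_whisker]
      · have hbl' : b ∉ l' := fun h1 => hbl ((hl.mem_iff b).2 (Or.inr h1))
        rw [rearr_cons_of_notMem hbl, rearr_cons_of_notMem hbl', assoc,
          ← id_tensorHom (X b), tensorHom_comp_tensorHom_assoc, comp_id, ih _ hl hm1,
          insert_swapFront]

lemma rearr_pullTo_of_notMem {a : ι} {l m m' : List ι} (h : Sub P l m) (hl : a ∉ l)
    (hm : Del a m m') :
    rearr X f h ≫ pullTo X hm = (λ_ _).inv ≫ (f a (h.4 a hm.mem hl) ⊗ₘ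
      rearr X f (h.del_right hl hm)) := by
  induction m generalizing l m' with
  | nil => exact absurd hm.mem List.not_mem_nil
  | cons b m ih =>
    cases hm with
    | head => rw [rearr_cons_of_notMem hl, pullTo_head X _ _ (Del.head _), comp_id]
    | tail hb hm1 =>
      rw [pullTo_tail X hm1 hb]
      by_cases hbl : b ∈ l
      · obtain ⟨l2, hl2⟩ := Del.exists_of_mem hbl
        have hal2 : a ∉ l2 := fun h1 => hl ((hl2.mem_iff a).2 (Or.inr h1))
        rw [rearr_cons_of_del hl2, rearr_cons_of_del hl2, assoc,
          ← whiskerLeft_comp_assoc, ih _ hal2 hm1, insert_swapFront']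
      · rw [rearr_cons_of_notMem hbl, rearr_cons_of_notMem hbl, assoc,
          ← id_tensorHom (X b), tensorHom_comp_tensorHom_assoc, comp_id, ih _ hl hm1,
          insert_insert_swapFront]

lemma rearr_comp {l m n : List ι} (h : Sub P l m) (h' : Sub P m n) :
    rearr X f h ≫ rearr X f h' = rearr X f (h.trans h') := by
  induction n generalizing l m with
  | nil =>
    have hm : m = [] := List.eq_nil_iff_forall_not_mem.2 fun a ha => List.not_mem_nil (h'.3 a ha)
    subst hm
    rw [rearr_nil h', comp_id]
  | cons a n ih =>
    by_cases ham : a ∈ m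
    · obtain ⟨m', hm'⟩ := Del.exists_of_mem ham
      rw [rearr_cons_of_del hm']
      by_cases hal : a ∈ l
      · obtain ⟨l', hl'⟩ := Del.exists_of_mem hal
        rw [rearr_cons_of_del hl', reassoc_of% rearr_pullTo_of_del h hl' hm', ← whiskerLeft_comp,
          ih]
      · rw [rearr_cons_of_notMem hal, reassoc_of% rearr_pullTo_of_notMem h hal hm',
          ← id_tensorHom (X a), tensorHom_comp_tensorHom, ih, comp_id]
    · have hal : a ∉ l := fun h1 => ham (h.3 a h1)
      rw [rearr_cons_of_notMem ham, rearr_cons_of_notMem hal, leftUnitor_inv_naturality_assoc,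
        ← id_tensorHom, tensorHom_comp_tensorHom, ih, id_comp]

end Rearrange
section Canonical

variable [SymmetricCategory V]
  {ι κ : Type}

lemma tensAppend_cons_hom (X : ι → V) (a : ι) (l m : List ι) :
    (tensAppend X m (a :: l)).hom = (α_ _ _ _).hom ≫ (X a ◁ (tensAppend X m l).hom) := rfl

lemma whisker_assoc_aux {A L M N LM MN K K' : V} {lm : L ⊗ M ⟶ LM} {mn : M ⊗ N ⟶ MN}
    {p : LM ⊗ N ⟶ K} {q : L ⊗ MN ⟶ K'} {e : K' ⟶ K}
    (h : (lm ▷ N) ≫ p = (α_ _ _ _).hom ≫ (L ◁ mn) ≫ q ≫ e) :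
    (((α_ A L M).hom ≫ (A ◁ lm)) ▷ N) ≫ (α_ _ _ _).hom ≫ (A ◁ p) =
      (α_ _ _ _).hom ≫ ((A ⊗ L) ◁ mn) ≫ ((α_ _ _ _).hom ≫ (A ◁ q)) ≫ (A ◁ e) := by
  have h1 : (((α_ A L M).hom ≫ (A ◁ lm)) ▷ N) ≫ (α_ _ _ _).hom ≫ (A ◁ p) =
      ((α_ A L M).hom ▷ N) ≫ (α_ _ _ _).hom ≫ (A ◁ ((lm ▷ N) ≫ p)) := by
    simp
  rw [h1, h]
  simp

lemma tensAppend_assoc (X : ι → V) (l m n : List ι) :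
    ((tensAppend X m l).hom ▷ tens X n) ≫ (tensAppend X n (l ++ m)).hom =
      (α_ _ _ _).hom ≫ (tens X l ◁ (tensAppend X n m).hom) ≫ (tensAppend X (m ++ n) l).hom ≫
        eqToHom (congrArg (tens X) (List.append_assoc l m n).symm) := by
  induction l with
  | nil => simp [tensAppend]
  | cons a l ih =>
    have h : eqToHom (congrArg (tens X) (List.append_assoc (a :: l) m n).symm) =
        X a ◁ eqToHom (congrArg (tens X) (List.append_assoc l m n).symm) :=
      (whiskerLeft_eqToHom' _ _).symm
    rw [h]
    exact whisker_assoc_aux ih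

lemma tensAppend_nil (X : ι → V) (l : List ι) :
    (tensAppend X [] l).hom ≫ eqToHom (congrArg (tens X) (List.append_nil l)) = (ρ_ _).hom := by
  induction l with
  | nil => simp [tensAppend, unitors_equal]
  | cons a l ih =>
    have h : eqToHom (congrArg (tens X) (List.append_nil (a :: l))) =
        X a ◁ eqToHom (congrArg (tens X) (List.append_nil l)) :=
      (whiskerLeft_eqToHom' _ _).symm
    rw [h, tensAppend_cons_hom, assoc, rightUnitor_tensor_hom, ← ih, whiskerLeft_comp]

lemma swapFront_append (A B T M : V) :
    (swapFront A B T ▷ M) ≫ (α_ _ _ _).hom ≫ (B ◁ (α_ _ _ _).hom) =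
      (α_ _ _ _).hom ≫ (A ◁ (α_ _ _ _).hom) ≫ swapFront A B (T ⊗ M) := by
  simp only [swapFront]
  monoidal

lemma swapFront_tensor (A B C D : V) :
    (α_ A B (C ⊗ D)).hom ≫ (A ◁ swapFront B C D) ≫ swapFront A C (B ⊗ D) =
      swapFront (A ⊗ B) C D ≫ (C ◁ (α_ _ _ _).hom) := by
  simp only [swapFront, BraidedCategory.braiding_tensor_left_hom]
  monoidal

lemma whisker_swap_append_aux {A B L L' M LM LM' : V} {p : L ⟶ A ⊗ L'} {ap : L ⊗ M ⟶ LM}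
    {ap' : L' ⊗ M ⟶ LM'} {q : LM ⟶ A ⊗ LM'}
    (h : (p ▷ M) ≫ (α_ _ _ _).hom ≫ (A ◁ ap') = ap ≫ q) :
    (((B ◁ p) ≫ swapFront B A L') ▷ M) ≫ (α_ _ _ _).hom ≫ (A ◁ ((α_ _ _ _).hom ≫ (B ◁ ap'))) =
      ((α_ _ _ _).hom ≫ (B ◁ ap)) ≫ (B ◁ q) ≫ swapFront B A LM' := by
  rw [assoc, ← whiskerLeft_comp_assoc, ← h]
  simp only [whiskerLeft_comp, assoc, comp_whiskerRight, swapFront_whisker]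
  rw [reassoc_of% swapFront_append]
  simp

variable [DecidableEq ι]

lemma pullTo_append (X : ι → V) {a : ι} {l l' : List ι} (h : Del a l l') (m : List ι) :
    (pullTo X h ▷ tens X m) ≫ (α_ _ _ _).hom ≫ (X a ◁ (tensAppend X m l').hom) =
      (tensAppend X m l).hom ≫ pullTo X (h.append_left m) := by
  induction l generalizing l' with
  | nil => exact absurd h.mem List.not_mem_nil
  | cons b l ih =>
    cases h with
    | head =>
      have h1 := pullTo_head X a (l ++ m) (Del.head _)
      rw [pullTo_head, id_whiskerRight, id_comp]
      exact ((congrArg ((tensAppend X m (a :: l)).hom ≫ ·) h1).trans (comp_id _)).symm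
    | tail hb h1 =>
      have h2 := pullTo_tail X (h1.append_left m) hb (Del.tail hb (h1.append_left m))
      rw [pullTo_tail X h1 hb]
      exact (whisker_swap_append_aux (ih h1)).trans
        (congrArg ((tensAppend X m (b :: l)).hom ≫ ·) h2.symm)

lemma pullTo_append_right (X : ι → V) {a : ι} {l : List ι} (h : a ∉ l) (m : List ι)
    (h' : Del a (l ++ a :: m) (l ++ m)) :
    (tensAppend X (a :: m) l).hom ≫ pullTo X h' =
      swapFront (tens X l) (X a) (tens X m) ≫ (X a ◁ (tensAppend X m l).hom) := by
  induction l with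
  | nil =>
    have h1 := pullTo_head X a m h'
    have h2 := swapFront_unit (X a) (tens X m)
    refine (congrArg ((λ_ (X a ⊗ tens X m)).hom ≫ ·) h1).trans ?_
    refine (comp_id _).trans ?_
    rw [← cancel_epi (λ_ _).inv]
    refine Eq.trans ?_ ((congrArg (· ≫ (X a ◁ (λ_ (tens X m)).hom)) h2).symm.trans
      (assoc _ _ _))
    simp
  | cons b l ih =>
    have hb : b ≠ a := fun e => h (e ▸ List.mem_cons_self)
    have hl : a ∉ l := fun h' => h (List.mem_cons_of_mem _ h')
    have h1 := pullTo_tail X (Del.append_right a m hl) hb h'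
    refine (congrArg ((tensAppend X (a :: m) (b :: l)).hom ≫ ·) h1).trans ?_
    rw [tensAppend_cons_hom, tensAppend_cons_hom, assoc, ← whiskerLeft_comp_assoc, ih hl]
    simp only [whiskerLeft_comp, assoc, swapFront_whisker]
    rw [reassoc_of% swapFront_tensor]

variable {X : ι → V} {P : ι → Prop} {f : ∀ a, P a → (𝟙_ V ⟶ X a)}

lemma eqToHom_eq_rearr {l m : List ι} (h : l = m) (h' : Sub P l m) :
    eqToHom (congrArg (tens X) h) = rearr X f h' := by
  subst h
  rw [rearr_self, eqToHom_refl]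

lemma append_aux {A L L1 L' M M' N K K1 : V} {p : L ⟶ A ⊗ L1} {r : L1 ⟶ M} {r' : L' ⟶ M'}
    {apM : M ⊗ M' ⟶ N} {apL1 : L1 ⊗ L' ⟶ K1} {apL : L ⊗ L' ⟶ K} {q : K ⟶ A ⊗ K1} {s : K1 ⟶ N}
    (h : (p ▷ L') ≫ (α_ _ _ _).hom ≫ (A ◁ apL1) = apL ≫ q) (h' : (r ⊗ₘ r') ≫ apM = apL1 ≫ s) :
    ((p ≫ (A ◁ r)) ⊗ₘ r') ≫ (α_ _ _ _).hom ≫ (A ◁ apM) = apL ≫ q ≫ (A ◁ s) := by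
  rw [← assoc apL, ← h]
  simp only [assoc, ← whiskerLeft_comp, ← h']
  simp [MonoidalCategory.tensorHom_def]

lemma append_aux' {A L L' M M' N K : V} {u : 𝟙_ V ⟶ A} {r : L ⟶ M} {r' : L' ⟶ M'}
    {apM : M ⊗ M' ⟶ N} {apL : L ⊗ L' ⟶ K} {s : K ⟶ N}
    (h' : (r ⊗ₘ r') ≫ apM = apL ≫ s) :
    (((λ_ _).inv ≫ (u ⊗ₘ r)) ⊗ₘ r') ≫ (α_ _ _ _).hom ≫ (A ◁ apM) =
      apL ≫ (λ_ _).inv ≫ (u ⊗ₘ s) := by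
  have h1 : apL ≫ (λ_ _).inv ≫ (u ⊗ₘ s) = (λ_ _).inv ≫ (u ▷ _) ≫ (A ◁ (apL ≫ s)) := by
    rw [leftUnitor_inv_naturality_assoc, MonoidalCategory.tensorHom_def, whisker_exchange_assoc,
      whiskerLeft_comp]
  rw [h1, ← h']
  simp [MonoidalCategory.tensorHom_def]

lemma rearr_append {l m l' m' : List ι} (h : Sub P l m) (h' : Sub P l' m') (hd : m.Disjoint m') :
    (rearr X f h ⊗ₘ rearr X f h') ≫ (tensAppend X m' m).hom =
      (tensAppend X l' l).hom ≫ rearr X f (h.append h' hd) := by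
  induction m generalizing l with
  | nil =>
    have hm : l = [] := List.eq_nil_iff_forall_not_mem.2 fun a ha => List.not_mem_nil (h.3 a ha)
    subst hm
    rw [rearr_nil h, id_tensorHom]
    exact leftUnitor_naturality _
  | cons a m ih =>
    have hd' : m.Disjoint m' := fun b hb hb' => hd (List.mem_cons_of_mem _ hb) hb'
    have ham' : a ∉ m' := fun h1 => hd List.mem_cons_self h1
    by_cases ha : a ∈ l
    · obtain ⟨l1, hl1⟩ := Del.exists_of_mem ha
      rw [rearr_cons_of_del hl1]
      refine (append_aux (pullTo_append X hl1 l') (ih (h.del hl1 (Del.head m)) hd')).trans ?_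
      refine congrArg ((tensAppend X l' l).hom ≫ ·) ?_
      exact (rearr_cons_of_del (m := m ++ m') (hl1.append_left l') (h.append h' hd)).symm
    · have ha' : a ∉ l ++ l' := fun h1 => by
        rcases List.mem_append.1 h1 with h2 | h2
        · exact ha h2
        · exact ham' (h'.3 a h2)
      rw [rearr_cons_of_notMem ha]
      refine (append_aux' (ih (h.del_right ha (Del.head m)) hd')).trans ?_
      refine congrArg ((tensAppend X l' l).hom ≫ ·) ?_
      exact (rearr_cons_of_notMem (m := m ++ m') ha' (h.append h' hd)).symm

lemma rearr_braiding {l m : List ι} (h : Sub P (l ++ m) (m ++ l)) :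
    (β_ (tens X l) (tens X m)).hom ≫ (tensAppend X l m).hom =
      (tensAppend X m l).hom ≫ rearr X f h := by
  induction m with
  | nil =>
    have h1 := eqToHom_eq_rearr (X := X) (f := f) (List.append_nil l) h
    refine Eq.trans ?_ (congrArg ((tensAppend X [] l).hom ≫ ·) h1)
    refine Eq.trans ?_ (tensAppend_nil X l).symm
    simp [tensAppend]
  | cons a m ih =>
    have ha : a ∉ l := fun h1 => List.disjoint_of_nodup_append h.1 h1 List.mem_cons_self
    have h0 := Del.append_right a m ha
    have h1 := rearr_cons_of_del (X := X) (f := f) (m := m ++ l) h0 h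
    refine Eq.trans ?_ (congrArg ((tensAppend X (a :: m) l).hom ≫ ·) h1).symm
    rw [reassoc_of% pullTo_append_right X ha m h0]
    refine Eq.trans ?_ (congrArg (swapFront (tens X l) (X a) (tens X m) ≫ ·)
      ((congrArg (X a ◁ ·) (ih (h.del h0 (Del.head (m ++ l))))).trans (whiskerLeft_comp _ _ _)))
    rw [tensAppend_cons_hom, BraidedCategory.braiding_tensor_right_hom]
    simp [swapFront]

end Canonical
section Canonical

variable [SymmetricCategory V]
  {ι κ : Type}

/-- The concatenation of the lists `m k`, where `k` runs through a list. -/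
@[reducible] def flat (m : κ → List ι) : List κ → List ι
  | [] => []
  | k :: l => m k ++ flat m l

lemma mem_flat {m : κ → List ι} {l : List κ} {i : ι} : i ∈ flat m l ↔ ∃ k ∈ l, i ∈ m k := by
  induction l with
  | nil => simp
  | cons k l ih => simp [ih]

/-- The lists `m k` are duplicate-free and pairwise disjoint. -/
structure Sep (m : κ → List ι) : Prop where
  nodup : ∀ k, (m k).Nodup
  inj : ∀ k k' i, i ∈ m k → i ∈ m k' → k = k'

lemma Sep.flat_nodup {m : κ → List ι} (h : Sep m) {l : List κ} (hl : l.Nodup) :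
    (flat m l).Nodup := by
  induction l with
  | nil => simp
  | cons k l ih =>
    refine (h.1 k).append (ih (List.nodup_cons.1 hl).2) fun i hi hi' => ?_
    obtain ⟨k', hk', hi'⟩ := mem_flat.1 hi'
    exact (List.nodup_cons.1 hl).1 (h.2 k k' i hi hi' ▸ hk')

lemma Sep.comp {m : κ → List ι} (h : Sep m) {κ' : Type} {e : κ' → κ} (he : Function.Injective e) :
    Sep (fun k => m (e k)) :=
  ⟨fun k => h.1 _, fun k k' i hi hi' => he (h.2 _ _ i hi hi')⟩

variable {X Y : ι → V} {A B C A' B' C' : V} {l m n l' m' n' : List ι}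

/-- `𝟙_ V` as a tensor product of labelled factors. -/
def canUnit (X : ι → V) : 𝟙_ V ≅ tens X [] := Iso.refl _

/-- `X i` as a tensor product of labelled factors. -/
def canAtom (X : ι → V) (i : ι) : X i ≅ tens X [i] := (ρ_ (X i)).symm

/-- `A ⊗ B` as a tensor product of labelled factors. -/
def canTensor (a : A ≅ tens X l) (b : B ≅ tens X m) : A ⊗ B ≅ tens X (l ++ m) :=
  (a ⊗ᵢ b) ≪≫ tensAppend X m l

/-- An iterated tensor product as a tensor product of labelled factors. -/
def canTens {A : κ → V} {m : κ → List ι} (a : ∀ k, A k ≅ tens X (m k)) :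
    ∀ l : List κ, tens A l ≅ tens X (flat m l)
  | [] => Iso.refl _
  | k :: l => canTensor (a k) (canTens a l)

variable {P : ι → Prop} {f : ∀ a, P a → (𝟙_ V ⟶ X a)} {f' : ∀ a, P a → (𝟙_ V ⟶ Y a)}

/-- With respect to presentations of `A` and `B` as tensor products of labelled factors, `g`
permutes the factors as prescribed by the labels and inserts the morphisms `f i` at the new labels. -/
def IsCan (f : ∀ a, P a → (𝟙_ V ⟶ X a)) (a : A ≅ tens X l) (b : B ≅ tens X m) (g : A ⟶ B) : Prop :=
  ∃ h : Sub P l m, g ≫ b.hom = a.hom ≫ rearr X f h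

/-- The isomorphism between two objects that are presented as tensor products of the same labelled
factors. -/
def canIso (a : A ≅ tens X l) (b : B ≅ tens X m) (hl : l.Nodup) (hm : m.Nodup)
    (h : ∀ i, i ∈ l ↔ i ∈ m) : A ≅ B :=
  have h1 : Sub (fun _ => False) l m := Sub.of_iff hl hm h
  have h2 : Sub (fun _ => False) m l := Sub.of_iff hm hl fun i => (h i).symm
  { hom := a.hom ≫ rearr X (fun _ h => h.elim) h1 ≫ b.inv
    inv := b.hom ≫ rearr X (fun _ h => h.elim) h2 ≫ a.inv
    hom_inv_id := by
      simp only [assoc, Iso.inv_hom_id_assoc]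
      rw [reassoc_of% rearr_comp, rearr_self]
      simp
    inv_hom_id := by
      simp only [assoc, Iso.inv_hom_id_assoc]
      rw [reassoc_of% rearr_comp, rearr_self]
      simp }

lemma rearr_mono {Q : ι → Prop} (hQ : ∀ i, Q i → P i) {l m : List ι} (h : Sub P l m)
    (h' : Sub Q l m) : rearr X (fun i hi => f i (hQ i hi)) h' = rearr X f h := by
  induction m generalizing l with
  | nil =>
    have hm : l = [] := List.eq_nil_iff_forall_not_mem.2 fun a ha => List.not_mem_nil (h.3 a ha)
    subst hm
    rw [rearr_nil, rearr_nil]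
  | cons k m ih =>
    by_cases hk : k ∈ l
    · obtain ⟨l1, h1⟩ := Del.exists_of_mem hk
      rw [rearr_cons_of_del h1, rearr_cons_of_del h1, ih]
    · rw [rearr_cons_of_notMem hk, rearr_cons_of_notMem hk, ih]

lemma isCan_canIso (a : A ≅ tens X l) (b : B ≅ tens X m)
    (hl : l.Nodup) (hm : m.Nodup) (h : ∀ i, i ∈ l ↔ i ∈ m) :
    IsCan f a b (canIso a b hl hm h).hom := by
  have h1 : Sub P l m := Sub.of_iff hl hm h
  have h2 : Sub (fun _ => False) l m := Sub.of_iff hl hm h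
  refine ⟨h1, ?_⟩
  simp only [canIso, assoc, Iso.inv_hom_id, comp_id]
  rw [← rearr_mono (f := f) (fun _ h => h.elim) h1 h2]
  congr 2
  funext i hi
  exact hi.elim

namespace IsCan

variable {a : A ≅ tens X l} {b : B ≅ tens X m} {c : C ≅ tens X n}
  {a' : A' ≅ tens X l'} {b' : B' ≅ tens X m'} {c' : C' ≅ tens X n'}

lemma unique {g g' : A ⟶ B} (h : IsCan f a b g) (h' : IsCan f a b g') : g = g' := by
  obtain ⟨h1, h2⟩ := h
  obtain ⟨h3, h4⟩ := h'
  rw [← cancel_mono b.hom, h2, h4]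

lemma nodup_left {g : A ⟶ B} (h : IsCan f a b g) : l.Nodup := h.1.1
lemma comp {g : A ⟶ B} {g' : B ⟶ C} (h : IsCan f a b g) (h' : IsCan f b c g') :
    IsCan f a c (g ≫ g') := by
  obtain ⟨h1, h2⟩ := h
  obtain ⟨h3, h4⟩ := h'
  exact ⟨h1.trans h3, by rw [assoc, h4, reassoc_of% h2, rearr_comp]⟩

lemma of_eq (hl : l.Nodup) {b : B ≅ tens X l} {g : A ⟶ B} (h : g ≫ b.hom = a.hom) :
    IsCan f a b g :=
  ⟨Sub.refl hl, by rw [rearr_self, h, comp_id]⟩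

lemma of_eq' (hl : l.Nodup) (hlm : l = m) {g : A ⟶ B}
    (h : g ≫ b.hom = a.hom ≫ eqToHom (congrArg (tens X) hlm)) :
    IsCan f a b g := by
  subst hlm
  exact of_eq hl (by simpa using h)

lemma id (hl : l.Nodup) : IsCan f a a (𝟙 A) := of_eq hl (id_comp _)

lemma inv {g : A ≅ B} (h : IsCan f a b g.hom) (hlm : ∀ i, i ∈ m → i ∈ l) : IsCan f b a g.inv := by
  obtain ⟨h1, h2⟩ := h
  have h3 : Sub P m l := Sub.of_iff h1.2 h1.1 fun i => ⟨hlm i, h1.3 i⟩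
  refine ⟨h3, ?_⟩
  rw [← cancel_epi g.hom, Iso.hom_inv_id_assoc, reassoc_of% h2, rearr_comp, rearr_self,
    comp_id]

lemma tensor {g : A ⟶ B} {g' : A' ⟶ B'} (h : IsCan f a b g) (h' : IsCan f a' b' g')
    (hd : m.Disjoint m') : IsCan f (canTensor a a') (canTensor b b') (g ⊗ₘ g') := by
  obtain ⟨h1, h2⟩ := h
  obtain ⟨h3, h4⟩ := h'
  refine ⟨h1.append h3 hd, ?_⟩
  simp only [canTensor, Iso.trans_hom, tensorIso_hom, assoc]
  rw [← rearr_append h1 h3 hd, tensorHom_comp_tensorHom_assoc, h2, h4,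
    tensorHom_comp_tensorHom_assoc]

lemma whiskerRight {g : A ⟶ B} (h : IsCan f a b g) (c : C ≅ tens X n)
    (hd : (m ++ n).Nodup) : IsCan f (canTensor a c) (canTensor b c) (g ▷ C) := by
  rw [← tensorHom_id]
  exact h.tensor (id (List.nodup_append.1 hd).2.1) (List.disjoint_of_nodup_append hd)

lemma whiskerLeft {g : A ⟶ B} (h : IsCan f a b g) (c : C ≅ tens X n)
    (hd : (n ++ m).Nodup) : IsCan f (canTensor c a) (canTensor c b) (C ◁ g) := by
  rw [← id_tensorHom]
  exact (id (List.nodup_append.1 hd).1).tensor h (List.disjoint_of_nodup_append hd)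

lemma associator (hn : (l ++ m ++ n).Nodup) :
    IsCan f (canTensor (canTensor a b) c) (canTensor a (canTensor b c)) (α_ A B C).hom := by
  refine of_eq' hn (List.append_assoc l m n) ?_
  have h := tensAppend_assoc X l m n
  simp only [canTensor, Iso.trans_hom, tensorIso_hom, assoc]
  have h1 : ((a.hom ⊗ₘ b.hom) ≫ (tensAppend X m l).hom ⊗ₘ c.hom) ≫ (tensAppend X n (l ++ m)).hom =
      ((a.hom ⊗ₘ b.hom) ⊗ₘ c.hom) ≫ ((tensAppend X m l).hom ▷ tens X n) ≫
        (tensAppend X n (l ++ m)).hom := by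
    rw [← tensorHom_id, tensorHom_comp_tensorHom_assoc, comp_id]
  rw [reassoc_of% h1, reassoc_of% h, eqToHom_trans, eqToHom_refl, comp_id,
    associator_naturality_assoc, ← id_tensorHom, tensorHom_comp_tensorHom_assoc, comp_id]

lemma assoc_inv (hn : (l ++ m ++ n).Nodup) :
    IsCan f (canTensor a (canTensor b c)) (canTensor (canTensor a b) c) (α_ A B C).inv :=
  inv (associator hn) (by simp)

lemma leftUnitor (hl : l.Nodup) : IsCan f (canTensor (canUnit X) a) a (λ_ A).hom := by
  refine of_eq (l := l) hl ?_
  rw [← leftUnitor_naturality]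
  simp [canTensor, canUnit, tensAppend]

lemma leftUnitor_inv (hl : l.Nodup) : IsCan f a (canTensor (canUnit X) a) (λ_ A).inv :=
  inv (leftUnitor hl) (by simp)

lemma rightUnitor (hl : l.Nodup) : IsCan f (canTensor a (canUnit X)) a (ρ_ A).hom := by
  refine of_eq' (by simpa using hl) (List.append_nil l) ?_
  have := tensAppend_nil X l
  simp only [canTensor, Iso.trans_hom, tensorIso_hom, assoc, this]
  rw [← rightUnitor_naturality]
  simp [canUnit]

lemma rightUnitor_inv (hl : l.Nodup) : IsCan f a (canTensor a (canUnit X)) (ρ_ A).inv :=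
  inv (rightUnitor hl) (by simp)

lemma braiding (hn : (l ++ m).Nodup) : IsCan f (canTensor a b) (canTensor b a) (β_ A B).hom := by
  have h : Sub P (l ++ m) (m ++ l) := Sub.of_iff hn (List.nodup_append_comm.1 hn) (by simp [or_comm])
  refine ⟨h, ?_⟩
  simp only [canTensor, Iso.trans_hom, tensorIso_hom, assoc, ← rearr_braiding]
  rw [← reassoc_of% BraidedCategory.braiding_naturality]

lemma swapFront (hn : (l ++ m ++ n).Nodup) :
    IsCan f (canTensor a (canTensor b c)) (canTensor b (canTensor a c)) (swapFront A B C) := by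
  have h1 : (m ++ l ++ n).Nodup := by
    rw [List.nodup_append] at hn ⊢
    refine ⟨List.nodup_append_comm.1 hn.1, hn.2.1, ?_⟩
    intro x hx
    exact hn.2.2 x (by simpa [or_comm] using hx)
  exact ((assoc_inv hn).comp ((braiding (List.nodup_append.1 hn).1).whiskerRight c h1)).comp
    (associator h1) |> fun h => by simpa [LambdaOperad.swapFront] using h

lemma atom (i : ι) (hi : P i) : IsCan f (canUnit X) (canAtom X i) (f i hi) := by
  refine ⟨⟨List.nodup_nil, by simp, by simp, by simpa using hi⟩, ?_⟩
  rw [rearr_cons_of_notMem List.not_mem_nil, rearr_nil, tensorHom_id]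
  simp only [canUnit, canAtom, Iso.symm_hom, Iso.refl_hom, id_comp]
  rw [rightUnitor_inv_naturality, unitors_inv_equal]

section Family

variable {A B : κ → V} {mA mB : κ → List ι} {a : ∀ k, A k ≅ tens X (mA k)}
  {b : ∀ k, B k ≅ tens X (mB k)} {Q : κ → Prop} {fA : ∀ k, Q k → (𝟙_ V ⟶ A k)}

lemma tensMap {g : ∀ k, A k ⟶ B k} (h : ∀ k, IsCan f (a k) (b k) (g k)) (hm : Sep mB)
    {l : List κ} (hl : l.Nodup) : IsCan f (canTens a l) (canTens b l) (tensMap g l) := by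
  induction l with
  | nil => exact id List.nodup_nil
  | cons k l ih =>
    exact (h k).tensor (ih (List.nodup_cons.1 hl).2)
      (List.disjoint_of_nodup_append (hm.flat_nodup hl))

lemma pullTo (hm : Sep mA) {k : κ} {l l' : List κ} (h : Del k l l') (hl : l.Nodup) :
    IsCan f (canTens a l) (canTensor (a k) (canTens a l')) (pullTo A h) := by
  induction l generalizing l' with
  | nil => exact absurd h.mem List.not_mem_nil
  | cons b l ih =>
    cases h with
    | head =>
      rw [pullTo_head]
      exact id (hm.flat_nodup hl)
    | @tail _ _ l' hb h1 =>
      have hl' := (List.nodup_cons.1 hl).2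
      have h2 : (flat mA (b :: k :: l')).Nodup := hm.flat_nodup (by
        have h3 := h1.nodup hl'
        have h4 := (List.nodup_cons.1 hl).1
        rw [h1.mem_iff] at h4
        simp only [List.nodup_cons, List.mem_cons]
        exact ⟨h4, h3.2, h3.1⟩)
      rw [pullTo_tail A h1 hb]
      refine ((ih h1 hl').whiskerLeft (a b) h2).comp (swapFront ?_)
      simpa [flat] using h2

lemma rearr (hm : Sep mA) (hf : ∀ k hk, IsCan f (canUnit X) (a k) (fA k hk)) {l l' : List κ}
    (h : Sub Q l l') : IsCan f (canTens a l) (canTens a l') (rearr A fA h) := by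
  induction l' generalizing l with
  | nil =>
    have hl : l = [] := List.eq_nil_iff_forall_not_mem.2 fun a ha => List.not_mem_nil (h.3 a ha)
    subst hl
    rw [rearr_nil]
    exact id List.nodup_nil
  | cons k l' ih =>
    by_cases hk : k ∈ l
    · obtain ⟨l1, h1⟩ := Del.exists_of_mem hk
      rw [rearr_cons_of_del h1]
      exact (pullTo hm h1 h.1).comp ((ih (h.del h1 (Del.head l'))).whiskerLeft (a k)
        (hm.flat_nodup h.2))
    · rw [rearr_cons_of_notMem hk]
      exact (leftUnitor_inv (hm.flat_nodup h.1)).comp ((hf k _).tensor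
        (ih (h.del_right hk (Del.head l'))) (List.disjoint_of_nodup_append (hm.flat_nodup h.2)))

end Family

end IsCan

/-- `α` is the tensor product of the morphisms `t i` with respect to presentations of its source and
target. -/
def IsNat (t : ∀ i, X i ⟶ Y i) (a : A ≅ tens X l) (b : B ≅ tens Y l) (α : A ⟶ B) : Prop :=
  α ≫ b.hom = a.hom ≫ tensMap t l

namespace IsNat

variable {t : ∀ i, X i ⟶ Y i}

lemma atom (i : ι) : IsNat t (canAtom X i) (canAtom Y i) (t i) := by
  simp [IsNat, canAtom, tensMap]

lemma append_naturality_aux {A A' L L' M M' K K' : V} {s : A ⟶ A'} {p : L ⟶ L'} {q : M ⟶ M'}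
    {ap : L ⊗ M ⟶ K} {ap' : L' ⊗ M' ⟶ K'} {r : K ⟶ K'} (h : (p ⊗ₘ q) ≫ ap' = ap ≫ r) :
    ((s ⊗ₘ p) ⊗ₘ q) ≫ (α_ _ _ _).hom ≫ (A' ◁ ap') = ((α_ _ _ _).hom ≫ (A ◁ ap)) ≫ (s ⊗ₘ r) := by
  rw [associator_naturality_assoc, ← id_tensorHom, ← id_tensorHom, tensorHom_comp_tensorHom, h,
    assoc, tensorHom_comp_tensorHom, id_comp, comp_id]

lemma tensAppend_naturality (t : ∀ i, X i ⟶ Y i) (l m : List ι) :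
    (tensMap t l ⊗ₘ tensMap t m) ≫ (tensAppend Y m l).hom =
      (tensAppend X m l).hom ≫ tensMap t (l ++ m) := by
  induction l with
  | nil =>
    refine Eq.trans ?_ (leftUnitor_naturality _)
    rw [← id_tensorHom]
    rfl
  | cons i l ih =>
    exact append_naturality_aux ih

lemma tensor {a : A ≅ tens X l} {b : B ≅ tens Y l} {a' : A' ≅ tens X m} {b' : B' ≅ tens Y m}
    {α : A ⟶ B} {α' : A' ⟶ B'} (h : IsNat t a b α) (h' : IsNat t a' b' α') :
    IsNat t (canTensor a a') (canTensor b b') (α ⊗ₘ α') := by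
  unfold IsNat at *
  simp only [canTensor, Iso.trans_hom, tensorIso_hom, assoc]
  rw [← tensAppend_naturality, tensorHom_comp_tensorHom_assoc, h, h',
    tensorHom_comp_tensorHom_assoc]

lemma tens {A B : κ → V} {mA : κ → List ι} {a : ∀ k, A k ≅ tens X (mA k)}
    {b : ∀ k, B k ≅ LambdaOperad.tens Y (mA k)} {g : ∀ k, A k ⟶ B k} (h : ∀ k, IsNat t (a k) (b k) (g k)) :
    ∀ l : List κ, IsNat t (canTens a l) (canTens b l) (tensMap g l)
  | [] => rfl
  | k :: l => (h k).tensor (tens h l)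

lemma comp_eq {a : A ≅ LambdaOperad.tens X l} {b : B ≅ LambdaOperad.tens Y l}
    {a' : A' ≅ LambdaOperad.tens X m} {b' : B' ≅ LambdaOperad.tens Y m}
    {α : A ⟶ B} {α' : A' ⟶ B'} (h : IsNat t a b α) (h' : IsNat t a' b' α')
    (ht : ∀ i hi, f i hi ≫ t i = f' i hi) {g : A ⟶ A'} {g' : B ⟶ B'} (hg : IsCan f a a' g)
    (hg' : IsCan f' b b' g') : α ≫ g' = g ≫ α' := by
  obtain ⟨h1, h2⟩ := hg
  obtain ⟨h3, h4⟩ := hg'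
  unfold IsNat at *
  rw [← cancel_mono b'.hom, assoc, h4, reassoc_of% h, assoc, h', reassoc_of% h2]
  exact congrArg (a.hom ≫ ·) (rearrange_naturality f f' t ht _ _ _ _ _ _)

end IsNat

end Canonical
/-- A finite type with a chosen enumeration. -/
class Enum (S : Type) where
  /-- The number of elements. -/
  n : ℕ
  /-- The enumeration. -/
  e : S ≃ Fin n

instance (k : ℕ) : Enum (Fin k) := ⟨k, Equiv.refl _⟩

section Unordered

variable [SymmetricCategory V]
  {ι κ : Type}

section Substitution

variable {X : ι → V} {P : ι → Prop} {f : ∀ a, P a → (𝟙_ V ⟶ X a)} {A : κ → V} {mA : κ → List ι}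
  {a : ∀ k, A k ≅ tens X (mA k)}

namespace IsCan

lemma tensAppend (hm : Sep mA) {l m : List κ} (h : (l ++ m).Nodup) :
    IsCan f (canTensor (canTens a l) (canTens a m)) (canTens a (l ++ m))
      (tensAppend A m l).hom := by
  induction l with
  | nil => exact leftUnitor (hm.flat_nodup h)
  | cons k l ih =>
    have h1 := (ih (List.nodup_cons.1 h).2).whiskerLeft (a k) (hm.flat_nodup h)
    have h2 := h1.nodup_left
    rw [← List.append_assoc] at h2
    exact (associator h2).comp h1

lemma tensRelabel {κ' : Type} (hm : Sep mA) (g : κ' → κ) {l : List κ'} (h : (l.map g).Nodup) :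
    IsCan f (canTens (fun k => a (g k)) l) (canTens a (l.map g)) (tensRelabel A g l).hom := by
  induction l with
  | nil => exact id List.nodup_nil
  | cons k l ih => exact (ih (List.nodup_cons.1 h).2).whiskerLeft (a (g k)) (hm.flat_nodup h)

lemma atom_trans (hm : Sep mA) (k : κ) : IsCan f (a k) (canAtom A k ≪≫ canTens a [k]) (𝟙 _) := by
  have h := rightUnitor_inv (f := f) (a := a k) (hm.1 k)
  obtain ⟨h1, h2⟩ := h
  refine ⟨h1, ?_⟩
  rw [← h2, id_comp]
  rfl

lemma tensor_trans (hm : Sep mA) {B C : V} {l m : List κ} (b : B ≅ tens A l) (c : C ≅ tens A m)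
    (h : (l ++ m).Nodup) :
    IsCan f (canTensor (b ≪≫ canTens a l) (c ≪≫ canTens a m))
      (canTensor b c ≪≫ canTens a (l ++ m)) (𝟙 _) := by
  obtain ⟨h1, h2⟩ := tensAppend (f := f) (a := a) hm h
  refine ⟨h1, ?_⟩
  have h3 : (canTensor (b ≪≫ canTens a l) (c ≪≫ canTens a m)).hom =
      (b.hom ⊗ₘ c.hom) ≫ (canTensor (canTens a l) (canTens a m)).hom := by
    simp [canTensor]
  rw [h3, assoc, ← h2, id_comp]
  simp [canTensor]

lemma tens_trans (hm : Sep mA) {κ' : Type} {B : κ' → V} {m : κ' → List κ}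
    (b : ∀ k, B k ≅ tens A (m k)) (h : Sep m) {l : List κ'} (hl : l.Nodup) :
    IsCan f (canTens (fun k => b k ≪≫ canTens a (m k)) l) (canTens b l ≪≫ canTens a (flat m l))
      (𝟙 _) := by
  induction l with
  | nil => exact of_eq List.nodup_nil (by simp [canTens])
  | cons k l ih =>
    have h1 := tensor_trans (f := f) (a := a) hm (b k) (canTens b l) (h.flat_nodup hl)
    have h2 := (ih (List.nodup_cons.1 hl).2).whiskerLeft (b k ≪≫ canTens a (m k)) h1.nodup_left
    have h3 := h2.comp h1
    rwa [MonoidalCategory.whiskerLeft_id, id_comp] at h3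

/-- Canonical morphisms with respect to the labels `κ` are canonical with respect to the labels `ι`. -/
lemma subst {Q : κ → Prop} {fA : ∀ k, Q k → (𝟙_ V ⟶ A k)} (hm : Sep mA)
    (hf : ∀ k hk, IsCan f (canUnit X) (a k) (fA k hk)) {B C : V} {l m : List κ}
    {b : B ≅ tens A l} {c : C ≅ tens A m} {g : B ⟶ C} (h : IsCan fA b c g) :
    IsCan f (b ≪≫ canTens a l) (c ≪≫ canTens a m) g := by
  obtain ⟨h1, h2⟩ := h
  obtain ⟨h3, h4⟩ := rearr (f := f) (a := a) hm hf h1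
  exact ⟨h3, by rw [Iso.trans_hom, Iso.trans_hom, reassoc_of% h2, h4, assoc]⟩

lemma congr_id {A B : V} {l m l' m' : List ι} {a : A ≅ tens X l} {a' : A ≅ tens X l'}
    {b : B ≅ tens X m} {b' : B ≅ tens X m'} {g : A ⟶ B} (ha : IsCan f a' a (𝟙 _))
    (h : IsCan f a b g) (hb : IsCan f b b' (𝟙 _)) : IsCan f a' b' g := by
  have := (ha.comp h).comp hb
  rwa [id_comp, comp_id] at this

lemma id_symm {A : V} {l l' : List ι} {a : A ≅ tens X l} {a' : A ≅ tens X l'}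
    (h : IsCan f a a' (𝟙 _)) (hl : ∀ i, i ∈ l' → i ∈ l) : IsCan f a' a (𝟙 _) :=
  inv (g := Iso.refl A) h hl

end IsCan
end Substitution

section Ut

variable {S S' N : Type} [Enum S] [Enum S'] [Enum N]

/-- The tensor product of a family of objects that is indexed by an enumerated type. -/
abbrev ut (A : S → V) : V := finTensor fun q : Fin (Enum.n S) => A (Enum.e.symm q)

/-- Functoriality of `ut`. -/
abbrev utMap {A B : S → V} (g : ∀ s, A s ⟶ B s) : ut A ⟶ ut B :=
  finTensorMap fun q : Fin (Enum.n S) => g (Enum.e.symm q)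

lemma utMap_id (A : S → V) : utMap (fun s => 𝟙 (A s)) = 𝟙 (ut A) := tensMap_id _ _

lemma utMap_comp {A B C : S → V} (g : ∀ s, A s ⟶ B s) (h : ∀ s, B s ⟶ C s) :
    utMap g ≫ utMap h = utMap fun s => g s ≫ h s := (tensMap_comp _ _ _).symm

/-- The concatenation of the lists `m s`. -/
abbrev utList (m : S → List ι) : List ι :=
  flat (fun q : Fin (Enum.n S) => m (Enum.e.symm q)) (List.finRange _)

lemma mem_utList {m : S → List ι} {i : ι} : i ∈ utList m ↔ ∃ s, i ∈ m s := by
  rw [mem_flat]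
  constructor
  · rintro ⟨q, -, h⟩
    exact ⟨_, h⟩
  · rintro ⟨s, h⟩
    exact ⟨Enum.e s, List.mem_finRange _, by simpa using h⟩

lemma Sep.nodup_utList {m : S → List ι} (h : Sep m) : (utList m).Nodup :=
  (h.comp Enum.e.symm.injective).flat_nodup (List.nodup_finRange _)

variable {X Y : ι → V} {P : ι → Prop} {f : ∀ a, P a → (𝟙_ V ⟶ X a)} {A B : S → V}
  {mA mB : S → List ι}

/-- `ut A` as a tensor product of labelled factors. -/
def canUt (a : ∀ s, A s ≅ tens X (mA s)) : ut A ≅ tens X (utList mA) :=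
  canTens (fun q : Fin (Enum.n S) => a (Enum.e.symm q)) _

lemma IsCan.utMap {a : ∀ s, A s ≅ tens X (mA s)} {b : ∀ s, B s ≅ tens X (mB s)}
    {g : ∀ s, A s ⟶ B s} (h : ∀ s, IsCan f (a s) (b s) (g s)) (hm : Sep mB) :
    IsCan f (canUt a) (canUt b) (utMap g) :=
  IsCan.tensMap (fun q => h _) (hm.comp Enum.e.symm.injective) (List.nodup_finRange _)

lemma IsCan.utMap_id {a : ∀ s, A s ≅ tens X (mA s)} {b : ∀ s, A s ≅ tens X (mB s)}
    (h : ∀ s, IsCan f (a s) (b s) (𝟙 _)) (hm : Sep mB) :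
    IsCan f (canUt a) (canUt b) (𝟙 _) := by
  have := IsCan.utMap h hm
  rwa [LambdaOperad.utMap_id] at this

lemma IsNat.ut {t : ∀ i, X i ⟶ Y i} {a : ∀ s, A s ≅ LambdaOperad.tens X (mA s)}
    {b : ∀ s, B s ≅ LambdaOperad.tens Y (mA s)} {g : ∀ s, A s ⟶ B s} (h : ∀ s, IsNat t (a s) (b s) (g s)) :
    IsNat t (canUt a) (canUt b) (LambdaOperad.utMap g) :=
  IsNat.tens (fun q => h _) _

lemma nodup_map_enum : ((List.finRange _).map (Enum.e (S := S)).symm).Nodup :=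
  (List.nodup_finRange _).map Enum.e.symm.injective

/-- For an injection `φ`, permute the factors as prescribed by `φ` and insert the morphisms `u t` at
the places `t` that are not in the image of `φ`. -/
def utSpread (φ : S ↪ S') (A : S' → V) (u : ∀ t, t ∉ range φ → (𝟙_ V ⟶ A t)) :
    ut (fun s => A (φ s)) ⟶ ut A :=
  (tensRelabel A (fun q => φ (Enum.e.symm q)) _).hom ≫ rearr A u
    ⟨(List.nodup_finRange _).map (φ.injective.comp Enum.e.symm.injective), nodup_map_enum,
      fun t _ => List.mem_map.2 ⟨Enum.e t, List.mem_finRange _, by simp⟩,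
      fun t _ h h' => h (by
        obtain ⟨s, rfl⟩ := h'
        exact List.mem_map.2 ⟨Enum.e s, List.mem_finRange _, by simp⟩)⟩ ≫
    (tensRelabel A Enum.e.symm _).inv

lemma IsCan.utSpread (φ : S ↪ S') {A : S' → V} {mA : S' → List ι} {a : ∀ s, A s ≅ tens X (mA s)}
    (hm : Sep mA) (u : ∀ t, t ∉ range φ → (𝟙_ V ⟶ A t))
    (hu : ∀ t ht, IsCan f (canUnit X) (a t) (u t ht)) :
    IsCan f (canUt fun s => a (φ s)) (canUt a) (utSpread φ A u) := by
  refine (IsCan.tensRelabel (f := f) (a := a) hm (fun q => φ (Enum.e.symm q))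
    ((List.nodup_finRange _).map (φ.injective.comp Enum.e.symm.injective))).comp
    ((IsCan.rearr hm hu _).comp ?_)
  refine inv (IsCan.tensRelabel (f := f) (a := a) hm (fun q => Enum.e.symm q) nodup_map_enum) ?_
  intro i hi
  obtain ⟨s, hs, hi'⟩ := mem_flat.1 hi
  exact mem_utList.2 ⟨s, hi'⟩

/-- The map `(s, t) ↦ r s t` is a bijection. -/
def IsPart {S N : Type} {T : S → Type} (r : ∀ s, T s → N) : Prop :=
  Function.Bijective fun p : Σ s, T s => r p.1 p.2

variable {T : S → Type} [∀ s, Enum (T s)] {r : ∀ s, T s → N}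

lemma IsPart.inj (hr : IsPart r) (s : S) : Function.Injective (r s) := fun t t' h => by
  have h1 := @hr.1 ⟨s, t⟩ ⟨s, t'⟩ h
  simpa using h1

lemma IsPart.inj' (hr : IsPart r) {s s' : S} {t : T s} {t' : T s'} (h : r s t = r s' t') : s = s' :=
  congrArg Sigma.fst (@hr.1 ⟨s, t⟩ ⟨s', t'⟩ h)

lemma IsPart.exists (hr : IsPart r) (n : N) : ∃ s t, r s t = n := by
  obtain ⟨⟨s, t⟩, h⟩ := hr.2 n
  exact ⟨s, t, h⟩

lemma Sep.inl {mA : S → List ι} {mB : N → List ι} (h : Sep (Sum.elim mA mB)) : Sep mA :=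
  ⟨fun s => h.1 (Sum.inl s), fun s s' i hi hi' => Sum.inl.inj (h.2 (Sum.inl s) (Sum.inl s') i hi hi')⟩

lemma Sep.inr {mA : S → List ι} {mB : N → List ι} (h : Sep (Sum.elim mA mB)) : Sep mB :=
  ⟨fun s => h.1 (Sum.inr s), fun s s' i hi hi' => Sum.inr.inj (h.2 (Sum.inr s) (Sum.inr s') i hi hi')⟩

lemma Sep.disj {mA : S → List ι} {mB : N → List ι} (h : Sep (Sum.elim mA mB)) (s : S) (n : N) (i : ι)
    (hi : i ∈ mA s) (hi' : i ∈ mB n) : False :=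
  Sum.inl_ne_inr (h.2 (Sum.inl s) (Sum.inr n) i hi hi')

lemma Sep.nodup_append {mA : S → List ι} {mB : N → List ι} (h : Sep (Sum.elim mA mB)) :
    (utList mA ++ utList mB).Nodup := by
  refine h.inl.nodup_utList.append h.inr.nodup_utList fun i hi hi' => ?_
  obtain ⟨s, hs⟩ := mem_utList.1 hi
  obtain ⟨n, hn⟩ := mem_utList.1 hi'
  exact h.disj s n i hs hn

lemma Sep.fibre {mA : S → List ι} {mB : N → List ι} (h : Sep (Sum.elim mA mB))
    (hr : IsPart r) :
    Sep (fun s => mA s ++ utList fun t => mB (r s t)) := by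
  have h1 : ∀ s, Sep fun t => mB (r s t) := fun s =>
    h.inr.comp (e := r s) (hr.inj s)
  refine ⟨fun s => (h.inl.1 s).append (h1 s).nodup_utList fun i hi hi' => ?_,
    fun s s' i hi hi' => ?_⟩
  · obtain ⟨t, ht⟩ := mem_utList.1 hi'
    exact h.disj _ _ i hi ht
  · rcases List.mem_append.1 hi with h2 | h2 <;> rcases List.mem_append.1 hi' with h3 | h3
    · exact h.inl.2 _ _ i h2 h3
    · obtain ⟨t, ht⟩ := mem_utList.1 h3
      exact (h.disj _ _ i h2 ht).elim
    · obtain ⟨t, ht⟩ := mem_utList.1 h2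
      exact (h.disj _ _ i h3 ht).elim
    · obtain ⟨t, ht⟩ := mem_utList.1 h2
      obtain ⟨t', ht'⟩ := mem_utList.1 h3
      exact hr.inj' (h.inr.2 _ _ i ht ht')

lemma mem_fibre_iff {mA : S → List ι} {mB : N → List ι} (hr : IsPart r) (i : ι) :
    i ∈ utList mA ++ utList mB ↔ i ∈ utList (fun s => mA s ++ utList fun t => mB (r s t)) := by
  simp only [List.mem_append, mem_utList]
  constructor
  · rintro (⟨s, h⟩ | ⟨n, h⟩)
    · exact ⟨s, Or.inl h⟩
    · obtain ⟨s, t, rfl⟩ := hr.exists n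
      exact ⟨s, Or.inr ⟨t, h⟩⟩
  · rintro ⟨s, h | ⟨t, h⟩⟩
    · exact Or.inl ⟨s, h⟩
    · exact Or.inr ⟨_, h⟩

/-- The labels of the factors of `ut A ⊗ ut B`. -/
lemma sep_atoms : Sep (Sum.elim (fun s : S => [(Sum.inl s : S ⊕ N)]) (fun n : N => [Sum.inr n])) :=
  ⟨by rintro (s | n) <;> simp, by rintro (s | n) (s' | n') (i | i) <;> simp <;> grind⟩

/-- The object `A s` as a tensor product of factors labelled by a disjoint union. -/
def canInl (A : S → V) (B : N → V) (s : S) : A s ≅ tens (Sum.elim A B) [Sum.inl s] :=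
  canAtom (Sum.elim A B) (Sum.inl s)

/-- The object `B n` as a tensor product of factors labelled by a disjoint union. -/
def canInr (A : S → V) (B : N → V) (n : N) : B n ≅ tens (Sum.elim A B) [Sum.inr n] :=
  canAtom (Sum.elim A B) (Sum.inr n)

/-- The isomorphism `(⨂ₛ A s) ⊗ (⨂ₙ B n) ≅ ⨂ₛ (A s ⊗ ⨂ₜ B (r s t))`, where `n` runs through a set
that is identified with the set of pairs `(s, t)` by `r`. -/
def sh (hr : IsPart r) (A : S → V) (B : N → V) :
    ut A ⊗ ut B ≅ ut (fun s => A s ⊗ ut (fun t => B (r s t))) :=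
  canIso (canTensor (canUt (canInl A B)) (canUt (canInr A B)))
    (canUt fun s => canTensor (canInl A B s) (canUt fun t => canInr A B (r s t)))
    sep_atoms.nodup_append (sep_atoms.fibre hr).nodup_utList
    (mem_fibre_iff (mA := fun s => [Sum.inl s]) (mB := fun n => [Sum.inr n]) hr)

lemma IsCan.ut_trans {ZZ : κ → V} {mZ : κ → List ι} {z : ∀ i, ZZ i ≅ tens X (mZ i)} (hZ : Sep mZ)
    {m : S → List κ} (hm : Sep m) {a : ∀ s, A s ≅ tens X (mA s)} {c : ∀ s, A s ≅ tens ZZ (m s)}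
    (h : ∀ s, IsCan f (a s) (c s ≪≫ canTens z (m s)) (𝟙 _)) :
    IsCan f (canUt a) (canUt c ≪≫ canTens z _) (𝟙 _) := by
  have h1 : Sep fun s => flat mZ (m s) := by
    refine ⟨fun s => hZ.flat_nodup (hm.1 s), fun s s' i hi hi' => ?_⟩
    obtain ⟨k, hk, hi⟩ := mem_flat.1 hi
    obtain ⟨k', hk', hi'⟩ := mem_flat.1 hi'
    exact hm.2 s s' k hk (hZ.2 _ _ _ hi hi' ▸ hk')
  have h2 := (IsCan.utMap_id h h1).comp (tens_trans (f := f) hZ (fun q => c (Enum.e.symm q))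
    (hm.comp Enum.e.symm.injective) (List.nodup_finRange _))
  rwa [comp_id] at h2

lemma IsCan.sh {B : N → V} {mB : N → List ι} {a : ∀ s, A s ≅ tens X (mA s)}
    {b : ∀ n, B n ≅ tens X (mB n)} (h : Sep (Sum.elim mA mB)) (hr : IsPart r) :
    IsCan f (canTensor (canUt a) (canUt b))
      (canUt fun s => canTensor (a s) (canUt fun t => b (r s t))) (sh hr A B).hom := by
  let z : ∀ i, Sum.elim A B i ≅ tens X (Sum.elim mA mB i) := fun i => match i with
    | Sum.inl s => a s
    | Sum.inr n => b n
  have h0 := isCan_canIso (P := fun _ => False) (f := fun _ h => h.elim)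
    (canTensor (canUt (canInl A B)) (canUt (canInr A B)))
    (canUt fun s => canTensor (canInl A B s) (canUt fun t => canInr A B (r s t)))
    sep_atoms.nodup_append (sep_atoms.fibre hr).nodup_utList
    (mem_fibre_iff (mA := fun s => [Sum.inl s]) (mB := fun n => [Sum.inr n]) hr)
  have h1 := h0.subst (f := f) (a := z) h (fun _ h => h.elim)
  have hs1 : Sep (fun s : S => [(Sum.inl s : S ⊕ N)]) := sep_atoms.inl
  have hs2 : Sep (fun n : N => [(Sum.inr n : S ⊕ N)]) := sep_atoms.inr
  have l1 : IsCan f (canUt a) (canUt (canInl A B) ≪≫ canTens z _) (𝟙 _) :=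
    IsCan.ut_trans h hs1 fun s => IsCan.atom_trans (a := z) h (Sum.inl s)
  have l2 : IsCan f (canUt b) (canUt (canInr A B) ≪≫ canTens z _) (𝟙 _) :=
    IsCan.ut_trans h hs2 fun s => IsCan.atom_trans (a := z) h (Sum.inr s)
  have l3 := tensor_trans (f := f) (a := z) h (canUt (canInl A B)) (canUt (canInr A B))
    (sep_atoms.nodup_append)
  have l4 := ((l1.tensor l2 (List.disjoint_of_nodup_append l3.nodup_left)).comp l3)
  rw [id_tensorHom_id, comp_id] at l4
  have r0 := sep_atoms.fibre (S := S) (N := N) hr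
  have r1 : ∀ s, IsCan f (canTensor (a s) (canUt fun t => b (r s t)))
      (canTensor (canInl A B s) (canUt fun t => canInr A B (r s t)) ≪≫ canTens z _) (𝟙 _) := by
    intro s
    have r2 : IsCan f (canUt fun t => b (r s t))
        ((canUt fun t => canInr A B (r s t)) ≪≫ canTens z _) (𝟙 _) :=
      IsCan.ut_trans h (hs2.comp (hr.inj s))
        fun t => IsCan.atom_trans (a := z) h (Sum.inr _)
    have r3 := tensor_trans (f := f) (a := z) h (canInl A B s) (canUt fun t => canInr A B (r s t))
      (r0.1 s)
    have r5 : IsCan f (a s) (canInl A B s ≪≫ canTens z [Sum.inl s]) (𝟙 (A s)) :=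
      IsCan.atom_trans (f := f) (a := z) h (Sum.inl s)
    have r4 := (r5.tensor r2
      (List.disjoint_of_nodup_append r3.nodup_left)).comp r3
    rwa [id_tensorHom_id, comp_id] at r4
  have r5 := IsCan.ut_trans (f := f) h r0 r1
  refine congr_id l4 h1 (id_symm r5 ?_)
  have := h1.1.3
  intro i hi
  obtain ⟨k, hk, hi⟩ := mem_flat.1 hi
  obtain ⟨s, hs⟩ := mem_utList.1 hk
  refine mem_utList.2 ⟨s, ?_⟩
  rcases List.mem_append.1 hs with h2 | h2
  · rw [List.mem_singleton.1 h2] at hi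
    exact List.mem_append.2 (Or.inl hi)
  · obtain ⟨t, ht⟩ := mem_utList.1 h2
    rw [List.mem_singleton.1 ht] at hi
    exact List.mem_append.2 (Or.inr (mem_utList.2 ⟨t, hi⟩))

end Ut
end Unordered
section Unordered

variable [SymmetricCategory V]
  {ι κ : Type} {S S' S'' N N' M : Type} [Enum S] [Enum S'] [Enum S''] [Enum N] [Enum N'] [Enum M]

section Spread

variable {X Y : ι → V} {P : ι → Prop} {f : ∀ a, P a → (𝟙_ V ⟶ X a)}

lemma sep_singleton {e : S → ι} (he : Function.Injective e) : Sep fun s => [e s] :=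
  ⟨fun _ => by simp, fun k k' i h h' => he (by
    rw [← List.mem_singleton.1 h, ← List.mem_singleton.1 h'])⟩

lemma IsCan.eqToHom {S : Type} {A : S → V} {mA : S → List ι} (a : ∀ s, A s ≅ tens X (mA s))
    {s s' : S} (h : s = s') (hs : (mA s).Nodup) :
    IsCan f (a s) (a s') (eqToHom (congrArg A h)) := by
  subst h
  exact IsCan.id hs

lemma utSpread_naturality (φ : S ↪ S') {A B : S' → V} (u : ∀ t, t ∉ range φ → (𝟙_ V ⟶ A t))
    (g : ∀ t, A t ⟶ B t) : utMap (fun s => g (φ s)) ≫ utSpread φ B (fun t ht => u t ht ≫ g t) =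
      utSpread φ A u ≫ utMap g :=
  IsNat.comp_eq (t := g) (a := canUt fun s => canAtom A (φ s)) (a' := canUt fun s => canAtom A s)
    (b := canUt fun s => canAtom B (φ s)) (b' := canUt fun s => canAtom B s)
    (f := u) (IsNat.ut fun s => IsNat.atom _) (IsNat.ut fun s => IsNat.atom _) (fun _ _ => rfl)
    (IsCan.utSpread φ (sep_singleton Function.injective_id) u fun t ht => IsCan.atom t ht)
    (IsCan.utSpread φ (sep_singleton Function.injective_id) _ fun t ht => IsCan.atom t ht)

lemma utSpread_comp (φ : S ↪ S') (φ' : S' ↪ S'') {A : S'' → V}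
    (u : ∀ t, t ∉ range (φ.trans φ') → (𝟙_ V ⟶ A t)) (h : ∀ t, t ∉ range φ →
      φ' t ∉ range (φ.trans φ')) (h' : ∀ t, t ∉ range φ' → t ∉ range (φ.trans φ')) :
    utSpread φ (fun t => A (φ' t)) (fun t ht => u (φ' t) (h t ht)) ≫
      utSpread φ' A (fun t ht => u t (h' t ht)) = utSpread (φ.trans φ') A u :=
  ((IsCan.utSpread (f := u) φ (a := fun s => canAtom A (φ' s)) (sep_singleton φ'.injective) _
    fun t ht => IsCan.atom _ _).comp (IsCan.utSpread φ' (a := fun s => canAtom A s)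
    (sep_singleton Function.injective_id) _ fun t ht => IsCan.atom t _)).unique
    (IsCan.utSpread (φ.trans φ') (a := fun s => canAtom A s) (sep_singleton Function.injective_id) u
      fun t ht => IsCan.atom t ht)

lemma utSpread_refl (A : S → V) (u : ∀ t, t ∉ range (Embedding.refl S) → (𝟙_ V ⟶ A t)) :
    utSpread (Embedding.refl S) A u = 𝟙 _ :=
  (IsCan.utSpread (f := u) (Embedding.refl S) (a := fun s => canAtom A s)
    (sep_singleton Function.injective_id) u fun t ht => IsCan.atom t ht).unique
    (IsCan.id (sep_singleton Function.injective_id).nodup_utList)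

/-- For an injection `φ : S → S'`, the morphism `⨂ₛ A s ⟶ ⨂ₜ B t` given by `c s : A s ⟶ B (φ s)` and
`u t : 𝟙_ V ⟶ B t` for the `t` that are not in the image of `φ`. -/
def utSp (φ : S ↪ S') {A : S → V} {B : S' → V} (c : ∀ s t, φ s = t → (A s ⟶ B t))
    (u : ∀ t, t ∉ range φ → (𝟙_ V ⟶ B t)) : ut A ⟶ ut B :=
  utMap (fun s => c s (φ s) rfl) ≫ utSpread φ B u

lemma utSp_congr {φ φ' : S ↪ S'} {A : S → V} {B : S' → V} {c : ∀ s t, φ s = t → (A s ⟶ B t)}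
    {u : ∀ t, t ∉ range φ → (𝟙_ V ⟶ B t)} {c' : ∀ s t, φ' s = t → (A s ⟶ B t)}
    {u' : ∀ t, t ∉ range φ' → (𝟙_ V ⟶ B t)} (hφ : φ = φ')
    (hc : ∀ s t h h', c s t h = c' s t h')
    (hu : ∀ t h h', u t h = u' t h') : utSp φ c u = utSp φ' c' u' := by
  subst hφ
  congr 1
  · funext s t h; exact hc s t h h
  · funext t h; exact hu t h h

lemma utMap_utSp (φ : S ↪ S') {A A' : S → V} {B : S' → V} (g : ∀ s, A' s ⟶ A s)
    (c : ∀ s t, φ s = t → (A s ⟶ B t)) (u : ∀ t, t ∉ range φ → (𝟙_ V ⟶ B t)) :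
    utMap g ≫ utSp φ c u = utSp φ (fun s t h => g s ≫ c s t h) u := by
  rw [utSp, reassoc_of% utMap_comp]; rfl

lemma utSp_utMap (φ : S ↪ S') {A : S → V} {B B' : S' → V} (g : ∀ t, B t ⟶ B' t)
    (c : ∀ s t, φ s = t → (A s ⟶ B t)) (u : ∀ t, t ∉ range φ → (𝟙_ V ⟶ B t)) :
    utSp φ c u ≫ utMap g = utSp φ (fun s t h => c s t h ≫ g t) (fun t ht => u t ht ≫ g t) := by
  rw [utSp, assoc, ← utSpread_naturality, reassoc_of% utMap_comp]; rfl

lemma utSp_refl {A B : S → V} (c : ∀ s t, Embedding.refl S s = t → (A s ⟶ B t))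
    (u : ∀ t, t ∉ range (Embedding.refl S) → (𝟙_ V ⟶ B t)) :
    utSp (Embedding.refl S) c u = utMap fun s => c s s rfl := by
  exact (congrArg (utMap (fun s => c s s rfl) ≫ ·) (utSpread_refl B u)).trans (comp_id _)

lemma utSp_comp {φ : S ↪ S'} {φ' : S' ↪ S''} {φ'' : S ↪ S''} {A : S → V} {B : S' → V} {C : S'' → V}
    {c : ∀ s t, φ s = t → (A s ⟶ B t)} {u : ∀ t, t ∉ range φ → (𝟙_ V ⟶ B t)}
    {c' : ∀ s t, φ' s = t → (B s ⟶ C t)} {u' : ∀ t, t ∉ range φ' → (𝟙_ V ⟶ C t)}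
    {c'' : ∀ s t, φ'' s = t → (A s ⟶ C t)} {u'' : ∀ t, t ∉ range φ'' → (𝟙_ V ⟶ C t)}
    (hφ : ∀ s, φ' (φ s) = φ'' s)
    (hc : ∀ s t r h h' h'', c s t h ≫ c' t r h' = c'' s r h'')
    (hu : ∀ t r h h' h'', u t h ≫ c' t r h' = u'' r h'')
    (hu' : ∀ r h h', u' r h = u'' r h') :
    utSp φ c u ≫ utSp φ' c' u' = utSp φ'' c'' u'' := by
  obtain rfl : φ.trans φ' = φ'' := Embedding.ext hφ
  have h1 : ∀ t, t ∉ range φ → φ' t ∉ range (φ.trans φ') := by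
    rintro t ht ⟨s, hs⟩
    exact ht ⟨s, φ'.injective hs⟩
  have h2 : ∀ t, t ∉ range φ' → t ∉ range (φ.trans φ') := by
    rintro t ht ⟨s, hs⟩
    exact ht ⟨φ s, hs⟩
  rw [utSp, utSp, assoc, ← assoc (utSpread φ B u), ← utSpread_naturality,
    assoc, reassoc_of% utMap_comp]
  have e1 : (fun t ht => u t ht ≫ c' t (φ' t) rfl) = fun t ht => u'' (φ' t) (h1 t ht) := by
    funext t ht; exact hu _ _ _ _ _
  have e2 : u' = fun t ht => u'' t (h2 t ht) := by funext t ht; exact hu' _ _ _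
  rw [e1, e2, utSpread_comp φ φ' u'' h1 h2, utSp]
  congr 2
  funext s
  exact hc _ _ _ _ _ _

lemma IsCan.utSp {φ : S ↪ S'} {A : S → V} {B : S' → V} {mA : S → List ι} {mB : S' → List ι}
    {a : ∀ s, A s ≅ tens X (mA s)} {b : ∀ s, B s ≅ tens X (mB s)}
    {c : ∀ s t, φ s = t → (A s ⟶ B t)} {u : ∀ t, t ∉ range φ → (𝟙_ V ⟶ B t)}
    (hm : Sep mB) (hc : ∀ s t h, IsCan f (a s) (b t) (c s t h))
    (hu : ∀ t ht, IsCan f (canUnit X) (b t) (u t ht)) :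
    IsCan f (canUt a) (canUt b) (utSp φ c u) :=
  (IsCan.utMap (fun s => hc s (φ s) rfl) (hm.comp φ.injective)).comp
    (IsCan.utSpread φ hm u hu)

/-- `𝟙_ V ⟶ ⨂ₛ A s` -/
abbrev utUnits {A : S → V} (u : ∀ s, 𝟙_ V ⟶ A s) : 𝟙_ V ⟶ ut A :=
  finTensorUnits fun q : Fin (Enum.n S) => u (Enum.e.symm q)

lemma IsCan.tensUnits {A : κ → V} {mA : κ → List ι} {a : ∀ s, A s ≅ tens X (mA s)}
    {u : ∀ s, 𝟙_ V ⟶ A s} (hm : Sep mA) (hu : ∀ s, IsCan f (canUnit X) (a s) (u s)) {l : List κ}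
    (hl : l.Nodup) : IsCan f (canUnit X) (canTens a l) (tensUnits u l) := by
  induction l with
  | nil => exact IsCan.id List.nodup_nil
  | cons k l ih =>
    exact (IsCan.leftUnitor_inv List.nodup_nil).comp ((hu k).tensor (ih (List.nodup_cons.1 hl).2)
      (List.disjoint_of_nodup_append (hm.flat_nodup hl)))

lemma IsCan.utUnits {A : S → V} {mA : S → List ι} {a : ∀ s, A s ≅ tens X (mA s)}
    {u : ∀ s, 𝟙_ V ⟶ A s} (hm : Sep mA) (hu : ∀ s, IsCan f (canUnit X) (a s) (u s)) :
    IsCan f (canUnit X) (canUt a) (utUnits u) :=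
  IsCan.tensUnits (hm.comp Enum.e.symm.injective) (fun q => hu _) (List.nodup_finRange _)

end Spread

section Sh

variable {T : S → Type} [∀ s, Enum (T s)] {T' : S' → Type} [∀ s, Enum (T' s)]
  {r : ∀ s, T s → N} {r' : ∀ s, T' s → N}

lemma sh_naturality (hr : IsPart r) {A A' : S → V} {B B' : N → V} (g : ∀ s, A s ⟶ A' s)
    (g' : ∀ n, B n ⟶ B' n) :
    (utMap g ⊗ₘ utMap g') ≫ (sh hr A' B').hom =
      (sh hr A B).hom ≫ utMap fun s => g s ⊗ₘ utMap fun t => g' (r s t) := by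
  let t : ∀ i : S ⊕ N, Sum.elim A B i ⟶ Sum.elim A' B' i := fun i => match i with
    | Sum.inl s => g s
    | Sum.inr n => g' n
  have h1 : ∀ s, IsNat t (canInl A B s) (canInl A' B' s) (g s) := fun s => IsNat.atom (t := t) _
  have h2 : ∀ n, IsNat t (canInr A B n) (canInr A' B' n) (g' n) := fun s => IsNat.atom (t := t) _
  exact IsNat.comp_eq (P := fun _ => False) (f := fun _ h => h.elim) (f' := fun _ h => h.elim)
    ((IsNat.ut h1).tensor (IsNat.ut h2))
    (IsNat.ut fun s => (h1 s).tensor (IsNat.ut fun t => h2 (r s t))) (fun _ h => h.elim)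
    (IsCan.sh sep_atoms hr) (IsCan.sh sep_atoms hr)

lemma sh_utSpread_left (φ : S ↪ S') {A : S' → V} (u : ∀ t, t ∉ range φ → (𝟙_ V ⟶ A t))
    (hr : IsPart r) (hr' : IsPart r') (σ : ∀ s s', φ s = s' → (T s ≃ T' s'))
    (hσ : ∀ s s' h t, r' s' (σ s s' h t) = r s t) (he : ∀ s, s ∉ range φ → IsEmpty (T' s))
    (B : N → V) (hh : ∀ s s' (h : φ s = s') t t', (σ s s' h).toEmbedding t = t' → r s t = r' s' t') :
    (utSpread φ A u ▷ ut B) ≫ (sh hr' A B).hom = (sh hr (fun s => A (φ s)) B).hom ≫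
      utSp φ (B := fun s' => A s' ⊗ ut fun t => B (r' s' t))
        (fun s s' h => eqToHom (congrArg A h) ⊗ₘ utSp (σ s s' h).toEmbedding
          (fun t t' ht => eqToHom (congrArg B (hh s s' h t t' ht)))
          (fun t' ht' => absurd ((σ s s' h).surjective t') ht'))
        (fun s' hs' => u s' hs' ≫ (ρ_ _).inv ≫ (A s' ◁ utUnits fun t => ((he s' hs').elim t))) := by
  let P : S' ⊕ N → Prop := Sum.elim (fun s => s ∉ range φ) (fun _ => False)
  let f : ∀ i, P i → (𝟙_ V ⟶ Sum.elim A B i) := fun i => match i with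
    | Sum.inl s => u s
    | Sum.inr n => fun h => h.elim
  have hS := sep_atoms (S := S') (N := N)
  have hu : ∀ s hs, IsCan f (canUnit _) (canInl A B s) (u s hs) := fun s hs => IsCan.atom (f := f) (Sum.inl s) hs
  have hS1 : Sep (Sum.elim (fun s : S => [(Sum.inl (φ s) : S' ⊕ N)]) (fun n : N => [Sum.inr n])) :=
    ⟨by rintro (s | n) <;> simp, by
      rintro (s | n) (s' | n') (i | i) <;> simp
      · rintro rfl h; exact φ.injective h
      · rintro rfl h; exact h⟩
  have h1 := ((IsCan.utSpread (f := f) φ (a := canInl A B) hS.inl u hu).whiskerRight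
    (canUt (canInr A B)) hS.nodup_append).comp (IsCan.sh hS hr')
  refine h1.unique ((IsCan.sh (a := fun s => canInl A B (φ s)) (b := canInr A B) hS1 hr).comp
    (IsCan.utSp (hS.fibre hr') ?_ ?_))
  · intro s s' h
    refine (IsCan.eqToHom (canInl A B) h (hS.inl.1 _)).tensor (IsCan.utSp (hS.inr.comp (hr'.inj s')) ?_ ?_)
      (List.disjoint_of_nodup_append ((hS.fibre hr').1 s'))
    · intro t t' ht
      exact IsCan.eqToHom (canInr A B) (hh s s' h t t' ht) (hS.inr.1 _)
    · intro t' ht'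
      exact absurd ((σ s s' h).surjective t') ht'
  · intro s' hs'
    exact (hu s' hs').comp ((IsCan.rightUnitor_inv (hS.inl.1 s')).comp
      ((IsCan.utUnits (hS.inr.comp (hr'.inj s')) (fun t => ((he s' hs').elim t))).whiskerLeft _
        ((hS.fibre hr').1 s')))

lemma sh_utSp_left {φ : S ↪ S'} {A : S → V} {A' : S' → V} (c : ∀ s t, φ s = t → (A s ⟶ A' t))
    (u : ∀ t, t ∉ range φ → (𝟙_ V ⟶ A' t))
    (hr : IsPart r) (hr' : IsPart r') (σ : ∀ s s', φ s = s' → (T s ≃ T' s'))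
    (hσ : ∀ s s' h t, r' s' (σ s s' h t) = r s t) (he : ∀ s, s ∉ range φ → IsEmpty (T' s))
    (B : N → V) (hh : ∀ s s' (h : φ s = s') t t', (σ s s' h).toEmbedding t = t' → r s t = r' s' t') :
    (utSp φ c u ▷ ut B) ≫ (sh hr' A' B).hom = (sh hr A B).hom ≫
      utSp φ (B := fun s' => A' s' ⊗ ut fun t => B (r' s' t))
        (fun s s' h => c s s' h ⊗ₘ utSp (σ s s' h).toEmbedding
          (fun t t' ht => eqToHom (congrArg B (hh s s' h t t' ht)))
          (fun t' ht' => absurd ((σ s s' h).surjective t') ht'))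
        (fun s' hs' => u s' hs' ≫ (ρ_ _).inv ≫ (A' s' ◁ utUnits fun t => ((he s' hs').elim t))) := by
  rw [utSp, comp_whiskerRight, assoc, sh_utSpread_left φ u hr hr' σ hσ he B hh]
  have h1 := sh_naturality hr (fun s => c s (φ s) rfl) (fun n => 𝟙 (B n))
  rw [utMap_id, tensorHom_id] at h1
  rw [reassoc_of% h1, utMap_utSp]
  congr 1
  refine utSp_congr rfl (fun s s' h h' => ?_) fun _ _ _ => rfl
  subst h
  rw [utMap_id, tensorHom_comp_tensorHom, eqToHom_refl, comp_id, id_comp]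

end Sh

section Sh'

variable {T T' : S → Type} [∀ s, Enum (T s)] [∀ s, Enum (T' s)]
  {r : ∀ s, T s → N} {r' : ∀ s, T' s → N'}

lemma IsPart.notMem_range (hr : IsPart r) (hr' : IsPart r') (ψ : N ↪ N') (σ : ∀ s, T s ↪ T' s)
    (hσ : ∀ s t, r' s (σ s t) = ψ (r s t)) (s : S) (t' : T' s) (ht' : t' ∉ range (σ s)) :
    r' s t' ∉ range ψ := by
  rintro ⟨n, hn⟩
  obtain ⟨s1, t1, rfl⟩ := hr.exists n
  rw [← hσ] at hn
  obtain rfl := hr'.inj' hn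
  exact ht' ⟨t1, hr'.inj _ hn⟩

lemma sh_utSpread_right (ψ : N ↪ N') (σ : ∀ s, T s ↪ T' s) (hr : IsPart r) (hr' : IsPart r')
    (A : S → V) {B : N' → V} (u : ∀ n, n ∉ range ψ → (𝟙_ V ⟶ B n))
    (hh : ∀ s t t', σ s t = t' → ψ (r s t) = r' s t')
    (hn : ∀ s t', t' ∉ range (σ s) → r' s t' ∉ range ψ) :
    (ut A ◁ utSpread ψ B u) ≫ (sh hr' A B).hom = (sh hr A (fun n => B (ψ n))).hom ≫
      utMap fun s => A s ◁ utSp (B := fun t => B (r' s t)) (σ s)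
        (fun t t' ht => eqToHom (congrArg B (hh s t t' ht)))
        (fun t' ht' => u (r' s t') (hn s t' ht')) := by
  let P : S ⊕ N' → Prop := Sum.elim (fun _ => False) (fun n => n ∉ range ψ)
  let f : ∀ i, P i → (𝟙_ V ⟶ Sum.elim A B i) := fun i => match i with
    | Sum.inl s => fun h => h.elim
    | Sum.inr n => u n
  have hS := sep_atoms (S := S) (N := N')
  have hu : ∀ n hn, IsCan f (canUnit _) (canInr A B n) (u n hn) :=
    fun n hn => IsCan.atom (f := f) (Sum.inr n) hn
  have hS1 : Sep (Sum.elim (fun s : S => [(Sum.inl s : S ⊕ N')]) (fun n : N => [Sum.inr (ψ n)])) :=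
    ⟨by rintro (s | n) <;> simp, by
      rintro (s | n) (s' | n') (i | i) <;> simp
      · rintro rfl h; exact h
      · rintro rfl h; exact ψ.injective h⟩
  have h1 := ((IsCan.utSpread (f := f) ψ (a := canInr A B) hS.inr u hu).whiskerLeft
    (canUt (canInl A B)) hS.nodup_append).comp (IsCan.sh hS hr')
  refine h1.unique ((IsCan.sh (a := canInl A B) (b := fun n => canInr A B (ψ n)) hS1 hr).comp
    (IsCan.utMap (fun s => ?_) (hS.fibre hr')))
  refine (IsCan.utSp (hS.inr.comp (hr'.inj s)) (fun t t' ht => ?_) (fun t' ht' => hu _ _)).whiskerLeft _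
    ((hS.fibre hr').1 s)
  exact IsCan.eqToHom (canInr A B) (hh s t t' ht) (hS.inr.1 _)

lemma sh_utSp_right {ψ : N ↪ N'} (σ : ∀ s, T s ↪ T' s) (hr : IsPart r) (hr' : IsPart r')
    (A : S → V) {B : N → V} {B' : N' → V} (c : ∀ n n', ψ n = n' → (B n ⟶ B' n'))
    (u : ∀ n, n ∉ range ψ → (𝟙_ V ⟶ B' n))
    (hh : ∀ s t t', σ s t = t' → ψ (r s t) = r' s t')
    (hn : ∀ s t', t' ∉ range (σ s) → r' s t' ∉ range ψ) :
    (ut A ◁ utSp ψ c u) ≫ (sh hr' A B').hom = (sh hr A B).hom ≫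
      utMap fun s => A s ◁ utSp (B := fun t => B' (r' s t)) (σ s)
        (fun t t' ht => c (r s t) (r' s t') (hh s t t' ht))
        (fun t' ht' => u (r' s t') (hn s t' ht')) := by
  rw [utSp, whiskerLeft_comp, assoc, sh_utSpread_right ψ σ hr hr' A u hh hn]
  have h1 := sh_naturality hr (fun s => 𝟙 (A s)) (fun n => c n (ψ n) rfl)
  rw [utMap_id, id_tensorHom] at h1
  rw [reassoc_of% h1, utMap_comp]
  congr 2
  funext s
  rw [id_tensorHom, ← whiskerLeft_comp, utMap_utSp]
  congr 1
  refine utSp_congr rfl (fun t t' h h' => ?_) fun _ _ _ => rfl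
  have : ∀ n' (e : ψ (r s t) = n'), c (r s t) _ rfl ≫ CategoryTheory.eqToHom (congrArg B' e) = c (r s t) n' e := by
    rintro _ rfl; simp
  exact this _ _

end Sh'

section Pentagon

variable {T : S → Type} [∀ s, Enum (T s)] {r : ∀ s, T s → N} {U : N → Type} [∀ n, Enum (U n)]
  {w : ∀ n, U n → M} {M' : S → Type} [∀ s, Enum (M' s)]

lemma sep_three : Sep (Sum.elim (fun s : S => [(Sum.inl s : S ⊕ (N ⊕ M))])
    (Sum.elim (fun n : N => [Sum.inr (Sum.inl n)]) (fun m : M => [Sum.inr (Sum.inr m)]))) :=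
  ⟨by rintro (s | n | m) <;> simp, by rintro (s | n | m) (s' | n' | m') (i | i | i) <;> simp <;> grind⟩

lemma Sep.elim {κ₁ κ₂ : Type} {mA : κ₁ → List ι} {mB : κ₂ → List ι} (hA : Sep mA) (hB : Sep mB)
    (h : ∀ s n i, i ∈ mA s → i ∈ mB n → False) : Sep (Sum.elim mA mB) :=
  ⟨by rintro (s | n); exacts [hA.1 s, hB.1 n], by
    rintro (s | n) (s' | n') i hi hi'
    · exact congrArg _ (hA.2 _ _ i hi hi')
    · exact (h _ _ i hi hi').elim
    · exact (h _ _ i hi' hi).elim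
    · exact congrArg _ (hB.2 _ _ i hi hi')⟩

lemma sh_pentagon (hr : IsPart r) (hw : IsPart w) {r1 : ∀ s, M' s → M} (hr1 : IsPart r1)
    {w1 : ∀ s (t : T s), U (r s t) → M' s} (hw1 : ∀ s, IsPart (w1 s))
    (h : ∀ s t u, r1 s (w1 s t u) = w (r s t) u) (A : S → V) (B : N → V) (C : M → V) :
    ((sh hr A B).hom ▷ ut C) ≫ (sh hr1 (fun s => A s ⊗ ut fun t => B (r s t)) C).hom ≫
      utMap (fun s => (α_ _ _ _).hom ≫ (A s ◁ (sh (hw1 s) (fun t => B (r s t))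
        (fun m => C (r1 s m))).hom)) =
    (α_ _ _ _).hom ≫ (ut A ◁ (sh hw B C).hom) ≫
      (sh hr A (fun n => B n ⊗ ut fun u => C (w n u))).hom ≫
      utMap fun s => A s ◁ utMap fun t => B (r s t) ◁ utMap fun u =>
        eqToHom (congrArg C (h s t u).symm) := by
  have h3 := sep_three (S := S) (N := N) (M := M)
  have hBC : Sep (Sum.elim (fun n : N => [(Sum.inr (Sum.inl n) : S ⊕ (N ⊕ M))])
      (fun m : M => [Sum.inr (Sum.inr m)])) := h3.comp Sum.inr_injective
  have hA : Sep fun s : S => [(Sum.inl s : S ⊕ (N ⊕ M))] := h3.comp Sum.inl_injective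
  have hB := hBC.inl
  have hC := hBC.inr
  let X := Sum.elim A (Sum.elim B C)
  let f : ∀ i, False → (𝟙_ V ⟶ X i) := fun _ h => h.elim
  let a : ∀ s, A s ≅ tens X [Sum.inl s] := fun s => canAtom X (Sum.inl s)
  let b : ∀ n, B n ≅ tens X [Sum.inr (Sum.inl n)] := fun n => canAtom X (Sum.inr (Sum.inl n))
  let c : ∀ m, C m ≅ tens X [Sum.inr (Sum.inr m)] := fun m => canAtom X (Sum.inr (Sum.inr m))
  have hAB := hA.elim hB fun s n i h h' => by simp_all
  have h1 := (hAB.fibre hr).elim hC fun s n i h h' => by simp_all [mem_utList]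
  have h2 := hA.elim (hBC.fibre hw) fun s n i h h' => by simp_all [mem_utList]
  have h4 : ∀ s, Sep (Sum.elim (fun t => [(Sum.inr (Sum.inl (r s t)) : S ⊕ (N ⊕ M))])
      fun m => [Sum.inr (Sum.inr (r1 s m))]) := fun s =>
    (hB.comp (hr.inj s)).elim (hC.comp (hr1.inj s)) fun s n i h h' => by simp_all
  have h5 := h2.fibre hr
  have h5' : Sep fun s => [(Sum.inl s : S ⊕ (N ⊕ M))] ++ utList fun t =>
      [Sum.inr (Sum.inl (r s t))] ++ utList fun u => [Sum.inr (Sum.inr (r1 s (w1 s t u)))] := by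
    simpa only [h] using h5
  have h6 := fun s => (h4 s).fibre (hw1 s)
  have l1 := ((IsCan.sh (f := f) (a := a) (b := b) hAB hr).whiskerRight (canUt c)
    h1.nodup_append).comp ((IsCan.sh (f := f) (a := fun s => canTensor (a s) (canUt fun t => b (r s t)))
      (b := c) h1 hr1).comp (IsCan.utMap (fun s => (IsCan.associator (by
        have := (h1.fibre hr1).1 s
        simpa only [List.append_assoc] using this)).comp ((IsCan.sh (f := f)
        (a := fun t => b (r s t)) (b := fun m => c (r1 s m)) (h4 s) (hw1 s)).whiskerLeft (a s)
        (h5'.1 s))) h5'))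
  have r1 := (IsCan.associator (f := f) (a := canUt a) (b := canUt b) (c := canUt c) (by
        have := h1.nodup_append
        have := l1.nodup_left
        simpa only [List.append_assoc] using this)).comp (((IsCan.sh (f := f) (a := b) (b := c) hBC
        hw).whiskerLeft (canUt a) h2.nodup_append).comp ((IsCan.sh (f := f) (a := a)
          (b := fun n => canTensor (b n) (canUt fun u => c (w n u))) h2 hr).comp
        (IsCan.utMap (fun s => (IsCan.utMap (fun t => (IsCan.utMap (fun u => 
          IsCan.eqToHom c (h s t u).symm (hC.1 _)) (hC.comp ((hr1.inj s).comp ((hw1 s).inj t)))).whiskerLeft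
            (b (r s t)) ((h6 s).1 t)) (h6 s)).whiskerLeft (a s) (h5'.1 s)) h5')))
  exact l1.unique r1

end Pentagon

end Unordered
section Enumerated

variable {S S' T N N' M : Type} [Enum S] [Enum S'] [Enum T] [Enum N] [Enum N'] [Enum M]

instance {T : S → Type} [∀ s, Enum (T s)] : Enum (Σ s, T s) where
  n := ∑ q : Fin (Enum.n S), Enum.n (T (Enum.e.symm q))
  e := (finSigmaFinEquiv.symm.trans (Equiv.sigmaCongr Enum.e.symm fun q => Enum.e.symm)).symm

instance (p : S → Prop) : Enum {s // p s} :=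
  haveI : Finite S := Finite.of_equiv _ Enum.e.symm
  ⟨Nat.card {s // p s}, Finite.equivFin _⟩

lemma Enum.e_sigma_symm {T : S → Type} [∀ s, Enum (T s)] (q : Fin (Enum.n S))
    (p : Fin (Enum.n (T (Enum.e.symm q)))) :
    (Enum.e (S := Σ s, T s)).symm (finSigmaFinEquiv ⟨q, p⟩) = ⟨Enum.e.symm q, Enum.e.symm p⟩ := by
  change (Equiv.sigmaCongr Enum.e.symm fun q => Enum.e.symm) (finSigmaFinEquiv.symm
    (finSigmaFinEquiv ⟨q, p⟩)) = _
  rw [Equiv.symm_apply_apply]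
  rfl

lemma Enum.e_sigma_fin {k : ℕ} {j : Fin k → ℕ} (x : Σ s, Fin (j s)) :
    Enum.e (S := Σ s, Fin (j s)) x = finSigmaFinEquiv x := by
  apply (Enum.e (S := Σ s, Fin (j s))).symm.injective
  rw [Equiv.symm_apply_apply]
  exact (Enum.e_sigma_symm (T := fun s => Fin (j s)) x.1 x.2).symm

/-- The map between the enumerating sets that corresponds to an injection. -/
def toFin (x : S ↪ T) : Fin (Enum.n S) ↪ Fin (Enum.n T) :=
  Enum.e.symm.toEmbedding.trans (x.trans Enum.e.toEmbedding)

lemma toFin_apply (x : S ↪ T) (q : Fin (Enum.n S)) : toFin x q = Enum.e (x (Enum.e.symm q)) := rfl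

variable {V : Type u} [Category.{v} V]

/-- The value of a functor on `Λᵒᵖ` at an enumerated set. -/
abbrev ev (G : Lamᵒᵖ ⥤ V) (S : Type) [Enum S] : V := G.obj (op ⟨Enum.n S⟩)

/-- The morphism of `Λ` given by an injection. -/
abbrev lamHom (x : S ↪ T) : (⟨Enum.n S⟩ : Lam) ⟶ ⟨Enum.n T⟩ := toFin x

/-- The contravariant action of an injection. -/
def res (G : Lamᵒᵖ ⥤ V) (x : S ↪ T) : ev G T ⟶ ev G S := G.map (lamHom x).op

lemma res_congr (G : Lamᵒᵖ ⥤ V) {x y : S ↪ T} (h : ∀ s, x s = y s) : res G x = res G y := by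
  rw [Embedding.ext h]

lemma res_refl' (G : Lamᵒᵖ ⥤ V) {x : S ↪ S} (h : ∀ s, x s = s) : res G x = 𝟙 _ := by
  have : lamHom x = 𝟙 _ := Embedding.ext fun q => by
    change Enum.e (x (Enum.e.symm q)) = q
    rw [h, Equiv.apply_symm_apply]
  rw [res, this, op_id, G.map_id]

lemma res_comp' (G : Lamᵒᵖ ⥤ V) {x : S ↪ T} {y : T ↪ N} {z : S ↪ N} (h : ∀ s, y (x s) = z s) :
    res G y ≫ res G x = res G z := by
  have : lamHom z = lamHom x ≫ lamHom y := Embedding.ext fun q => by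
    change Enum.e (z (Enum.e.symm q)) = Enum.e (y (Enum.e.symm (Enum.e (x (Enum.e.symm q)))))
    rw [Equiv.symm_apply_apply, h]
  rw [res, res, res, this, op_comp, G.map_comp]

lemma res_comp (G : Lamᵒᵖ ⥤ V) (x : S ↪ T) (y : T ↪ N) :
    res G y ≫ res G x = res G (x.trans y) := res_comp' G fun _ => rfl

lemma res_refl (G : Lamᵒᵖ ⥤ V) : res G (Embedding.refl S) = 𝟙 _ := res_refl' G fun _ => rfl

lemma res_naturality {G H : Lamᵒᵖ ⥤ V} (g : G ⟶ H) (x : S ↪ T) :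
    res G x ≫ g.app (op ⟨Enum.n S⟩) = g.app (op ⟨Enum.n T⟩) ≫ res H x := g.naturality _

lemma eqToHom_eq_res (G : Lamᵒᵖ ⥤ V) {m n : ℕ} (h : m = n) :
    eqToHom (congrArg (fun n => G.obj (op ⟨n⟩)) h) = res G (S := Fin n) (T := Fin m)
      (finCongr h.symm).toEmbedding := by
  subst h
  exact (res_refl' (S := Fin m) G (x := (finCongr rfl).toEmbedding) fun _ => rfl).symm

lemma eqToHom_ev (G : Lamᵒᵖ ⥤ V) {T : S → Type} [∀ s, Enum (T s)] {s s' : S} (h : s = s') :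
    eqToHom (congrArg (fun s => ev G (T s)) h) = res G (S := T s') (T := T s)
      (Equiv.cast (congrArg T h.symm)).toEmbedding := by
  subst h
  exact (res_refl' G (x := (Equiv.cast rfl).toEmbedding) fun _ => rfl).symm

variable [MonoidalCategory V]

/-- The base map of a `Λ`-sequence at an empty set. -/
def bs (E : LambdaSeq V) (hT : IsEmpty T) : 𝟙_ V ⟶ ev E.seq T :=
  E.base ≫ res E.seq (S := T) (T := Fin 0) ⟨fun t => hT.elim t, fun t => hT.elim t⟩

lemma bs_res (E : LambdaSeq V) (hT : IsEmpty T) (hS : IsEmpty S) (x : S ↪ T) :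
    bs E hT ≫ res E.seq x = bs E hS := by
  rw [bs, assoc, bs, res_comp']
  exact fun s => hS.elim s

lemma bs_zero (E : LambdaSeq V) (h : IsEmpty (Fin 0)) : bs E h = E.base := by
  refine (congrArg (E.base ≫ ·) (res_refl' _ fun s => s.elim0)).trans (comp_id _)

lemma bs_naturality {E F : LambdaSeq V} (g : E ⟶ F) (hT : IsEmpty T) :
    bs E hT ≫ g.hom.app (op ⟨Enum.n T⟩) = bs F hT := by
  rw [bs, assoc, res_naturality, ← assoc]
  erw [g.base_hom]
  rfl

end Enumerated

section Sequences

variable [SymmetricCategory V]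
  {S S' S'' N N' M : Type} [Enum S] [Enum S'] [Enum S''] [Enum N] [Enum N'] [Enum M]
  {T : S → Type} [∀ s, Enum (T s)] {T' : S' → Type} [∀ s, Enum (T' s)]
  {T'' : S'' → Type} [∀ s, Enum (T'' s)]

/-- The morphism `⨂ₛ E (T s) ⟶ ⨂ₛ E (T' s)` given by an injection `φ`, injections
`T' (φ s) → T s` and the base maps at the places that are not in the image of `φ`. -/
def utRes (E : LambdaSeq V) (φ : S ↪ S') (f : ∀ s s', φ s = s' → (T' s' ↪ T s))
    (he : ∀ s', s' ∉ range φ → IsEmpty (T' s')) :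
    ut (fun s => ev E.seq (T s)) ⟶ ut (fun s => ev E.seq (T' s)) :=
  utSp φ (fun s s' h => res E.seq (f s s' h)) (fun s' hs' => bs E (he s' hs'))

lemma utSp_eq_fin {φ : S ↪ S'} {A : S → V} {B : S' → V} (c : ∀ s t, φ s = t → (A s ⟶ B t))
    (u : ∀ t, t ∉ range φ → (𝟙_ V ⟶ B t)) (h1 : ∀ {q q'}, toFin φ q = q' →
      φ (Enum.e.symm q) = Enum.e.symm q') (h2 : ∀ {q'}, q' ∉ range (toFin φ) →
      Enum.e.symm q' ∉ range φ) :
    utSp φ c u = utSp (S := Fin (Enum.n S)) (S' := Fin (Enum.n S')) (A := fun q => A (Enum.e.symm q))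
      (B := fun q => B (Enum.e.symm q)) (toFin φ)
      (fun q q' h => c (Enum.e.symm q) (Enum.e.symm q') (h1 h))
      (fun q' h => u (Enum.e.symm q') (h2 h)) := by
  have h3 : ∀ q, c (Enum.e.symm q) (Enum.e.symm (toFin φ q)) (h1 rfl) =
      c (Enum.e.symm q) (φ (Enum.e.symm q)) rfl ≫ eqToHom (congrArg B (h1 rfl)) := by
    intro q
    have : ∀ t (e : φ (Enum.e.symm q) = t), c (Enum.e.symm q) t e =
      c (Enum.e.symm q) (φ (Enum.e.symm q)) rfl ≫ eqToHom (congrArg B e) := by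
      rintro _ rfl; simp
    exact this _ _
  have h4 : utSpread φ B u = utMap (S := Fin (Enum.n S)) (fun q => eqToHom (congrArg B (h1 rfl))) ≫
      utSpread (S := Fin (Enum.n S)) (S' := Fin (Enum.n S')) (toFin φ)
        (fun q => B (Enum.e.symm q)) (fun q' h => u (Enum.e.symm q') (h2 h)) := by
    have hs : Sep fun t : S' => [t] := sep_singleton Function.injective_id
    refine (IsCan.utSpread (f := u) φ (a := fun s => canAtom B s) hs u
      fun t ht => IsCan.atom t ht).unique (g' := _) ?_
    refine (IsCan.utMap (S := Fin (Enum.n S)) (b := fun q => canAtom B (Enum.e.symm (toFin φ q)))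
      (fun q => IsCan.eqToHom (fun s => canAtom B s) (h1 rfl) (hs.1 _)) ?_).comp
      (IsCan.utSpread (f := u) (S := Fin (Enum.n S)) (S' := Fin (Enum.n S')) (toFin φ)
        (a := fun q => canAtom B (Enum.e.symm q)) ?_ _ fun t ht => IsCan.atom _ _)
    · exact sep_singleton (e := fun q => Enum.e.symm (toFin φ q))
        (Enum.e.symm.injective.comp (toFin φ).injective)
    · exact sep_singleton (e := fun q : Fin (Enum.n S') => Enum.e.symm q) Enum.e.symm.injective
  refine (congrArg (utMap (fun s => c s (φ s) rfl) ≫ ·) h4).trans ((assoc _ _ _).symm.trans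
    (congrArg (· ≫ _) ?_))
  exact (utMap_comp (S := Fin (Enum.n S)) _ _).trans
    (congrArg (fun z => utMap (S := Fin (Enum.n S)) z) (funext h3).symm)

lemma rearrange_decEq {ι : Type} (d d' : DecidableEq ι) (X : ι → V) {P : ι → Prop}
    (f : ∀ a, P a → (𝟙_ V ⟶ X a)) (m l : List ι) (hl : l.Nodup) (hm : m.Nodup)
    (hs : ∀ a ∈ l, a ∈ m) (hP : ∀ a ∈ m, a ∉ l → P a) :
    @rearrange V _ _ ι _ d X P f m l hl hm hs hP = @rearrange V _ _ ι _ d' X P f m l hl hm hs hP := by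
  obtain rfl := Subsingleton.elim d d'
  rfl

lemma spread_eq_utSpread {k l : ℕ} (φ : Fin k ↪ Fin l) (X : Fin l → V)
    (f : ∀ t, t ∉ range φ → (𝟙_ V ⟶ X t)) : spread φ X f = utSpread φ X f := by
  have hs : Sep fun t : Fin l => [t] := sep_singleton Function.injective_id
  refine IsCan.unique (f := f) (a := canUt fun s : Fin k => canAtom X (φ s))
    (b := canUt fun s => canAtom X s) ?_
    (IsCan.utSpread φ hs f fun t ht => IsCan.atom t ht)
  rw [spread, rearrange_decEq _ (Classical.decEq _)]
  exact (IsCan.tensRelabel (f := f) (a := fun s => canAtom X s) hs φ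
    ((List.nodup_finRange k).map φ.injective)).comp
    (IsCan.rearr (a := fun s => canAtom X s) hs (fun t ht => IsCan.atom t ht)
    (⟨(List.nodup_finRange k).map φ.injective, List.nodup_finRange l,
      (fun _ _ => List.mem_finRange _),
      (fun _ _ ht ⟨s, hs⟩ => ht (List.mem_map.2 ⟨s, List.mem_finRange s, hs⟩))⟩ :
      Sub (fun t => t ∉ range φ) ((List.finRange k).map φ) (List.finRange l)))

lemma comp_aux {C : Type*} [Category* C] {X₀ X₁ X₂ X₃ X₄ X₅ X₆ : C} {a : X₀ ⟶ X₁} {b : X₁ ⟶ X₂}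
    {p : X₀ ⟶ X₃} {q : X₃ ⟶ X₄} {w : X₄ ⟶ X₂} {x : X₂ ⟶ X₅} {y : X₄ ⟶ X₅} {z : X₃ ⟶ X₆}
    {v : X₆ ⟶ X₅} {r : X₀ ⟶ X₆} (h1 : a ≫ b = p ≫ q ≫ w) (h2 : w ≫ x = y) (h3 : q ≫ y = z ≫ v)
    (h4 : p ≫ z = r) : a ≫ b ≫ x = r ≫ v := by
  rw [reassoc_of% h1, h2, h3, reassoc_of% h4]

variable [HasColimits V]

lemma dayGen_res {E : LambdaSeq V} {k l : ℕ} (φ : Fin k ↪ Fin l) (j : Fin k → ℕ) (j' : Fin l → ℕ)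
    (f : ∀ s t, φ s = t → (Fin (j' t) ↪ Fin (j s))) (he : ∀ t, t ∉ range φ → IsEmpty (Fin (j' t)))
    (x : Fin (∑ t, j' t) ↪ Fin (∑ s, j s))
    (hx : ∀ s q, x (finSigmaFinEquiv ⟨φ s, q⟩) = finSigmaFinEquiv ⟨s, f s (φ s) rfl q⟩) :
    dayGen E.seq j ≫ (dayAct E φ).app _ ≫ res (dayPow E.seq l) x =
      utRes E φ f he ≫ dayGen E.seq j' := by
  let J : Fin k → Lam := fun s => ⟨j s⟩
  let J' : Fin l → Lam := fun s => ⟨j' s⟩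
  obtain ⟨g, hg⟩ : ∃ g : J' ⟶ push φ J, ∀ s, g (φ s) =
      (show J' (φ s) ⟶ J s from f s (φ s) rfl) ≫ eqToHom (push_apply φ J s).symm := by
    have : ∀ t, ∃ g : J' t ⟶ push φ J t, ∀ s (h : φ s = t), g =
        (show J' t ⟶ J s from f s t h) ≫ eqToHom (by rw [← h, push_apply φ J s]) := by
      intro t
      by_cases ht : t ∈ range φ
      · obtain ⟨s, rfl⟩ := ht
        refine ⟨(show J' (φ s) ⟶ J s from f s (φ s) rfl) ≫ eqToHom (push_apply φ J s).symm, ?_⟩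
        intro s' h
        obtain rfl := φ.injective h
        rfl
      · refine ⟨show Fin (j' t) ↪ _ from ⟨fun q => (he t ht).elim q, fun q => (he t ht).elim q⟩, ?_⟩
        intro s h
        exact (ht ⟨s, h⟩).elim
    choose g hg using this
    exact ⟨g, fun s => hg _ s rfl⟩
  have h1 := dayUnit_dayAct E φ (op J)
  have h2 : lamHom x ≫ pushBlock φ J = (wedge l).map g := by
    refine blockEmb_ext (j := fun s => (J' s).n) fun t q => ?_
    by_cases ht : t ∈ range φ
    · obtain ⟨s, rfl⟩ := ht
      have e1 := blockEmb_apply (j := fun s => (J s).n) (j' := fun t => (push φ J t).n) φ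
        (fun s => eqToHom (push_apply φ J s).symm) s (f s (φ s) rfl q)
      have e2 := blockEmb_apply (j := fun s => (J' s).n) (j' := fun t => (push φ J t).n)
        (Embedding.refl _) g (φ s) q
      refine (congrArg (Lam.emb (pushBlock φ J)) (hx s q)).trans (e1.trans (Eq.trans ?_ e2.symm))
      rw [hg]
      rfl
    · exact (he t ht).elim q
  have h3 : (dayUnit E.seq l).app (op (push φ J)) ≫ (dayPow E.seq l).map ((wedge l).map g).op =
      (extTensor E.seq l).map g.op ≫ dayGen E.seq j' := ((dayUnit E.seq l).naturality g.op).symm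
  have h4 : extTensorPush E φ J ≫ (extTensor E.seq l).map g.op = utRes E φ f he := by
    rw [extTensorPush, spread_eq_utSpread]
    have h5 := utSpread_naturality φ (A := fun t => E.seq.obj (op (push φ J t)))
      (B := fun t => ev E.seq (Fin (j' t)))
      (fun _ ht => E.base ≫ eqToHom (by rw [push_of_notMem φ J ht])) (fun t => E.seq.map (g t).op)
    refine (assoc _ _ _).trans ((congrArg (_ ≫ ·) h5.symm).trans ?_)
    refine (assoc _ _ _).symm.trans ((eq_whisker (tensMap_comp _ _ _).symm _).trans ?_)
    have h6 : (fun t ht => (E.base ≫ eqToHom (by rw [push_of_notMem φ J ht])) ≫ E.seq.map (g t).op) =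
        fun t ht => bs E (he t ht) := by
      funext t ht
      have h7 : g t = (show Fin (j' t) ↪ Fin 0 from
          ⟨fun q => (he t ht).elim q, fun q => (he t ht).elim q⟩) ≫
          eqToHom (push_of_notMem φ J ht).symm :=
        Embedding.ext fun q => (he t ht).elim q
      rw [h7, op_comp, E.seq.map_comp, eqToHom_op, eqToHom_map, assoc, eqToHom_trans_assoc,
        eqToHom_refl, id_comp]
      rfl
    refine congrArg₂ (· ≫ ·) (congrArg (fun z => tensMap z (List.finRange k)) (funext fun s => ?_))
      (congrArg (utSpread φ _) h6)
    have h8 : (g (φ s)).op = eqToHom (congrArg op (push_apply φ J s)) ≫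
        Quiver.Hom.op (show J' (φ s) ⟶ J s from f s (φ s) rfl) := by
      rw [hg, op_comp, eqToHom_op]
    change _ ≫ E.seq.map (g (φ s)).op = _
    rw [h8, E.seq.map_comp, eqToHom_map, eqToHom_trans_assoc, eqToHom_refl, id_comp]
    rfl
  have h5 : (dayPow E.seq l).map (pushBlock φ J).op ≫ res (dayPow E.seq l) x =
      (dayPow E.seq l).map ((wedge l).map g).op :=
    ((dayPow E.seq l).map_comp (pushBlock φ J).op (lamHom x).op).symm.trans
      (congrArg (fun z => (dayPow E.seq l).map z.op) h2)
  exact comp_aux h1 h5 h3 h4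

end Sequences
section Generators

variable [SymmetricCategory V]
  {S S' S'' N N' M : Type} [Enum S] [Enum S'] [Enum S''] [Enum N] [Enum N'] [Enum M]
  {T : S → Type} [∀ s, Enum (T s)] {T' : S' → Type} [∀ s, Enum (T' s)]
  {T'' : S'' → Type} [∀ s, Enum (T'' s)] {r : ∀ s, T s → N} {r' : ∀ s, T' s → N'}

/-- The bijection between the set of pairs `(s, t)` and the set `N`. -/
def IsPart.equiv (hr : IsPart r) : (Σ s, T s) ≃ N := Equiv.ofBijective _ hr

lemma IsPart.equiv_symm (hr : IsPart r) (s : S) (t : T s) : hr.equiv.symm (r s t) = ⟨s, t⟩ :=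
  hr.equiv.symm_apply_apply ⟨s, t⟩

/-- The set of pairs `(s, t)` as a partition of itself. -/
lemma IsPart.mk : IsPart (fun s (t : T s) => (⟨s, t⟩ : Σ s, T s)) := Function.bijective_id

lemma IsPart.comp (hr : IsPart r) (e : N ≃ M) : IsPart fun s t => e (r s t) := e.bijective.comp hr

lemma IsPart.fin {k : ℕ} (j : Fin k → ℕ) : IsPart fun s (q : Fin (j s)) => finSigmaFinEquiv ⟨s, q⟩ :=
  finSigmaFinEquiv.bijective

/-- The partition of `N` by the fibres of a map. -/
lemma IsPart.fibres (π : N → S) : IsPart fun s (i : {i // π i = s}) => i.1 := by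
  refine ⟨?_, fun i => ⟨⟨π i, i, rfl⟩, rfl⟩⟩
  rintro ⟨_, i, rfl⟩ ⟨_, i', rfl⟩ h
  obtain rfl : i = i' := h
  rfl

lemma utRes_eq_fin (E : LambdaSeq V) (φ : S ↪ S') (f : ∀ s s', φ s = s' → (T' s' ↪ T s))
    (he : ∀ s', s' ∉ range φ → IsEmpty (T' s')) (h1 : ∀ {q q'}, toFin φ q = q' →
      φ (Enum.e.symm q) = Enum.e.symm q') (h2 : ∀ {q'}, q' ∉ range (toFin φ) →
      IsEmpty (Fin (Enum.n (T' (Enum.e.symm q'))))) :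
    utRes E φ f he = utRes (S := Fin (Enum.n S)) (S' := Fin (Enum.n S'))
      (T := fun q => Fin (Enum.n (T (Enum.e.symm q)))) (T' := fun q => Fin (Enum.n (T' (Enum.e.symm q))))
      E (toFin φ) (fun q q' h => toFin (f (Enum.e.symm q) (Enum.e.symm q') (h1 h)))
      (fun q' h => h2 h) := by
  refine (utSp_eq_fin _ _ h1 (fun {q'} h ⟨s, hs⟩ => h ⟨Enum.e s, by simp [toFin_apply, hs]⟩)).trans ?_
  refine utSp_congr rfl (fun _ _ _ _ => rfl) (fun t ht ht' => ?_)
  exact congrArg (E.base ≫ ·) (congrArg (fun x : Fin _ ↪ Fin 0 => E.seq.map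
    (Quiver.Hom.op (X := (⟨_⟩ : Lam)) (Y := ⟨0⟩) x))
    (Embedding.ext fun q => (h2 ht).elim q))

variable [HasColimits V]

/-- The canonical maps `⨂ₛ E (T s) ⟶ E^{⊠ S} N`. -/
def dG (E : LambdaSeq V) (hr : IsPart r) :
    ut (fun s => ev E.seq (T s)) ⟶ ev (dayPow E.seq (Enum.n S)) N :=
  dayGen E.seq (fun q : Fin (Enum.n S) => Enum.n (T (Enum.e.symm q))) ≫
    res (S := N) (T := Σ s, T s) (dayPow E.seq (Enum.n S)) hr.equiv.symm.toEmbedding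

lemma dG_res (E : LambdaSeq V) (hr : IsPart r) (hr' : IsPart r') (φ : S ↪ S')
    (f : ∀ s s', φ s = s' → (T' s' ↪ T s)) (he : ∀ s', s' ∉ range φ → IsEmpty (T' s'))
    (ψ : N' ↪ N) (hψ : ∀ s s' h t', ψ (r' s' t') = r s (f s s' h t')) :
    dG E hr ≫ (dayAct E (toFin φ)).app _ ≫ res _ ψ = utRes E φ f he ≫ dG E hr' := by
  have h1 : ∀ {q q'}, toFin φ q = q' → φ (Enum.e.symm q) = Enum.e.symm q' := by
    rintro q _ rfl
    rw [toFin_apply, Equiv.symm_apply_apply]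
  have h2 : ∀ {q'}, q' ∉ range (toFin φ) → IsEmpty (Fin (Enum.n (T' (Enum.e.symm q')))) := by
    intro q' h
    have := he (Enum.e.symm q') (fun ⟨s, hs⟩ => h ⟨Enum.e s, by simp [toFin_apply, hs]⟩)
    exact Equiv.isEmpty Enum.e.symm
  let x : (Σ s, T' s) ↪ Σ s, T s := hr'.equiv.toEmbedding.trans (ψ.trans hr.equiv.symm.toEmbedding)
  have h3 := dayGen_res (E := E) (toFin φ) (fun q => Enum.n (T (Enum.e.symm q)))
    (fun q => Enum.n (T' (Enum.e.symm q)))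
    (fun q q' h => toFin (f (Enum.e.symm q) (Enum.e.symm q') (h1 h))) (fun _ h => h2 h)
    (toFin x) (by
      intro q p
      apply (Enum.e (S := Σ s, T s)).symm.injective
      refine ((Enum.e (S := Σ s, T s)).symm_apply_apply _).trans ?_
      refine Eq.trans ?_ (Enum.e_sigma_symm (T := T) q _).symm
      refine (congrArg x (Enum.e_sigma_symm (T := T') (toFin φ q) p)).trans ?_
      change hr.equiv.symm (ψ (r' _ _)) = _
      rw [hψ _ _ (h1 rfl), hr.equiv_symm]
      refine congrArg (Sigma.mk _) ?_
      exact (Enum.e.symm_apply_apply _).symm)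
  rw [utRes_eq_fin E φ f he h1 h2]
  have h4 : res (dayPow E.seq (Enum.n S)) hr.equiv.symm.toEmbedding ≫ (dayAct E (toFin φ)).app _ =
      (dayAct E (toFin φ)).app _ ≫ res _ hr.equiv.symm.toEmbedding := res_naturality _ _
  have h5 : res (dayPow E.seq (Enum.n S')) hr.equiv.symm.toEmbedding ≫ res _ ψ =
      res _ x ≫ res _ hr'.equiv.symm.toEmbedding := by
    rw [res_comp, res_comp]
    refine res_congr _ fun i => ?_
    exact congrArg (fun i => hr.equiv.symm (ψ i)) (hr'.equiv.apply_symm_apply i).symm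
  have aux : ∀ {X₀ X₁ X₂ X₃ X₄ X₅ Y Z : V} {a : X₀ ⟶ X₁} {b : X₁ ⟶ X₂} {c : X₂ ⟶ X₃} {d : X₃ ⟶ X₄}
      {c' : X₁ ⟶ X₅} {b' : X₅ ⟶ X₃} {y : X₅ ⟶ Y} {z : Y ⟶ X₄} {u : X₀ ⟶ Z} {v : Z ⟶ Y}
      (h3 : a ≫ c' ≫ y = u ≫ v) (h4 : b ≫ c = c' ≫ b') (h5 : b' ≫ d = y ≫ z),
      (a ≫ b) ≫ c ≫ d = u ≫ v ≫ z := by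
    intros
    rename_i h3 h4 h5
    rw [assoc, reassoc_of% h4, h5, reassoc_of% h3]
  exact aux h3 h4 h5

lemma dG_fin (E : LambdaSeq V) {k : ℕ} (j : Fin k → ℕ) : dG E (IsPart.fin j) = dayGen E.seq j := by
  have h : lamHom (IsPart.fin j).equiv.symm.toEmbedding = 𝟙 (⟨∑ s, j s⟩ : Lam) :=
    Embedding.ext fun i => by
      obtain ⟨⟨s, q⟩, rfl⟩ := finSigmaFinEquiv.surjective i
      exact (congrArg (Enum.e (S := Σ s, Fin (j s)))
        ((IsPart.fin j).equiv_symm s q)).trans (Enum.e_sigma_fin ⟨s, q⟩)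
  exact (congrArg (fun z : (⟨∑ s, j s⟩ : Lam) ⟶ ⟨∑ s, j s⟩ => dayGen E.seq j ≫
    (dayPow E.seq k).map z.op) h).trans ((congrArg (_ ≫ ·) ((dayPow E.seq k).map_id _)).trans
    (comp_id _))

/-- The canonical maps `D S ⊗ ⨂ₛ E (T s) ⟶ (D ⊙ E) N`, where `N` is identified with the set of pairs
`(s, t)` by `r`. -/
def Gen (D E : LambdaSeq V) (hr : IsPart r) :
    ev D.seq S ⊗ ut (fun s => ev E.seq (T s)) ⟶ ev (kelly D E).seq N :=
  (ev D.seq S ◁ dG E hr) ≫ (kellyι D E (Enum.n S)).app (op ⟨Enum.n N⟩)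

lemma Gen_fin (D E : LambdaSeq V) {k : ℕ} (j : Fin k → ℕ) :
    Gen D E (IsPart.fin j) = kellyGen D E j := by
  rw [Gen, dG_fin]
  rfl

lemma Gen_res (D E : LambdaSeq V) (hr : IsPart r) (hr' : IsPart r') (φ : S ↪ S')
    (f : ∀ s s', φ s = s' → (T' s' ↪ T s)) (he : ∀ s', s' ∉ range φ → IsEmpty (T' s'))
    (ψ : N' ↪ N) (hψ : ∀ s s' h t', ψ (r' s' t') = r s (f s s' h t')) :
    (res D.seq φ ▷ _) ≫ Gen D E hr ≫ res _ ψ = (_ ◁ utRes E φ f he) ≫ Gen D E hr' := by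
  have h1 := dG_res E hr hr' φ f he ψ hψ
  have h2 : (res D.seq φ ▷ ev (dayPow E.seq (Enum.n S)) N') ≫ (kellyι D E (Enum.n S)).app _ =
      (_ ◁ (dayAct E (toFin φ)).app _) ≫ (kellyι D E (Enum.n S')).app _ :=
    NatTrans.congr_app (kelly_condition D E (toFin φ)) (op ⟨Enum.n N'⟩)
  have h3 : (kellyι D E (Enum.n S)).app (op ⟨Enum.n N⟩) ≫ res (kelly D E).seq ψ =
      (_ ◁ res _ ψ) ≫ (kellyι D E (Enum.n S)).app (op ⟨Enum.n N'⟩) :=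
    ((kellyι D E (Enum.n S)).naturality (lamHom ψ).op).symm
  have h4 : (dayAct E (toFin φ)).app _ ≫ res (dayPow E.seq (Enum.n S')) ψ =
    res _ ψ ≫ (dayAct E (toFin φ)).app _ := (res_naturality _ _).symm
  have aux : ∀ {A A' X X₁ Y Y₁ Y₂ Z Z' : V} {a : A ⟶ A'} {g : X ⟶ X₁} {i : A' ⊗ X₁ ⟶ Z}
      {p : Z ⟶ Z'} {w : X₁ ⟶ Y₁} {i' : A' ⊗ Y₁ ⟶ Z'} {c : Y₁ ⟶ Y₂} {i'' : A ⊗ Y₂ ⟶ Z'}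
      {u : X ⟶ Y} {g' : Y ⟶ Y₂} (h1 : g ≫ w ≫ c = u ≫ g') (h2 : (a ▷ Y₁) ≫ i' = (A ◁ c) ≫ i'')
      (h3 : i ≫ p = (A' ◁ w) ≫ i'), (a ▷ X) ≫ ((A' ◁ g) ≫ i) ≫ p = (A ◁ u) ≫ (A ◁ g') ≫ i'' := by
    intros
    rename_i h1 h2 h3
    rw [assoc, h3, ← whiskerLeft_comp_assoc, ← whiskerLeft_comp_assoc, ← h1,
      ← whisker_exchange_assoc, h2]
    simp
  exact aux (Y₁ := ev (dayPow E.seq (Enum.n S)) N') (Y₂ := ev (dayPow E.seq (Enum.n S')) N')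
    ((congrArg (dG E hr ≫ ·) h4.symm).trans h1) h2 h3

lemma dG_naturality {E E' : LambdaSeq V} (g : E ⟶ E') (hr : IsPart r) :
    dG E hr ≫ (dayPowMap g.hom (Enum.n S)).app (op ⟨Enum.n N⟩) =
      (utMap fun s => g.hom.app (op ⟨Enum.n (T s)⟩)) ≫ dG E' hr := by
  refine (assoc _ _ _).trans ((whisker_eq _ (res_naturality (S := N) (T := Σ s, T s)
    (dayPowMap g.hom (Enum.n S)) _)).trans ?_)
  refine (assoc _ _ _).symm.trans ((eq_whisker (dayGen_naturality _ _) _).trans ?_)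
  exact assoc _ _ _

lemma Gen_naturality {D D' E E' : LambdaSeq V} (f : D ⟶ D') (g : E ⟶ E') (hr : IsPart r) :
    Gen D E hr ≫ (kellyMap f g).hom.app (op ⟨Enum.n N⟩) =
      (f.hom.app _ ⊗ₘ utMap fun s => g.hom.app (op ⟨Enum.n (T s)⟩)) ≫ Gen D' E' hr := by
  have h1 : (kellyι D E (Enum.n S)).app (op ⟨Enum.n N⟩) ≫ (kellyMap f g).hom.app (op ⟨Enum.n N⟩) =
      (f.hom.app (op ⟨Enum.n S⟩) ⊗ₘ (dayPowMap g.hom (Enum.n S)).app (op ⟨Enum.n N⟩)) ≫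
        (kellyι D' E' (Enum.n S)).app (op ⟨Enum.n N⟩) :=
    NatTrans.congr_app (kellyι_kellySeqMap f g (Enum.n S)) (op ⟨Enum.n N⟩)
  have h2 := dG_naturality g hr
  have aux : ∀ {A A' X X₁ Y Y₁ Z Z' : V} {a : A ⟶ A'} {x : X ⟶ X₁} {y : Y ⟶ Y₁} {z : Z ⟶ Z'}
      {u : X ⟶ Y} {u' : X₁ ⟶ Y₁} {w : A ⊗ Y ⟶ Z} {w' : A' ⊗ Y₁ ⟶ Z'} (h1 : w ≫ z = (a ⊗ₘ y) ≫ w')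
      (h2 : u ≫ y = x ≫ u'), ((A ◁ u) ≫ w) ≫ z = (a ⊗ₘ x) ≫ (A' ◁ u') ≫ w' := by
    intros
    rename_i h1 h2
    rw [assoc, h1, ← id_tensorHom, ← id_tensorHom, tensorHom_comp_tensorHom_assoc,
      tensorHom_comp_tensorHom_assoc, h2, id_comp, comp_id]
  exact aux h1 h2

end Generators
section UniversalProperty

variable [SymmetricCategory V]

lemma utRes_refl {S : Type} [Enum S] (E : LambdaSeq V) {T T' : S → Type} [∀ s, Enum (T s)]
    [∀ s, Enum (T' s)] (f : ∀ s s', Embedding.refl S s = s' → (T' s' ↪ T s))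
    (he : ∀ s', s' ∉ range (Embedding.refl S) → IsEmpty (T' s')) :
    utRes E (Embedding.refl S) f he = utMap fun s => res E.seq (f s s rfl) :=
  utSp_refl _ _

variable [HasColimits V]

lemma dayAct_refl (E : LambdaSeq V) (k : ℕ) :
    dayAct E (Embedding.refl (Fin k)) = 𝟙 (dayPow E.seq k) := by
  refine dayPow_hom_ext fun j => ?_
  have h := dayGen_res (E := E) (Embedding.refl (Fin k)) (fun s => (j.unop s).n)
    (fun s => (j.unop s).n) (fun s t h => (finCongr (by rw [← h]; rfl)).toEmbedding)
    (fun t ht => absurd ⟨t, rfl⟩ ht) (Embedding.refl _) (fun _ _ => rfl)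
  rw [utRes_refl] at h
  have h1 : (fun s => res E.seq (S := Fin (j.unop s).n) (T := Fin (j.unop s).n)
      (finCongr rfl).toEmbedding) = fun s : Fin k => 𝟙 (ev E.seq (Fin (j.unop s).n)) :=
    funext fun s => res_refl' _ fun _ => rfl
  have h2 : res (dayPow E.seq k) (Embedding.refl (Fin (∑ s, (j.unop s).n))) = 𝟙 _ :=
    res_refl _
  have h3 := (congrArg (utMap (S := Fin k)) h1).trans (utMap_id (S := Fin k) _)
  have aux : ∀ {X Y : V} {a : X ⟶ Y} {b c : Y ⟶ Y} {d : X ⟶ X} (h : a ≫ b ≫ c = d ≫ a) (h2 : c = 𝟙 _)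
      (h3 : d = 𝟙 _), a ≫ b = a ≫ 𝟙 _ := by
    rintro X Y a b _ _ h rfl rfl
    simpa using h
  exact aux h h2 h3

lemma dG_res_id {S N N' : Type} [Enum S] [Enum N] [Enum N'] {T T' : S → Type} [∀ s, Enum (T s)]
    [∀ s, Enum (T' s)] {r : ∀ s, T s → N} {r' : ∀ s, T' s → N'} (E : LambdaSeq V)
    (hr : IsPart r) (hr' : IsPart r') (f : ∀ s, T' s ↪ T s) (ψ : N' ↪ N)
    (hψ : ∀ s t', ψ (r' s t') = r s (f s t')) :
    dG E hr ≫ res _ ψ = (utMap fun s => res E.seq (f s)) ≫ dG E hr' := by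
  have h := dG_res E hr hr' (Embedding.refl S) (fun s s' h =>
    (Equiv.cast (congrArg T' h.symm)).toEmbedding.trans (f s)) (fun t ht => absurd ⟨t, rfl⟩ ht) ψ
    (by rintro s _ rfl t'; exact hψ s t')
  rw [utRes_refl] at h
  have h1 : dayAct E (toFin (Embedding.refl S)) = 𝟙 _ := by
    rw [show toFin (Embedding.refl S) = Embedding.refl _ from
      Embedding.ext fun q => Enum.e.apply_symm_apply q, dayAct_refl]
  have h2 := NatTrans.congr_app h1 (op ⟨Enum.n N⟩)
  have aux : ∀ {X Y Z : V} {a : X ⟶ Y} {b : Y ⟶ Y} {c : Y ⟶ Z} {d : X ⟶ Z}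
      (h : a ≫ b ≫ c = d) (h2 : b = 𝟙 _), a ≫ c = d := by
    rintro X Y Z a _ c d h rfl
    simpa using h
  exact aux h h2

/-- The colimit cocone that computes the Day convolution powers. -/
def dayColimit (E : Lamᵒᵖ ⥤ V) (k n : ℕ) :
    IsColimit ((Functor.LeftExtension.mk (dayPow E k) (dayUnit E k)).coconeAt (op ⟨n⟩)) :=
  Functor.isPointwiseLeftKanExtensionLeftKanExtensionUnit (wedge k).op (extTensor E k) (op ⟨n⟩)

lemma exists_block {k n : ℕ} {j : Fin k → ℕ} (x : Fin n ↪ Fin (∑ s, j s)) (π : Fin n → Fin k)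
    (hπ : ∀ i, π i = (finSigmaFinEquiv.symm (x i)).1) :
    ∃ f : ∀ s, {i // π i = s} ↪ Fin (j s), ∀ s i, x i.1 = finSigmaFinEquiv ⟨s, f s i⟩ := by
  have : ∀ s (i : {i // π i = s}), ∃ q, x i.1 = finSigmaFinEquiv ⟨s, q⟩ := by
    rintro s ⟨i, hi⟩
    obtain rfl : _ = s := (hπ i).symm.trans hi
    exact ⟨_, (finSigmaFinEquiv.apply_symm_apply _).symm⟩
  choose f hf using this
  refine ⟨fun s => ⟨f s, fun i i' h => Subtype.ext (x.injective ?_)⟩, hf⟩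
  rw [hf, hf, h]

variable (E : LambdaSeq V) {k n : ℕ}

/-- The summands of the Day convolution power. -/
abbrev daySummand (π : Fin n → Fin k) : V := ut fun s : Fin k => ev E.seq {i // π i = s}

/-- The restriction of the exterior tensor power to a summand. -/
def toSummand {j : Fin k → ℕ} {π : Fin n → Fin k} (f : ∀ s, {i // π i = s} ↪ Fin (j s)) :
    (extTensor E.seq k).obj (op fun s => ⟨j s⟩) ⟶ daySummand E π :=
  utMap (S := Fin k) (A := fun s => ev E.seq (Fin (j s))) fun s => res E.seq (f s)

lemma toSummand_unique {j : Fin k → ℕ} {x : Fin n → Fin (∑ s, j s)} {π π' : Fin n → Fin k}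
    (f : ∀ s, {i // π i = s} ↪ Fin (j s)) (f' : ∀ s, {i // π' i = s} ↪ Fin (j s))
    (hf : ∀ s i, x i.1 = finSigmaFinEquiv ⟨s, f s i⟩)
    (hf' : ∀ s i, x i.1 = finSigmaFinEquiv ⟨s, f' s i⟩) {Z : V}
    (h : ∀ π : Fin n → Fin k, daySummand E π ⟶ Z) :
    toSummand E f ≫ h π = toSummand E f' ≫ h π' := by
  obtain rfl : π = π' := funext fun i => by
    have h1 := finSigmaFinEquiv.injective ((hf _ ⟨i, rfl⟩).symm.trans (hf' _ ⟨i, rfl⟩))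
    exact congrArg Sigma.fst h1
  obtain rfl : f = f' := funext fun s => Embedding.ext fun i => by
    have h1 := finSigmaFinEquiv.injective ((hf s i).symm.trans (hf' s i))
    simpa using h1
  rfl

lemma dayUnit_eq_toSummand {j : Fin k → ℕ} (x : Fin n ↪ Fin (∑ s, j s)) {π : Fin n → Fin k}
    (f : ∀ s, {i // π i = s} ↪ Fin (j s)) (hf : ∀ s i, x i.1 = finSigmaFinEquiv ⟨s, f s i⟩) :
    dayGen E.seq j ≫ (dayPow E.seq k).map (Quiver.Hom.op (X := (⟨n⟩ : Lam)) (Y := ⟨_⟩) x) =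
      toSummand E f ≫ dG E (IsPart.fibres π) := by
  have h := dG_res_id E (IsPart.fin j) (IsPart.fibres π) f x hf
  rwa [dG_fin] at h

/-- The values of the Day convolution power are the coproducts of the summands. -/
def dayCofanIsColimit (k n : ℕ) :
    IsColimit (Cofan.mk ((dayPow E.seq k).obj (op ⟨n⟩))
      fun π : Fin n → Fin k => (dG E (IsPart.fibres π) :)) := by
  have hx := fun g : CostructuredArrow (wedge k).op (op (⟨n⟩ : Lam)) =>
    exists_block (j := fun s => (g.left.unop s).n) g.hom.unop _ fun _ => rfl
  choose f hf using hx
  have key : ∀ g : CostructuredArrow (wedge k).op (op (⟨n⟩ : Lam)),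
      ((Functor.LeftExtension.mk (dayPow E.seq k) (dayUnit E.seq k)).coconeAt (op ⟨n⟩)).ι.app g =
        toSummand E (f g) ≫ dG E (IsPart.fibres _) := fun g =>
    dayUnit_eq_toSummand E (j := fun s => (g.left.unop s).n) g.hom.unop (f g) (hf g)
  refine Cofan.IsColimit.mk _ (fun s => (dayColimit E.seq k n).desc
    { pt := s.pt
      ι :=
      { app := fun g => toSummand E (f g) ≫ s.inj _
        naturality := fun g g' φ => ?_ } }) (fun s π => ?_) fun s m hm => ?_
  · have h1 : (extTensor E.seq k).map φ.left ≫ toSummand E (f g') =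
        toSummand E fun s => (f g' s).trans (Lam.emb (φ.left.unop s)) := by
      refine (tensMap_comp _ _ _).symm.trans (congrArg (fun z => tensMap z _) (funext fun s => ?_))
      exact res_comp (N := Fin (g.left.unop s).n) E.seq (f g' s) (Lam.emb (φ.left.unop s))
    refine (assoc _ _ _).symm.trans ((eq_whisker h1 _).trans
      (Eq.trans ?_ (comp_id _).symm))
    refine toSummand_unique E (j := fun s => (g.left.unop s).n) (x := Lam.emb g.hom.unop) _ _
      (fun s i => ?_) (hf g) s.inj
    have h2 : g.hom.unop = g'.hom.unop ≫ (wedge k).map φ.left.unop :=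
      congrArg Quiver.Hom.unop (CostructuredArrow.w φ).symm
    refine (DFunLike.congr_fun (F := _ ↪ _) h2 i.1).trans ?_
    exact (congrArg (Lam.emb ((wedge k).map φ.left.unop)) (hf g' s i)).trans
      (blockEmb_apply (j := fun s => (g'.left.unop s).n) (j' := fun s => (g.left.unop s).n) _ _ s _)
  · let g : CostructuredArrow (wedge k).op (op (⟨n⟩ : Lam)) :=
      CostructuredArrow.mk (Y := op fun s => (⟨Enum.n {i // π i = s}⟩ : Lam))
        (lamHom (IsPart.fibres π).equiv.symm.toEmbedding).op
    refine ((dayColimit E.seq k n).fac _ g).trans ?_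
    refine (toSummand_unique E (j := fun s => Enum.n {i // π i = s}) (x := Lam.emb g.hom.unop)
      (f g) (fun s => (Enum.e (S := {i // π i = s})).toEmbedding) (hf g) (fun s i => ?_) s.inj).trans ?_
    · refine (congrArg (Enum.e (S := Σ s, {i // π i = s})) ((IsPart.fibres π).equiv_symm s i)).trans ?_
      apply (Enum.e (S := Σ s, {i // π i = s})).symm.injective
      rw [Equiv.symm_apply_apply]
      refine Eq.trans ?_ (Enum.e_sigma_symm (T := fun s => {i // π i = s}) s (Enum.e i)).symm
      exact congrArg (Sigma.mk s) (Enum.e.symm_apply_apply i).symm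
    · have h1 : (toSummand E fun s => (Enum.e (S := {i // π i = s})).toEmbedding) = 𝟙 _ := by
        refine (congrArg (fun z => tensMap z (List.finRange k)) (funext fun s => ?_)).trans
          (tensMap_id _ _)
        have : lamHom (Enum.e (S := {i // π i = s})).toEmbedding = 𝟙 _ :=
          Embedding.ext fun q => Enum.e.apply_symm_apply q
        exact (congrArg (fun z => E.seq.map (Quiver.Hom.op z)) this).trans (E.seq.map_id _)
      exact (eq_whisker h1 _).trans (id_comp _)
  · refine (dayColimit E.seq k n).hom_ext fun g => ?_
    rw [(dayColimit E.seq k n).fac]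
    refine (eq_whisker (key g) m).trans ((assoc _ _ _).trans ?_)
    exact whisker_eq _ (hm _)

variable [TensorCocts V]

lemma day_hom_ext {W Z : V} {t t' : W ⊗ (dayPow E.seq k).obj (op ⟨n⟩) ⟶ Z}
    (h : ∀ π : Fin n → Fin k, (W ◁ dG E (S := Fin k) (N := Fin n) (IsPart.fibres π)) ≫ t =
      (W ◁ dG E (S := Fin k) (N := Fin n) (IsPart.fibres π)) ≫ t') : t = t' :=
  Cofan.IsColimit.hom_ext (isColimitCofanMkObjOfIsColimit (tensorLeft W) _ _
    (dayCofanIsColimit E k n)) _ _ h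

lemma exists_day_desc {W Z : V} (h : ∀ π : Fin n → Fin k, W ⊗ daySummand E π ⟶ Z) :
    ∃ t : W ⊗ (dayPow E.seq k).obj (op ⟨n⟩) ⟶ Z,
      ∀ π, (W ◁ dG E (S := Fin k) (N := Fin n) (IsPart.fibres π)) ≫ t = h π := by
  have hc := isColimitCofanMkObjOfIsColimit (tensorLeft W) _ _ (dayCofanIsColimit E k n)
  exact ⟨Cofan.IsColimit.desc hc h, fun π => Cofan.IsColimit.fac hc h π⟩

instance : Infinite (Σ k l : ℕ, Fin k ↪ Fin l) :=
  Infinite.of_injective (fun k : ℕ => (⟨k, k, Embedding.refl _⟩ : Σ k l : ℕ, Fin k ↪ Fin l))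
    fun _ _ h => congrArg Sigma.fst h

instance (X : V) : PreservesColimitsOfShape (Discrete (Σ k l : ℕ, Fin k ↪ Fin l)) (tensorLeft X) :=
  preservesColimitsOfShape_of_equiv (Discrete.equivalence
    (Classical.choice (nonempty_equiv_of_countable (α := ℕ)
      (β := Σ k l : ℕ, Fin k ↪ Fin l)))) (tensorLeft X)

lemma kelly_hom_ext' (D E : LambdaSeq V) {n : ℕ} {W Z : V}
    {t t' : W ⊗ (kellySeq D E).obj (op ⟨n⟩) ⟶ Z}
    (h : ∀ k, (W ◁ (kellyι D E k).app (op ⟨n⟩)) ≫ t = (W ◁ (kellyι D E k).app (op ⟨n⟩)) ≫ t') :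
    t = t' := by
  let G := (evaluation Lamᵒᵖ V).obj (op ⟨n⟩) ⋙ tensorLeft W
  refine Cofork.IsColimit.hom_ext (isColimitOfHasCoequalizerOfPreservesColimit G (kellyLeft D E)
    (kellyRight D E)) ?_
  refine Cofan.IsColimit.hom_ext (isColimitOfHasCoproductOfPreservesColimit G
    fun k : ℕ => kellyTerm D E k k) _ _ fun k => ?_
  have h1 := h k
  have h2 : W ◁ (kellyι D E k).app (op ⟨n⟩) = G.map (Sigma.ι (fun k : ℕ => kellyTerm D E k k) k) ≫
      G.map (coequalizer.π (kellyLeft D E) (kellyRight D E)) := (G.map_comp _ _)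
  rw [h2] at h1
  exact (assoc _ _ _).symm.trans (h1.trans (assoc _ _ _))

lemma exists_kelly_desc' (D E : LambdaSeq V) {n : ℕ} {W Z : V}
    (h : ∀ k, W ⊗ (kellyTerm D E k k).obj (op ⟨n⟩) ⟶ Z)
    (w : ∀ {k l : ℕ} (φ : Fin k ↪ Fin l), (W ◁ (kellyActLeft D E φ).app (op ⟨n⟩)) ≫ h k =
      (W ◁ (kellyActRight D E φ).app (op ⟨n⟩)) ≫ h l) :
    ∃ t : W ⊗ (kellySeq D E).obj (op ⟨n⟩) ⟶ Z, ∀ k,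
      (W ◁ (kellyι D E k).app (op ⟨n⟩)) ≫ t = h k := by
  let G := (evaluation Lamᵒᵖ V).obj (op ⟨n⟩) ⋙ tensorLeft W
  have hc := isColimitOfHasCoequalizerOfPreservesColimit G (kellyLeft D E) (kellyRight D E)
  have hg := isColimitOfHasCoproductOfPreservesColimit G fun k : ℕ => kellyTerm D E k k
  have hr := isColimitOfHasCoproductOfPreservesColimit G
    fun p : (Σ k l : ℕ, Fin k ↪ Fin l) => kellyTerm D E p.2.1 p.1
  let d : G.obj (∐ fun k : ℕ => kellyTerm D E k k) ⟶ Z := Cofan.IsColimit.desc hg h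
  have hd : ∀ k, G.map (Sigma.ι (fun k : ℕ => kellyTerm D E k k) k) ≫ d = h k :=
    fun k => Cofan.IsColimit.fac hg h k
  have e : G.map (kellyLeft D E) ≫ d = G.map (kellyRight D E) ≫ d := by
    refine Cofan.IsColimit.hom_ext hr _ _ fun p => ?_
    have e1 : Sigma.ι (fun p : (Σ k l : ℕ, Fin k ↪ Fin l) => kellyTerm D E p.2.1 p.1) p ≫
      kellyLeft D E = _ := Sigma.ι_desc _ _
    have e2 : Sigma.ι (fun p : (Σ k l : ℕ, Fin k ↪ Fin l) => kellyTerm D E p.2.1 p.1) p ≫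
      kellyRight D E = _ := Sigma.ι_desc _ _
    have e3 := congrArg G.map e1
    have e4 := congrArg G.map e2
    rw [G.map_comp, G.map_comp] at e3 e4
    refine (assoc _ _ _).symm.trans ((eq_whisker e3 d).trans ?_)
    refine Eq.trans ?_ ((eq_whisker e4 d).symm.trans (assoc _ _ _))
    rw [assoc, assoc, hd, hd]
    exact w p.2.2
  refine ⟨Cofork.IsColimit.desc hc d e, fun k => ?_⟩
  have h2 : W ◁ (kellyι D E k).app (op ⟨n⟩) = G.map (Sigma.ι (fun k : ℕ => kellyTerm D E k k) k) ≫
      G.map (coequalizer.π (kellyLeft D E) (kellyRight D E)) := (G.map_comp _ _)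
  rw [h2]
  refine (assoc _ _ _).trans (Eq.trans ?_ (hd k))
  exact whisker_eq _ (Cofork.IsColimit.π_desc' hc d e)

end UniversalProperty
section Cones

variable [SymmetricCategory V]

/-- A family of morphisms on the objects `W ⊗ (D S ⊗ ⨂ₛ E (T s))` for the partitions of `N` that is
compatible with the relations between the canonical maps to `(D ⊙ E) N`. -/
structure KellyCone (D E : LambdaSeq V) (N : Type) [Enum N] (W Z : V) where
  /-- The morphisms of the family. -/
  map : ∀ {S : Type} [Enum S] {T : S → Type} [∀ s, Enum (T s)] {r : ∀ s, T s → N} (hr : IsPart r),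
    W ⊗ (ev D.seq S ⊗ ut fun s => ev E.seq (T s)) ⟶ Z
  law : ∀ {S S' : Type} [Enum S] [Enum S'] {T : S → Type} [∀ s, Enum (T s)] {T' : S' → Type}
    [∀ s, Enum (T' s)] {r : ∀ s, T s → N} {r' : ∀ s, T' s → N} (hr : IsPart r) (hr' : IsPart r')
    (φ : S ↪ S') (f : ∀ s s', φ s = s' → (T' s' ↪ T s))
    (he : ∀ s', s' ∉ range φ → IsEmpty (T' s')),
    (∀ s s' h t', r' s' t' = r s (f s s' h t')) →
    (W ◁ (res D.seq φ ▷ ut fun s => ev E.seq (T s))) ≫ map hr =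
      (W ◁ (ev D.seq S' ◁ utRes E φ f he)) ≫ map hr'

/-- The restriction of the notion of a `KellyCone` to the partitions that are indexed by sets
`{1, …, k}`. -/
structure KellyConeFin (D E : LambdaSeq V) (N : Type) [Enum N] (W Z : V) where
  /-- The morphisms of the family. -/
  map : ∀ {k : ℕ} {T : Fin k → Type} [∀ s, Enum (T s)] {r : ∀ s, T s → N} (hr : IsPart r),
    W ⊗ (ev D.seq (Fin k) ⊗ ut fun s => ev E.seq (T s)) ⟶ Z
  law : ∀ {k l : ℕ} {T : Fin k → Type} [∀ s, Enum (T s)] {T' : Fin l → Type}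
    [∀ s, Enum (T' s)] {r : ∀ s, T s → N} {r' : ∀ s, T' s → N} (hr : IsPart r) (hr' : IsPart r')
    (φ : Fin k ↪ Fin l) (f : ∀ s s', φ s = s' → (T' s' ↪ T s))
    (he : ∀ s', s' ∉ range φ → IsEmpty (T' s')),
    (∀ s s' h t', r' s' t' = r s (f s s' h t')) →
    (W ◁ (res D.seq φ ▷ ut fun s => ev E.seq (T s))) ≫ map hr =
      (W ◁ (ev D.seq (Fin l) ◁ utRes E φ f he)) ≫ map hr'

/-- The restriction of a `KellyCone`. -/
def KellyCone.toFin {D E : LambdaSeq V} {N : Type} [Enum N] {W Z : V} (c : KellyCone D E N W Z) :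
    KellyConeFin D E N W Z where
  map hr := c.map hr
  law hr hr' φ f he h := c.law hr hr' φ f he h

lemma IsPart.fibresAt {S N : Type} [Enum S] [Enum N] (π : Fin (Enum.n N) → S) :
    IsPart fun s (i : {i // π i = s}) => (Enum.e.symm i.1 : N) := (IsPart.fibres π).comp Enum.e.symm

lemma IsPart.exists_fibre_emb {S N : Type} [Enum N] {T : S → Type} {r : ∀ s, T s → N}
    (hr : IsPart r) : ∃ (π : Fin (Enum.n N) → S) (f : ∀ s, {i // π i = s} ↪ T s),
      ∀ s i, Enum.e.symm i.1 = r s (f s i) := by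
  have h1 : ∀ s (i : {i : Fin (Enum.n N) // (hr.equiv.symm (Enum.e.symm i)).1 = s}),
      ∃ t, Enum.e.symm i.1 = r s t := by
    rintro _ ⟨i, rfl⟩
    exact ⟨_, (hr.equiv.apply_symm_apply _).symm⟩
  choose f hf using h1
  refine ⟨fun i => (hr.equiv.symm (Enum.e.symm i)).1, fun s => ⟨f s, fun i i' h => ?_⟩, hf⟩
  exact Subtype.ext (Enum.e.symm.injective (by rw [hf, hf, h]))

variable [HasColimits V]

lemma dG_comp_e {S N : Type} [Enum S] [Enum N] {T : S → Type} [∀ s, Enum (T s)]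
    (E : LambdaSeq V) {r : ∀ s, T s → N} (hr : IsPart r) {r' : ∀ s, T s → Fin (Enum.n N)}
    (hr' : IsPart r') (h : ∀ s t, Enum.e.symm (r' s t) = r s t) : dG E hr = dG E hr' := by
  have h : lamHom hr.equiv.symm.toEmbedding = lamHom hr'.equiv.symm.toEmbedding := by
    refine Embedding.ext fun q => ?_
    refine congrArg (Enum.e (S := Σ s, T s)) ?_
    obtain ⟨s, t, rfl⟩ := hr'.exists q
    refine Eq.trans ?_ (hr'.equiv_symm s t).symm
    refine Eq.trans ?_ (hr.equiv_symm s t)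
    exact congrArg hr.equiv.symm (h s t)
  exact congrArg (fun z : (⟨Enum.n N⟩ : Lam) ⟶ ⟨Enum.n (Σ s, T s)⟩ =>
    dayGen E.seq (fun q : Fin (Enum.n S) => Enum.n (T (Enum.e.symm q))) ≫
      (dayPow E.seq (Enum.n S)).map z.op) h

namespace KellyConeFin

variable {D E : LambdaSeq V} {N : Type} [Enum N] {W Z : V}

lemma map_relabel (c : KellyConeFin D E N W Z) {k : ℕ} {T T' : Fin k → Type}
    [∀ s, Enum (T s)] [∀ s, Enum (T' s)] {r : ∀ s, T s → N} {r' : ∀ s, T' s → N} (hr : IsPart r)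
    (hr' : IsPart r') (f : ∀ s, T' s ↪ T s) (h : ∀ s t, r' s t = r s (f s t)) :
    c.map hr = (W ◁ (_ ◁ utMap fun s => res E.seq (f s))) ≫ c.map hr' := by
  have h1 := c.law hr hr' (Embedding.refl (Fin k)) (fun s s' h =>
    (Equiv.cast (congrArg T' h.symm)).toEmbedding.trans (f s)) (fun t ht => absurd ⟨t, rfl⟩ ht)
    (by rintro s _ rfl t'; exact h s t')
  rw [utRes_refl, res_refl, id_whiskerRight, whiskerLeft_id, id_comp] at h1
  exact h1

end KellyConeFin

lemma res_e {S : Type} [Enum S] (G : Lamᵒᵖ ⥤ V) :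
    res G (Enum.e (S := S)).toEmbedding = 𝟙 (G.obj (op ⟨Enum.n S⟩)) := by
  have : lamHom (Enum.e (S := S)).toEmbedding = 𝟙 _ :=
    Embedding.ext fun q => Enum.e.apply_symm_apply q
  exact (congrArg (fun z => G.map (Quiver.Hom.op z)) this).trans (G.map_id _)

variable [TensorCocts V]
  {D E : LambdaSeq V} {N : Type} [Enum N] {W Z : V}

lemma Gen_hom_ext_whisker {t t' : W ⊗ ev (kelly D E).seq N ⟶ Z}
    (h : ∀ {k : ℕ} {T : Fin k → Type} [∀ s, Enum (T s)] {r : ∀ s, T s → N} (hr : IsPart r),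
      (W ◁ Gen D E hr) ≫ t = (W ◁ Gen D E hr) ≫ t') : t = t' := by
  refine kelly_hom_ext' D E fun k => ?_
  rw [← cancel_epi (α_ W (D.obj k) _).hom]
  refine day_hom_ext E fun π => ?_
  have h1 := h (IsPart.fibresAt π)
  rw [Gen, dG_comp_e E (IsPart.fibresAt π) (IsPart.fibres π) (fun _ _ => rfl)] at h1
  have aux : ∀ {A B C B' : V} {x : B ⟶ B'} {y : A ⊗ B' ⟶ C} {t t' : W ⊗ C ⟶ Z}
      (h : (W ◁ ((A ◁ x) ≫ y)) ≫ t = (W ◁ ((A ◁ x) ≫ y)) ≫ t'),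
      ((W ⊗ A) ◁ x) ≫ (α_ _ _ _).hom ≫ (W ◁ y) ≫ t =
        ((W ⊗ A) ◁ x) ≫ (α_ _ _ _).hom ≫ (W ◁ y) ≫ t' := by
    intros
    rename_i h
    simpa using h
  exact aux h1

theorem KellyConeFin.exists_desc (c : KellyConeFin D E N W Z) :
    ∃ t : W ⊗ ev (kelly D E).seq N ⟶ Z, ∀ {k : ℕ} {T : Fin k → Type} [∀ s, Enum (T s)]
      {r : ∀ s, T s → N} (hr : IsPart r), (W ◁ Gen D E hr) ≫ t = c.map hr := by
  have h1 := fun k : ℕ => exists_day_desc E (W := W ⊗ D.obj k) (Z := Z) (n := Enum.n N)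
    fun π : Fin (Enum.n N) → Fin k => (α_ _ _ _).hom ≫ c.map (IsPart.fibresAt π)
  choose t ht using h1
  have h2 : ∀ {k : ℕ} {T : Fin k → Type} [∀ s, Enum (T s)] {r : ∀ s, T s → N} (hr : IsPart r),
      ((W ⊗ D.obj k) ◁ dG E hr) ≫ t k = (α_ _ _ _).hom ≫ c.map hr := by
    intro k T _ r hr
    obtain ⟨π, f, hf⟩ := hr.exists_fibre_emb
    rw [c.map_relabel hr (IsPart.fibresAt π) f hf]
    have h3 := dG_res_id E hr (IsPart.fibresAt π) f (Embedding.refl N) hf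
    rw [res_refl, comp_id] at h3
    have h4 := ht k π
    rw [← dG_comp_e E (IsPart.fibresAt π) (IsPart.fibres π) (fun _ _ => rfl)] at h4
    rw [h3, whiskerLeft_comp, assoc]
    refine (whisker_eq _ h4).trans ?_
    exact associator_naturality_right_assoc _ _ _ _
  obtain ⟨g, hg⟩ := exists_kelly_desc' D E (n := Enum.n N) (W := W) (Z := Z)
    (fun k => (α_ _ _ _).inv ≫ t k) (by
      intro k l φ
      rw [← cancel_epi (α_ W (D.obj l) _).hom]
      refine day_hom_ext E fun π => ?_
      have h5 := dG_res E (IsPart.fibresAt π) (IsPart.fibresAt (fun i => φ (π i))) φ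
        (fun s s' h => ⟨fun i => ⟨i.1, φ.injective (i.2.trans h.symm)⟩, fun i i' h =>
          Subtype.ext (congrArg (fun x => x.1) h :)⟩)
        (fun s' h => ⟨fun i => h ⟨_, i.2⟩⟩) (Embedding.refl N) (fun s s' h t' => rfl)
      have h6 := c.law (IsPart.fibresAt π) (IsPart.fibresAt (fun i => φ (π i))) φ
        (fun s s' h => ⟨fun i => ⟨i.1, φ.injective (i.2.trans h.symm)⟩, fun i i' h =>
          Subtype.ext (congrArg (fun x => x.1) h :)⟩)
        (fun s' h => ⟨fun i => h ⟨_, i.2⟩⟩) (fun s s' h t' => rfl)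
      have h7 := h2 (IsPart.fibresAt π)
      have h8 := h2 (IsPart.fibresAt (fun i => φ (π i)))
      rw [res_refl, comp_id] at h5
      rw [dG_comp_e E (IsPart.fibresAt π) (IsPart.fibres π) (fun _ _ => rfl)] at h5 h7
      have aux : ∀ {A A' X X' Y Y' : V} {x : X ⟶ Y} {a : A ⟶ A'} {b : Y ⟶ Y'} {x' : X' ⟶ Y'}
          {u : X ⟶ X'} {m : W ⊗ (A' ⊗ X) ⟶ Z} {m' : W ⊗ (A ⊗ X') ⟶ Z} {t : (W ⊗ A') ⊗ Y ⟶ Z}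
          {t' : (W ⊗ A) ⊗ Y' ⟶ Z} (h5 : x ≫ b = u ≫ x')
          (h6 : (W ◁ (a ▷ X)) ≫ m = (W ◁ (A ◁ u)) ≫ m')
          (h7 : ((W ⊗ A') ◁ x) ≫ t = (α_ _ _ _).hom ≫ m)
          (h8 : ((W ⊗ A) ◁ x') ≫ t' = (α_ _ _ _).hom ≫ m'),
          ((W ⊗ A) ◁ x) ≫ (α_ _ _ _).hom ≫ (W ◁ (a ▷ Y)) ≫ (α_ _ _ _).inv ≫ t =
          ((W ⊗ A) ◁ x) ≫ (α_ _ _ _).hom ≫ (W ◁ (A ◁ b)) ≫ (α_ _ _ _).inv ≫ t' := by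
        intros
        rename_i h5 h6 h7 h8
        have e1 : ∀ {A A' Y : V} (a : A ⟶ A'), (α_ W A Y).hom ≫ (W ◁ (a ▷ Y)) ≫ (α_ _ _ _).inv =
          (W ◁ a) ▷ Y := by intros; simp
        have e2 : ∀ {A Y Y' : V} (b : Y ⟶ Y'), (α_ W A Y).hom ≫ (W ◁ (A ◁ b)) ≫ (α_ _ _ _).inv =
          (W ⊗ A) ◁ b := by intros; simp
        rw [reassoc_of% e1, reassoc_of% e2, ← whiskerLeft_comp_assoc, h5, whiskerLeft_comp_assoc,
          h8, whisker_exchange_assoc, h7, associator_naturality_middle_assoc, h6]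
        simp
      exact aux h5 h6 h7 h8)
  refine ⟨g, fun {k} {T} _ {r} hr => ?_⟩
  have aux : ∀ {A X Y Y' : V} {x : X ⟶ Y} {y : A ⊗ Y ⟶ Y'} {g : W ⊗ Y' ⟶ Z} {t : (W ⊗ A) ⊗ Y ⟶ Z}
      {m : W ⊗ (A ⊗ X) ⟶ Z} (h : (W ◁ y) ≫ g = (α_ _ _ _).inv ≫ t)
      (h' : ((W ⊗ A) ◁ x) ≫ t = (α_ _ _ _).hom ≫ m), (W ◁ ((A ◁ x) ≫ y)) ≫ g = m := by
    intros
    rename_i h h'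
    rw [whiskerLeft_comp, assoc, h, ← cancel_epi (α_ _ _ _).hom, ← h']
    simp
  exact aux (hg k) (h2 hr)

theorem KellyCone.exists_desc (c : KellyCone D E N W Z) :
    ∃ t : W ⊗ ev (kelly D E).seq N ⟶ Z, ∀ {S : Type} [Enum S] {T : S → Type} [∀ s, Enum (T s)]
      {r : ∀ s, T s → N} (hr : IsPart r), (W ◁ Gen D E hr) ≫ t = c.map hr := by
  obtain ⟨g, h3⟩ := c.toFin.exists_desc
  refine ⟨g, fun {S} _ {T} _ {r} hr => ?_⟩
  have hr' : IsPart fun (q : Fin (Enum.n S)) (t : T (Enum.e.symm q)) => r (Enum.e.symm q) t := by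
    refine ⟨?_, fun n => ?_⟩
    · rintro ⟨q, t⟩ ⟨q', t'⟩ h
      have := @hr.1 ⟨_, t⟩ ⟨_, t'⟩ h
      obtain ⟨h1, h2⟩ := Sigma.mk.inj_iff.1 this
      obtain rfl := Enum.e.symm.injective h1
      rw [eq_of_heq h2]
    · obtain ⟨s, t, rfl⟩ := hr.exists n
      obtain ⟨q, rfl⟩ := Enum.e.symm.surjective s
      exact ⟨⟨q, t⟩, rfl⟩
  let f : ∀ (s : S) (q : Fin (Enum.n S)), (Enum.e (S := S)).toEmbedding s = q →
      (T (Enum.e.symm q) ↪ T s) :=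
    fun s q h => (Equiv.cast (congrArg T (by rw [← h]; exact Enum.e.symm_apply_apply s))).toEmbedding
  have hf : ∀ s q h t, r (Enum.e.symm q) t = r s (f s q h t) := by
    intro s q h t
    have : ∀ s' (h : s' = s) (t : T s'), r s' t = r s (Equiv.cast (congrArg T h) t) := by
      rintro _ rfl t; rfl
    exact this _ (by rw [← h]; exact Enum.e.symm_apply_apply s) t
  have he : ∀ q, q ∉ range (Enum.e (S := S)).toEmbedding → IsEmpty (T (Enum.e.symm q)) :=
    fun q hq => absurd ⟨Enum.e.symm q, Enum.e.apply_symm_apply q⟩ hq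
  have e1 := Gen_res D E hr hr' (Enum.e (S := S)).toEmbedding f he (Embedding.refl N) hf
  have e2 := c.law hr hr' (Enum.e (S := S)).toEmbedding f he hf
  have aux : ∀ {A X X' Y : V} {a : A ⟶ A} (h : a = 𝟙 _) {x : A ⊗ X ⟶ Y} {y : Y ⟶ Y} (h' : y = 𝟙 _)
      {u : X ⟶ X'} {x' : A ⊗ X' ⟶ Y} (e1 : (a ▷ X) ≫ x ≫ y = (A ◁ u) ≫ x')
      {m : W ⊗ (A ⊗ X) ⟶ Z} {m' : W ⊗ (A ⊗ X') ⟶ Z} (e2 : (W ◁ (a ▷ X)) ≫ m = (W ◁ (A ◁ u)) ≫ m')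
      {g : W ⊗ Y ⟶ Z} (e3 : (W ◁ x') ≫ g = m'), (W ◁ x) ≫ g = m := by
    rintro A X X' Y _ rfl x _ rfl u x' e1 m m' e2 g e3
    simp only [id_whiskerRight, id_comp, comp_id, whiskerLeft_id] at e1 e2
    rw [e1, e2, ← e3, whiskerLeft_comp, assoc]
  exact aux (res_e D.seq) (res_refl _) e1 e2 (h3 hr')

end Cones
section Presentations

/-- A presentation of `Q` by generators and relations that is preserved by tensor products. -/
structure Pres (Q : V) where
  /-- The index type of the generators. -/
  A : Type 1
  /-- The generating objects. -/
  X : A → V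
  /-- The maps from the generating objects. -/
  g : ∀ a, X a ⟶ Q
  /-- The relations. -/
  Rel : ∀ (a b : A) {Y : V}, (Y ⟶ X a) → (Y ⟶ X b) → Prop
  refl : ∀ a, Rel a a (𝟙 (X a)) (𝟙 (X a))
  hom_ext : ∀ {W Z : V} {t t' : W ⊗ Q ⟶ Z}, (∀ a, (W ◁ g a) ≫ t = (W ◁ g a) ≫ t') → t = t'
  exists_desc : ∀ {W Z : V} (h : ∀ a, W ⊗ X a ⟶ Z),
    (∀ {a b Y} (y : Y ⟶ X a) (y' : Y ⟶ X b), Rel a b y y' → (W ◁ y) ≫ h a = (W ◁ y') ≫ h b) →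
    ∃ t : W ⊗ Q ⟶ Z, ∀ a, (W ◁ g a) ≫ t = h a

/-- `X 1 ⊗ ⋯ ⊗ X k`, defined by recursion on `k`. -/
def ftens : ∀ {k : ℕ}, (Fin k → V) → V
  | 0, _ => 𝟙_ V
  | _ + 1, X => X 0 ⊗ ftens fun s => X s.succ

/-- Functoriality of `ftens`. -/
def ftensMap : ∀ {k : ℕ} {X Y : Fin k → V}, (∀ s, X s ⟶ Y s) → (ftens X ⟶ ftens Y)
  | 0, _, _, _ => 𝟙 _
  | _ + 1, _, _, f => f 0 ⊗ₘ ftensMap fun s => f s.succ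

lemma ftensMap_id : ∀ {k : ℕ} (X : Fin k → V), (ftensMap fun s => 𝟙 (X s)) = 𝟙 (ftens X)
  | 0, _ => rfl
  | _ + 1, X => (congrArg (𝟙 _ ⊗ₘ ·) (ftensMap_id fun s => X (Fin.succ s))).trans
    (id_tensorHom_id _ _)

/-- The comparison of the two definitions of tensor products of finite families. -/
def ftensIso : ∀ {k : ℕ} (X : Fin k → V), finTensor X ≅ ftens X
  | 0, _ => Iso.refl _
  | k + 1, X => eqToIso (congrArg (tens X) (List.finRange_succ (n := k))) ≪≫
    whiskerLeftIso (X 0) ((tensRelabel X Fin.succ (List.finRange k)).symm ≪≫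
      ftensIso fun s => X s.succ)

lemma ftensIso_naturality : ∀ {k : ℕ} {X Y : Fin k → V} (f : ∀ s, X s ⟶ Y s),
    finTensorMap f ≫ (ftensIso Y).hom = (ftensIso X).hom ≫ ftensMap f
  | 0, _, _, _ => rfl
  | k + 1, X, Y, f => by
    have h1 := tensMap_eqToHom f (List.finRange_succ (n := k))
    have h2 := tensRelabel_naturality f Fin.succ (List.finRange k)
    have h3 := ftensIso_naturality fun s : Fin k => f s.succ
    have h4 : tensMap f (List.map Fin.succ (List.finRange k)) ≫
        (tensRelabel Y Fin.succ (List.finRange k)).inv =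
        (tensRelabel X Fin.succ (List.finRange k)).inv ≫ tensMap (fun s : Fin k => f s.succ) (List.finRange k) := by
      rw [Iso.comp_inv_eq, assoc, h2, Iso.inv_hom_id_assoc]
    have aux : ∀ {A A' B B' C C' D D' E E' : V} {x : A ⟶ A'} {e : A ⟶ B ⊗ C} {e' : A' ⟶ B' ⊗ C'}
        {b : B ⟶ B'} {c : C ⟶ C'} {i : C ⟶ D} {i' : C' ⟶ D'} {d : D ⟶ D'} {j : D ⟶ E} {j' : D' ⟶ E'}
        {f : E ⟶ E'} (h1 : e ≫ (b ⊗ₘ c) = x ≫ e') (h4 : c ≫ i' = i ≫ d) (h3 : d ≫ j' = j ≫ f),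
        x ≫ e' ≫ (B' ◁ (i' ≫ j')) = (e ≫ (B ◁ (i ≫ j))) ≫ (b ⊗ₘ f) := by
      intros
      rename_i h1 h4 h3
      rw [← reassoc_of% h1, assoc, ← id_tensorHom, ← id_tensorHom, tensorHom_comp_tensorHom,
        tensorHom_comp_tensorHom, reassoc_of% h4, h3, comp_id, id_comp,
        assoc]
    exact aux h1 h4 h3

variable [SymmetricCategory V]

/-- `W ⊗ (Q ⊗ R) ≅ (W ⊗ R) ⊗ Q` -/
def moveRight (W Q R : V) : W ⊗ (Q ⊗ R) ≅ (W ⊗ R) ⊗ Q :=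
  whiskerLeftIso W (β_ Q R) ≪≫ (α_ W R Q).symm

lemma moveRight_naturality (W R : V) {Q Q' : V} (q : Q ⟶ Q') :
    (W ◁ (q ▷ R)) ≫ (moveRight W Q' R).hom = (moveRight W Q R).hom ≫ ((W ⊗ R) ◁ q) := by
  simp only [moveRight, Iso.trans_hom, whiskerLeftIso_hom, Iso.symm_hom, assoc]
  rw [← whiskerLeft_comp_assoc, BraidedCategory.braiding_naturality_left, whiskerLeft_comp_assoc,
    associator_inv_naturality_right]

lemma moveRight_inv_naturality (W R : V) {Q Q' : V} (q : Q ⟶ Q') :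
    ((W ⊗ R) ◁ q) ≫ (moveRight W Q' R).inv = (moveRight W Q R).inv ≫ (W ◁ (q ▷ R)) := by
  rw [Iso.comp_inv_eq, assoc, moveRight_naturality, Iso.inv_hom_id_assoc]

namespace Pres

lemma hom_ext_right {Q : V} (P : Pres Q) {W R Z : V} {t t' : W ⊗ (Q ⊗ R) ⟶ Z}
    (h : ∀ a, (W ◁ (P.g a ▷ R)) ≫ t = (W ◁ (P.g a ▷ R)) ≫ t') : t = t' := by
  rw [← cancel_epi (moveRight W Q R).inv]
  refine P.hom_ext fun a => ?_
  rw [← assoc, moveRight_inv_naturality, assoc, h, ← assoc,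
    ← moveRight_inv_naturality, assoc]

lemma exists_desc_right {Q : V} (P : Pres Q) {W R Z : V} (h : ∀ a, W ⊗ (P.X a ⊗ R) ⟶ Z)
    (w : ∀ {a b Y} (y : Y ⟶ P.X a) (y' : Y ⟶ P.X b), P.Rel a b y y' →
      (W ◁ (y ▷ R)) ≫ h a = (W ◁ (y' ▷ R)) ≫ h b) :
    ∃ t : W ⊗ (Q ⊗ R) ⟶ Z, ∀ a, (W ◁ (P.g a ▷ R)) ≫ t = h a := by
  obtain ⟨t, ht⟩ := P.exists_desc (W := W ⊗ R) (fun a => (moveRight W (P.X a) R).inv ≫ h a)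
    fun y y' hy => by
      rw [← assoc, moveRight_inv_naturality, assoc, w y y' hy, ← assoc,
        ← moveRight_inv_naturality, assoc]
  refine ⟨(moveRight W Q R).hom ≫ t, fun a => ?_⟩
  rw [← assoc, moveRight_naturality, assoc, ht, Iso.hom_inv_id_assoc]

lemma ftens_hom_ext : ∀ {k : ℕ} {Q : Fin k → V} (P : ∀ s, Pres (Q s)) {W Z : V}
    {t t' : W ⊗ ftens Q ⟶ Z}, (∀ a : ∀ s, (P s).A, (W ◁ ftensMap fun s => (P s).g (a s)) ≫ t =
      (W ◁ ftensMap fun s => (P s).g (a s)) ≫ t') → t = t'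
  | 0, _, _, W, _, t, t', h => by
    have := h fun s => s.elim0
    have aux : ∀ {X Y : V} {d : X ⟶ X} {t t' : W ⊗ X ⟶ Y} (hd : d = 𝟙 _)
        (h : (W ◁ d) ≫ t = (W ◁ d) ≫ t'), t = t' := by
      rintro X Y _ t t' rfl h
      simpa using h
    exact aux rfl this
  | k + 1, Q, P, W, Z, t, t', h => by
    refine (P 0).hom_ext_right fun a => ?_
    rw [← cancel_epi (α_ _ _ _).hom]
    refine ftens_hom_ext (fun s => P s.succ) fun a' => ?_
    have h1 := h (Fin.cons a a')
    have aux : ∀ {X Q₀ R R' : V} {x : X ⟶ Q₀} {y : R' ⟶ R} {t t' : W ⊗ (Q₀ ⊗ R) ⟶ Z}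
        (h1 : (W ◁ (x ⊗ₘ y)) ≫ t = (W ◁ (x ⊗ₘ y)) ≫ t'),
        ((W ⊗ X) ◁ y) ≫ (α_ _ _ _).hom ≫ (W ◁ (x ▷ R)) ≫ t =
          ((W ⊗ X) ◁ y) ≫ (α_ _ _ _).hom ≫ (W ◁ (x ▷ R)) ≫ t' := by
      intros
      rename_i h1
      rw [MonoidalCategory.tensorHom_def'] at h1
      simpa using h1
    exact aux h1

lemma exists_ftens_desc : ∀ {k : ℕ} {Q : Fin k → V} (P : ∀ s, Pres (Q s)) {W Z : V}
    (h : ∀ a : ∀ s, (P s).A, W ⊗ ftens (fun s => (P s).X (a s)) ⟶ Z),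
    (∀ (a b : ∀ s, (P s).A) (Y : Fin k → V) (y : ∀ s, Y s ⟶ (P s).X (a s))
      (y' : ∀ s, Y s ⟶ (P s).X (b s)), (∀ s, (P s).Rel (a s) (b s) (y s) (y' s)) →
      (W ◁ ftensMap y) ≫ h a = (W ◁ ftensMap y') ≫ h b) →
    ∃ t : W ⊗ ftens Q ⟶ Z, ∀ a : ∀ s, (P s).A, (W ◁ ftensMap fun s => (P s).g (a s)) ≫ t = h a
  | 0, Q, P, W, Z, h, w => by
    refine ⟨h fun s => s.elim0, fun a => ?_⟩
    have aux : ∀ {X : V} {d : X ⟶ X} {t : W ⊗ X ⟶ Z} (hd : d = 𝟙 _), (W ◁ d) ≫ t = t := by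
      rintro X _ t rfl
      simp
    obtain rfl : (fun s => s.elim0) = a := funext fun s => s.elim0
    exact aux (X := 𝟙_ V) rfl
  | k + 1, Q, P, W, Z, h, w => by
    let R := ftens fun s : Fin k => Q s.succ
    have ih := fun a : (P 0).A => exists_ftens_desc (fun s => P s.succ) (W := W ⊗ (P 0).X a) (Z := Z)
      (fun a' => (α_ _ _ _).hom ≫ h (Fin.cons a a')) (fun a' b' Y y y' hy => by
        have h1 := w (Fin.cons a a') (Fin.cons a b') (Fin.cons ((P 0).X a) Y)
          (Fin.cons (𝟙 ((P 0).X a)) y) (Fin.cons (𝟙 ((P 0).X a)) y') (Fin.cases ((P 0).refl a) hy)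
        have aux : ∀ {X B B' C : V} {u : X ⟶ X} {y : C ⟶ B} {y' : C ⟶ B'} {p : W ⊗ (X ⊗ B) ⟶ Z}
            {p' : W ⊗ (X ⊗ B') ⟶ Z} (hu : u = 𝟙 _) (h1 : (W ◁ (u ⊗ₘ y)) ≫ p = (W ◁ (u ⊗ₘ y')) ≫ p'),
            ((W ⊗ X) ◁ y) ≫ (α_ _ _ _).hom ≫ p = ((W ⊗ X) ◁ y') ≫ (α_ _ _ _).hom ≫ p' := by
          rintro X B B' C _ y y' p p' rfl h1
          simpa using h1
        exact aux rfl h1)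
    choose t ht using ih
    obtain ⟨g, hg⟩ := (P 0).exists_desc_right (W := W) (R := R) (Z := Z)
      (fun a => (α_ _ _ _).inv ≫ t a) (fun {a b Y} y y' hy => by
        rw [← cancel_epi (α_ _ _ _).hom]
        refine ftens_hom_ext (fun s => P s.succ) fun a' => ?_
        have h1 := w (Fin.cons a a') (Fin.cons b a') (Fin.cons Y fun s => (P s.succ).X (a' s))
          (Fin.cons y fun s => 𝟙 _) (Fin.cons y' fun s => 𝟙 _)
          (Fin.cases hy fun s => (P s.succ).refl (a' s))
        have hid : (ftensMap fun s => 𝟙 ((P (Fin.succ s)).X (a' s))) = 𝟙 _ := ftensMap_id _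
        have aux : ∀ {X X' C R' : V} {y : Y ⟶ X} {y' : Y ⟶ X'} {u : R' ⟶ R'} {x : R' ⟶ R}
            {p : W ⊗ (X ⊗ R') ⟶ Z} {p' : W ⊗ (X' ⊗ R') ⟶ Z} {t : (W ⊗ X) ⊗ R ⟶ Z}
            {t' : (W ⊗ X') ⊗ R ⟶ Z} (hu : u = 𝟙 _)
            (h1 : (W ◁ (y ⊗ₘ u)) ≫ p = (W ◁ (y' ⊗ₘ u)) ≫ p')
            (h2 : ((W ⊗ X) ◁ x) ≫ t = (α_ _ _ _).hom ≫ p)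
            (h3 : ((W ⊗ X') ◁ x) ≫ t' = (α_ _ _ _).hom ≫ p'),
            ((W ⊗ Y) ◁ x) ≫ (α_ _ _ _).hom ≫ (W ◁ (y ▷ R)) ≫ (α_ _ _ _).inv ≫ t =
              ((W ⊗ Y) ◁ x) ≫ (α_ _ _ _).hom ≫ (W ◁ (y' ▷ R)) ≫ (α_ _ _ _).inv ≫ t' := by
          rintro X X' C R' y y' _ x p p' t t' rfl h1 h2 h3
          have e1 : ∀ {X : V} (y : Y ⟶ X), (α_ W Y R).hom ≫ (W ◁ (y ▷ R)) ≫ (α_ _ _ _).inv =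
            (W ◁ y) ▷ R := by intros; simp
          rw [reassoc_of% e1, reassoc_of% e1, whisker_exchange_assoc, h2,
            whisker_exchange_assoc, h3]
          simpa using h1
        exact aux (C := Y) hid h1 (ht a a') (ht b a'))
    refine ⟨g, fun a => ?_⟩
    have h1 := ht (a 0) fun s => a s.succ
    have h2 := hg (a 0)
    have ha : Fin.cons (a 0) (fun s => a s.succ) = a := Fin.cons_self_tail a
    have aux : ∀ {X Q₀ R' : V} {x : X ⟶ Q₀} {r : R' ⟶ R} {g : W ⊗ (Q₀ ⊗ R) ⟶ Z}
        {t : (W ⊗ X) ⊗ R ⟶ Z} {p : W ⊗ (X ⊗ R') ⟶ Z} (h1 : ((W ⊗ X) ◁ r) ≫ t = (α_ _ _ _).hom ≫ p)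
        (h2 : (W ◁ (x ▷ R)) ≫ g = (α_ _ _ _).inv ≫ t), (W ◁ (x ⊗ₘ r)) ≫ g = p := by
      intros
      rename_i h1 h2
      rw [MonoidalCategory.tensorHom_def', whiskerLeft_comp, assoc, h2,
        ← cancel_epi (α_ _ _ _).hom, ← h1]
      simp
    have key : ∀ b (hb : b = a), (W ◁ ftensMap fun s => (P s).g (b s)) ≫ g = h b →
        (W ◁ ftensMap fun s => (P s).g (a s)) ≫ g = h a := by
      rintro _ rfl h
      exact h
    exact key _ ha (aux h1 h2)

lemma finTensor_hom_ext {k : ℕ} {Q : Fin k → V} (P : ∀ s, Pres (Q s)) {W Z : V}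
    {t t' : W ⊗ finTensor Q ⟶ Z} (h : ∀ a : ∀ s, (P s).A,
      (W ◁ finTensorMap fun s => (P s).g (a s)) ≫ t =
      (W ◁ finTensorMap fun s => (P s).g (a s)) ≫ t') : t = t' := by
  rw [← cancel_epi (W ◁ (ftensIso Q).inv)]
  refine ftens_hom_ext P fun a => ?_
  have h1 := ftensIso_naturality fun s => (P s).g (a s)
  have aux : ∀ {X X' Y Y' : V} {i : X ≅ X'} {j : Y ≅ Y'} {x : X ⟶ Y} {x' : X' ⟶ Y'}
      {t t' : W ⊗ Y ⟶ Z} (h1 : x ≫ j.hom = i.hom ≫ x') (h2 : (W ◁ x) ≫ t = (W ◁ x) ≫ t'),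
      (W ◁ x') ≫ (W ◁ j.inv) ≫ t = (W ◁ x') ≫ (W ◁ j.inv) ≫ t' := by
    intros
    rename_i i j x x' t t' h1 h2
    have h3 : x' ≫ j.inv = i.inv ≫ x := by rw [Iso.comp_inv_eq, assoc, h1,
      Iso.inv_hom_id_assoc]
    rw [← whiskerLeft_comp_assoc, ← whiskerLeft_comp_assoc, h3, whiskerLeft_comp_assoc, h2,
      whiskerLeft_comp_assoc]
  exact aux h1 (h a)

lemma exists_finTensor_desc {k : ℕ} {Q : Fin k → V} (P : ∀ s, Pres (Q s)) {W Z : V}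
    (h : ∀ a : ∀ s, (P s).A, W ⊗ finTensor (fun s => (P s).X (a s)) ⟶ Z)
    (w : ∀ (a b : ∀ s, (P s).A) (Y : Fin k → V) (y : ∀ s, Y s ⟶ (P s).X (a s))
      (y' : ∀ s, Y s ⟶ (P s).X (b s)), (∀ s, (P s).Rel (a s) (b s) (y s) (y' s)) →
      (W ◁ finTensorMap y) ≫ h a = (W ◁ finTensorMap y') ≫ h b) :
    ∃ t : W ⊗ finTensor Q ⟶ Z,
      ∀ a : ∀ s, (P s).A, (W ◁ finTensorMap fun s => (P s).g (a s)) ≫ t = h a := by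
  have hinv : ∀ {X Y : Fin k → V} (f : ∀ s, X s ⟶ Y s),
      ftensMap f ≫ (ftensIso Y).inv = (ftensIso X).inv ≫ finTensorMap f := fun f => by
    rw [Iso.comp_inv_eq, assoc, ftensIso_naturality, Iso.inv_hom_id_assoc]
  obtain ⟨t, ht⟩ := exists_ftens_desc P (fun a => (W ◁ (ftensIso _).inv) ≫ h a)
    fun a b Y y y' hy => by
      rw [← whiskerLeft_comp_assoc, ← whiskerLeft_comp_assoc, hinv, hinv, whiskerLeft_comp_assoc,
        w a b Y y y' hy, whiskerLeft_comp_assoc]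
  refine ⟨(W ◁ (ftensIso Q).hom) ≫ t, fun a => ?_⟩
  rw [← whiskerLeft_comp_assoc, ftensIso_naturality, whiskerLeft_comp_assoc, ht,
    ← whiskerLeft_comp_assoc, Iso.hom_inv_id, whiskerLeft_id, id_comp]

end Pres
end Presentations
section Calculus

variable [SymmetricCategory V]
  {S S' S'' N N' M : Type} [Enum S] [Enum S'] [Enum S''] [Enum N] [Enum N'] [Enum M]
  {T : S → Type} [∀ s, Enum (T s)] {T' : S' → Type} [∀ s, Enum (T' s)]
  {T'' : S'' → Type} [∀ s, Enum (T'' s)] {r : ∀ s, T s → N} {r' : ∀ s, T' s → N'}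

lemma utUnits_utSp {φ : S ↪ S'} {A : S → V} {B : S' → V} {u : ∀ s, 𝟙_ V ⟶ A s}
    {c : ∀ s t, φ s = t → (A s ⟶ B t)} {u' : ∀ t, t ∉ range φ → (𝟙_ V ⟶ B t)}
    {v : ∀ t, 𝟙_ V ⟶ B t} (h : ∀ s t h, u s ≫ c s t h = v t) (h' : ∀ t ht, u' t ht = v t) :
    utUnits u ≫ utSp φ c u' = utUnits v := by
  have h1 : ∀ (l : List (Fin (Enum.n S))),
      tensUnits (fun q => u (Enum.e.symm q)) l ≫ tensMap (fun q => c (Enum.e.symm q) _ rfl) l =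
        tensUnits (fun q => v (φ (Enum.e.symm q))) l := by
    intro l
    induction l with
    | nil => exact comp_id _
    | cons a l ih =>
      rw [tensUnits, tensMap, assoc, tensorHom_comp_tensorHom, ih, h]
      rfl
  obtain rfl : u' = fun t _ => v t := by funext t ht; exact h' t ht
  have hs : Sep fun t : S' => [t] := sep_singleton Function.injective_id
  have h2 : utUnits (fun s => v (φ s)) ≫ utSpread φ B (fun t _ => v t) = utUnits v :=
    IsCan.unique (P := fun _ => True) (f := fun t _ => v t)
      ((IsCan.utUnits (a := fun s => canAtom B (φ s)) (sep_singleton φ.injective)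
        fun s => IsCan.atom (f := fun t _ => v t) (φ s) trivial).comp
        (IsCan.utSpread φ (a := fun s => canAtom B s) hs _ fun t _ => IsCan.atom t trivial))
      (IsCan.utUnits (a := fun s => canAtom B s) hs
        fun s => IsCan.atom (f := fun t _ => v t) s trivial)
  exact (assoc _ _ _).symm.trans ((eq_whisker (h1 _) _).trans h2)

lemma utRes_congr (E : LambdaSeq V) {φ φ' : S ↪ S'} {f : ∀ s s', φ s = s' → (T' s' ↪ T s)}
    {f' : ∀ s s', φ' s = s' → (T' s' ↪ T s)} (he : ∀ s', s' ∉ range φ → IsEmpty (T' s'))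
    (he' : ∀ s', s' ∉ range φ' → IsEmpty (T' s')) (hφ : ∀ s, φ s = φ' s)
    (hf : ∀ s s' h h' t, f s s' h t = f' s s' h' t) : utRes E φ f he = utRes E φ' f' he' :=
  utSp_congr (Embedding.ext hφ) (fun s s' h h' => res_congr _ (hf s s' h h'))
    (fun _ _ _ => rfl)

lemma utRes_comp (E : LambdaSeq V) {φ : S ↪ S'} {φ' : S' ↪ S''} {φ'' : S ↪ S''}
    {f : ∀ s s', φ s = s' → (T' s' ↪ T s)} {f' : ∀ s s', φ' s = s' → (T'' s' ↪ T' s)}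
    {f'' : ∀ s s', φ'' s = s' → (T'' s' ↪ T s)} (he : ∀ s', s' ∉ range φ → IsEmpty (T' s'))
    (he' : ∀ s', s' ∉ range φ' → IsEmpty (T'' s'))
    (he'' : ∀ s', s' ∉ range φ'' → IsEmpty (T'' s')) (hφ : ∀ s, φ' (φ s) = φ'' s)
    (hf : ∀ s s' s'' h h' h'' t, f s s' h (f' s' s'' h' t) = f'' s s'' h'' t) :
    utRes E φ f he ≫ utRes E φ' f' he' = utRes E φ'' f'' he'' :=
  utSp_comp hφ (fun s t r h h' h'' => res_comp' _ (hf s t r h h' h''))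
    (fun t r h h' h'' => bs_res _ _ _ _) fun _ _ _ => rfl

lemma utRes_id (E : LambdaSeq V) {T₁ : S → Type} [∀ s, Enum (T₁ s)] (φ : S ↪ S)
    (f : ∀ s s', φ s = s' → (T₁ s' ↪ T₁ s)) (he : ∀ s', s' ∉ range φ → IsEmpty (T₁ s'))
    (hφ : ∀ s, φ s = s) (hf : ∀ s h t, f s s h t = t) : utRes E φ f he = 𝟙 _ := by
  obtain rfl : φ = Embedding.refl S := Embedding.ext hφ
  rw [utRes_refl, ← utMap_id]
  exact congrArg (fun z => utMap z) (funext fun s => res_refl' _ (hf s rfl))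

lemma utRes_naturality {E E' : LambdaSeq V} (g : E ⟶ E') (φ : S ↪ S')
    (f : ∀ s s', φ s = s' → (T' s' ↪ T s)) (he : ∀ s', s' ∉ range φ → IsEmpty (T' s')) :
    utRes E φ f he ≫ (utMap fun s => g.hom.app (op ⟨Enum.n (T' s)⟩)) =
      (utMap fun s => g.hom.app (op ⟨Enum.n (T s)⟩)) ≫ utRes E' φ f he := by
  refine (utSp_utMap _ _ _ _).trans (Eq.trans ?_ (utMap_utSp _ _ _ _).symm)
  exact utSp_congr rfl (fun s s' h h' => res_naturality _ _) fun _ _ _ => bs_naturality g _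

lemma utSp_cast (E : LambdaSeq V) {S S' : Type} [Enum S] [Enum S'] {U : N → Type} [∀ n, Enum (U n)]
    (φ : S ↪ S') {b : S → N} {b' : S' → N} (h : ∀ s s', φ s = s' → b s = b' s')
    (he : ∀ s', s' ∉ range φ → IsEmpty (U (b' s')))
    (u : ∀ s', s' ∉ range φ → (𝟙_ V ⟶ ev E.seq (U (b' s'))))
    (hu : ∀ s' h, u s' h = bs E (he s' h)) :
    utSp φ (A := fun s => ev E.seq (U (b s))) (B := fun s => ev E.seq (U (b' s)))
      (fun s s' hs => eqToHom (congrArg (fun n => ev E.seq (U n)) (h s s' hs))) u =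
    utRes E φ (T := fun s => U (b s)) (T' := fun s => U (b' s))
      (fun s s' hs => (Equiv.cast (congrArg U (h s s' hs).symm)).toEmbedding) he :=
  utSp_congr rfl (fun s s' hs _ => eqToHom_ev E.seq (h s s' hs)) fun s' h _ => hu s' h

lemma IsPart.exists_restrict {r' : ∀ s, T s → N'} (hr : IsPart r') (ψ : N ↪ N') :
    ∃ (T₁ : S → Type) (_ : ∀ s, Enum (T₁ s)) (r₁ : ∀ s, T₁ s → N) (f : ∀ s, T₁ s ↪ T s),
      IsPart r₁ ∧ ∀ s t, r' s (f s t) = ψ (r₁ s t) := by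
  have h1 : ∀ s (t : {t // r' s t ∈ range ψ}), ∃ n, ψ n = r' s t.1 := fun s t => t.2
  choose r₁ hr₁ using h1
  refine ⟨fun s => {t // r' s t ∈ range ψ}, inferInstance, r₁,
    fun s => Embedding.subtype _, ⟨?_, fun n => ?_⟩, fun s t => (hr₁ s t).symm⟩
  · rintro ⟨s, t⟩ ⟨s', t'⟩ h
    have h2 := congrArg ψ h
    simp only [hr₁] at h2
    have h3 := @hr.1 ⟨s, t.1⟩ ⟨s', t'.1⟩ h2
    obtain ⟨rfl, h4⟩ := Sigma.mk.inj_iff.1 h3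
    rw [Subtype.ext (eq_of_heq h4)]
  · obtain ⟨s, t, h⟩ := hr.exists (ψ n)
    refine ⟨⟨s, t, n, h.symm⟩, ψ.injective ?_⟩
    exact (hr₁ s _).trans h

lemma exists_emb_of_range {A B N : Type} {f : A → N} {g : B → N} (hf : Function.Injective f)
    (h : ∀ a, ∃ b, g b = f a) : ∃ i : A ↪ B, ∀ a, g (i a) = f a := by
  choose i hi using h
  exact ⟨⟨i, fun a a' h => hf (by rw [← hi, ← hi, h])⟩, hi⟩

variable [HasColimits V]

lemma Gen_ext_res (D E : LambdaSeq V) {T' : S → Type} [∀ s, Enum (T' s)] {r' : ∀ s, T' s → N'}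
    (hr : IsPart r) (hr' : IsPart r') (f : ∀ s, T' s ↪ T s)
    (ψ : N' ↪ N) (hψ : ∀ s t', ψ (r' s t') = r s (f s t')) :
    Gen D E hr ≫ res _ ψ = (_ ◁ utMap fun s => res E.seq (f s)) ≫ Gen D E hr' := by
  have h := Gen_res D E hr hr' (Embedding.refl S) (fun s s' h =>
    (Equiv.cast (congrArg T' h.symm)).toEmbedding.trans (f s)) (fun t ht => absurd ⟨t, rfl⟩ ht) ψ
    (by rintro s _ rfl t'; exact hψ s t')
  rwa [utRes_refl, res_refl, id_whiskerRight, id_comp] at h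

lemma Gen_equiv (D E : LambdaSeq V) (hr : IsPart r) (hr' : IsPart r') (σ : S ≃ S')
    (f : ∀ s s', σ.toEmbedding s = s' → (T' s' ↪ T s))
    (he : ∀ s', s' ∉ range σ.toEmbedding → IsEmpty (T' s'))
    (ψ : N' ↪ N) (hψ : ∀ s s' h t', ψ (r' s' t') = r s (f s s' h t')) :
    Gen D E hr ≫ res _ ψ =
      (res D.seq σ.symm.toEmbedding ⊗ₘ utRes E σ.toEmbedding f he) ≫ Gen D E hr' := by
  have h := Gen_res D E hr hr' σ.toEmbedding f he ψ hψ
  rw [MonoidalCategory.tensorHom_def, assoc, ← h, ← comp_whiskerRight_assoc, res_comp,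
    res_refl' _ (fun s => by simp), id_whiskerRight, id_comp]

lemma bs_Gen (D E : LambdaSeq V) (hr : IsPart r) (hS : IsEmpty S) (hN : IsEmpty N)
    (u : ∀ s, 𝟙_ V ⟶ ev E.seq (T s)) :
    bs D hS ≫ (ρ_ _).inv ≫ (_ ◁ utUnits u) ≫ Gen D E hr = bs (kelly D E) hN := by
  let T₀ : Fin 0 → Type := fun s => Fin (Fin.elim0 s)
  have hr₀ := IsPart.fin (k := 0) Fin.elim0
  have h0 : IsEmpty (Fin (∑ s : Fin 0, (Fin.elim0 s : ℕ))) := by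
    rw [Fin.sum_univ_zero]; infer_instance
  let φ : S ↪ Fin 0 := ⟨fun s => hS.elim s, fun s => hS.elim s⟩
  let ψ : Fin (∑ s : Fin 0, (Fin.elim0 s : ℕ)) ↪ N := ⟨fun s => h0.elim s, fun s => h0.elim s⟩
  let ψ' : N ↪ Fin (∑ s : Fin 0, (Fin.elim0 s : ℕ)) := ⟨fun s => hN.elim s, fun s => hN.elim s⟩
  have h1 := Gen_res D E hr hr₀ φ (fun s => hS.elim s) (fun s => s.elim0) ψ fun s => hS.elim s
  have h2 : utUnits u ≫ utRes E φ (T' := fun s => Fin (Fin.elim0 s)) (fun s => hS.elim s)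
      (fun s => s.elim0) = utUnits (S := Fin 0) fun s => s.elim0 :=
    utUnits_utSp (fun s => hS.elim s) (fun s => s.elim0)
  have h3 : bs D hS = D.base ≫ res D.seq φ := rfl
  have h4 : res (kelly D E).seq ψ ≫ res _ ψ' = 𝟙 _ :=
    (res_comp _ _ _).trans (res_refl' _ fun s => hN.elim s)
  have h5 : bs (kelly D E) hN = D.base ≫ (ρ_ _).inv ≫ (_ ◁ utUnits (S := Fin 0) fun s => s.elim0) ≫
      Gen D E hr₀ ≫ res _ ψ' := by
    have h6 : bs (kelly D E) hN = kellyBase D E ≫ res _ (S := N) (T := Fin 0)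
        ⟨fun s => hN.elim s, fun s => hN.elim s⟩ := rfl
    have h7 : kellyBase D E = D.base ≫ (ρ_ _).inv ≫ (_ ◁ utUnits (S := Fin 0) fun s => s.elim0) ≫
      Gen D E hr₀ ≫ eqToHom (congrArg (fun n => (kellySeq D E).obj (op ⟨n⟩)) (Fin.sum_univ_zero _)) := by
      rw [Gen_fin]
      rfl
    have h8 := eqToHom_eq_res (kellySeq D E) (Fin.sum_univ_zero (fun s : Fin 0 => (Fin.elim0 s : ℕ)))
    have aux : ∀ {A₀ A B C F G H : V} {a : A ⟶ B} {b : B ⟶ C} {c : C ⟶ F} {d : F ⟶ G} {e e' : G ⟶ H}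
        {k : A ⟶ H} {x : H ⟶ A₀} {y : G ⟶ A₀} {z : A ⟶ A₀} (h6 : z = k ≫ x)
        (h7 : k = a ≫ b ≫ c ≫ d ≫ e) (h8 : e = e') (h9 : e' ≫ x = y), z = a ≫ b ≫ c ≫ d ≫ y := by
      rintro A₀ A B C F G H a b c d e _ _ x _ _ rfl rfl rfl rfl
      simp only [assoc]
    exact aux h6 h7 h8 (res_comp' _ fun s => hN.elim s)
  rw [h3, h5]
  have aux : ∀ {I A B X X₀ Y Y₀ : V} {b : I ⟶ A} {ρ₁ : A ⟶ A ⊗ I} {f : A ⟶ B} {ρ₂ : B ⟶ B ⊗ I}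
    {u : I ⟶ X} {v : I ⟶ X₀} {w : X ⟶ X₀} {g : B ⊗ X ⟶ Y} {g₀ : A ⊗ X₀ ⟶ Y₀} {p : Y ⟶ Y₀}
    {p' : Y₀ ⟶ Y} (h1 : (f ▷ X) ≫ g ≫ p = (A ◁ w) ≫ g₀) (h2 : u ≫ w = v) (h3 : p ≫ p' = 𝟙 _)
    (h4 : f ≫ ρ₂ = ρ₁ ≫ (f ▷ I)), (b ≫ f) ≫ ρ₂ ≫ (B ◁ u) ≫ g =
      b ≫ ρ₁ ≫ (A ◁ v) ≫ g₀ ≫ p' := by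
    intros
    rename_i h1 h2 h3 h4
    subst h2
    rw [assoc, reassoc_of% h4, ← whisker_exchange_assoc, whiskerLeft_comp, assoc,
      ← reassoc_of% h1, h3, comp_id]
  exact aux h1 h2 h4 (rightUnitor_inv_naturality _)

end Calculus

section Families

variable [SymmetricCategory V] [HasColimits V]
  [TensorCocts V]

/-- A partition of `N`, indexed by an enumerated set and with enumerated parts. -/
structure Part (N : Type) : Type 1 where
  /-- The index set. -/
  S : Type
  [enumS : Enum S]
  /-- The parts. -/
  T : S → Type
  [enumT : ∀ s, Enum (T s)]
  /-- The inclusions of the parts. -/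
  r : ∀ s, T s → N
  hr : IsPart r

attribute [instance] Part.enumS Part.enumT

/-- The presentation of the Kelly product by its canonical maps. -/
def kellyPres (D E : LambdaSeq V) (N : Type) [Enum N] : Pres (ev (kelly D E).seq N) where
  A := Part N
  X p := ev D.seq p.S ⊗ ut fun s => ev E.seq (p.T s)
  g p := Gen D E p.hr
  Rel a b Y y y' := ∃ (φ : a.S ↪ b.S) (f : ∀ s s', φ s = s' → (b.T s' ↪ a.T s))
    (he : ∀ s', s' ∉ range φ → IsEmpty (b.T s')) (u : Y ⟶ ev D.seq b.S ⊗ ut fun s => ev E.seq (a.T s)),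
    (∀ s s' h t', b.r s' t' = a.r s (f s s' h t')) ∧ y = u ≫ (res D.seq φ ▷ _) ∧
      y' = u ≫ (_ ◁ utRes E φ f he)
  refl a := ⟨Embedding.refl _, fun s s' h => (Equiv.cast (congrArg a.T h.symm)).toEmbedding,
    fun t ht => absurd ⟨t, rfl⟩ ht, 𝟙 _, by rintro s _ rfl t; rfl, by
      rw [res_refl, id_whiskerRight, comp_id], by
      have h := utRes_id E (T₁ := a.T) (Embedding.refl a.S)
        (fun s s' h => (Equiv.cast (congrArg a.T h.symm)).toEmbedding)
        (fun t ht => absurd ⟨t, rfl⟩ ht) (fun _ => rfl) (fun _ _ _ => rfl)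
      exact ((id_comp _).trans ((congrArg (fun z => _ ◁ z) h).trans
        (whiskerLeft_id _ _))).symm⟩
  hom_ext h := Gen_hom_ext_whisker fun {k} {T} _ {r} hr => h ⟨Fin k, T, r, hr⟩
  exists_desc {W Z} h w := by
    obtain ⟨t, ht⟩ := KellyCone.exists_desc (D := D) (E := E) (N := N) (W := W) (Z := Z)
      { map := fun {S} _ {T} _ {r} hr => h ⟨S, T, r, hr⟩
        law := fun {S S'} _ _ {T} _ {T'} _ {r r'} hr hr' φ f he hf =>
          w (a := ⟨S, T, r, hr⟩) (b := ⟨S', T', r', hr'⟩) _ _ ⟨φ, f, he, 𝟙 _, hf,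
            (id_comp _).symm, (id_comp _).symm⟩ }
    exact ⟨t, fun a => ht a.hr⟩

variable {D E : LambdaSeq V}

lemma Gen_hom_ext {N : Type} [Enum N] {Z : V} {t t' : ev (kelly D E).seq N ⟶ Z}
    (h : ∀ {k : ℕ} {T : Fin k → Type} [∀ s, Enum (T s)] {r : ∀ s, T s → N} (hr : IsPart r),
      Gen D E hr ≫ t = Gen D E hr ≫ t') : t = t' := by
  rw [← cancel_epi (λ_ _).hom]
  refine Gen_hom_ext_whisker fun hr => ?_
  rw [leftUnitor_naturality_assoc, leftUnitor_naturality_assoc, h hr]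

lemma Gen_hom_ext_right {N : Type} [Enum N] {W Z : V} {t t' : ev (kelly D E).seq N ⊗ W ⟶ Z}
    (h : ∀ {k : ℕ} {T : Fin k → Type} [∀ s, Enum (T s)] {r : ∀ s, T s → N} (hr : IsPart r),
      (Gen D E hr ▷ W) ≫ t = (Gen D E hr ▷ W) ≫ t') : t = t' := by
  rw [← cancel_epi (β_ W _).hom]
  refine Gen_hom_ext_whisker fun hr => ?_
  rw [BraidedCategory.braiding_naturality_right_assoc, BraidedCategory.braiding_naturality_right_assoc,
    h hr]

/-- A family of morphisms `D S ⊗ ⨂ₛ E (T s) ⟶ F N` that is compatible with the relations between the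
canonical maps to `(D ⊙ E) N` and natural in `N`. -/
structure KellyFam (D E : LambdaSeq V) (F : Lamᵒᵖ ⥤ V) where
  /-- The morphisms of the family. -/
  map : ∀ {S N : Type} [Enum S] [Enum N] {T : S → Type} [∀ s, Enum (T s)] {r : ∀ s, T s → N}
    (hr : IsPart r), ev D.seq S ⊗ (ut fun s => ev E.seq (T s)) ⟶ ev F N
  law : ∀ {S S' N N' : Type} [Enum S] [Enum S'] [Enum N] [Enum N'] {T : S → Type}
    [∀ s, Enum (T s)] {T' : S' → Type} [∀ s, Enum (T' s)] {r : ∀ s, T s → N} {r' : ∀ s, T' s → N'}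
    (hr : IsPart r) (hr' : IsPart r') (φ : S ↪ S') (f : ∀ s s', φ s = s' → (T' s' ↪ T s))
    (he : ∀ s', s' ∉ range φ → IsEmpty (T' s')) (ψ : N' ↪ N),
    (∀ s s' h t', ψ (r' s' t') = r s (f s s' h t')) →
    (res D.seq φ ▷ _) ≫ map hr ≫ res F ψ = (_ ◁ utRes E φ f he) ≫ map hr'

lemma KellyFam.map_res {F : Lamᵒᵖ ⥤ V} (c : KellyFam D E F) {S N N' : Type} [Enum S] [Enum N]
    [Enum N'] {T T' : S → Type} [∀ s, Enum (T s)] [∀ s, Enum (T' s)] {r : ∀ s, T s → N}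
    {r' : ∀ s, T' s → N'} (hr : IsPart r) (hr' : IsPart r') (f : ∀ s, T' s ↪ T s)
    (ψ : N' ↪ N) (hψ : ∀ s t', ψ (r' s t') = r s (f s t')) :
    c.map hr ≫ res _ ψ = (_ ◁ utMap fun s => res E.seq (f s)) ≫ c.map hr' := by
  have h := c.law hr hr' (Embedding.refl S) (fun s s' h =>
    (Equiv.cast (congrArg T' h.symm)).toEmbedding.trans (f s)) (fun t ht => absurd ⟨t, rfl⟩ ht) ψ
    (by rintro s _ rfl t'; exact hψ s t')
  rwa [utRes_refl, res_refl, id_whiskerRight, id_comp] at h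

theorem KellyFam.exists_desc {F : Lamᵒᵖ ⥤ V} (c : KellyFam D E F) :
    ∃ t : (kelly D E).seq ⟶ F, ∀ {S N : Type} [Enum S] [Enum N] {T : S → Type} [∀ s, Enum (T s)]
      {r : ∀ s, T s → N} (hr : IsPart r), Gen D E hr ≫ t.app (op ⟨Enum.n N⟩) = c.map hr := by
  have h1 : ∀ n : ℕ, ∃ t : ev (kelly D E).seq (Fin n) ⟶ ev F (Fin n), ∀ {S : Type} [Enum S]
      {T : S → Type} [∀ s, Enum (T s)] {r : ∀ s, T s → Fin n} (hr : IsPart r),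
      Gen D E hr ≫ t = c.map hr := by
    intro n
    obtain ⟨t, ht⟩ := KellyCone.exists_desc (D := D) (E := E) (N := Fin n) (W := 𝟙_ V) (Z := ev F (Fin n))
      { map := fun hr => (λ_ _).hom ≫ c.map hr
        law := fun hr hr' φ f he hf => by
          have := c.law hr hr' φ f he (Embedding.refl _) hf
          rw [res_refl, comp_id] at this
          rw [leftUnitor_naturality_assoc, leftUnitor_naturality_assoc, this] }
    refine ⟨(λ_ _).inv ≫ t, fun hr => ?_⟩
    rw [leftUnitor_inv_naturality_assoc, ht, Iso.inv_hom_id_assoc]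
  choose t ht using h1
  refine ⟨{ app := fun n => t n.unop.n, naturality := fun n m x => ?_ }, ?_⟩
  · refine Gen_hom_ext (N := Fin n.unop.n) fun {k T} _ {r} hr => ?_
    obtain ⟨T', _, r', f, hr', hf⟩ := hr.exists_restrict (N := Fin m.unop.n) (Lam.emb x.unop)
    have h2 := Gen_ext_res D E hr hr' f (Lam.emb x.unop) fun s t' => (hf s t').symm
    have h3 := c.map_res hr hr' f (Lam.emb x.unop) fun s t' => (hf s t').symm
    rw [← ht _ hr, ← ht _ hr'] at h3
    have aux : ∀ {A B C X Y Y' : V} {g : A ⟶ B} {x : B ⟶ C} {u : A ⟶ X} {g' : X ⟶ C} {t : C ⟶ Y}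
        {t' : B ⟶ Y'} {y : Y' ⟶ Y} (h2 : g ≫ x = u ≫ g') (h3 : (g ≫ t') ≫ y = u ≫ g' ≫ t),
        g ≫ x ≫ t = g ≫ t' ≫ y := by
      intros
      rename_i h2 h3
      rw [reassoc_of% h2, ← h3, assoc]
    exact aux h2 h3
  · intro S N _ _ T _ r hr
    have hr' : IsPart fun s t => Enum.e (r s t) := hr.comp Enum.e
    have h2 := Gen_ext_res D E hr hr' (fun s => Embedding.refl _)
      (Enum.e (S := N)).symm.toEmbedding fun s t => Enum.e.symm_apply_apply _
    have h3 := c.map_res hr hr' (fun s => Embedding.refl _)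
      (Enum.e (S := N)).symm.toEmbedding fun s t => Enum.e.symm_apply_apply _
    have h4 : ∀ G : Lamᵒᵖ ⥤ V, res G (Enum.e (S := N)).symm.toEmbedding =
        𝟙 (G.obj (op ⟨Enum.n N⟩)) := fun G => by
      have : lamHom (Enum.e (S := N)).symm.toEmbedding = 𝟙 _ :=
        Embedding.ext fun q => (Enum.e (S := N)).apply_symm_apply q
      exact (congrArg (fun z => G.map (Quiver.Hom.op z)) this).trans (G.map_id _)
    have aux : ∀ {A B X Y : V} {g : A ⟶ B} {x : B ⟶ B} {u : A ⟶ X} {g' : X ⟶ B} {t : B ⟶ Y}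
        {m : A ⟶ Y} {y : Y ⟶ Y} {m' : X ⟶ Y} (hx : x = 𝟙 _) (hy : y = 𝟙 _) (h2 : g ≫ x = u ≫ g')
        (h3 : m ≫ y = u ≫ m') (h : g' ≫ t = m'), g ≫ t = m := by
      rintro A B X Y g _ u g' t m _ m' rfl rfl h2 h3 rfl
      rw [comp_id] at h2 h3
      rw [h2, h3, assoc]
    exact aux (h4 _) (h4 _) h2 h3 (ht _ hr')

end Families
section Associator

variable [SymmetricCategory V] [HasColimits V]
  {S S' N N' M M' : Type} [Enum S] [Enum S'] [Enum N] [Enum N'] [Enum M] [Enum M']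
  {T T₂ : S → Type} [∀ s, Enum (T s)] [∀ s, Enum (T₂ s)] {T' : S' → Type} [∀ s, Enum (T' s)]
  {U : N → Type} [∀ n, Enum (U n)] {U' : N' → Type} [∀ n, Enum (U' n)]
  {L L₂ : S → Type} [∀ s, Enum (L s)] [∀ s, Enum (L₂ s)] {L' : S' → Type} [∀ s, Enum (L' s)]
  {r : ∀ s, T s → N} {r₂ : ∀ s, T₂ s → N'} {r' : ∀ s, T' s → N}
  {w : ∀ n, U n → M} {w' : ∀ n, U' n → M'}
  {l : ∀ s, L s → M} {l₂ : ∀ s, L₂ s → M'} {l' : ∀ s, L' s → M}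
  {x : ∀ s (t : T s), U (r s t) → L s} {x₂ : ∀ s (t : T₂ s), U' (r₂ s t) → L₂ s}
  {x' : ∀ s (t : T' s), U (r' s t) → L' s}

lemma apply_cast {w : ∀ n, U n → M} {n n' : N} (h : n' = n) (u : U n') :
    w n (Equiv.cast (congrArg U h) u) = w n' u := by
  subst h
  rfl

lemma sh_Gen_left (E F : LambdaSeq V) (hr : IsPart r) (hr' : IsPart r') (hl : IsPart l)
    (hx : ∀ s, IsPart (x s)) (hx' : ∀ s, IsPart (x' s)) (hw : ∀ s t u, l s (x s t u) = w (r s t) u)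
    (hw' : ∀ s t u, l' s (x' s t u) = w (r' s t) u) (φ : S ↪ S')
    (f : ∀ s s', φ s = s' → (T' s' ↪ T s)) (he : ∀ s', s' ∉ range φ → IsEmpty (T' s'))
    (hf : ∀ s s' h t', r' s' t' = r s (f s s' h t')) (g : ∀ s s', φ s = s' → (L' s' ↪ L s))
    (he' : ∀ s', s' ∉ range φ → IsEmpty (L' s')) (hg : ∀ s s' h t', l' s' t' = l s (g s s' h t')) :
    (sh hr (fun s => ev E.seq (T s)) (fun n => ev F.seq (U n))).hom ≫
        (utMap fun s => Gen E F (hx s)) ≫ utRes (kelly E F) φ g he' =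
      (utRes E φ f he ▷ _) ≫ (sh hr' (fun s => ev E.seq (T' s)) (fun n => ev F.seq (U n))).hom ≫
        utMap fun s => Gen E F (hx' s) := by
  have hb : ∀ s s' h, Function.Bijective (f s s' h) := by
    rintro s _ rfl
    refine ⟨(f s _ rfl).injective, fun t => ?_⟩
    obtain ⟨s', t', h⟩ := hr'.exists (r s t)
    by_cases hs : s' ∈ range φ
    · obtain ⟨s₁, rfl⟩ := hs
      rw [hf s₁ _ rfl] at h
      obtain rfl := hr.inj' h
      exact ⟨t', hr.inj _ h⟩
    · exact (he _ hs).elim t'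
  let σ : ∀ s s', φ s = s' → (T s ≃ T' s') := fun s s' h => (Equiv.ofBijective _ (hb s s' h)).symm
  have hσ : ∀ s s' h t, f s s' h (σ s s' h t) = t :=
    fun s s' h t => (Equiv.ofBijective _ (hb s s' h)).apply_symm_apply t
  have hrσ : ∀ s s' h t, r' s' (σ s s' h t) = r s t := fun s s' h t => by rw [hf s s' h, hσ]
  have hh : ∀ s s' (h : φ s = s') t t', (σ s s' h).toEmbedding t = t' → r s t = r' s' t' := by
    rintro s s' h t _ rfl
    exact (hrσ s s' h t).symm
  have K1 := sh_utSp_left (φ := φ) (A' := fun s => ev E.seq (T' s)) (fun s s' h => res E.seq (f s s' h))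
    (fun s' hs' => bs E (he s' hs')) hr hr' σ hrσ he (fun n => ev F.seq (U n)) hh
  refine Eq.trans ?_ ((assoc _ _ _).symm.trans
    ((eq_whisker K1 _).trans (assoc _ _ _))).symm
  refine whisker_eq _ ?_
  refine (utMap_utSp _ _ _ _).trans (Eq.trans ?_ (utSp_utMap _ _ _ _).symm)
  refine utSp_congr rfl (fun s s' h _ => ?_) (fun s' hs' _ => ?_)
  · have h1 := Gen_equiv E F (hx s) (hx' s') (σ s s' h)
      (fun t t' ht => (Equiv.cast (congrArg U (hh s s' h t t' ht).symm)).toEmbedding)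
      (fun t' ht' => absurd ((σ s s' h).surjective t') ht') (g s s' h) (fun t t' ht u => by
        apply hl.inj s
        rw [← hg, hw', hw]
        exact (apply_cast (w := w) (hh s s' h t t' ht).symm u).symm)
    have h2 := utSp_cast F (U := U) (σ s s' h).toEmbedding (b := r s) (b' := r' s') (hh s s' h)
      (fun t' ht' => absurd ((σ s s' h).surjective t') ht')
      (fun t' ht' => absurd ((σ s s' h).surjective t') ht')
      (fun t' ht' => absurd ((σ s s' h).surjective t') ht')
    refine h1.trans (eq_whisker (congrArg₂ (· ⊗ₘ ·) (res_congr _ fun t => rfl) h2.symm) _)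
  · have aux : ∀ {A B C D : V} {a : 𝟙_ V ⟶ A} {b : A ⟶ B} {c : B ⟶ C} {d : C ⟶ D} {e : 𝟙_ V ⟶ D}
        (h : a ≫ b ≫ c ≫ d = e), e = (a ≫ b ≫ c) ≫ d := by
      intros
      simp only [assoc]
      symm
      assumption
    exact aux (bs_Gen E F (hx' s') (he s' hs') (he' s' hs') _)

lemma sh_Gen_right (E F : LambdaSeq V) (hr : IsPart r) (hr₂ : IsPart r₂) (hl : IsPart l)
    (hx : ∀ s, IsPart (x s)) (hx₂ : ∀ s, IsPart (x₂ s)) (hw : ∀ s t u, l s (x s t u) = w (r s t) u)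
    (hw' : ∀ s t u, l₂ s (x₂ s t u) = w' (r₂ s t) u) (φ : N ↪ N') (f : ∀ s, T s ↪ T₂ s)
    (hf : ∀ s t, r₂ s (f s t) = φ (r s t)) (σ : ∀ n n', φ n = n' → (U' n' ↪ U n))
    (he : ∀ n', n' ∉ range φ → IsEmpty (U' n')) (ψ : M' ↪ M)
    (hσ : ∀ n n' h u, ψ (w' n' u) = w n (σ n n' h u)) (g : ∀ s, L₂ s ↪ L s)
    (hg : ∀ s q, ψ (l₂ s q) = l s (g s q)) :
    ((utMap fun s => res E.seq (f s)) ▷ _) ≫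
        (sh hr (fun s => ev E.seq (T s)) (fun n => ev F.seq (U n))).hom ≫
        (utMap fun s => Gen E F (hx s)) ≫ (utMap fun s => res (kelly E F).seq (g s)) =
      (_ ◁ utRes F φ σ he) ≫ (sh hr₂ (fun s => ev E.seq (T₂ s)) (fun n => ev F.seq (U' n))).hom ≫
        utMap fun s => Gen E F (hx₂ s) := by
  have hh : ∀ s t t', f s t = t' → φ (r s t) = r₂ s t' := by
    rintro s t _ rfl
    exact (hf s t).symm
  have hn := fun s t' ht' => hr.notMem_range hr₂ φ f hf s t' ht'
  have K2 := sh_utSp_right (ψ := φ) f hr hr₂ (fun s => ev E.seq (T₂ s))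
    (B := fun n => ev F.seq (U n)) (B' := fun n => ev F.seq (U' n)) (fun n n' h => res F.seq (σ n n' h))
    (fun n' hn' => bs F (he n' hn')) hh hn
  have h1 := sh_naturality hr (fun s => res E.seq (f s)) (fun n => 𝟙 (ev F.seq (U n)))
  rw [utMap_id, tensorHom_id] at h1
  have h3 : ∀ s, (res E.seq (f s) ⊗ₘ utMap fun t => 𝟙 (ev F.seq (U (r s t)))) ≫ Gen E F (hx s) ≫
      res _ (g s) = (_ ◁ utRes F (T := fun t => U (r s t)) (T' := fun t => U' (r₂ s t)) (f s)
        (fun t t' h => σ _ _ (hh s t t' h)) fun t' ht' => he _ (hn s t' ht')) ≫ Gen E F (hx₂ s) := by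
    intro s
    rw [utMap_id, tensorHom_id]
    refine Gen_res E F (hx s) (hx₂ s) (f s) _ _ (g s) fun t t' h u => ?_
    apply hl.inj s
    rw [← hg, hw', hw]
    exact hσ _ _ _ _
  have h4 : (utMap fun s => res E.seq (f s) ⊗ₘ utMap fun t => 𝟙 (ev F.seq (U (r s t)))) ≫
      (utMap fun s => Gen E F (hx s)) ≫ (utMap fun s => res (kelly E F).seq (g s)) =
      (utMap fun s => _ ◁ utRes F (T := fun t => U (r s t)) (T' := fun t => U' (r₂ s t)) (f s)
        (fun t t' h => σ _ _ (hh s t t' h)) fun t' ht' => he _ (hn s t' ht')) ≫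
        utMap fun s => Gen E F (hx₂ s) := by
    refine (whisker_eq _ (utMap_comp _ _)).trans ((utMap_comp _ _).trans
      (Eq.trans ?_ (utMap_comp _ _).symm))
    exact congrArg (fun z => utMap z) (funext h3)
  refine (assoc _ _ _).symm.trans ((eq_whisker h1 _).trans ((assoc _ _ _).trans ?_))
  refine (whisker_eq _ h4).trans ?_
  exact (assoc _ _ _).symm.trans ((eq_whisker K2.symm _).trans (assoc _ _ _))

lemma utUnits_sh (hr : IsPart r) {A : S → V} {B : N → V} (a : ∀ s, 𝟙_ V ⟶ A s) (b : ∀ n, 𝟙_ V ⟶ B n) :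
    (ρ_ (𝟙_ V)).inv ≫ (utUnits a ⊗ₘ utUnits b) ≫ (sh hr A B).hom =
      utUnits fun s => a s ≫ (ρ_ _).inv ≫ (A s ◁ utUnits fun t => b (r s t)) := by
  have hs := sep_atoms (S := S) (N := N)
  let f : ∀ i, True → (𝟙_ V ⟶ Sum.elim A B i) := fun i _ => match i with
    | Sum.inl s => a s
    | Sum.inr n => b n
  have ha : ∀ s, IsCan f (canUnit _) (canInl A B s) (a s) := fun s => IsCan.atom (f := f) (Sum.inl s) trivial
  have hb : ∀ n, IsCan f (canUnit _) (canInr A B n) (b n) := fun n => IsCan.atom (f := f) (Sum.inr n) trivial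
  have h1 := IsCan.utUnits hs.inl ha
  have h2 := IsCan.utUnits hs.inr hb
  refine IsCan.unique (f := f) (a := canUnit _)
    (b := canUt fun s => canTensor (canInl A B s) (canUt fun t => canInr A B (r s t))) ?_ ?_
  · exact (IsCan.rightUnitor_inv List.nodup_nil).comp ((h1.tensor h2
      (List.disjoint_of_nodup_append hs.nodup_append)).comp (IsCan.sh hs hr))
  · refine IsCan.utUnits (hs.fibre hr) fun s => ?_
    exact (ha s).comp ((IsCan.rightUnitor_inv (hs.inl.1 s)).comp (IsCan.whiskerLeft
      (IsCan.utUnits (hs.inr.comp (hr.inj s)) fun t => hb (r s t)) _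
      ((hs.fibre hr).1 s)))

/-- The associator on the canonical maps. -/
def asc (D E F : LambdaSeq V) (hr : IsPart r) (hx : ∀ s, IsPart (x s)) (hl : IsPart l) :
    (ev D.seq S ⊗ ut fun s => ev E.seq (T s)) ⊗ (ut fun n => ev F.seq (U n)) ⟶
      ev (kelly D (kelly E F)).seq M :=
  (α_ _ _ _).hom ≫ (_ ◁ ((sh hr (fun s => ev E.seq (T s)) (fun n => ev F.seq (U n))).hom ≫
    utMap fun s => Gen E F (hx s))) ≫ Gen D (kelly E F) hl

lemma asc_left (D E F : LambdaSeq V) (hr : IsPart r) (hr' : IsPart r') (hl : IsPart l) (hl' : IsPart l')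
    (hx : ∀ s, IsPart (x s)) (hx' : ∀ s, IsPart (x' s)) (hw : ∀ s t u, l s (x s t u) = w (r s t) u)
    (hw' : ∀ s t u, l' s (x' s t u) = w (r' s t) u) (φ : S ↪ S')
    (f : ∀ s s', φ s = s' → (T' s' ↪ T s)) (he : ∀ s', s' ∉ range φ → IsEmpty (T' s'))
    (hf : ∀ s s' h t', r' s' t' = r s (f s s' h t')) :
    ((res D.seq φ ▷ _) ▷ _) ≫ asc D E F hr hx hl =
      ((_ ◁ utRes E φ f he) ▷ _) ≫ asc D E F hr' hx' hl' := by
  have he' : ∀ s', s' ∉ range φ → IsEmpty (L' s') := fun s' h => ⟨fun q => by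
    obtain ⟨t, u, rfl⟩ := (hx' s').exists q
    exact (he s' h).elim t⟩
  have hg : ∀ s s', φ s = s' → ∃ g : L' s' ↪ L s, ∀ q, l s (g q) = l' s' q := fun s s' h => by
    refine exists_emb_of_range (hl'.inj s') fun q => ?_
    obtain ⟨t, u, rfl⟩ := (hx' s').exists q
    refine ⟨x s (f s s' h t) (Equiv.cast (congrArg U (hf s s' h t)) u), ?_⟩
    rw [hw, hw']
    exact apply_cast (w := w) (hf s s' h t) u
  choose g hg using hg
  have h1 := sh_Gen_left E F hr hr' hl hx hx' hw hw' φ f he hf g he' fun s s' h t' => (hg s s' h t').symm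
  have h2 := Gen_res D (kelly E F) hl hl' φ g he' (Embedding.refl M)
    fun s s' h t' => (hg s s' h t').symm
  rw [res_refl, comp_id] at h2
  have aux : ∀ {A A' B B' X Y Y' C C' Z : V} {a : A' ⟶ A} {b : B ⟶ B'} {s : B ⊗ X ⟶ Y} {s' : B' ⊗ X ⟶ Y'}
      {c : Y ⟶ C} {c' : Y' ⟶ C'} {d : C ⟶ C'} {g : A ⊗ C ⟶ Z} {g' : A' ⊗ C' ⟶ Z}
      (h1 : s ≫ c ≫ d = (b ▷ X) ≫ s' ≫ c') (h2 : (a ▷ C) ≫ g = (A' ◁ d) ≫ g'),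
      ((a ▷ B) ▷ X) ≫ (α_ _ _ _).hom ≫ (A ◁ (s ≫ c)) ≫ g =
        ((A' ◁ b) ▷ X) ≫ (α_ _ _ _).hom ≫ (A' ◁ (s' ≫ c')) ≫ g' := by
    intros
    rename_i h1 h2
    rw [associator_naturality_left_assoc, ← whisker_exchange_assoc, h2, associator_naturality_middle_assoc,
      ← whiskerLeft_comp_assoc, ← whiskerLeft_comp_assoc, assoc, h1]
  exact aux h1 h2

lemma asc_right (D E F : LambdaSeq V) (hr : IsPart r) (hr₂ : IsPart r₂) (hl : IsPart l) (hl₂ : IsPart l₂)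
    (hx : ∀ s, IsPart (x s)) (hx₂ : ∀ s, IsPart (x₂ s)) (hw : ∀ s t u, l s (x s t u) = w (r s t) u)
    (hw' : ∀ s t u, l₂ s (x₂ s t u) = w' (r₂ s t) u) (φ : N ↪ N') (f : ∀ s, T s ↪ T₂ s)
    (hf : ∀ s t, r₂ s (f s t) = φ (r s t)) (σ : ∀ n n', φ n = n' → (U' n' ↪ U n))
    (he : ∀ n', n' ∉ range φ → IsEmpty (U' n')) (ψ : M' ↪ M)
    (hσ : ∀ n n' h u, ψ (w' n' u) = w n (σ n n' h u)) :
    ((_ ◁ (utMap fun s => res E.seq (f s))) ▷ _) ≫ asc D E F hr hx hl ≫ res _ ψ =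
      (_ ◁ utRes F φ σ he) ≫ asc D E F hr₂ hx₂ hl₂ := by
  have hg : ∀ s, ∃ g : L₂ s ↪ L s, ∀ q, l s (g q) = ψ (l₂ s q) := fun s => by
    refine exists_emb_of_range (f := fun q => ψ (l₂ s q)) (ψ.injective.comp (hl₂.inj s)) fun q => ?_
    obtain ⟨t', u, rfl⟩ := (hx₂ s).exists q
    have h1 : t' ∈ range (f s) := by
      by_contra h
      exact (he _ (hr.notMem_range hr₂ φ f hf s t' h)).elim u
    obtain ⟨t, rfl⟩ := h1
    refine ⟨x s t (σ _ _ (hf s t).symm u), ?_⟩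
    rw [hw, hw', hσ]
  choose g hg using hg
  have h1 := sh_Gen_right E F hr hr₂ hl hx hx₂ hw hw' φ f hf σ he ψ hσ g fun s q => (hg s q).symm
  have h2 := Gen_ext_res D (kelly E F) hl hl₂ g ψ fun s q => (hg s q).symm
  have aux : ∀ {A B B' X X' Y Y' C C' Z Z' : V} {b : B ⟶ B'} {e : X ⟶ X'} {s : B' ⊗ X ⟶ Y} {s' : B ⊗ X' ⟶ Y'}
      {c : Y ⟶ C} {c' : Y' ⟶ C'} {d : C ⟶ C'} {g : A ⊗ C ⟶ Z} {g' : A ⊗ C' ⟶ Z'} {p : Z ⟶ Z'}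
      (h1 : (b ▷ X) ≫ s ≫ c ≫ d = (B ◁ e) ≫ s' ≫ c') (h2 : g ≫ p = (A ◁ d) ≫ g'),
      ((A ◁ b) ▷ X) ≫ ((α_ _ _ _).hom ≫ (A ◁ (s ≫ c)) ≫ g) ≫ p =
        ((A ⊗ B) ◁ e) ≫ (α_ _ _ _).hom ≫ (A ◁ (s' ≫ c')) ≫ g' := by
    intros
    rename_i h1 h2
    simp only [assoc]
    rw [h2, associator_naturality_middle_assoc, associator_naturality_right_assoc,
      ← whiskerLeft_comp_assoc, ← whiskerLeft_comp_assoc, ← whiskerLeft_comp_assoc, ← h1]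
    simp only [assoc]
  exact aux h1 h2

/-- The partition of `M` obtained from a partition of `N` and a partition of `M` that is indexed by
`N`. -/
lemma IsPart.assoc (hr : IsPart r) (hw : IsPart w) :
    IsPart (fun s (p : Σ t, U (r s t)) => w (r s p.1) p.2) := by
  refine ⟨?_, fun m => ?_⟩
  · rintro ⟨s, t, u⟩ ⟨s', t', u'⟩ h
    have h1 := @hw.1 ⟨r s t, u⟩ ⟨r s' t', u'⟩ h
    obtain ⟨h2, h3⟩ := Sigma.mk.inj_iff.1 h1
    have h4 := @hr.1 ⟨s, t⟩ ⟨s', t'⟩ h2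
    cases h4
    cases h3
    rfl
  · obtain ⟨n, u, rfl⟩ := hw.exists m
    obtain ⟨s, t, rfl⟩ := hr.exists n
    exact ⟨⟨s, t, u⟩, rfl⟩

variable [TensorCocts V]

lemma asc_indep (D E F : LambdaSeq V) {L₂ : S → Type} [∀ s, Enum (L₂ s)] {l₂ : ∀ s, L₂ s → M}
    {x₂ : ∀ s (t : T s), U (r s t) → L₂ s} (hr : IsPart r) (hl : IsPart l)
    (hl₂ : IsPart l₂) (hx : ∀ s, IsPart (x s)) (hx₂ : ∀ s, IsPart (x₂ s))
    (hw : ∀ s t u, l s (x s t u) = w (r s t) u) (hw₂ : ∀ s t u, l₂ s (x₂ s t u) = w (r s t) u) :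
    asc D E F hr hx hl = asc D E F hr hx₂ hl₂ := by
  have h := asc_left D E F hr hr hl hl₂ hx hx₂ hw hw₂ (Embedding.refl S)
    (fun s s' h => (Equiv.cast (congrArg T h.symm)).toEmbedding) (fun t ht => absurd ⟨t, rfl⟩ ht)
    (by rintro s _ rfl t; rfl)
  rw [res_refl, id_whiskerRight, id_whiskerRight, id_comp] at h
  refine h.trans ?_
  have h1 := utRes_id E (T₁ := T) (Embedding.refl S)
        (fun s s' h => (Equiv.cast (congrArg T h.symm)).toEmbedding)
        (fun t ht => absurd ⟨t, rfl⟩ ht) (fun _ => rfl) (fun _ _ _ => rfl)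
  have aux : ∀ {A B C D : V} {a : B ⟶ B} (h : a = 𝟙 _) (g : (A ⊗ B) ⊗ C ⟶ D), ((A ◁ a) ▷ C) ≫ g = g := by
    rintro A B C D _ rfl g
    simp
  exact aux h1 _

/-- The cone for the first variable of the associator. -/
def ascCone (D E F : LambdaSeq V) (hw : IsPart w) :
    KellyCone D E N (ut fun n => ev F.seq (U n)) (ev (kelly D (kelly E F)).seq M) where
  map hr := (β_ _ _).hom ≫ asc D E F hr (fun s => IsPart.mk) (hr.assoc hw)
  law hr hr' φ f he hf := by
    have h := asc_left D E F hr hr' (hr.assoc hw) (hr'.assoc hw) (fun s => IsPart.mk)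
      (fun s => IsPart.mk) (fun _ _ _ => rfl) (fun _ _ _ => rfl) φ f he hf
    rw [BraidedCategory.braiding_naturality_right_assoc,
      BraidedCategory.braiding_naturality_right_assoc, h]

lemma exists_asc_desc (D E F : LambdaSeq V) (hw : IsPart w) :
    ∃ t : ev (kelly D E).seq N ⊗ (ut fun n => ev F.seq (U n)) ⟶ ev (kelly D (kelly E F)).seq M,
      ∀ {S : Type} [Enum S] {T : S → Type} [∀ s, Enum (T s)] {r : ∀ s, T s → N} (hr : IsPart r),
        (Gen D E hr ▷ _) ≫ t = asc D E F hr (fun s => IsPart.mk) (hr.assoc hw) := by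
  obtain ⟨t, ht⟩ := (ascCone D E F hw).exists_desc
  refine ⟨(β_ _ _).hom ≫ t, fun hr => ?_⟩
  rw [BraidedCategory.braiding_naturality_left_assoc, ht]
  change (β_ _ _).hom ≫ (β_ _ _).hom ≫ _ = _
  rw [SymmetricCategory.symmetry_assoc]

end Associator

section Associator

variable [SymmetricCategory V] [HasColimits V]
  [TensorCocts V]

lemma exists_ascNat (D E F : LambdaSeq V) :
    ∃ t : (kelly (kelly D E) F).seq ⟶ (kelly D (kelly E F)).seq, ∀ {S N M : Type} [Enum S] [Enum N] [Enum M]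
      {T : S → Type} [∀ s, Enum (T s)] {U : N → Type} [∀ n, Enum (U n)] {L : S → Type}
      [∀ s, Enum (L s)] {r : ∀ s, T s → N} {w : ∀ n, U n → M} {l : ∀ s, L s → M}
      {x : ∀ s (t : T s), U (r s t) → L s} (hr : IsPart r) (hw : IsPart w) (hx : ∀ s, IsPart (x s))
      (hl : IsPart l), (∀ s t u, l s (x s t u) = w (r s t) u) →
        (Gen D E hr ▷ _) ≫ Gen (kelly D E) F hw ≫ t.app (op ⟨Enum.n M⟩) = asc D E F hr hx hl := by
  choose m hm using fun {N M : Type} [Enum N] [Enum M] {U : N → Type} [∀ n, Enum (U n)]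
    {w : ∀ n, U n → M} (hw : IsPart w) => exists_asc_desc D E F hw
  obtain ⟨t, ht⟩ := KellyFam.exists_desc (D := kelly D E) (E := F)
    (F := (kelly D (kelly E F)).seq)
    { map := fun hw => m hw
      law := fun {N N' M M'} _ _ _ _ {U} _ {U'} _ {w w'} hw hw' φ σ he ψ hσ => by
        refine Gen_hom_ext_right fun {k T₂} _ {r₂} hr₂ => ?_
        obtain ⟨T, _, r, f, hr, hf⟩ := hr₂.exists_restrict φ
        have h1 := Gen_ext_res D E hr₂ hr f φ fun s t => (hf s t).symm
        have h2 := asc_right D E F hr hr₂ (hr.assoc hw) (hr₂.assoc hw') (fun s => IsPart.mk)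
          (fun s => IsPart.mk) (fun _ _ _ => rfl) (fun _ _ _ => rfl) φ f hf σ he ψ hσ
        rw [← hm hw hr, ← hm hw' hr₂] at h2
        have aux : ∀ {A B A' B' X X' Z Z' : V} {g₂ : A ⟶ B} {p : B ⟶ B'} {e : A ⟶ A'} {g : A' ⟶ B'}
            {t : B' ⊗ X ⟶ Z} {q : Z ⟶ Z'} {o : X ⟶ X'} {t' : B ⊗ X' ⟶ Z'} (h1 : g₂ ≫ p = e ≫ g)
            (h2 : (e ▷ X) ≫ ((g ▷ X) ≫ t) ≫ q = (A ◁ o) ≫ (g₂ ▷ X') ≫ t'),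
            (g₂ ▷ X) ≫ (p ▷ X) ≫ t ≫ q = (g₂ ▷ X) ≫ (B ◁ o) ≫ t' := by
          intros
          rename_i h1 h2
          rw [← comp_whiskerRight_assoc, h1, comp_whiskerRight_assoc, ← whisker_exchange_assoc, ← h2,
            assoc]
        exact aux h1 h2 }
  refine ⟨t, fun hr hw hx hl h => ?_⟩
  refine (whisker_eq _ (ht hw)).trans ((hm hw hr).trans ?_)
  exact asc_indep D E F hr _ hl _ hx (fun _ _ _ => rfl) h

end Associator
section Associator

variable [SymmetricCategory V] [HasColimits V]
  {S S' N N' M M' : Type} [Enum S] [Enum S'] [Enum N] [Enum N'] [Enum M] [Enum M']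
  {T T₂ : S → Type} [∀ s, Enum (T s)] [∀ s, Enum (T₂ s)] {T' : S' → Type} [∀ s, Enum (T' s)]
  {U : N → Type} [∀ n, Enum (U n)] {U' : N' → Type} [∀ n, Enum (U' n)]
  {r : ∀ s, T s → N} {r₂ : ∀ s, T₂ s → N'} {r' : ∀ s, T' s → N}
  {w : ∀ n, U n → M} {w' : ∀ n, U' n → M}

/-- The inverse of the associator on the canonical maps. -/
def asi (D E F : LambdaSeq V) (hr : IsPart r) (hw : IsPart w) :
    ev D.seq S ⊗ (ut fun s => ev E.seq (T s) ⊗ ut fun t => ev F.seq (U (r s t))) ⟶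
      ev (kelly (kelly D E) F).seq M :=
  (_ ◁ (sh hr (fun s => ev E.seq (T s)) (fun n => ev F.seq (U n))).inv) ≫ (α_ _ _ _).inv ≫
    (Gen D E hr ▷ _) ≫ Gen (kelly D E) F hw

lemma asi_left (D E F : LambdaSeq V) (hr : IsPart r) (hr' : IsPart r') (hw : IsPart w) (φ : S ↪ S')
    (f : ∀ s s', φ s = s' → (T' s' ↪ T s)) (he : ∀ s', s' ∉ range φ → IsEmpty (T' s'))
    (hf : ∀ s s' h t', r' s' t' = r s (f s s' h t')) :
    (res D.seq φ ▷ _) ≫ asi D E F hr hw =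
      (_ ◁ ((sh hr (fun s => ev E.seq (T s)) (fun n => ev F.seq (U n))).inv ≫ (utRes E φ f he ▷ _) ≫
        (sh hr' (fun s => ev E.seq (T' s)) (fun n => ev F.seq (U n))).hom)) ≫ asi D E F hr' hw := by
  have h2 := Gen_res D E hr hr' φ f he (Embedding.refl N) hf
  rw [res_refl, comp_id] at h2
  have aux : ∀ {A A' B B' X Y Y' C Z : V} {a : A' ⟶ A} {b : B ⟶ B'} {s : B ⊗ X ≅ Y} {s' : B' ⊗ X ≅ Y'}
      {g : A ⊗ B ⟶ C} {g' : A' ⊗ B' ⟶ C} {k : C ⊗ X ⟶ Z} (h2 : (a ▷ B) ≫ g = (A' ◁ b) ≫ g'),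
      (a ▷ Y) ≫ (A ◁ s.inv) ≫ (α_ _ _ _).inv ≫ (g ▷ X) ≫ k =
        (A' ◁ (s.inv ≫ (b ▷ X) ≫ s'.hom)) ≫ (A' ◁ s'.inv) ≫ (α_ _ _ _).inv ≫ (g' ▷ X) ≫ k := by
    intros
    rename_i h2
    rw [← whiskerLeft_comp_assoc, assoc, assoc, Iso.hom_inv_id, comp_id,
      ← whisker_exchange_assoc, associator_inv_naturality_left_assoc, ← comp_whiskerRight_assoc, h2,
      whiskerLeft_comp_assoc, associator_inv_naturality_middle_assoc, comp_whiskerRight_assoc]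
  exact aux h2

lemma asi_right (D E F : LambdaSeq V) (hr : IsPart r) (hr₂ : IsPart r₂) (hw : IsPart w) (hw' : IsPart w')
    (φ : N ↪ N') (f : ∀ s, T s ↪ T₂ s)
    (hf : ∀ s t, r₂ s (f s t) = φ (r s t)) (σ : ∀ n n', φ n = n' → (U' n' ↪ U n))
    (he : ∀ n', n' ∉ range φ → IsEmpty (U' n')) 
    (hσ : ∀ n n' h u, w' n' u = w n (σ n n' h u))
    (σ' : ∀ s t t', f s t = t' → (U' (r₂ s t') ↪ U (r s t)))
    (he' : ∀ s t', t' ∉ range (f s) → IsEmpty (U' (r₂ s t')))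
    (hσ' : ∀ s t t' h h' u, σ' s t t' h u = σ (r s t) (r₂ s t') h' u) :
    (_ ◁ utMap fun s => res E.seq (f s) ▷ ut fun t => ev F.seq (U (r s t))) ≫ asi D E F hr hw =
      (_ ◁ utMap fun s => ev E.seq (T₂ s) ◁ utRes F (T := fun t => U (r s t)) (T' := fun t => U' (r₂ s t))
        (f s) (σ' s) (he' s)) ≫ asi D E F hr₂ hw' := by
  have hh : ∀ s t t', f s t = t' → φ (r s t) = r₂ s t' := by
    rintro s t _ rfl
    exact (hf s t).symm
  have hn := fun s t' ht' => hr.notMem_range hr₂ φ f hf s t' ht'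
  have K2 := sh_utSp_right (ψ := φ) f hr hr₂ (fun s => ev E.seq (T₂ s))
    (B := fun n => ev F.seq (U n)) (B' := fun n => ev F.seq (U' n)) (fun n n' h => res F.seq (σ n n' h))
    (fun n' hn' => bs F (he n' hn')) hh hn
  have h0 : (fun s => ev E.seq (T₂ s) ◁ utSp (B := fun t => ev F.seq (U' (r₂ s t))) (f s)
        (fun t t' ht => res F.seq (σ (r s t) (r₂ s t') (hh s t t' ht)))
        (fun t' ht' => bs F (he (r₂ s t') (hn s t' ht')))) =
      fun s => ev E.seq (T₂ s) ◁ utRes F (T := fun t => U (r s t)) (T' := fun t => U' (r₂ s t))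
        (f s) (σ' s) (he' s) := by
    funext s
    refine congrArg (fun z => _ ◁ z) (utSp_congr rfl (fun t t' h _ => ?_) fun _ _ _ => rfl)
    exact res_congr _ fun u => (hσ' s t t' h _ u).symm
  have h1 := sh_naturality hr (fun s => res E.seq (f s)) (fun n => 𝟙 (ev F.seq (U n)))
  have h0' : (utMap fun s => res E.seq (f s) ⊗ₘ utMap fun t => 𝟙 (ev F.seq (U (r s t)))) =
      utMap fun s => res E.seq (f s) ▷ ut fun t => ev F.seq (U (r s t)) :=
    congrArg (fun z => utMap z) (funext fun s => by rw [utMap_id, tensorHom_id])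
  rw [utMap_id, tensorHom_id] at h1
  have h2 := h1.trans (whisker_eq _ h0')
  have h3 := K2.trans (whisker_eq _ (congrArg (fun z => utMap z) h0))
  have h4 := Gen_ext_res D E hr₂ hr f φ fun s t => (hf s t).symm
  have h5 := Gen_res (kelly D E) F hw hw' φ σ he (Embedding.refl M) hσ
  rw [res_refl, comp_id] at h5
  have aux : ∀ {A B B' X X' Y₁ Y₂ Y₃ C C' Z : V} {f : B' ⟶ B} {s : B ⊗ X ≅ Y₁} {s₂ : B' ⊗ X' ≅ Y₂}
      {s₃ : B' ⊗ X ≅ Y₃} {m : Y₃ ⟶ Y₁} {k : Y₃ ⟶ Y₂} {b : X ⟶ X'} {G : A ⊗ B ⟶ C} {G₂ : A ⊗ B' ⟶ C'}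
      {p : C' ⟶ C} {H : C ⊗ X ⟶ Z} {H' : C' ⊗ X' ⟶ Z}
      (h2 : (f ▷ X) ≫ s.hom = s₃.hom ≫ m) (h3 : (B' ◁ b) ≫ s₂.hom = s₃.hom ≫ k)
      (h4 : G₂ ≫ p = (A ◁ f) ≫ G) (h5 : (p ▷ X) ≫ H = (C' ◁ b) ≫ H'),
      (A ◁ m) ≫ (A ◁ s.inv) ≫ (α_ _ _ _).inv ≫ (G ▷ X) ≫ H =
        (A ◁ k) ≫ (A ◁ s₂.inv) ≫ (α_ _ _ _).inv ≫ (G₂ ▷ X') ≫ H' := by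
    intros
    rename_i h2 h3 h4 h5
    rw [← Iso.inv_comp_eq] at h2 h3
    rw [← whiskerLeft_comp_assoc, ← whiskerLeft_comp_assoc, ← h2, ← h3]
    simp only [assoc, Iso.hom_inv_id, comp_id, whiskerLeft_comp]
    rw [associator_inv_naturality_middle_assoc, ← comp_whiskerRight_assoc, ← h4,
      associator_inv_naturality_right_assoc, whisker_exchange_assoc, ← h5, comp_whiskerRight_assoc]
  exact aux h2 h3 h4 h5

lemma asc_asi {L : S → Type} [∀ s, Enum (L s)] {l : ∀ s, L s → M} {x : ∀ s (t : T s), U (r s t) → L s}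
    {D E F : LambdaSeq V} (hr : IsPart r) (hw : IsPart w) (hx : ∀ s, IsPart (x s)) (hl : IsPart l)
    {Z : V} {h : ev (kelly D (kelly E F)).seq M ⟶ Z} {h' : ev (kelly (kelly D E) F).seq M ⟶ Z} :
    asc D E F hr hx hl ≫ h = (Gen D E hr ▷ _) ≫ Gen (kelly D E) F hw ≫ h' ↔
    (_ ◁ utMap fun s => Gen E F (hx s)) ≫ Gen D (kelly E F) hl ≫ h = asi D E F hr hw ≫ h' := by
  have aux : ∀ {A B X Y C Q Z Z' : V} {s : B ⊗ X ≅ Y} {m : Y ⟶ C} {g : A ⊗ C ⟶ Z} {h : Z ⟶ Z'}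
      {k : A ⊗ B ⟶ Q} {k' : Q ⊗ X ⟶ Z'}, ((α_ _ _ _).hom ≫ (A ◁ (s.hom ≫ m)) ≫ g) ≫ h = (k ▷ X) ≫ k' ↔
      (A ◁ m) ≫ g ≫ h = (A ◁ s.inv) ≫ (α_ _ _ _).inv ≫ (k ▷ X) ≫ k' := by
    intros
    rw [← whiskerLeftIso_inv, Iso.eq_inv_comp, Iso.eq_inv_comp]
    simp
  refine aux.trans ?_
  rw [asi]
  simp only [assoc]

lemma IsPart.sigma {N : S → Type} {L : S → Type} {U : ∀ s, N s → Type} {l : ∀ s, L s → M}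
    {x : ∀ s (t : N s), U s t → L s} (hl : IsPart l) (hx : ∀ s, IsPart (x s)) :
    IsPart fun (n : Σ s, N s) (u : U n.1 n.2) => l n.1 (x n.1 n.2 u) := by
  refine ⟨?_, fun m => ?_⟩
  · rintro ⟨⟨s, t⟩, u⟩ ⟨⟨s', t'⟩, u'⟩ h
    obtain ⟨rfl, h1⟩ := Sigma.mk.inj_iff.1 (@hl.1 ⟨s, _⟩ ⟨s', _⟩ h)
    obtain ⟨rfl, h2⟩ := Sigma.mk.inj_iff.1 (@(hx s).1 ⟨t, u⟩ ⟨t', u'⟩ (eq_of_heq h1))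
    cases h2
    rfl
  · obtain ⟨⟨s, q⟩, rfl⟩ := hl.2 m
    obtain ⟨⟨t, u⟩, rfl⟩ := (hx s).2 q
    exact ⟨⟨⟨s, t⟩, u⟩, rfl⟩

variable [TensorCocts V]

lemma exists_asi_desc (D E F : LambdaSeq V) {k : ℕ} {L : Fin k → Type} [∀ s, Enum (L s)]
    {l : ∀ s, L s → M} (hl : IsPart l) :
    ∃ t : ev D.seq (Fin k) ⊗ (ut fun s => ev (kelly E F).seq (L s)) ⟶ ev (kelly (kelly D E) F).seq M,
      ∀ {N : Type} [Enum N] {T : Fin k → Type} [∀ s, Enum (T s)] {U : N → Type} [∀ n, Enum (U n)]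
        {r : ∀ s, T s → N} {w : ∀ n, U n → M} {x : ∀ s (t : T s), U (r s t) → L s} (hr : IsPart r)
        (hw : IsPart w) (hx : ∀ s, IsPart (x s)), (∀ s t u, l s (x s t u) = w (r s t) u) →
        (_ ◁ utMap fun s => Gen E F (hx s)) ≫ t = asi D E F hr hw := by
  have H := Pres.exists_finTensor_desc (fun s => kellyPres E F (L s)) (W := ev D.seq (Fin k))
    (Z := ev (kelly (kelly D E) F).seq M)
    (fun p : ∀ s, Part (L s) => asi D E F (IsPart.mk (S := Fin k) (T := fun s => (p s).S))
      (hl.sigma fun s => (p s).hr)) (by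
      intro (a : ∀ s, Part (L s)) (b : ∀ s, Part (L s)) Y y y' hy
      choose φ f he u hf h1 h2 using hy
      let Φ : (Σ s, (a s).S) ↪ Σ s, (b s).S :=
        ⟨fun n => ⟨n.1, φ n.1 n.2⟩, by
          rintro ⟨s, n⟩ ⟨s', n'⟩ h
          obtain rfl : s = s' := congrArg Sigma.fst h
          exact congrArg (Sigma.mk s) ((φ s).injective (eq_of_heq (Sigma.mk.inj_iff.1 h).2))⟩
      have h3 := asi_right D E F (S := Fin k) (IsPart.mk (T := fun s => (a s).S)) (IsPart.mk (T := fun s => (b s).S))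
        (U := fun n => (a n.1).T n.2) (U' := fun n => (b n.1).T n.2)
        (hl.sigma fun s => (a s).hr) (hl.sigma fun s => (b s).hr) Φ φ (fun _ _ => rfl)
        (fun n n' h => (Equiv.cast (congrArg (fun n => (b n.1).T n.2) h.symm)).toEmbedding.trans
          (f n.1 n.2 _ rfl)) (fun n' hn' => he n'.1 n'.2 fun ⟨t, ht⟩ => hn' ⟨⟨n'.1, t⟩,
            congrArg (Sigma.mk n'.1) ht⟩) (by
          rintro n _ rfl u
          exact congrArg (l n.1) (hf n.1 n.2 _ rfl u)) f he (by
          rintro s t _ rfl h' u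
          rfl)
      have h4 : ∀ {X X' : Fin k → V} {Y : Fin k → V} {g : ∀ s, Y s ⟶ X s} {c : ∀ s, X s ⟶ X' s}
          {d : ∀ s, Y s ⟶ X' s} (h : ∀ s, d s = g s ≫ c s), finTensorMap d =
          finTensorMap g ≫ finTensorMap c := fun h => by
        rw [funext h]
        exact tensMap_comp _ _ _
      have aux : ∀ {W A B C D E : V} {y : A ⟶ B} {u : A ⟶ C} {c : C ⟶ B} {d : C ⟶ D} {y' : A ⟶ D}
          {g : W ⊗ B ⟶ E} {g' : W ⊗ D ⟶ E} (h1 : y = u ≫ c) (h2 : y' = u ≫ d)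
          (h3 : (W ◁ c) ≫ g = (W ◁ d) ≫ g'), (W ◁ y) ≫ g = (W ◁ y') ≫ g' := by
        rintro W A B C D E _ u c d _ g g' rfl rfl h3
        rw [whiskerLeft_comp_assoc, h3, whiskerLeft_comp_assoc]
      exact aux (h4 h1) (h4 h2) h3)
  obtain ⟨t, ht⟩ := H
  refine ⟨t, fun {N} _ {T} _ {U} _ {r w x} hr hw hx h => ?_⟩
  refine (ht fun s => ⟨T s, fun t => U (r s t), x s, hx s⟩).trans ?_
  have hn : ∀ (n : N) (n' : Σ s, T s), hr.equiv.symm.toEmbedding n = n' → r n'.1 n'.2 = n := by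
    rintro n _ rfl
    exact hr.equiv.apply_symm_apply n
  have h3 := asi_right D E F (S := Fin k) hr IsPart.mk hw
    (U' := fun n : (Σ s, T s) => U (r n.1 n.2)) (hl.sigma hx) hr.equiv.symm.toEmbedding
    (fun s => Embedding.refl _) (fun s t => (hr.equiv_symm s t).symm)
    (fun n n' h => (Equiv.cast (congrArg U (hn n n' h))).toEmbedding)
    (fun n' hn' => absurd (hr.equiv.symm.surjective n') hn') (fun n n' h' u => (h _ _ _).trans
      (apply_cast (w := w) (hn n n' h') u).symm) (fun s t t' ht => (Equiv.cast (by rw [← ht]; rfl)).toEmbedding)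
    (fun s t' ht' => absurd ⟨t', rfl⟩ ht') (by
      rintro s t _ rfl h' u
      rfl)
  have h4 : ∀ s, (res E.seq (Embedding.refl (T s)) ▷ ut fun t => ev F.seq (U (r s t))) = 𝟙 _ :=
    fun s => by rw [res_refl, id_whiskerRight]
  have h5 : ∀ s, (ev E.seq (T s) ◁ utRes F (T := fun t => U (r s t)) (T' := fun t => U (r s t))
      (Embedding.refl (T s))
      (fun t t' ht => (Equiv.cast (by rw [← ht]; rfl)).toEmbedding)
      (fun t' ht' => absurd ⟨t', rfl⟩ ht')) = 𝟙 _ := fun s => by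
    refine (congrArg (fun z => _ ◁ z) (utRes_id F (T₁ := fun t => U (r s t)) _ _ _ (fun _ => rfl)
      (fun _ _ _ => rfl))).trans (whiskerLeft_id _ _)
  have aux : ∀ {W B E : V} {c d : B ⟶ B}
      {g g' : W ⊗ B ⟶ E} (h1 : c = 𝟙 _) (h2 : d = 𝟙 _)
      (h3 : (W ◁ c) ≫ g = (W ◁ d) ≫ g'), g' = g := by
    rintro W B E _ _ g g' rfl rfl h3
    simpa using h3.symm
  exact aux ((congrArg (fun z => utMap z) (funext h4)).trans (utMap_id _))
    ((congrArg (fun z => utMap z) (funext h5)).trans (utMap_id _)) h3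

lemma exists_ascInv (D E F : LambdaSeq V) (M : Type) [Enum M] :
    ∃ t : ev (kelly D (kelly E F)).seq M ⟶ ev (kelly (kelly D E) F).seq M,
      ∀ {k : ℕ} {N : Type} [Enum N] {L : Fin k → Type} [∀ s, Enum (L s)] {T : Fin k → Type}
        [∀ s, Enum (T s)] {U : N → Type} [∀ n, Enum (U n)] {l : ∀ s, L s → M}
        {r : ∀ s, T s → N} {w : ∀ n, U n → M} {x : ∀ s (t : T s), U (r s t) → L s} (hl : IsPart l) (hr : IsPart r)
        (hw : IsPart w) (hx : ∀ s, IsPart (x s)), (∀ s t u, l s (x s t u) = w (r s t) u) →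
        (_ ◁ utMap fun s => Gen E F (hx s)) ≫ Gen D (kelly E F) hl ≫ t = asi D E F hr hw := by
  choose m hm using fun {k : ℕ} {L : Fin k → Type} [∀ s, Enum (L s)]
    {l : ∀ s, L s → M} (hl : IsPart l) => exists_asi_desc D E F hl
  obtain ⟨t, ht⟩ := KellyConeFin.exists_desc (D := D) (E := kelly E F) (N := M) (W := 𝟙_ V)
    (Z := ev (kelly (kelly D E) F).seq M)
    { map := fun hl => (λ_ _).hom ≫ m hl
      law := fun {k k'} {L} _ {L'} _ {l l'} hl hl' φ g he' hg => by
        rw [leftUnitor_naturality_assoc, leftUnitor_naturality_assoc]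
        refine whisker_eq _ (Pres.finTensor_hom_ext (fun s => kellyPres E F (L s))
          fun (p : ∀ s, Part (L s)) => ?_)
        let N := Σ s, (p s).S
        let hr : IsPart fun s (t : (p s).S) => (⟨s, t⟩ : N) := IsPart.mk
        let hw := hl.sigma fun s => (p s).hr
        let T' : Fin k' → Type := fun s' => Σ s : {s // φ s = s'}, (p s.1).S
        let r' : ∀ s', T' s' → N := fun s' t => ⟨t.1.1, t.2⟩
        have hr' : IsPart r' := by
          refine ⟨?_, fun ⟨s, n⟩ => ⟨⟨φ s, ⟨⟨s, rfl⟩, n⟩⟩, rfl⟩⟩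
          rintro ⟨_, ⟨s, rfl⟩, n⟩ ⟨_, ⟨s', rfl⟩, n'⟩ h
          cases h
          rfl
        have hb : ∀ s s' h, Function.Bijective (g s s' h) := by
          rintro s _ rfl
          refine ⟨(g s _ rfl).injective, fun t => ?_⟩
          obtain ⟨s', t', h⟩ := hl'.exists (l s t)
          by_cases hs : s' ∈ range φ
          · obtain ⟨s₁, rfl⟩ := hs
            rw [hg s₁ _ rfl] at h
            obtain rfl := hl.inj' h
            exact ⟨t', hl.inj _ h⟩
          · exact (he' _ hs).elim t'
        let σ : ∀ s s', φ s = s' → (L s ≃ L' s') := fun s s' h => (Equiv.ofBijective _ (hb s s' h)).symm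
        have hσ : ∀ s s' h t, g s s' h (σ s s' h t) = t :=
          fun s s' h t => (Equiv.ofBijective _ (hb s s' h)).apply_symm_apply t
        let x' : ∀ s' (t : T' s'), (p (r' s' t).1).T (r' s' t).2 → L' s' :=
          fun s' t u => σ t.1.1 s' t.1.2 ((p t.1.1).r t.2 u)
        have hw' : ∀ s t u, l' s (x' s t u) = l (r' s t).1 ((p (r' s t).1).r (r' s t).2 u) := by
          rintro _ ⟨⟨s, rfl⟩, t⟩ u
          rw [hg _ _ rfl]
          exact congrArg (l s) (hσ _ _ _ _)
        have hx' : ∀ s', IsPart (x' s') := by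
          intro s'
          refine ⟨?_, fun q => ?_⟩
          · rintro ⟨⟨⟨s, rfl⟩, t⟩, u⟩ ⟨⟨⟨s', hs⟩, t'⟩, u'⟩ h
            obtain rfl := φ.injective hs
            cases @(p _).hr.1 ⟨t, u⟩ ⟨t', u'⟩ ((σ _ _ _).injective h)
            rfl
          · by_cases hs : s' ∈ range φ
            · obtain ⟨s, rfl⟩ := hs
              obtain ⟨t, u, h⟩ := (p s).hr.exists ((σ s _ rfl).symm q)
              exact ⟨⟨⟨⟨s, rfl⟩, t⟩, u⟩, (congrArg (σ s _ rfl) h).trans ((σ s _ rfl).apply_symm_apply q)⟩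
            · exact (he' _ hs).elim q
        let f : ∀ s s', φ s = s' → (T' s' ↪ (p s).S) := fun s s' h =>
          ⟨fun t => cast (by rw [φ.injective (h.trans t.1.2.symm)]) t.2, by
            subst h
            rintro ⟨⟨s₁, h₁⟩, t₁⟩ ⟨⟨s₂, h₂⟩, t₂⟩ h
            obtain rfl := φ.injective h₁
            obtain rfl := φ.injective h₂
            obtain rfl : t₁ = t₂ := h
            rfl⟩
        have hf : ∀ s s' h t', r' s' t' = ⟨s, f s s' h t'⟩ := by
          rintro s _ rfl ⟨⟨s₁, h₁⟩, t₁⟩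
          obtain rfl := φ.injective h₁
          rfl
        have he : ∀ s', s' ∉ range φ → IsEmpty (T' s') := fun s' h => ⟨fun t => h ⟨_, t.1.2⟩⟩
        have h1 := asi_left D E F (S := Fin k) (S' := Fin k') hr hr' hw φ f he hf
        have h2 := sh_Gen_left E F (S := Fin k) (S' := Fin k') hr hr' hl (fun s => (p s).hr) hx'
          (w := fun n u => l n.1 ((p n.1).r n.2 u)) (fun _ _ _ => rfl) hw' φ f he hf g he' hg
        have h3 := hm hl hr hw (fun s => (p s).hr) fun _ _ _ => rfl
        have h4 := hm hl' hr' hw hx' hw'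
        have aux : ∀ {A A' B C C' Q X Y Z : V} {d : A ⟶ A'} {b : B ⟶ C} {j : A' ⊗ C ⟶ Z} {a : A' ⊗ B ⟶ Z}
            {s : X ≅ B} {u : C ⟶ C'} {v : X ⟶ Y} {s' : Y ⟶ Q} {b' : Q ⟶ C'} {a' : A ⊗ Q ⟶ Z}
            {j' : A ⊗ C' ⟶ Z}
            (h1 : (d ▷ B) ≫ a = (A ◁ (s.inv ≫ v ≫ s')) ≫ a') (h2 : s.hom ≫ b ≫ u = v ≫ s' ≫ b')
            (h3 : (A' ◁ b) ≫ j = a) (h4 : (A ◁ b') ≫ j' = a'),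
            (A ◁ b) ≫ (d ▷ C) ≫ j = (A ◁ b) ≫ (A ◁ u) ≫ j' := by
          intros
          rename_i h1 h2 h3 h4
          rw [whisker_exchange_assoc, h3, h1, ← h4, ← whiskerLeft_comp_assoc, ← whiskerLeft_comp_assoc,
            assoc, assoc, ← h2, Iso.inv_hom_id_assoc]
        exact aux h1 h2 h3 h4 }
  refine ⟨(λ_ _).inv ≫ t, fun hl hr hw hx h => ?_⟩
  have h1 := ht hl
  refine Eq.trans (whisker_eq _ ?_) (hm hl hr hw hx h)
  rw [leftUnitor_inv_naturality_assoc, h1, Iso.inv_hom_id_assoc]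

end Associator
section Associator

variable [SymmetricCategory V]

lemma tensUnits_tensMap {ι : Type} {X Y : ι → V} (u : ∀ i, 𝟙_ V ⟶ X i) (g : ∀ i, X i ⟶ Y i) :
    ∀ l : List ι, tensUnits u l ≫ tensMap g l = tensUnits (fun i => u i ≫ g i) l
  | [] => comp_id _
  | a :: l => by
    rw [tensUnits, tensMap, assoc, tensorHom_comp_tensorHom, tensUnits_tensMap u g l, tensUnits]

lemma utUnits_utMap {S : Type} [Enum S] {A B : S → V} (u : ∀ s, 𝟙_ V ⟶ A s) (g : ∀ s, A s ⟶ B s) :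
    utUnits u ≫ utMap g = utUnits fun s => u s ≫ g s := tensUnits_tensMap _ _ _

variable [HasColimits V] [TensorCocts V]

lemma exists_ascHom (D E F : LambdaSeq V) :
    ∃ t : kelly (kelly D E) F ⟶ kelly D (kelly E F), ∀ {S N M : Type} [Enum S] [Enum N] [Enum M]
      {T : S → Type} [∀ s, Enum (T s)] {U : N → Type} [∀ n, Enum (U n)] {L : S → Type}
      [∀ s, Enum (L s)] {r : ∀ s, T s → N} {w : ∀ n, U n → M} {l : ∀ s, L s → M}
      {x : ∀ s (t : T s), U (r s t) → L s} (hr : IsPart r) (hw : IsPart w) (hx : ∀ s, IsPart (x s))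
      (hl : IsPart l), (∀ s t u, l s (x s t u) = w (r s t) u) →
        (Gen D E hr ▷ _) ≫ Gen (kelly D E) F hw ≫ t.hom.app (op ⟨Enum.n M⟩) = asc D E F hr hx hl := by
  obtain ⟨t, ht⟩ := exists_ascNat D E F
  refine ⟨⟨t, ?_⟩, ht⟩
  have h0 : IsEmpty (Fin 0) := inferInstance
  have hp : ∀ {S : Type} {N : Type} (hS : IsEmpty S) (hN : IsEmpty N) {T : S → Type} (r : ∀ s, T s → N), IsPart r :=
    fun hS hN T r => ⟨fun x => hS.elim x.1, fun n => hN.elim n⟩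
  let T : Fin 0 → Type := fun _ => Fin 0
  let r : ∀ s, T s → Fin 0 := fun s _ => s
  have hr : IsPart r := hp h0 h0 r
  let u (D : LambdaSeq V) (s : Fin 0) : 𝟙_ V ⟶ ev D.seq (T s) := bs D h0
  have h1 := bs_Gen D E hr h0 h0 (u E)
  have h2 := bs_Gen (kelly D E) F hr h0 h0 (u F)
  have h3 := ht hr hr (x := fun s _ _ => s) (fun s => s.elim0) hr fun s => s.elim0
  have h4 := utUnits_sh hr (u E) (u F)
  have h5 := utUnits_utMap (fun s : Fin 0 => u E s ≫ (ρ_ _).inv ≫ (_ ◁ utUnits fun t => u F (r s t)))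
    (fun s => Gen E F (r := fun (t : T s) (_ : T (r s t)) => s) (s.elim0))
  have h6 := bs_Gen D (kelly E F) hr h0 h0 (fun s => (u E s ≫ (ρ_ _).inv ≫ (_ ◁ utUnits fun t => u F (r s t))) ≫
    Gen E F (r := fun (t : T s) (_ : T (r s t)) => s) (s.elim0))
  have aux : ∀ {A X Y W L Q Z Z' : V} {b : 𝟙_ V ⟶ A} {u : 𝟙_ V ⟶ X} {v : 𝟙_ V ⟶ Y}
      {G : A ⊗ X ⟶ Q} {H : Q ⊗ Y ⟶ Z} {t : Z ⟶ Z'} {s : X ⊗ Y ⟶ W} {m : W ⟶ L} {K : A ⊗ L ⟶ Z'}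
      {b₁ : 𝟙_ V ⟶ Q} {b₂ : 𝟙_ V ⟶ Z} {b₃ : 𝟙_ V ⟶ Z'} {k : 𝟙_ V ⟶ W} {n : 𝟙_ V ⟶ L}
      (h1 : b ≫ (ρ_ A).inv ≫ (A ◁ u) ≫ G = b₁) (h2 : b₁ ≫ (ρ_ Q).inv ≫ (Q ◁ v) ≫ H = b₂)
      (h3 : (G ▷ Y) ≫ H ≫ t = (α_ _ _ _).hom ≫ (A ◁ (s ≫ m)) ≫ K)
      (h4 : (ρ_ (𝟙_ V)).inv ≫ (u ⊗ₘ v) ≫ s = k) (h5 : k ≫ m = n)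
      (h6 : b ≫ (ρ_ A).inv ≫ (A ◁ n) ≫ K = b₃), b₂ ≫ t = b₃ := by
    rintro A X Y W L Q Z Z' b u v G H t s m K _ _ _ _ _ rfl rfl h3 rfl rfl rfl
    simp only [assoc]
    have h7 : G ≫ (ρ_ Q).inv ≫ (Q ◁ v) = (ρ_ _).inv ≫ (_ ◁ v) ≫ (G ▷ Y) := by
      rw [rightUnitor_inv_naturality_assoc, whisker_exchange]
    rw [reassoc_of% h7, h3]
    simp [MonoidalCategory.tensorHom_def]
  exact aux h1 (h2.trans (bs_zero _ _)) h3 h4 h5 (h6.trans (bs_zero _ _))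

/-- The associator. -/
def ascHom (D E F : LambdaSeq V) : kelly (kelly D E) F ⟶ kelly D (kelly E F) :=
  (exists_ascHom D E F).choose

variable {S N M : Type} [Enum S] [Enum N] [Enum M]
      {T : S → Type} [∀ s, Enum (T s)] {U : N → Type} [∀ n, Enum (U n)] {L : S → Type}
      [∀ s, Enum (L s)] {r : ∀ s, T s → N} {w : ∀ n, U n → M} {l : ∀ s, L s → M}
      {x : ∀ s (t : T s), U (r s t) → L s}

lemma Gen_ascHom (D E F : LambdaSeq V) (hr : IsPart r) (hw : IsPart w) (hx : ∀ s, IsPart (x s))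
    (hl : IsPart l) (h : ∀ s t u, l s (x s t u) = w (r s t) u) :
    (Gen D E hr ▷ _) ≫ Gen (kelly D E) F hw ≫ (ascHom D E F).hom.app (op ⟨Enum.n M⟩) =
      asc D E F hr hx hl :=
  (exists_ascHom D E F).choose_spec hr hw hx hl h

instance (D E F : LambdaSeq V) (n : Lamᵒᵖ) : IsIso ((ascHom D E F).hom.app n) := by
  obtain ⟨t, ht⟩ := exists_ascInv D E F (Fin n.unop.n)
  refine ⟨t, ?_, ?_⟩
  · refine Gen_hom_ext (N := Fin n.unop.n) fun {k U} _ {w} hw => Gen_hom_ext_right fun {k' T} _ {r} hr => ?_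
    have h1 := Gen_ascHom D E F hr hw (fun s => IsPart.mk) (hr.assoc hw) fun _ _ _ => rfl
    have h2 := ht (hr.assoc hw) hr hw (fun s => IsPart.mk) fun _ _ _ => rfl
    have h3 := (asc_asi (h' := 𝟙 _) hr hw (fun s => IsPart.mk) (hr.assoc hw)).2
      (h2.trans (comp_id _).symm)
    have aux : ∀ {A B C D : V} {a : A ⟶ B} {b : B ⟶ C} {t : C ⟶ D} {t' : D ⟶ C} {c : A ⟶ D}
        (h1 : a ≫ b ≫ t = c) (h3 : c ≫ t' = a ≫ b ≫ 𝟙 _), a ≫ b ≫ t ≫ t' = a ≫ b ≫ 𝟙 _ := by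
      intros
      rename_i h1 h3
      rw [← h3, ← h1]
      simp
    exact aux h1 h3
  · refine Gen_hom_ext (N := Fin n.unop.n) fun {k L} _ {l} hl => ?_
    refine Pres.finTensor_hom_ext (fun s => kellyPres E F (L s)) fun (p : ∀ s, Part (L s)) => ?_
    have h1 := Gen_ascHom D E F (S := Fin k) (IsPart.mk (T := fun s => (p s).S)) (hl.sigma fun s => (p s).hr)
      (fun s => (p s).hr) hl fun _ _ _ => rfl
    have h2 := ht hl (IsPart.mk (T := fun s => (p s).S)) (hl.sigma fun s => (p s).hr)
      (fun s => (p s).hr) fun _ _ _ => rfl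
    have h3 := (asc_asi (D := D) (E := E) (F := F) (S := Fin k) (h := 𝟙 _) (IsPart.mk (T := fun s => (p s).S))
      (hl.sigma fun s => (p s).hr) (fun s => (p s).hr) hl).1 ((comp_id _).trans h1.symm)
    have aux : ∀ {A B C D : V} {a : A ⟶ B} {b : B ⟶ C} {t : C ⟶ D} {t' : D ⟶ C} {c : A ⟶ D}
        (h1 : a ≫ b ≫ t = c) (h3 : a ≫ b ≫ 𝟙 _ = c ≫ t'), a ≫ b ≫ t ≫ t' = a ≫ b ≫ 𝟙 _ := by
      intros
      rename_i h1 h3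
      rw [h3, ← h1]
      simp
    exact aux h2 h3

lemma isIso_of_app {D E : LambdaSeq V} (f : D ⟶ E) [∀ n, IsIso (f.hom.app n)] : IsIso f := by
  have : IsIso f.hom := NatIso.isIso_of_isIso_app _
  refine ⟨⟨inv f.hom, ?_⟩, LambdaSeq.hom_ext (IsIso.hom_inv_id f.hom),
    LambdaSeq.hom_ext (IsIso.inv_hom_id f.hom)⟩
  rw [← f.base_hom, assoc, ← NatTrans.comp_app, IsIso.hom_inv_id, NatTrans.id_app, comp_id]

/-- The associator, as an isomorphism. -/
def ascIso (D E F : LambdaSeq V) : kelly (kelly D E) F ≅ kelly D (kelly E F) :=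
  haveI := isIso_of_app (ascHom D E F)
  asIso (ascHom D E F)

lemma kelly_hom_ext {D E F : LambdaSeq V} {f g : kelly D E ⟶ F}
    (h : ∀ {k : ℕ} {N : Type} [Enum N] {T : Fin k → Type} [∀ s, Enum (T s)] {r : ∀ s, T s → N}
      (hr : IsPart r), Gen D E hr ≫ f.hom.app (op ⟨Enum.n N⟩) = Gen D E hr ≫ g.hom.app (op ⟨Enum.n N⟩)) :
    f = g :=
  LambdaSeq.hom_ext (NatTrans.ext (funext fun n => Gen_hom_ext (N := Fin n.unop.n) fun hr => h hr))

lemma kelly_hom_ext₃ {D E F G : LambdaSeq V} {f g : kelly (kelly D E) F ⟶ G}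
    (h : ∀ {k k' : ℕ} {M : Type} [Enum M] {T : Fin k → Type} [∀ s, Enum (T s)] {U : Fin k' → Type}
      [∀ s, Enum (U s)] {r : ∀ s, T s → Fin k'} {w : ∀ n, U n → M} (hr : IsPart r) (hw : IsPart w),
      (Gen D E hr ▷ _) ≫ Gen (kelly D E) F hw ≫ f.hom.app (op ⟨Enum.n M⟩) =
        (Gen D E hr ▷ _) ≫ Gen (kelly D E) F hw ≫ g.hom.app (op ⟨Enum.n M⟩)) :
    f = g :=
  kelly_hom_ext fun hw => Gen_hom_ext_right fun hr => h hr hw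

lemma ascHom_naturality {D D' E E' F F' : LambdaSeq V} (f : D ⟶ D') (g : E ⟶ E') (h : F ⟶ F') :
    kellyMap (kellyMap f g) h ≫ ascHom D' E' F' = ascHom D E F ≫ kellyMap f (kellyMap g h) := by
  refine kelly_hom_ext₃ fun {k k' M} _ {T} _ {U} _ {r w} hr hw => ?_
  have h1 := Gen_ascHom D E F hr hw (fun s => IsPart.mk) (hr.assoc hw) fun _ _ _ => rfl
  have h2 := Gen_ascHom D' E' F' hr hw (fun s => IsPart.mk) (hr.assoc hw) fun _ _ _ => rfl
  have h3 := Gen_naturality f g hr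
  have h4 := Gen_naturality (kellyMap f g) h hw
  have h5 := Gen_naturality f (kellyMap g h) (hr.assoc hw)
  have h6 := sh_naturality hr (fun s => g.hom.app (op ⟨Enum.n (T s)⟩)) (fun n => h.hom.app (op ⟨Enum.n (U n)⟩))
  have h7 : (utMap fun s => Gen E F (IsPart.mk (T := fun t : T s => U (r s t)))) ≫ (utMap fun s => (kellyMap g h).hom.app
      (op ⟨Enum.n (Σ t, U (r s t))⟩)) = (utMap fun s => (g.hom.app (op ⟨Enum.n (T s)⟩)) ⊗ₘ utMap fun t =>
        h.hom.app (op ⟨Enum.n (U (r s t))⟩)) ≫ utMap fun s => Gen E' F' (IsPart.mk (T := fun t : T s => U (r s t))) := by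
    refine (tensMap_comp _ _ _).symm.trans (Eq.trans ?_ (tensMap_comp _ _ _))
    exact congrArg (fun z => tensMap z _) (funext fun s => Gen_naturality g h _)
  have aux : ∀ {A A' B B' X X' Q Q' Z Z' Y Y' J J' K K' : V} {G : A ⊗ B ⟶ Q} {H : Q ⊗ X ⟶ Z} {p : Z ⟶ Z'}
      {t : Z' ⟶ Y'} {t' : Z ⟶ Y} {q : Y ⟶ Y'} {s : B ⊗ X ⟶ J} {m : J ⟶ K} {R : A ⊗ K ⟶ Y}
      {G' : A' ⊗ B' ⟶ Q'} {H' : Q' ⊗ X' ⟶ Z'} {s' : B' ⊗ X' ⟶ J'} {m' : J' ⟶ K'} {R' : A' ⊗ K' ⟶ Y'}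
      {a : A ⟶ A'} {b : B ⟶ B'} {c : X ⟶ X'} {d : Q ⟶ Q'} {e : K ⟶ K'} {n : J ⟶ J'}
      (h1 : (G ▷ X) ≫ H ≫ t' = (α_ _ _ _).hom ≫ (A ◁ (s ≫ m)) ≫ R)
      (h2 : (G' ▷ X') ≫ H' ≫ t = (α_ _ _ _).hom ≫ (A' ◁ (s' ≫ m')) ≫ R')
      (h3 : G ≫ d = (a ⊗ₘ b) ≫ G') (h4 : H ≫ p = (d ⊗ₘ c) ≫ H') (h5 : R ≫ q = (a ⊗ₘ e) ≫ R')
      (h6 : (b ⊗ₘ c) ≫ s' = s ≫ n) (h7 : m ≫ e = n ≫ m'),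
      (G ▷ X) ≫ H ≫ p ≫ t = (G ▷ X) ≫ H ≫ t' ≫ q := by
    intro A A' B B' X X' Q Q' Z Z' Y Y' J J' K K' G H p t t' q s m R G' H' s' m' R' a b c d e n
      h1 h2 h3 h4 h5 h6 h7
    have e1 : (G ▷ X) ≫ H ≫ t' ≫ q = ((G ▷ X) ≫ H ≫ t') ≫ q := by simp
    have e2 : (G ▷ _) ≫ (d ⊗ₘ c) = ((a ⊗ₘ b) ⊗ₘ c) ≫ (G' ▷ _) := by
      rw [← tensorHom_id, ← tensorHom_id, tensorHom_comp_tensorHom, tensorHom_comp_tensorHom, h3,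
        id_comp, comp_id]
    have e3 : (A ◁ (s ≫ m)) ≫ (a ⊗ₘ e) = (a ⊗ₘ (b ⊗ₘ c)) ≫ (A' ◁ (s' ≫ m')) := by
      rw [← id_tensorHom, ← id_tensorHom, tensorHom_comp_tensorHom, tensorHom_comp_tensorHom,
        id_comp, comp_id, reassoc_of% h6, assoc, h7]
    rw [e1, h1, reassoc_of% h4, reassoc_of% e2, h2, assoc, assoc, h5, reassoc_of% e3,
      associator_naturality_assoc]
  exact aux h1 h2 h3 h4 h5 h6 h7

lemma Gen_hom_ext_right₂ {D E F : LambdaSeq V} {W Z : V} {t t' : ev (kelly (kelly D E) F).seq M ⊗ W ⟶ Z}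
    (h : ∀ {k k' : ℕ} {T : Fin k → Type} [∀ s, Enum (T s)] {U : Fin k' → Type}
      [∀ s, Enum (U s)] {r : ∀ s, T s → Fin k'} {w : ∀ n, U n → M} (hr : IsPart r) (hw : IsPart w),
      ((Gen D E hr ▷ _) ▷ W) ≫ (Gen (kelly D E) F hw ▷ W) ≫ t =
        ((Gen D E hr ▷ _) ▷ W) ≫ (Gen (kelly D E) F hw ▷ W) ≫ t') : t = t' := by
  refine Gen_hom_ext_right fun {k U} _ {w} hw => ?_
  rw [← cancel_epi (α_ _ _ _).inv]
  refine Gen_hom_ext_right fun {k' T} _ {r} hr => ?_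
  rw [associator_inv_naturality_left_assoc, h hr hw, associator_inv_naturality_left_assoc]

attribute [local instance] Classical.decEq in
lemma asc_pentagon (D E F G : LambdaSeq V) :
    kellyMap (ascHom D E F) (𝟙 G) ≫ ascHom D (kelly E F) G ≫ kellyMap (𝟙 D) (ascHom E F G) =
      ascHom (kelly D E) F G ≫ ascHom D E (kelly F G) := by
  refine kelly_hom_ext fun {k P} _ {Q} _ {v} hv => Gen_hom_ext_right₂ fun {k₁ k₂ T} _ {U} _ {r w} hr hw => ?_
  have hl := hr.assoc hw
  have hk := hl.assoc hv
  have hx : ∀ s, IsPart fun (t : T s) (u : U (r s t)) => (⟨t, u⟩ : Σ t, U (r s t)) := fun s => IsPart.mk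
  have hy : ∀ s, IsPart fun (p : Σ t, U (r s t)) (q : Q (w (r s p.1) p.2)) =>
    (⟨p, q⟩ : Σ p : (Σ t, U (r s t)), Q (w (r s p.1) p.2)) := fun s => IsPart.mk
  have hz : ∀ n, IsPart fun (u : U n) (q : Q (w n u)) => (⟨u, q⟩ : Σ u, Q (w n u)) := fun n => IsPart.mk
  have hxy := fun s => (hx s).assoc (hy s)
  have h1 := Gen_naturality (ascHom D E F) (𝟙 G) hv
  have hA := Gen_ascHom D E F hr hw hx hl fun _ _ _ => rfl
  have hB := Gen_ascHom D (kelly E F) G hl hv hy hk fun _ _ _ => rfl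
  have hC := Gen_naturality (𝟙 D) (ascHom E F G) hk
  have hD := sh_naturality hl (fun s => Gen E F (hx s)) (fun m => 𝟙 (ev G.seq (Q m)))
  have hE₀ := fun s => Gen_ascHom E F G (hx s) (hy s) (fun t => hz (r s t)) (hxy s) fun _ _ _ => rfl
  have hF := sh_pentagon hr hw hl hx (fun _ _ _ => rfl) (fun s => ev E.seq (T s)) (fun n => ev F.seq (U n))
    (fun m => ev G.seq (Q m))
  have hG := Gen_ascHom (kelly D E) F G hw hv hz (hw.assoc hv) fun _ _ _ => rfl
  have hH := Gen_ascHom D E (kelly F G) hr (hw.assoc hv) hxy hk fun _ _ _ => rfl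
  have hI := sh_naturality hr (fun s => 𝟙 (ev E.seq (T s))) (fun n => Gen F G (hz n))
  have h1' : (utMap fun s => (𝟙 G : G ⟶ G).hom.app (op ⟨Enum.n (Q s)⟩)) = 𝟙 _ := utMap_id _
  have hC' : (𝟙 D : D ⟶ D).hom.app (op ⟨Enum.n (Fin k₁)⟩) = 𝟙 _ := rfl
  have hD₀ : (utMap fun m => 𝟙 (ev G.seq (Q m))) = 𝟙 _ := utMap_id _
  have hI₀ : (utMap fun s => 𝟙 (ev E.seq (T s))) = 𝟙 _ := utMap_id _
  have hF₀ : (utMap fun s => ev E.seq (T s) ◁ utMap fun t => ev F.seq (U (r s t)) ◁ utMap fun u =>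
      eqToHom (congrArg (fun m => ev G.seq (Q m)) (rfl : w (r s t) u = w (r s t) u))) = 𝟙 _ := by
    refine Eq.trans (congrArg (fun z => utMap z) (funext fun s => ?_)) (utMap_id _)
    have e1 : ∀ t, (ev F.seq (U (r s t)) ◁ utMap fun u =>
      eqToHom (congrArg (fun m => ev G.seq (Q m)) (rfl : w (r s t) u = w (r s t) u))) = 𝟙 _ := fun t => by
      refine (congrArg (fun z => _ ◁ z) (utMap_id (fun u => ev G.seq (Q (w (r s t) u))))).trans
        (whiskerLeft_id _ _)
    refine (congrArg (fun z => _ ◁ z) ((congrArg (fun z => utMap z) (funext e1)).trans (utMap_id _))).trans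
        (whiskerLeft_id _ _)
  have hE : (utMap fun s => Gen E F (hx s) ⊗ₘ utMap fun q : Σ t, U (r s t) => 𝟙 (ev G.seq (Q (w (r s q.1) q.2)))) ≫
      (utMap fun s => Gen (kelly E F) G (hy s)) ≫ (utMap fun s => (ascHom E F G).hom.app (op ⟨Enum.n
        (Σ p : (Σ t, U (r s t)), Q (w (r s p.1) p.2))⟩)) =
      (utMap fun s => (α_ _ _ _).hom ≫ (_ ◁ (sh (hx s) (fun t => ev F.seq (U (r s t)))
        (fun p => ev G.seq (Q (w (r s p.1) p.2)))).hom)) ≫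
      (utMap fun s => 𝟙 (ev E.seq (T s)) ⊗ₘ utMap fun t => Gen F G (hz (r s t))) ≫
      utMap fun s => Gen E (kelly F G) (hxy s) := by
    refine (whisker_eq _ (tensMap_comp _ _ _).symm).trans ((tensMap_comp _ _ _).symm.trans ?_)
    refine Eq.trans ?_ (whisker_eq _ (tensMap_comp _ _ _))
    refine Eq.trans ?_ (tensMap_comp _ _ _)
    refine congrArg (fun z => tensMap z _) (funext fun s => ?_)
    have e1 := hE₀ s
    have e2 : (utMap fun q : Σ t, U (r s t) => 𝟙 (ev G.seq (Q (w (r s q.1) q.2)))) = 𝟙 _ := utMap_id _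
    have aux : ∀ {A B C X Y Z K L : V} {g : A ⊗ B ⟶ C} {i : X ⟶ X} {h : C ⊗ X ⟶ Y} {t : Y ⟶ Z}
        {s : B ⊗ X ⟶ K} {m : K ⟶ L} {j : A ⊗ L ⟶ Z} (e2 : i = 𝟙 _)
        (e1 : (g ▷ X) ≫ h ≫ t = (α_ _ _ _).hom ≫ (A ◁ (s ≫ m)) ≫ j),
        (g ⊗ₘ i) ≫ h ≫ t = ((α_ _ _ _).hom ≫ (A ◁ s)) ≫ (𝟙 A ⊗ₘ m) ≫ j := by
      rintro A B C X Y Z K L g _ h t s m j rfl e1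
      rw [tensorHom_id, e1, id_tensorHom]
      simp
    exact aux e2 e1
  have aux : ∀ {A B C X Q1 Q2 Q3 R2 R3 R4 R5 T4 Y1 Y2 Y3 Y4 Y5 Y6 Z1 Z2 Z3 Z5 : V}
      {a : A ⊗ B ⟶ Q1} {b : Q1 ⊗ C ⟶ Q2} {c : Q2 ⊗ X ⟶ Q3} {asc1 : Q2 ⟶ R2} {p1 : Q3 ⟶ R3} {c' : R2 ⊗ X ⟶ R3}
      {s1 : B ⊗ C ⟶ Y1} {m1 : Y1 ⟶ Z1} {d : A ⊗ Z1 ⟶ R2} {p2 : R3 ⟶ R4} {s2 : Z1 ⊗ X ⟶ Y2} {m2 : Y2 ⟶ Z2}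
      {e : A ⊗ Z2 ⟶ R4} {p3 : R4 ⟶ R5} {n : Z2 ⟶ Z3} {e' : A ⊗ Z3 ⟶ R5} {s2' : Y1 ⊗ X ⟶ Y3} {m1' : Y3 ⟶ Y2}
      {o : Y3 ⟶ Y4} {f : Y4 ⟶ Y6} {g : Y6 ⟶ Z3} {s3 : C ⊗ X ⟶ Y5} {s4 : B ⊗ Y5 ⟶ Y4} {p4 : Q3 ⟶ T4}
      {m3 : Y5 ⟶ Z5} {k : Q1 ⊗ Z5 ⟶ T4} {p5 : T4 ⟶ R5} {s5 : B ⊗ Z5 ⟶ Y6}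
      {i : X ⟶ X} {i' : A ⟶ A} {i₂ : X ⟶ X} {i₃ : B ⟶ B} {i₄ : Y4 ⟶ Y4}
      (hi : i = 𝟙 _) (hi' : i' = 𝟙 _) (hi₂ : i₂ = 𝟙 _) (hi₃ : i₃ = 𝟙 _) (hi₄ : i₄ = 𝟙 _)
      (h1 : c ≫ p1 = (asc1 ⊗ₘ i) ≫ c')
      (hA : (a ▷ C) ≫ b ≫ asc1 = (α_ _ _ _).hom ≫ (A ◁ (s1 ≫ m1)) ≫ d)
      (hB : (d ▷ X) ≫ c' ≫ p2 = (α_ _ _ _).hom ≫ (A ◁ (s2 ≫ m2)) ≫ e)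
      (hC : e ≫ p3 = (i' ⊗ₘ n) ≫ e')
      (hD : (m1 ⊗ₘ i₂) ≫ s2 = s2' ≫ m1')
      (hE : m1' ≫ m2 ≫ n = o ≫ f ≫ g)
      (hF : (s1 ▷ X) ≫ s2' ≫ o = (α_ _ _ _).hom ≫ (B ◁ s3) ≫ s4 ≫ i₄)
      (hG : (b ▷ X) ≫ c ≫ p4 = (α_ _ _ _).hom ≫ (Q1 ◁ (s3 ≫ m3)) ≫ k)
      (hH : (a ▷ Z5) ≫ k ≫ p5 = (α_ _ _ _).hom ≫ (A ◁ (s5 ≫ g)) ≫ e')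
      (hI : (i₃ ⊗ₘ m3) ≫ s5 = s4 ≫ f),
      ((a ▷ C) ▷ X) ≫ (b ▷ X) ≫ c ≫ p1 ≫ p2 ≫ p3 = ((a ▷ C) ▷ X) ≫ (b ▷ X) ≫ c ≫ p4 ≫ p5 := by
    rintro A B C X Q1 Q2 Q3 R2 R3 R4 R5 T4 Y1 Y2 Y3 Y4 Y5 Y6 Z1 Z2 Z3 Z5 a b c asc1 p1 c' s1 m1 d p2 s2 m2
      e p3 n e' s2' m1' o f g s3 s4 p4 m3 k p5 s5 _ _ _ _ _ rfl rfl rfl rfl rfl h1 hA hB hC hD hE hF hG hH hI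
    rw [tensorHom_id] at h1 hD
    rw [id_tensorHom] at hC hI
    rw [comp_id] at hF
    have l1 : ((s1 ≫ m1) ▷ X) ≫ s2 ≫ m2 ≫ n = (α_ _ _ _).hom ≫ (B ◁ (s3 ≫ m3)) ≫ s5 ≫ g := by
      rw [comp_whiskerRight_assoc, reassoc_of% hD, hE, reassoc_of% hF, whiskerLeft_comp_assoc,
        reassoc_of% hI]
    have l2 : ((a ▷ C) ▷ X) ≫ (b ▷ X) ≫ (asc1 ▷ X) = ((α_ _ _ _).hom ▷ X) ≫ ((A ◁ (s1 ≫ m1)) ▷ X) ≫ (d ▷ X) := by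
      rw [← comp_whiskerRight, ← comp_whiskerRight, hA, comp_whiskerRight, comp_whiskerRight]
    have l3 : ((a ▷ C) ▷ X) ≫ (α_ _ _ _).hom ≫ (Q1 ◁ (s3 ≫ m3)) = (α_ _ _ _).hom ≫ (_ ◁ (s3 ≫ m3)) ≫ (a ▷ Z5) := by
      rw [associator_naturality_left_assoc, whisker_exchange]
    rw [reassoc_of% h1, reassoc_of% l2, reassoc_of% hB, hC, reassoc_of% hG, reassoc_of% l3, hH,
      associator_naturality_middle_assoc, associator_naturality_right_assoc, ← pentagon_assoc,
      ← whiskerLeft_comp_assoc, ← whiskerLeft_comp_assoc, ← whiskerLeft_comp_assoc, ← whiskerLeft_comp_assoc]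
    simp only [assoc]
    rw [l1]
  exact aux h1' hC' hD₀ hI₀ hF₀ h1 hA hB hC hD hE hF hG hH hI

end Associator
section UnitObject

variable {S S' : Type} [Enum S] [Enum S']

section One

lemma tensUnits_eqToHom {ι : Type} {X : ι → V} (u : ∀ i, 𝟙_ V ⟶ X i) {l m : List ι} (h : l = m) :
    tensUnits u l ≫ eqToHom (congrArg (tens X) h) = tensUnits u m := by
  subst h
  simp

lemma finTensorOne_naturality {A B : Fin 1 → V} (g : ∀ i, A i ⟶ B i) :
    finTensorMap g ≫ (finTensorOne B).hom = (finTensorOne A).hom ≫ g 0 := by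
  have h1 := tensMap_eqToHom g (List.finRange_succ (n := 0))
  have h2 : tensMap g (0 :: List.map Fin.succ (List.finRange 0)) ≫ (ρ_ (B 0)).hom =
    (ρ_ (A 0)).hom ≫ g 0 := (eq_whisker (tensorHom_id _ _) _).trans (rightUnitor_naturality _)
  have aux : ∀ {X X' Y Y' Z Z' : V} {e : X ⟶ Y} {e' : X' ⟶ Y'} {t : X ⟶ X'} {m : Y ⟶ Y'} {p : Y ⟶ Z}
      {p' : Y' ⟶ Z'} {z : Z ⟶ Z'} (h1 : e ≫ m = t ≫ e') (h2 : m ≫ p' = p ≫ z),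
      t ≫ e' ≫ p' = (e ≫ p) ≫ z := by
    intros
    rename_i h1 h2
    rw [← reassoc_of% h1, h2, assoc]
  exact aux h1 h2

lemma finTensorUnits_one {A : Fin 1 → V} (u : ∀ i, 𝟙_ V ⟶ A i) :
    finTensorUnits u ≫ (finTensorOne A).hom = u 0 := by
  have h1 := tensUnits_eqToHom u (List.finRange_succ (n := 0))
  have h2 : tensUnits u (0 :: List.map Fin.succ (List.finRange 0)) ≫ (ρ_ (A 0)).hom = u 0 := by
    refine (assoc _ _ _).trans ?_
    rw [show tensUnits u (List.map Fin.succ (List.finRange 0)) = 𝟙 _ from rfl]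
    refine (whisker_eq _ ((eq_whisker (tensorHom_id _ _) _).trans (rightUnitor_naturality _))).trans ?_
    exact (whisker_eq _ (eq_whisker unitors_equal.symm _)).trans (Iso.inv_hom_id_assoc _ _)
  exact (assoc _ _ _).symm.trans ((eq_whisker h1 _).trans h2)

/-- `𝟙_ V ≅ 𝟙_ V ⊗ ⋯ ⊗ 𝟙_ V` -/
def tensUnitsIso {ι : Type} : ∀ l : List ι, 𝟙_ V ≅ tens (fun _ : ι => 𝟙_ V) l
  | [] => Iso.refl _
  | _ :: l => (λ_ _).symm ≪≫ whiskerLeftIso (𝟙_ V) (tensUnitsIso l)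

lemma tensUnitsIso_hom {ι : Type} : ∀ l : List ι,
    (tensUnitsIso l).hom = tensUnits (fun _ : ι => 𝟙 (𝟙_ V)) l
  | [] => rfl
  | a :: l => by
    rw [tensUnitsIso, tensUnits, Iso.trans_hom, whiskerLeftIso_hom, tensUnitsIso_hom l, id_tensorHom]
    rfl

end One

variable [HasColimits V]

/-- The coprojections of the unit `Λ`-sequence. -/
def unitGen (i : S ↪ Fin 1) : 𝟙_ V ⟶ ev (kellyUnit V).seq S :=
  Sigma.ι (fun _ : (⟨Enum.n S⟩ : Lam) ⟶ ⟨1⟩ => 𝟙_ V) (lamHom i)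

lemma unitGen_res (x : S ↪ S') (i : S' ↪ Fin 1) (j : S ↪ Fin 1) :
    unitGen i ≫ res (kellyUnit V).seq x = unitGen j := by
  have h : lamHom x ≫ lamHom i = lamHom j :=
    Embedding.ext fun q => Subsingleton.elim (α := Fin 1) _ _
  have h1 : unitGen i ≫ res (kellyUnit V).seq x =
      Sigma.ι (fun _ : (⟨Enum.n S⟩ : Lam) ⟶ ⟨1⟩ => 𝟙_ V) (lamHom x ≫ lamHom i) := by
    refine (Limits.Sigma.ι_comp_map' _ _ _).trans ?_
    exact id_comp _
  rw [h1, h]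
  rfl

lemma bs_unit (hS : IsEmpty S) (j : S ↪ Fin 1) : bs (kellyUnit V) hS = unitGen j :=
  unitGen_res (S' := Fin 0) _ Embedding.ofIsEmpty j

lemma kellyUnitGen_eq (i : Fin 1 ↪ Fin 1) : kellyUnitGen V = unitGen i := by
  have h : lamHom i = 𝟙 (⟨1⟩ : Lam) :=
    Embedding.ext fun q => Subsingleton.elim (α := Fin 1) _ _
  exact (congrArg (fun x => Sigma.ι (fun _ : (⟨1⟩ : Lam) ⟶ ⟨1⟩ => 𝟙_ V) x) h).symm

instance embedding_subsingleton {T : Type} : Subsingleton (T ↪ Fin 1) :=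
  ⟨fun i j => Embedding.ext fun _ => Subsingleton.elim _ _⟩

instance (n : ℕ) : Fintype ((⟨n⟩ : Lam) ⟶ ⟨1⟩) := inferInstanceAs (Fintype (Fin n ↪ Fin 1))

variable [TensorCocts V]

/-- The presentation of the values of the unit `Λ`-sequence. -/
def unitPres (S : Type) [Enum S] : Pres (ev (kellyUnit V).seq S) where
  A := ULift.{1} (S ↪ Fin 1)
  X _ := 𝟙_ V
  g i := unitGen i.down
  Rel a b _ y y' := a = b ∧ y = y'
  refl a := ⟨rfl, rfl⟩
  hom_ext {W Z t t'} h := by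
    refine (isColimitOfPreserves (tensorLeft W) (colimit.isColimit
      (Discrete.functor fun _ : (⟨Enum.n S⟩ : Lam) ⟶ ⟨1⟩ => 𝟙_ V))).hom_ext ?_
    rintro ⟨x⟩
    have hx : lamHom (S := S) (Enum.e.toEmbedding.trans (Lam.emb x)) = x :=
      Embedding.ext fun q => Subsingleton.elim (α := Fin 1) _ _
    have := h ⟨Enum.e.toEmbedding.trans (Lam.emb x)⟩
    simp only [unitGen] at this
    rw [hx] at this
    exact this
  exists_desc {W Z} h w := by
    refine ⟨(isColimitOfPreserves (tensorLeft W) (colimit.isColimit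
      (Discrete.functor fun _ : (⟨Enum.n S⟩ : Lam) ⟶ ⟨1⟩ => 𝟙_ V))).desc
        (Cocone.mk Z (Discrete.natTrans fun x => h ⟨Enum.e.toEmbedding.trans (Lam.emb x.as)⟩)), ?_⟩
    rintro ⟨i⟩
    refine ((isColimitOfPreserves (tensorLeft W) (colimit.isColimit
      (Discrete.functor fun _ : (⟨Enum.n S⟩ : Lam) ⟶ ⟨1⟩ => 𝟙_ V))).fac _ ⟨lamHom i⟩).trans ?_
    exact congrArg (fun i => h ⟨i⟩) (Subsingleton.elim _ _)

end UnitObject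

section LeftUnitor

variable [SymmetricCategory V] [HasColimits V]
  [TensorCocts V]
  {S S' N N' : Type} [Enum S] [Enum S'] [Enum N] [Enum N']
  {T : S → Type} [∀ s, Enum (T s)] {T' : S' → Type} [∀ s, Enum (T' s)]
  {r : ∀ s, T s → N} {r' : ∀ s, T' s → N'}

lemma unitGen_hom_ext_right {X Z : V} {t t' : ev (kellyUnit V).seq S ⊗ X ⟶ Z}
    (h : ∀ i : S ↪ Fin 1, (unitGen i ▷ X) ≫ t = (unitGen i ▷ X) ≫ t') : t = t' := by
  rw [← cancel_epi (λ_ _).hom]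
  refine (unitPres S).hom_ext_right fun i => ?_
  have h1 := h i.down
  change (𝟙_ V ◁ (unitGen i.down ▷ X)) ≫ _ = (𝟙_ V ◁ (unitGen i.down ▷ X)) ≫ _
  rw [leftUnitor_naturality_assoc, leftUnitor_naturality_assoc, h1]

lemma exists_unitGen_desc_right {X Z : V} (h : (S ↪ Fin 1) → (X ⟶ Z)) :
    ∃ t : ev (kellyUnit V).seq S ⊗ X ⟶ Z, ∀ i : S ↪ Fin 1, (unitGen i ▷ X) ≫ t = (λ_ X).hom ≫ h i := by
  obtain ⟨t, ht⟩ := (unitPres (V := V) S).exists_desc_right (W := 𝟙_ V) (R := X) (Z := Z)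
    (fun i => (λ_ _).hom ≫ (λ_ _).hom ≫ h i.down) (by rintro a _ Y y _ ⟨rfl, rfl⟩; rfl)
  refine ⟨(λ_ _).inv ≫ t, fun i => ?_⟩
  have h1 : (𝟙_ V ◁ (unitGen i ▷ X)) ≫ t = (λ_ _).hom ≫ (λ_ _).hom ≫ h i := ht ⟨i⟩
  rw [leftUnitor_inv_naturality_assoc, h1, Iso.inv_hom_id_assoc]

lemma IsPart.exists_over_one (hr : IsPart r) (i : S ↪ Fin 1) :
    (∃ f : ∀ s s', i s = s' → (N ↪ T s), ∀ s s' h n, r s (f s s' h n) = n) ∧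
      ∀ s', s' ∉ range i → IsEmpty N := by
  have hS : ∀ s s' : S, s = s' := fun s s' => i.injective (Subsingleton.elim _ _)
  constructor
  · have h1 : ∀ s n, ∃ t, r s t = n := by
      intro s n
      obtain ⟨s', t, h⟩ := hr.exists n
      obtain rfl := hS s s'
      exact ⟨t, h⟩
    choose g hg using h1
    exact ⟨fun s _ _ => ⟨g s, fun n n' h => by rw [← hg s n, h, hg]⟩, fun s _ _ n => hg s n⟩
  · intro s' hs'
    refine ⟨fun n => ?_⟩
    obtain ⟨s, t, h⟩ := hr.exists n
    exact hs' ⟨s, Subsingleton.elim _ _⟩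

lemma exists_leftUnitor (D : LambdaSeq V) : ∃ t : kelly (kellyUnit V) D ⟶ D,
    ∀ {S N : Type} [Enum S] [Enum N] {T : S → Type} [∀ s, Enum (T s)] {r : ∀ s, T s → N}
      (hr : IsPart r) (i : S ↪ Fin 1) (f : ∀ s s', i s = s' → (N ↪ T s))
      (he : ∀ s', s' ∉ range i → IsEmpty N), (∀ s s' h n, r s (f s s' h n) = n) →
      (unitGen i ▷ _) ≫ Gen (kellyUnit V) D hr ≫ t.hom.app (op ⟨Enum.n N⟩) =
        (λ_ _).hom ≫ utRes D i (T' := fun _ : Fin 1 => N) f he ≫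
          (finTensorOne fun _ => ev D.seq N).hom := by
  have h1 : ∀ {S N : Type} [Enum S] [Enum N] {T : S → Type} [∀ s, Enum (T s)] {r : ∀ s, T s → N}
      (hr : IsPart r), ∃ t : ev (kellyUnit V).seq S ⊗ (ut fun s => ev D.seq (T s)) ⟶ ev D.seq N,
      ∀ (i : S ↪ Fin 1) (f : ∀ s s', i s = s' → (N ↪ T s))
      (he : ∀ s', s' ∉ range i → IsEmpty N), (∀ s s' h n, r s (f s s' h n) = n) →
      (unitGen i ▷ _) ≫ t = (λ_ _).hom ≫ utRes D i (T' := fun _ : Fin 1 => N) f he ≫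
          (finTensorOne fun _ => ev D.seq N).hom := by
    intro S N _ _ T _ r hr
    have h2 := fun i : S ↪ Fin 1 => (hr.exists_over_one i).1
    choose f hf using h2
    obtain ⟨t, ht⟩ := exists_unitGen_desc_right (S := S) (X := ut fun s => ev D.seq (T s)) fun i =>
      utRes D i (T' := fun _ : Fin 1 => N) (f i) (hr.exists_over_one i).2 ≫
          (finTensorOne fun _ => ev D.seq N).hom
    refine ⟨t, fun i g he hg => (ht i).trans ?_⟩
    refine whisker_eq _ (eq_whisker (utRes_congr _ _ _ (fun _ => rfl) fun s s' h h' n => ?_) _)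
    exact hr.inj s ((hf i s s' h n).trans (hg s s' h' n).symm)
  choose m hm using @h1
  obtain ⟨t, ht⟩ := KellyFam.exists_desc (D := kellyUnit V) (E := D) (F := D.seq)
    { map := fun hr => m hr
      law := fun {S S' N N'} _ _ _ _ {T} _ {T'} _ {r r'} hr hr' φ f he ψ hψ => by
        refine unitGen_hom_ext_right fun i => ?_
        obtain ⟨⟨f₁, hf₁⟩, he₁⟩ := hr.exists_over_one (φ.trans i)
        obtain ⟨⟨f₂, hf₂⟩, he₂⟩ := hr'.exists_over_one i
        have e1 := hm hr (φ.trans i) f₁ he₁ hf₁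
        have e2 := hm hr' i f₂ he₂ hf₂
        have e3 := unitGen_res (V := V) φ i (φ.trans i)
        have e4 := finTensorOne_naturality (A := fun _ => ev D.seq N) (B := fun _ => ev D.seq N')
          fun _ => res D.seq ψ
        have he₃ : ∀ s', s' ∉ range (φ.trans i) → IsEmpty N' := fun s' hs' =>
          ⟨fun n => (he₁ s' hs').elim (ψ n)⟩
        have e5 : utRes D (φ.trans i) (T' := fun _ : Fin 1 => N) f₁ he₁ ≫
            (utMap (S := Fin 1) fun _ => res D.seq ψ) =
            utRes D φ f he ≫ utRes D i (T' := fun _ : Fin 1 => N') f₂ he₂ := by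
          refine (utSp_utMap _ _ _ _).trans (Eq.trans ?_ (utRes_comp (φ'' := φ.trans i) (f'' :=
            fun s s' h => ψ.trans (f₁ s s' h)) D he he₂ he₃ (fun _ => rfl) ?_).symm)
          · exact utSp_congr rfl (fun _ _ _ _ => res_comp _ _ _) fun _ _ _ => bs_res _ _ _ _
          · intro s s' s'' h h' h'' n
            apply hr.inj s
            exact (hψ s s' h _).symm.trans ((congrArg ψ (hf₂ s' s'' h' n)).trans (hf₁ s s'' h'' _).symm)
        have aux : ∀ {A A' X X' Y Y' Z Z' : V} {u : 𝟙_ V ⟶ A} {v : A ⟶ A'} {u' : 𝟙_ V ⟶ A'}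
            {m : A' ⊗ X ⟶ Z} {m' : A ⊗ X' ⟶ Z'} {p : Z ⟶ Z'} {a : X ⟶ X'} {b : X ⟶ Y} {c : Y ⟶ Z}
            {b' : X' ⟶ Y'} {c' : Y' ⟶ Z'} {d : Y ⟶ Y'} (e3 : u ≫ v = u')
            (e1 : (u' ▷ X) ≫ m = (λ_ _).hom ≫ b ≫ c) (e2 : (u ▷ X') ≫ m' = (λ_ _).hom ≫ b' ≫ c')
            (e4 : d ≫ c' = c ≫ p) (e5 : b ≫ d = a ≫ b'),
            (u ▷ X) ≫ (v ▷ X) ≫ m ≫ p = (u ▷ X) ≫ (A ◁ a) ≫ m' := by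
          rintro A A' X X' Y Y' Z Z' u v _ m m' p a b c b' c' d rfl e1 e2 e4 e5
          rw [comp_whiskerRight, assoc] at e1
          rw [reassoc_of% e1, ← whisker_exchange_assoc, e2, leftUnitor_naturality_assoc,
            ← reassoc_of% e5, e4]
        exact aux e3 e1 e2 e4 e5 }
  refine ⟨⟨t, ?_⟩, fun hr i f he hf => (whisker_eq _ (ht hr)).trans (hm hr i f he hf)⟩
  have h0 : IsEmpty (Fin 0) := inferInstance
  have hr : IsPart fun (s : Fin 0) (_ : Fin 0) => s := ⟨fun x => x.1.elim0, fun n => n.elim0⟩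
  have e1 := bs_Gen (kellyUnit V) D hr h0 h0 (fun s => s.elim0)
  let i : Fin 0 ↪ Fin 1 := Embedding.ofIsEmpty
  have e2 := (whisker_eq (unitGen i ▷ _) (ht hr)).trans (hm hr i (fun s => s.elim0) (fun _ _ => h0)
    fun s => s.elim0)
  have e3 : (utUnits fun s : Fin 0 => (s.elim0 : 𝟙_ V ⟶ ev D.seq (Fin 0))) ≫
      utRes D i (T' := fun _ : Fin 1 => Fin 0) (fun s => s.elim0) (fun _ _ => h0) =
      utUnits (S := Fin 1) fun _ => bs D h0 := utUnits_utSp (fun s => s.elim0) fun _ _ => rfl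
  have e4 := finTensorUnits_one (A := fun _ => ev D.seq (Fin 0)) fun _ => bs D h0
  have e5 := bs_unit (V := V) h0 i
  have e6 := bs_zero (kelly (kellyUnit V) D) h0
  have e7 := bs_zero D h0
  have aux : ∀ {A X Y Z B : V} {b : 𝟙_ V ⟶ A} {u : 𝟙_ V ⟶ X} {G : A ⊗ X ⟶ Z} {t : Z ⟶ B} {x : X ⟶ Y}
      {z z' : 𝟙_ V ⟶ Z} {a : 𝟙_ V ⟶ A} {y : Y ⟶ B} {w : 𝟙_ V ⟶ Y} {c c' : 𝟙_ V ⟶ B}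
      (e1 : b ≫ (ρ_ _).inv ≫ (A ◁ u) ≫ G = z) (e2 : (a ▷ X) ≫ G ≫ t = (λ_ _).hom ≫ x ≫ y) (e3 : u ≫ x = w)
      (e4 : w ≫ y = c) (e5 : b = a) (e6 : z = z') (e7 : c = c'), z' ≫ t = c' := by
    rintro A X Y Z B b u G t x _ _ _ y _ _ _ rfl e2 rfl rfl rfl rfl rfl
    simp only [assoc]
    rw [rightUnitor_inv_naturality_assoc, ← whisker_exchange_assoc, e2, leftUnitor_naturality_assoc]
    rw [unitors_equal, Iso.inv_hom_id_assoc]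
  exact aux e1 e2 e3 e4 e5 e6 e7

/-- The left unitor. -/
def luHom (D : LambdaSeq V) : kelly (kellyUnit V) D ⟶ D := (exists_leftUnitor D).choose

lemma Gen_luHom (D : LambdaSeq V) (hr : IsPart r) (i : S ↪ Fin 1) (f : ∀ s s', i s = s' → (N ↪ T s))
      (he : ∀ s', s' ∉ range i → IsEmpty N) (hf : ∀ s s' h n, r s (f s s' h n) = n) :
      (unitGen i ▷ _) ≫ Gen (kellyUnit V) D hr ≫ (luHom D).hom.app (op ⟨Enum.n N⟩) =
        (λ_ _).hom ≫ utRes D i (T' := fun _ : Fin 1 => N) f he ≫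
          (finTensorOne fun _ => ev D.seq N).hom :=
  (exists_leftUnitor D).choose_spec hr i f he hf

/-- A set as a partition of itself with one part. -/
lemma IsPart.one : IsPart fun (_ : Fin 1) (n : N) => n :=
  ⟨by rintro ⟨s, n⟩ ⟨s', n'⟩ h; obtain rfl : n = n' := h; obtain rfl := Subsingleton.elim s s'; rfl,
    fun n => ⟨⟨0, n⟩, rfl⟩⟩

lemma Gen_luHom_one (D : LambdaSeq V) (i : Fin 1 ↪ Fin 1) :
    (unitGen i ▷ _) ≫ Gen (kellyUnit V) D (IsPart.one (N := N)) ≫ (luHom D).hom.app (op ⟨Enum.n N⟩) =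
      (λ_ _).hom ≫ (finTensorOne fun _ => ev D.seq N).hom := by
  refine (Gen_luHom D IsPart.one i (fun _ _ _ => Embedding.refl N)
    (fun s hs => absurd ⟨s, Subsingleton.elim _ _⟩ hs) fun _ _ _ _ => rfl).trans (whisker_eq _ ?_)
  exact (eq_whisker (utRes_id D (T₁ := fun _ => N) i _ _ (fun _ => Subsingleton.elim _ _)
    fun _ _ _ => rfl) _).trans (id_comp _)

instance (D : LambdaSeq V) (n : Lamᵒᵖ) : IsIso ((luHom D).hom.app n) := by
  let j : Fin 1 ↪ Fin 1 := Embedding.refl _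
  let N := Fin n.unop.n
  refine ⟨(λ_ _).inv ≫ (unitGen j ⊗ₘ (finTensorOne fun _ => ev D.seq N).inv) ≫
    Gen (kellyUnit V) D (IsPart.one (N := N)), ?_, ?_⟩
  · refine Gen_hom_ext (N := N) fun {k T} _ {r} hr => unitGen_hom_ext_right fun i => ?_
    obtain ⟨⟨f, hf⟩, he⟩ := hr.exists_over_one i
    have e1 := Gen_luHom D hr i f he hf
    have e2 := Gen_res (kellyUnit V) D hr (IsPart.one (N := N)) i f he (Embedding.refl N)
      fun s s' h n => (hf s s' h n).symm
    have e3 := unitGen_res (V := V) i j i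
    have aux : ∀ {A A' X Y Z B : V} {u : 𝟙_ V ⟶ A} {u' : 𝟙_ V ⟶ A'} {G : A ⊗ X ⟶ Z} {t : Z ⟶ B} {x : X ⟶ Y}
        {o : Y ≅ B} {G' : A' ⊗ Y ⟶ Z} {i : A' ⟶ A} {z : Z ⟶ Z} (hz : z = 𝟙 _)
        (e1 : (u ▷ X) ≫ G ≫ t = (λ_ _).hom ≫ x ≫ o.hom) (e2 : (i ▷ X) ≫ G ≫ z = (A' ◁ x) ≫ G')
        (e3 : u' ≫ i = u), (u ▷ X) ≫ G ≫ t ≫ (λ_ _).inv ≫ (u' ⊗ₘ o.inv) ≫ G' = (u ▷ X) ≫ G ≫ 𝟙 _ := by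
      rintro A A' X Y Z B _ u' G t x o G' i _ rfl e1 e2 rfl
      rw [reassoc_of% e1, MonoidalCategory.tensorHom_def', leftUnitor_inv_naturality_assoc, assoc,
        ← whiskerLeft_comp_assoc, Iso.hom_inv_id, whiskerLeft_id, id_comp,
        ← leftUnitor_naturality_assoc, Iso.hom_inv_id_assoc, whisker_exchange_assoc,
        ← e2, comp_whiskerRight, assoc]
    exact aux (res_refl _) e1 e2 e3
  · have e1 := Gen_luHom_one (N := N) D j
    have aux : ∀ {A X Z B : V} {u : 𝟙_ V ⟶ A} {G : A ⊗ X ⟶ Z} {t : Z ⟶ B} {o : X ≅ B}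
      (e1 : (u ▷ X) ≫ G ≫ t = (λ_ _).hom ≫ o.hom), ((λ_ _).inv ≫ (u ⊗ₘ o.inv) ≫ G) ≫ t = 𝟙 _ := by
      intros
      rename_i e1
      rw [MonoidalCategory.tensorHom_def']
      simp only [assoc]
      rw [e1]
      simp
    exact aux e1

/-- The left unitor, as an isomorphism. -/
def luIso (D : LambdaSeq V) : kelly (kellyUnit V) D ≅ D :=
  haveI := isIso_of_app (luHom D)
  asIso (luHom D)

lemma luHom_naturality {D E : LambdaSeq V} (g : D ⟶ E) :
    kellyMap (𝟙 (kellyUnit V)) g ≫ luHom E = luHom D ≫ g := by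
  refine kelly_hom_ext fun {k N} _ {T} _ {r} hr => unitGen_hom_ext_right fun i => ?_
  obtain ⟨⟨f, hf⟩, he⟩ := hr.exists_over_one i
  have e1 := Gen_luHom D hr i f he hf
  have e2 := Gen_luHom E hr i f he hf
  have e3 := Gen_naturality (𝟙 (kellyUnit V)) g hr
  have e4 := utRes_naturality g i (T' := fun _ : Fin 1 => N) f he
  have e5 := finTensorOne_naturality (A := fun _ => ev D.seq N) (B := fun _ => ev E.seq N)
    fun _ => g.hom.app (op ⟨Enum.n N⟩)
  have aux : ∀ {A X X' Y Y' Z Z' B B' : V} {u : 𝟙_ V ⟶ A} {i : A ⟶ A} {G : A ⊗ X ⟶ Z} {t : Z ⟶ B}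
      {x : X ⟶ Y} {o : Y ⟶ B} {G' : A ⊗ X' ⟶ Z'} {t' : Z' ⟶ B'} {x' : X' ⟶ Y'} {o' : Y' ⟶ B'}
      {a : Z ⟶ Z'} {b : B ⟶ B'} {c : X ⟶ X'} {d : Y ⟶ Y'} (hi : i = 𝟙 _)
      (e1 : (u ▷ X) ≫ G ≫ t = (λ_ _).hom ≫ x ≫ o)
      (e2 : (u ▷ X') ≫ G' ≫ t' = (λ_ _).hom ≫ x' ≫ o') (e3 : G ≫ a = (i ⊗ₘ c) ≫ G')
      (e4 : x ≫ d = c ≫ x') (e5 : d ≫ o' = o ≫ b),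
      (u ▷ X) ≫ G ≫ a ≫ t' = (u ▷ X) ≫ G ≫ t ≫ b := by
    rintro A X X' Y Y' Z Z' B B' u _ G t x o G' t' x' o' a b c d rfl e1 e2 e3 e4 e5
    rw [id_tensorHom] at e3
    rw [reassoc_of% e3, reassoc_of% e1, ← e5, reassoc_of% e4, ← whisker_exchange_assoc, e2,
      leftUnitor_naturality_assoc]
  exact aux rfl e1 e2 e3 e4 e5

end LeftUnitor
section One

variable [SymmetricCategory V]

lemma isCan_finTensorOne {ι : Type} {X : ι → V} {P : ι → Prop} {f : ∀ a, P a → (𝟙_ V ⟶ X a)}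
    {A : Fin 1 → V} {m : Fin 1 → List ι} (a : ∀ s, A s ≅ tens X (m s)) (hm : (m 0).Nodup) :
    IsCan f (canUt a) (a 0) (finTensorOne A).hom := by
  have h : ∀ (l : List (Fin 1)) (hl : l = [0]), IsCan f (canTens a l) (a 0)
      (eqToHom (congrArg (tens A) hl) ≫ (ρ_ (A 0)).hom) := by
    rintro _ rfl
    refine (IsCan.id ?_).comp (IsCan.rightUnitor hm)
    simpa using hm
  exact h _ (List.finRange_succ (n := 0))

end One

section RightUnitor

variable [SymmetricCategory V] [HasColimits V]
  [TensorCocts V]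
  {S S' N N' : Type} [Enum S] [Enum S'] [Enum N] [Enum N']
  {T : S → Type} [∀ s, Enum (T s)] {T' : S' → Type} [∀ s, Enum (T' s)]
  {r : ∀ s, T s → N} {r' : ∀ s, T' s → N'}

lemma exists_family_of_enum {P : S → Type*} (a : ∀ q : Fin (Enum.n S), P (Enum.e.symm q)) :
    ∃ i : ∀ s, P s, ∀ q, i (Enum.e.symm q) = a q :=
  ⟨Equiv.piCongrLeft P Enum.e.symm a, fun q => Equiv.piCongrLeft_apply_apply P Enum.e.symm a q⟩

lemma utUnits_unitGen (i : ∀ s, T s ↪ Fin 1) :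
    utUnits (fun s => unitGen (V := V) (i s)) = (tensUnitsIso _).hom ≫
      utMap fun s => unitGen (V := V) (i s) := by
  rw [tensUnitsIso_hom, tensUnits_tensMap]
  simp

lemma unitGens_hom_ext {W Z : V} {t t' : W ⊗ (ut fun s => ev (kellyUnit V).seq (T s)) ⟶ Z}
    (h : ∀ i : ∀ s, T s ↪ Fin 1, (W ◁ utUnits fun s => unitGen (i s)) ≫ t =
      (W ◁ utUnits fun s => unitGen (i s)) ≫ t') : t = t' := by
  refine Pres.finTensor_hom_ext (fun q : Fin (Enum.n S) => unitPres (T (Enum.e.symm q)))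
    fun (a : ∀ q, ULift (T (Enum.e.symm q) ↪ Fin 1)) => ?_
  obtain ⟨i, hi⟩ := exists_family_of_enum (P := fun s => T s ↪ Fin 1) fun q => (a q).down
  have h1 := h i
  rw [utUnits_unitGen, whiskerLeft_comp, assoc, assoc, cancel_epi] at h1
  have h2 : (utMap fun s => unitGen (V := V) (i s)) =
      finTensorMap fun q => (unitPres (T (Enum.e.symm q))).g (a q) :=
    congrArg (fun z => tensMap z _) (funext fun q => congrArg unitGen (hi q))
  exact (eq_whisker (congrArg (fun z => W ◁ z) h2.symm) _).trans (h1.trans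
    (eq_whisker (congrArg (fun z => W ◁ z) h2) _))

lemma exists_unitGens_desc {W Z : V} (h : (∀ s, T s ↪ Fin 1) → (W ⟶ Z)) :
    ∃ t : W ⊗ (ut fun s => ev (kellyUnit V).seq (T s)) ⟶ Z, ∀ i : ∀ s, T s ↪ Fin 1,
      (W ◁ utUnits fun s => unitGen (i s)) ≫ t = (ρ_ W).hom ≫ h i := by
  have h0 := fun a : ∀ q : Fin (Enum.n S), ULift (T (Enum.e.symm q) ↪ Fin 1) =>
    exists_family_of_enum (P := fun s => T s ↪ Fin 1) fun q => (a q).down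
  choose j hj using h0
  obtain ⟨t, ht⟩ := Pres.exists_finTensor_desc
    (fun q : Fin (Enum.n S) => unitPres (V := V) (T (Enum.e.symm q))) (W := W) (Z := Z)
    (fun (a : ∀ q, ULift (T (Enum.e.symm q) ↪ Fin 1)) =>
      (W ◁ (tensUnitsIso (List.finRange (Enum.n S))).inv) ≫ (ρ_ W).hom ≫ h (j a)) (by
      intro a b Y y y' hy
      obtain rfl : a = b := funext fun q => (hy q).1
      obtain rfl : y = y' := funext fun q => (hy q).2
      rfl)
  refine ⟨t, fun i => ?_⟩
  have h1 := ht fun q => ⟨i (Enum.e.symm q)⟩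
  rw [utUnits_unitGen, whiskerLeft_comp, assoc]
  refine (whisker_eq _ h1).trans ?_
  refine (Iso.hom_inv_id_assoc (whiskerLeftIso W (tensUnitsIso _)) _).trans ?_
  exact congrArg (fun i => (ρ_ W).hom ≫ h i) (funext fun s => Subsingleton.elim _ _)

lemma IsPart.exists_section (hr : IsPart r) (i : ∀ s, T s ↪ Fin 1) :
    ∃ κ : N ↪ S, ∀ s t, κ (r s t) = s := by
  have h1 : ∀ n, ∃ s, ∃ t : T s, r s t = n := fun n => hr.exists n
  choose κ t ht using h1
  refine ⟨⟨κ, fun n n' h => ?_⟩, fun s t' => hr.inj' (ht _)⟩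
  have h2 : ∀ (s s') (t : T s) (t' : T s'), s = s' → r s t = r s' t' := by
    rintro s _ t t' rfl
    rw [(i s).injective (Subsingleton.elim (i s t) (i s t'))]
  rw [← ht n, ← ht n', h2 _ _ _ _ h]

lemma exists_restrict_unit {φ : S ↪ S'} (f : ∀ s s', φ s = s' → (T' s' ↪ T s))
    (he : ∀ s', s' ∉ range φ → IsEmpty (T' s')) (i : ∀ s, T s ↪ Fin 1) :
    ∃ i' : ∀ s, T' s ↪ Fin 1, utUnits (fun s => unitGen (V := V) (i s)) ≫ utRes (kellyUnit V) φ f he =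
      utUnits fun s => unitGen (i' s) := by
  have h1 : ∀ s', Nonempty (T' s' ↪ Fin 1) := by
    intro s'
    by_cases h : s' ∈ range φ
    · obtain ⟨s, rfl⟩ := h
      exact ⟨(f s _ rfl).trans (i s)⟩
    · have := he _ h
      exact ⟨Embedding.ofIsEmpty⟩
  exact ⟨fun s' => (h1 s').some, utUnits_utSp (fun s s' h => unitGen_res _ _ _) fun s' h => bs_unit _ _⟩

lemma exists_rightUnitor (D : LambdaSeq V) : ∃ t : kelly D (kellyUnit V) ⟶ D,
    ∀ {S N : Type} [Enum S] [Enum N] {T : S → Type} [∀ s, Enum (T s)] {r : ∀ s, T s → N}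
      (hr : IsPart r) (i : ∀ s, T s ↪ Fin 1) (κ : N ↪ S), (∀ s t, κ (r s t) = s) →
      (_ ◁ utUnits fun s => unitGen (i s)) ≫ Gen D (kellyUnit V) hr ≫ t.hom.app (op ⟨Enum.n N⟩) =
        (ρ_ _).hom ≫ res D.seq κ := by
  have h1 : ∀ {S N : Type} [Enum S] [Enum N] {T : S → Type} [∀ s, Enum (T s)] {r : ∀ s, T s → N}
      (hr : IsPart r), ∃ t : ev D.seq S ⊗ (ut fun s => ev (kellyUnit V).seq (T s)) ⟶ ev D.seq N,
      ∀ (i : ∀ s, T s ↪ Fin 1) (κ : N ↪ S), (∀ s t, κ (r s t) = s) →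
      (_ ◁ utUnits fun s => unitGen (i s)) ≫ t = (ρ_ _).hom ≫ res D.seq κ := by
    intro S N _ _ T _ r hr
    have h2 := hr.exists_section
    choose κ hκ using h2
    obtain ⟨t, ht⟩ := exists_unitGens_desc (T := T) fun i => res D.seq (κ i)
    refine ⟨t, fun i κ' hκ' => (ht i).trans (whisker_eq _ (res_congr _ fun n => ?_))⟩
    obtain ⟨s, t, rfl⟩ := hr.exists n
    rw [hκ, hκ']
  choose m hm using @h1
  obtain ⟨t, ht⟩ := KellyFam.exists_desc (D := D) (E := kellyUnit V) (F := D.seq)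
    { map := fun hr => m hr
      law := fun {S S' N N'} _ _ _ _ {T} _ {T'} _ {r r'} hr hr' φ f he ψ hψ => by
        refine unitGens_hom_ext fun i => ?_
        obtain ⟨i', hi'⟩ := exists_restrict_unit (V := V) f he i
        obtain ⟨κ, hκ⟩ := hr.exists_section i
        obtain ⟨κ', hκ'⟩ := hr'.exists_section i'
        have e1 := hm hr i κ hκ
        have e2 := hm hr' i' κ' hκ'
        have e3 : res D.seq φ ≫ res D.seq κ ≫ res D.seq ψ = res D.seq κ' := by
          refine (whisker_eq _ (res_comp _ _ _)).trans (res_comp' _ fun n => ?_)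
          obtain ⟨s', t', rfl⟩ := hr'.exists n
          by_cases hs : s' ∈ range φ
          · obtain ⟨s, rfl⟩ := hs
            rw [hκ']
            refine congrArg φ ((congrArg κ (hψ s _ rfl t')).trans (hκ _ _))
          · exact (he _ hs).elim t'
        have aux : ∀ {A A' X X' Z Z' : V} {u : 𝟙_ V ⟶ X} {u' : 𝟙_ V ⟶ X'} {a : A' ⟶ A} {m : A ⊗ X ⟶ Z}
            {m' : A' ⊗ X' ⟶ Z'} {p : Z ⟶ Z'} {b : X ⟶ X'} {k : A ⟶ Z} {k' : A' ⟶ Z'}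
            (hi' : u ≫ b = u') (e1 : (A ◁ u) ≫ m = (ρ_ _).hom ≫ k)
            (e2 : (A' ◁ u') ≫ m' = (ρ_ _).hom ≫ k') (e3 : a ≫ k ≫ p = k'),
            (A' ◁ u) ≫ (a ▷ X) ≫ m ≫ p = (A' ◁ u) ≫ (A' ◁ b) ≫ m' := by
          rintro A A' X X' Z Z' u _ a m m' p b k _ rfl e1 e2 rfl
          rw [whisker_exchange_assoc, reassoc_of% e1, ← whiskerLeft_comp_assoc, e2,
            rightUnitor_naturality_assoc]
        exact aux hi' e1 e2 e3 }
  refine ⟨⟨t, ?_⟩, fun hr i κ hκ => (whisker_eq _ (ht hr)).trans (hm hr i κ hκ)⟩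
  have h0 : IsEmpty (Fin 0) := inferInstance
  have hr : IsPart fun (s : Fin 0) (_ : Fin 0) => s := ⟨fun x => x.1.elim0, fun n => n.elim0⟩
  have e1 := bs_Gen D (kellyUnit V) hr h0 h0 fun s => unitGen (Embedding.ofIsEmpty)
  have e2 := (whisker_eq (_ ◁ _) (ht hr)).trans (hm hr (fun s => Embedding.ofIsEmpty)
    (Embedding.refl _) fun s => s.elim0)
  have e3 := bs_zero (kelly D (kellyUnit V)) h0
  have e4 := bs_zero D h0
  have aux : ∀ {A X Z : V} {b b' : 𝟙_ V ⟶ A} {u : 𝟙_ V ⟶ X} {G : A ⊗ X ⟶ Z} {t : Z ⟶ A}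
      {z z' : 𝟙_ V ⟶ Z} {k : A ⟶ A} (hk : k = 𝟙 _) (e1 : b ≫ (ρ_ _).inv ≫ (A ◁ u) ≫ G = z)
      (e2 : (A ◁ u) ≫ G ≫ t = (ρ_ _).hom ≫ k) (e3 : z = z') (e4 : b = b'), z' ≫ t = b' := by
    rintro A X Z b _ u G t _ _ _ rfl rfl e2 rfl rfl
    simp only [assoc]
    rw [e2, comp_id, Iso.inv_hom_id, comp_id]
  exact aux (res_refl _) e1 e2 e3 e4

/-- The right unitor. -/
def ruHom (D : LambdaSeq V) : kelly D (kellyUnit V) ⟶ D := (exists_rightUnitor D).choose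

lemma Gen_ruHom (D : LambdaSeq V) (hr : IsPart r) (i : ∀ s, T s ↪ Fin 1) (κ : N ↪ S)
    (hκ : ∀ s t, κ (r s t) = s) :
    (_ ◁ utUnits fun s => unitGen (i s)) ≫ Gen D (kellyUnit V) hr ≫ (ruHom D).hom.app (op ⟨Enum.n N⟩) =
      (ρ_ _).hom ≫ res D.seq κ :=
  (exists_rightUnitor D).choose_spec hr i κ hκ

/-- A set as a partition of itself with parts with one element. -/
lemma IsPart.points : IsPart fun (n : N) (_ : Fin 1) => n :=
  ⟨by rintro ⟨s, n⟩ ⟨s', n'⟩ h; obtain rfl : s = s' := h; obtain rfl := Subsingleton.elim n n'; rfl,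
    fun n => ⟨⟨n, 0⟩, rfl⟩⟩

/-- The inverse of the right unitor. -/
def ruInv (D : LambdaSeq V) (N : Type) [Enum N] : ev D.seq N ⟶ ev (kelly D (kellyUnit V)).seq N :=
  (ρ_ _).inv ≫ (_ ◁ utUnits fun _ => unitGen (Embedding.refl (Fin 1))) ≫
    Gen D (kellyUnit V) (IsPart.points (N := N))

lemma ruInv_ruHom (D : LambdaSeq V) : ruInv D N ≫ (ruHom D).hom.app (op ⟨Enum.n N⟩) = 𝟙 _ := by
  have e1 := Gen_ruHom D (IsPart.points (N := N)) (fun _ => Embedding.refl _)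
    (Embedding.refl N) fun _ _ => rfl
  have aux : ∀ {A X Z : V} {u : 𝟙_ V ⟶ X} {G : A ⊗ X ⟶ Z} {t : Z ⟶ A} {k : A ⟶ A} (hk : k = 𝟙 _)
      (e1 : (A ◁ u) ≫ G ≫ t = (ρ_ _).hom ≫ k), ((ρ_ _).inv ≫ (A ◁ u) ≫ G) ≫ t = 𝟙 _ := by
    rintro A X Z u G t _ rfl e1
    simp only [assoc]
    rw [e1, comp_id, Iso.inv_hom_id]
  exact aux (res_refl _) e1

lemma ruHom_ruInv (D : LambdaSeq V) : (ruHom D).hom.app (op ⟨Enum.n N⟩) ≫ ruInv D N = 𝟙 _ := by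
  refine Gen_hom_ext (N := N) fun {k T} _ {r} hr => unitGens_hom_ext fun i => ?_
  obtain ⟨κ, hκ⟩ := hr.exists_section i
  have e1 := Gen_ruHom D hr i κ hκ
  have he : ∀ s, s ∉ range κ → IsEmpty (T s) := fun s hs => ⟨fun t => hs ⟨r s t, hκ s t⟩⟩
  have e2 := Gen_res D (kellyUnit V) (IsPart.points (N := N)) hr κ (fun _ s _ => i s) he
    (Embedding.refl N) (fun n s h t => by
      subst h
      obtain ⟨s, t', rfl⟩ := hr.exists n
      have h1 : ∀ s' (t : T s'), s' = s → r s' t = r s t' := by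
        rintro _ t rfl
        exact congrArg (r _) ((i _).injective (Subsingleton.elim _ _))
      exact h1 _ t (hκ s t'))
  have e3 : (utUnits fun _ : N => unitGen (V := V) (Embedding.refl (Fin 1))) ≫
      utRes (kellyUnit V) κ (fun _ s _ => i s) he = utUnits fun s => unitGen (i s) :=
    utUnits_utSp (fun s s' h => unitGen_res _ _ _) fun s' h => bs_unit _ _
  have aux : ∀ {A B X Y Z : V} {u : 𝟙_ V ⟶ X} {u' : 𝟙_ V ⟶ Y} {G : A ⊗ X ⟶ Z} {t : Z ⟶ B} {k : A ⟶ B}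
      {G' : B ⊗ Y ⟶ Z} {z : Z ⟶ Z} {b : Y ⟶ X} (hz : z = 𝟙 _)
      (e1 : (A ◁ u) ≫ G ≫ t = (ρ_ _).hom ≫ k) (e2 : (k ▷ Y) ≫ G' ≫ z = (A ◁ b) ≫ G) (e3 : u' ≫ b = u),
      (A ◁ u) ≫ G ≫ t ≫ (ρ_ _).inv ≫ (B ◁ u') ≫ G' = (A ◁ u) ≫ G ≫ 𝟙 _ := by
    rintro A B X Y Z _ u' G t k G' _ b rfl e1 e2 rfl
    rw [reassoc_of% e1, rightUnitor_inv_naturality_assoc, Iso.hom_inv_id_assoc, ← whisker_exchange_assoc,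
      ← comp_id G', e2, whiskerLeft_comp, assoc, comp_id]
  exact aux (res_refl _) e1 e2 e3

instance (D : LambdaSeq V) (n : Lamᵒᵖ) : IsIso ((ruHom D).hom.app n) :=
  ⟨ruInv D (Fin n.unop.n), ruHom_ruInv (N := Fin n.unop.n) D, ruInv_ruHom (N := Fin n.unop.n) D⟩

/-- The right unitor, as an isomorphism. -/
def ruIso (D : LambdaSeq V) : kelly D (kellyUnit V) ≅ D :=
  haveI := isIso_of_app (ruHom D)
  asIso (ruHom D)

lemma ruHom_naturality {D E : LambdaSeq V} (g : D ⟶ E) :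
    kellyMap g (𝟙 (kellyUnit V)) ≫ ruHom E = ruHom D ≫ g := by
  refine kelly_hom_ext fun {k N} _ {T} _ {r} hr => unitGens_hom_ext fun i => ?_
  obtain ⟨κ, hκ⟩ := hr.exists_section i
  have e1 := Gen_ruHom D hr i κ hκ
  have e2 := Gen_ruHom E hr i κ hκ
  have e3 := Gen_naturality g (𝟙 (kellyUnit V)) hr
  have e4 := res_naturality g.hom κ
  have e5 : (utMap fun s => (𝟙 (kellyUnit V) : kellyUnit V ⟶ kellyUnit V).hom.app (op ⟨Enum.n (T s)⟩)) = 𝟙 _ :=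
    utMap_id _
  have aux : ∀ {A A' X Z Z' B B' : V} {u : 𝟙_ V ⟶ X} {i : X ⟶ X} {G : A ⊗ X ⟶ Z} {t : Z ⟶ B}
      {k : A ⟶ B} {G' : A' ⊗ X ⟶ Z'} {t' : Z' ⟶ B'} {k' : A' ⟶ B'} {a : Z ⟶ Z'} {b : B ⟶ B'} {c : A ⟶ A'}
      (hi : i = 𝟙 _) (e1 : (A ◁ u) ≫ G ≫ t = (ρ_ _).hom ≫ k)
      (e2 : (A' ◁ u) ≫ G' ≫ t' = (ρ_ _).hom ≫ k') (e3 : G ≫ a = (c ⊗ₘ i) ≫ G')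
      (e4 : k ≫ b = c ≫ k'), (A ◁ u) ≫ G ≫ a ≫ t' = (A ◁ u) ≫ G ≫ t ≫ b := by
    rintro A A' X Z Z' B B' u _ G t k G' t' k' a b c rfl e1 e2 e3 e4
    rw [tensorHom_id] at e3
    rw [reassoc_of% e3, reassoc_of% e1, e4, whisker_exchange_assoc, e2, rightUnitor_naturality_assoc]
  exact aux e5 e1 e2 e3 e4

lemma triangle_sh (B : N → V) :
    (utUnits (fun _ : N => 𝟙 (𝟙_ V)) ▷ ut B) ≫ (sh (IsPart.points (N := N)) (fun _ => 𝟙_ V) B).hom ≫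
      (utMap fun n => (λ_ _).hom ≫ (finTensorOne fun _ => B n).hom) = (λ_ _).hom := by
  have h1 : Sep (fun n : N => [n]) := sep_singleton Function.injective_id
  have h0 : Sep (fun n : N => ([] : List N)) := ⟨fun _ => List.nodup_nil, fun _ _ _ h => by simp at h⟩
  have h2 : Sep (Sum.elim (fun n : N => ([] : List N)) fun n : N => [n]) :=
    ⟨by rintro (s | n) <;> simp, by rintro (s | n) (s' | n') i <;> simp; grind⟩
  refine IsCan.unique (P := fun _ => False) (f := fun _ h => h.elim) (X := B) (((IsCan.utUnits h0
    fun n => IsCan.id List.nodup_nil).whiskerRight (canUt fun n => canAtom B n) ?_).comp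
      ((IsCan.sh h2 IsPart.points).comp (IsCan.utMap (b := fun n => canAtom B n) (fun n => ?_) h1)))
      (IsCan.leftUnitor h1.nodup_utList)
  · have : utList (fun n : N => ([] : List N)) = [] := List.eq_nil_iff_forall_not_mem.2 fun i hi => by
      obtain ⟨s, hs⟩ := mem_utList.1 hi
      simp at hs
    rw [this]
    exact h1.nodup_utList
  · refine (IsCan.leftUnitor ?_).comp (isCan_finTensorOne (fun _ => canAtom B n) (by simp))
    exact Sep.nodup_utList (S := Fin 1) ⟨fun _ => by simp, fun _ _ _ _ _ => Subsingleton.elim _ _⟩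

lemma triangle_ascHom (D E : LambdaSeq V) :
    ascHom D (kellyUnit V) E ≫ kellyMap (𝟙 D) (luHom E) = kellyMap (ruHom D) (𝟙 E) := by
  refine kelly_hom_ext fun {k M} _ {U} _ {w} hw => ?_
  let j : Fin 1 ↪ Fin 1 := Embedding.refl _
  have e1 := Gen_naturality (ruHom D) (𝟙 E) hw
  have e2 : (utMap fun s => (𝟙 E : E ⟶ E).hom.app (op ⟨Enum.n (U s)⟩)) = 𝟙 _ := utMap_id _
  have e3 := Gen_ascHom D (kellyUnit V) E (IsPart.points (N := Fin k)) hw (fun s => IsPart.one (N := U s)) hw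
    fun _ _ _ => rfl
  have e4 := Gen_naturality (𝟙 D) (luHom E) hw
  have e5 : (𝟙 D : D ⟶ D).hom.app (op ⟨Enum.n (Fin k)⟩) = 𝟙 _ := rfl
  have e6 := utUnits_utMap (fun _ : Fin k => 𝟙 (𝟙_ V)) fun _ => unitGen (V := V) j
  have e7 := sh_naturality (IsPart.points (N := Fin k)) (fun _ => unitGen (V := V) j)
    fun s => 𝟙 (ev E.seq (U s))
  have e8 : (utMap fun s => 𝟙 (ev E.seq (U s))) = 𝟙 _ := utMap_id _
  have e9 : (utMap fun n : Fin k => unitGen (V := V) j ⊗ₘ utMap fun _ : Fin 1 => 𝟙 (ev E.seq (U n))) ≫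
      (utMap fun s => Gen (kellyUnit V) E (IsPart.one (N := U s))) ≫
      (utMap fun s => (luHom E).hom.app (op ⟨Enum.n (U s)⟩)) =
      utMap fun n => (λ_ _).hom ≫ (finTensorOne fun _ => ev E.seq (U n)).hom := by
    refine (whisker_eq _ (utMap_comp _ _)).trans ((utMap_comp _ _).trans ?_)
    refine congrArg (fun z => utMap z) (funext fun s => ?_)
    refine Eq.trans ?_ (Gen_luHom_one E j)
    refine eq_whisker ?_ _
    refine Eq.trans ?_ (tensorHom_id _ _)
    exact congrArg (fun z => unitGen j ⊗ₘ z) (utMap_id _)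
  have e10 := triangle_sh fun s => ev E.seq (U s)
  have aux : ∀ {A K X Y Q Z B B' C C' F F' G : V} {u : 𝟙_ V ⟶ X} {v : 𝟙_ V ⟶ F'} {v' : F' ⟶ X} {g : A ⊗ X ⟶ Q}
      {H : Q ⊗ Y ⟶ Z} {t : Z ⟶ B} {s : X ⊗ Y ⟶ C} {m : C ⟶ C'} {G : A ⊗ C' ⟶ B} {p : B ⟶ B'} {q : C' ⟶ Y}
      {G' : A ⊗ Y ⟶ B'} {s' : F' ⊗ Y ⟶ F} {n : F ⟶ C} {o : F ⟶ Y} {ru : Q ⟶ A} {k : Z ⟶ B'}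
      {i₁ i₃ : Y ⟶ Y} {i₂ : A ⟶ A}
      (hi₁ : i₁ = 𝟙 _) (hi₂ : i₂ = 𝟙 _) (hi₃ : i₃ = 𝟙 _)
      (h1 : ((ρ_ _).inv ≫ (A ◁ u) ≫ g) ≫ ru = 𝟙 _) (h2 : ru ≫ ((ρ_ _).inv ≫ (A ◁ u) ≫ g) = 𝟙 _)
      (e1 : H ≫ k = (ru ⊗ₘ i₁) ≫ G')
      (e3 : (g ▷ Y) ≫ H ≫ t = (α_ _ _ _).hom ≫ (A ◁ (s ≫ m)) ≫ G)
      (e4 : G ≫ p = (i₂ ⊗ₘ q) ≫ G') (e6 : v ≫ v' = u) (e7 : (v' ⊗ₘ i₃) ≫ s = s' ≫ n)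
      (e9 : n ≫ m ≫ q = o) (e10 : (v ▷ Y) ≫ s' ≫ o = (λ_ _).hom), H ≫ t ≫ p = H ≫ k := by
    rintro A K X Y Q Z B B' C C' F F' G u v v' g H t s m G p q G' s' n o ru k _ _ _ rfl rfl rfl h1 h2 e1 e3 e4
      e6 e7 e9 e10
    rw [tensorHom_id] at e1 e7
    rw [id_tensorHom] at e4
    subst e6
    subst e9
    have h3 : ∀ {x y : Q ⊗ Y ⟶ B'}, (((ρ_ A).inv ≫ (A ◁ (v ≫ v')) ≫ g) ▷ Y) ≫ x =
        (((ρ_ A).inv ≫ (A ◁ (v ≫ v')) ≫ g) ▷ Y) ≫ y → x = y := by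
      intro x y h
      have := congrArg (fun z => (ru ▷ Y) ≫ z) h
      simpa only [← comp_whiskerRight_assoc, h2, id_whiskerRight, id_comp] using this
    apply h3
    have h4 : (((ρ_ A).inv ≫ (A ◁ (v ≫ v')) ≫ g) ▷ Y) ≫ H ≫ k = G' := by
      rw [e1, ← comp_whiskerRight_assoc, h1, id_whiskerRight, id_comp]
    have h5 : ((v ≫ v') ▷ Y) ≫ s ≫ m ≫ q = (λ_ _).hom := by
      rw [comp_whiskerRight_assoc, reassoc_of% e7, e10]
    rw [h4, comp_whiskerRight, comp_whiskerRight, assoc, assoc, reassoc_of% e3, e4,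
      associator_naturality_middle_assoc, ← whiskerLeft_comp_assoc, ← whiskerLeft_comp_assoc]
    simp only [assoc]
    rw [h5]
    simp
  exact aux (G := 𝟙_ V) (K := 𝟙_ V) e2 e5 e8 (ruInv_ruHom (N := Fin k) D) (ruHom_ruInv (N := Fin k) D)
    e1 e3 e4 (e6.trans (congrArg (fun z => utUnits z) (funext fun _ => id_comp _))) e7 e9 e10

end RightUnitor
section Lexicographic

lemma finSigmaFinEquiv_val {k : ℕ} {n : Fin k → ℕ} (s : Fin k) (q : Fin (n s)) :
    (finSigmaFinEquiv ⟨s, q⟩ : ℕ) = ∑ t ∈ Finset.univ.filter (· < s), n t + q := by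
  rw [finSigmaFinEquiv_apply]
  congr 1
  refine Finset.sum_bij (fun t _ => Fin.castLE s.2.le t) ?_ ?_ ?_ ?_
  · intro t _
    exact Finset.mem_filter.2 ⟨Finset.mem_univ _, t.2⟩
  · intro t _ t' _ h
    exact Fin.castLE_injective _ h
  · intro t ht
    exact ⟨⟨t.1, (Finset.mem_filter.1 ht).2⟩, Finset.mem_univ _, rfl⟩
  · intros
    rfl

lemma finSigmaFinEquiv_lt_right {k : ℕ} {n : Fin k → ℕ} (s : Fin k) {q q' : Fin (n s)} (h : q < q') :
    finSigmaFinEquiv ⟨s, q⟩ < finSigmaFinEquiv ⟨s, q'⟩ := by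
  rw [Fin.lt_def, finSigmaFinEquiv_val, finSigmaFinEquiv_val]
  exact Nat.add_lt_add_left h _

lemma finSigmaFinEquiv_lt_left {k : ℕ} {n : Fin k → ℕ} {s s' : Fin k} (h : s < s') (q : Fin (n s))
    (q' : Fin (n s')) : finSigmaFinEquiv ⟨s, q⟩ < finSigmaFinEquiv ⟨s', q'⟩ := by
  rw [Fin.lt_def, finSigmaFinEquiv_val, finSigmaFinEquiv_val]
  have h1 : insert s (Finset.univ.filter (· < s)) ⊆ Finset.univ.filter (· < s') := by
    intro t ht
    rw [Finset.mem_insert, Finset.mem_filter] at ht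
    rw [Finset.mem_filter]
    rcases ht with rfl | ht
    · exact ⟨Finset.mem_univ _, h⟩
    · exact ⟨Finset.mem_univ _, ht.2.trans h⟩
  have h2 := Finset.sum_le_sum_of_subset (f := n) h1
  rw [Finset.sum_insert (by simp)] at h2
  have := q.2
  omega

lemma finSigmaFinEquiv_lt_iff {k : ℕ} {n : Fin k → ℕ} {a b : Σ s, Fin (n s)}
    (h : finSigmaFinEquiv a < finSigmaFinEquiv b) :
    a.1 < b.1 ∨ ∃ (s : Fin k) (q q' : Fin (n s)), a = ⟨s, q⟩ ∧ b = ⟨s, q'⟩ ∧ q < q' := by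
  obtain ⟨s, q⟩ := a
  obtain ⟨s', q'⟩ := b
  rcases lt_trichotomy s s' with h1 | rfl | h1
  · exact Or.inl h1
  · refine Or.inr ⟨s, q, q', rfl, rfl, ?_⟩
    rcases lt_trichotomy q q' with h1 | rfl | h1
    · exact h1
    · exact (lt_irrefl _ h).elim
    · exact (lt_asymm h (finSigmaFinEquiv_lt_right s h1)).elim
  · exact (lt_asymm h (finSigmaFinEquiv_lt_left h1 q' q)).elim

lemma finSigmaFinEquiv_assoc {k : ℕ} (j : Fin k → ℕ) (i : Fin (∑ s, j s) → ℕ) (s : Fin k) (q : Fin (j s))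
    (u : Fin (i (finSigmaFinEquiv ⟨s, q⟩))) :
    finCongr (sum_regroup i).symm (finSigmaFinEquiv (n := fun s => ∑ q, i (finSigmaFinEquiv ⟨s, q⟩))
      ⟨s, finSigmaFinEquiv (n := fun q => i (finSigmaFinEquiv ⟨s, q⟩)) ⟨q, u⟩⟩) =
    finSigmaFinEquiv ⟨finSigmaFinEquiv ⟨s, q⟩, u⟩ := by
  let e : Fin (∑ r, i r) → Fin (∑ r, i r) := fun m =>
    let p := finSigmaFinEquiv.symm m
    let t := finSigmaFinEquiv.symm p.1
    finCongr (sum_regroup i).symm (finSigmaFinEquiv (n := fun s => ∑ q, i (finSigmaFinEquiv ⟨s, q⟩))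
      ⟨t.1, finSigmaFinEquiv (n := fun q => i (finSigmaFinEquiv ⟨t.1, q⟩))
        ⟨t.2, Fin.cast (congrArg i (finSigmaFinEquiv.apply_symm_apply p.1)).symm p.2⟩⟩)
  have h1 : ∀ s q u, e (finSigmaFinEquiv ⟨finSigmaFinEquiv ⟨s, q⟩, u⟩) =
      finCongr (sum_regroup i).symm (finSigmaFinEquiv (n := fun s => ∑ q, i (finSigmaFinEquiv ⟨s, q⟩))
      ⟨s, finSigmaFinEquiv (n := fun q => i (finSigmaFinEquiv ⟨s, q⟩)) ⟨q, u⟩⟩) := by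
    intro s q u
    have h2 : ∀ (p : Σ r, Fin (i r)) (hp : p = ⟨finSigmaFinEquiv ⟨s, q⟩, u⟩) (t : Σ s, Fin (j s))
        (ht : t = ⟨s, q⟩) (h : i p.1 = i (finSigmaFinEquiv t)),
        finCongr (sum_regroup i).symm (finSigmaFinEquiv (n := fun s => ∑ q, i (finSigmaFinEquiv ⟨s, q⟩))
          ⟨t.1, finSigmaFinEquiv (n := fun q => i (finSigmaFinEquiv ⟨t.1, q⟩)) ⟨t.2, Fin.cast h p.2⟩⟩) =
        finCongr (sum_regroup i).symm (finSigmaFinEquiv (n := fun s => ∑ q, i (finSigmaFinEquiv ⟨s, q⟩))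
          ⟨s, finSigmaFinEquiv (n := fun q => i (finSigmaFinEquiv ⟨s, q⟩)) ⟨q, u⟩⟩) := by
      rintro _ rfl _ rfl h
      rfl
    refine h2 _ (Equiv.symm_apply_apply _ _) _ ?_ _
    exact (congrArg finSigmaFinEquiv.symm (congrArg Sigma.fst (Equiv.symm_apply_apply _ _))).trans
      (Equiv.symm_apply_apply _ _)
  have h2 : StrictMono e := by
    intro a b hab
    obtain ⟨⟨r, u⟩, rfl⟩ := finSigmaFinEquiv.surjective a
    obtain ⟨⟨r', u'⟩, rfl⟩ := finSigmaFinEquiv.surjective b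
    obtain ⟨⟨s, q⟩, rfl⟩ := finSigmaFinEquiv.surjective r
    obtain ⟨⟨s', q'⟩, rfl⟩ := finSigmaFinEquiv.surjective r'
    rw [h1, h1]
    have hc : ∀ {m n : ℕ} (h : m = n) (x y : Fin m), x < y → finCongr h x < finCongr h y :=
      fun _ _ _ h => h
    refine hc _ _ _ ?_
    rcases finSigmaFinEquiv_lt_iff hab with h3 | ⟨r, v, v', h4, h5, h3⟩
    · rcases finSigmaFinEquiv_lt_iff h3 with h6 | ⟨s₁, w, w', h4, h5, h6⟩
      · exact finSigmaFinEquiv_lt_left h6 _ _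
      · obtain ⟨rfl, h4⟩ := Sigma.mk.inj_iff.1 h4
        obtain rfl := eq_of_heq h4
        obtain ⟨rfl, h5⟩ := Sigma.mk.inj_iff.1 h5
        obtain rfl := eq_of_heq h5
        exact finSigmaFinEquiv_lt_right _ (finSigmaFinEquiv_lt_left
          (n := fun q => i (finSigmaFinEquiv ⟨s', q⟩)) h6 _ _)
    · have h6 := congrArg Sigma.fst (h4 ▸ rfl : (⟨finSigmaFinEquiv ⟨s, q⟩, u⟩ : Σ r, Fin (i r)) = ⟨r, v⟩)
      have h7 : (⟨s', q'⟩ : Σ s, Fin (j s)) = ⟨s, q⟩ := finSigmaFinEquiv.injective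
        ((congrArg Sigma.fst h5).trans h6.symm)
      obtain ⟨rfl, h7⟩ := Sigma.mk.inj_iff.1 h7
      obtain rfl := eq_of_heq h7
      obtain ⟨rfl, h4⟩ := Sigma.mk.inj_iff.1 h4
      obtain rfl := eq_of_heq h4
      obtain ⟨-, h5⟩ := Sigma.mk.inj_iff.1 h5
      obtain rfl := eq_of_heq h5
      exact finSigmaFinEquiv_lt_right _ (finSigmaFinEquiv_lt_right
          (n := fun q => i (finSigmaFinEquiv ⟨s', q⟩)) _ h3)
  have h3 : e = id := (StrictMono.range_inj h2 strictMono_id).1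
    ((Finite.injective_iff_surjective.1 h2.injective).range_eq.trans Set.range_id.symm)
  rw [← h1, h3]
  rfl

end Lexicographic

section Shuffle

variable [SymmetricCategory V]
  {ι κ : Type} {X : ι → V} {P : ι → Prop} {f : ∀ a, P a → (𝟙_ V ⟶ X a)}

lemma IsCan.tensorμ {A B C D : V} {l m n o : List ι} {a : A ≅ tens X l} {b : B ≅ tens X m}
    {c : C ≅ tens X n} {d : D ≅ tens X o} (h : (l ++ m ++ (n ++ o)).Nodup) :
    IsCan f (canTensor (canTensor a b) (canTensor c d)) (canTensor (canTensor a c) (canTensor b d))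
      (tensorμ A B C D) := by
  have h1 : (l ++ (m ++ (n ++ o))).Nodup := by rwa [← List.append_assoc]
  have h2 : (m ++ n ++ o).Nodup := by
    rw [List.append_assoc]
    exact (List.nodup_append.1 h1).2.1
  have h3 : (n ++ m ++ o).Nodup := ((List.perm_append_comm.append_right o).nodup_iff).1 h2
  have h4 : (l ++ (n ++ m ++ o)).Nodup := by
    refine ((List.Perm.append_left l ?_).nodup_iff).1 h1
    rw [← List.append_assoc]
    exact List.perm_append_comm.append_right o
  refine (IsCan.associator h).comp (((IsCan.assoc_inv h2).whiskerLeft a ?_).comp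
    ((((IsCan.braiding (List.nodup_append.1 h2).1).whiskerRight d h3).whiskerLeft a h4).comp
    (((IsCan.associator h3).whiskerLeft a ?_).comp (IsCan.assoc_inv ?_))))
  · rwa [List.append_assoc m]
  · rwa [← List.append_assoc n]
  · rwa [List.append_assoc, ← List.append_assoc n]

lemma IsCan.tensZip {A B : κ → V} {mA mB : κ → List ι} {a : ∀ k, A k ≅ tens X (mA k)}
    {b : ∀ k, B k ≅ tens X (mB k)} (hm : Sep fun k => mA k ++ mB k) {l : List κ} (hl : l.Nodup) :
    IsCan f (canTensor (canTens a l) (canTens b l)) (canTens (fun k => canTensor (a k) (b k)) l)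
      (tensZip A B l) := by
  induction l with
  | nil => exact IsCan.leftUnitor List.nodup_nil
  | cons k l ih =>
    have h1 := ih (List.nodup_cons.1 hl).2
    have h2 := h1.whiskerLeft (canTensor (a k) (b k)) (hm.flat_nodup hl)
    refine (IsCan.tensorμ ?_).comp h2
    have h3 := h2.nodup_left
    simp only [List.append_assoc] at h3 ⊢
    refine ((List.Perm.append_left _ ?_).nodup_iff).1 h3
    rw [← List.append_assoc, ← List.append_assoc]
    exact List.perm_append_comm.append_right _

lemma IsCan.tensSigma {β : κ → Type} {A : (Σ k, β k) → V} {mA : (Σ k, β k) → List ι}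
    {a : ∀ p, A p ≅ tens X (mA p)} (hm : Sep mA) {m : ∀ k, List (β k)} (hn : ∀ k, (m k).Nodup)
    {l : List κ} (hl : l.Nodup) :
    IsCan f (canTens (fun k => canTens (fun q => a ⟨k, q⟩) (m k)) l) (canTens a (l.sigma m))
      (tensSigma A m l).hom := by
  induction l with
  | nil => exact IsCan.id List.nodup_nil
  | cons k l ih =>
    have h1 : ((m k).map (Sigma.mk k) ++ l.sigma m).Nodup := hl.sigma hn
    have h2 := IsCan.tensAppend (f := f) (a := a) hm h1
    exact ((IsCan.tensRelabel (f := f) (a := a) hm (Sigma.mk k) (List.nodup_append.1 h1).1).tensor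
      (ih (List.nodup_cons.1 hl).2) (List.disjoint_of_nodup_append h2.nodup_left)).comp h2

lemma IsCan.regroup {k : ℕ} {j : Fin k → ℕ} {A : Fin (∑ s, j s) → V} {m : Fin (∑ s, j s) → List ι}
    {a : ∀ r, A r ≅ tens X (m r)} (hm : Sep m) :
    IsCan f (canUt a) (canUt fun s => canUt fun q => a (finSigmaFinEquiv ⟨s, q⟩)) (regroup A) := by
  have h1 : ((List.finRange k).sigma (fun s => List.finRange (j s))).Nodup :=
    (List.nodup_finRange k).sigma fun s => List.nodup_finRange (j s)
  have h2 : Sub (fun _ : Fin (∑ s, j s) => False) (List.finRange (∑ s, j s))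
      (((List.finRange k).sigma (fun s => List.finRange (j s))).map finSigmaFinEquiv) :=
    Sub.of_iff (List.nodup_finRange _) (h1.map finSigmaFinEquiv.injective) fun r =>
      ⟨fun _ => List.mem_map.2 ⟨finSigmaFinEquiv.symm r, List.mem_sigma.2
        ⟨List.mem_finRange _, List.mem_finRange _⟩, finSigmaFinEquiv.apply_symm_apply r⟩,
        fun _ => List.mem_finRange r⟩
  have h3 := IsCan.rearr (f := f) (a := a) (fA := fun _ h => h.elim) hm (fun _ h => h.elim) h2
  have h4 := IsCan.tensRelabel (f := f) (a := a) hm finSigmaFinEquiv (h1.map finSigmaFinEquiv.injective)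
  have h5 := IsCan.tensSigma (f := f) (a := fun p => a (finSigmaFinEquiv p))
    (hm.comp finSigmaFinEquiv.injective) (fun s => List.nodup_finRange (j s)) (List.nodup_finRange k)
  have h6 := h3.comp ((IsCan.inv h4 ?_).comp (IsCan.inv h5 ?_))
  · rw [LambdaOperad.regroup, rearrange_decEq _ (Classical.decEq _)]
    exact h6
  · intro i hi
    obtain ⟨r, hr, hi⟩ := mem_flat.1 hi
    obtain ⟨p, hp, rfl⟩ := List.mem_map.1 hr
    exact mem_flat.2 ⟨p, hp, hi⟩
  · intro i hi
    obtain ⟨p, hp, hi⟩ := mem_flat.1 hi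
    exact mem_flat.2 ⟨p.1, List.mem_finRange _, mem_flat.2 ⟨p.2, List.mem_finRange _, hi⟩⟩

lemma shuffle_eq {k : ℕ} {j : Fin k → ℕ} (A : V) (B : Fin k → V) (Y : Fin (∑ s, j s) → V) :
    shuffle A B Y = (α_ _ _ _).hom ≫ (A ◁ (sh (IsPart.fin j) B Y).hom) := by
  refine congrArg (fun z => (α_ _ _ _).hom ≫ (A ◁ z)) ?_
  have hS := sep_atoms (S := Fin k) (N := Fin (∑ s, j s))
  have h1 := IsCan.sh (f := fun (_ : Fin k ⊕ Fin (∑ s, j s)) (h : False) => h.elim)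
    (a := canInl B Y) (b := canInr B Y) hS (IsPart.fin j)
  refine IsCan.unique ?_ h1
  have h2 := (IsCan.regroup (f := fun (_ : Fin k ⊕ Fin (∑ s, j s)) (h : False) => h.elim)
    (a := canInr B Y) hS.inr)
  have h3 := IsCan.tensZip (f := fun (_ : Fin k ⊕ Fin (∑ s, j s)) (h : False) => h.elim)
    (a := canInl B Y) (b := fun s => canUt fun q => canInr B Y (finSigmaFinEquiv ⟨s, q⟩))
    (hS.fibre (IsPart.fin j)) (List.nodup_finRange k)
  exact (h2.whiskerLeft (canUt (canInl B Y)) h3.nodup_left).comp h3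

end Shuffle

section KellyMonoidal

variable [SymmetricCategory V] [HasColimits V]
  [TensorCocts V]

lemma ascHom_gen (D E F : LambdaSeq V) {k : ℕ} (j : Fin k → ℕ) (i : Fin (∑ s, j s) → ℕ) :
    (kellyGen D E j ▷ finTensor (fun r => F.obj (i r))) ≫ kellyGen (kelly D E) F i ≫
        (ascHom D E F).hom.app (op ⟨∑ r, i r⟩) =
      shuffle (D.obj k) (fun s => E.obj (j s)) (fun r => F.obj (i r)) ≫
        (D.obj k ◁ finTensorMap (fun s => kellyGen E F (fun q => i (finSigmaFinEquiv ⟨s, q⟩)))) ≫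
        kellyGen D (kelly E F) (fun s => ∑ q, i (finSigmaFinEquiv ⟨s, q⟩)) ≫
        eqToHom (congrArg (kelly D (kelly E F)).obj (sum_regroup i).symm) := by
  let i' : Fin k → ℕ := fun s => ∑ q, i (finSigmaFinEquiv ⟨s, q⟩)
  have e1 := Gen_ascHom D E F (IsPart.fin j) (IsPart.fin i)
    (fun s => IsPart.fin fun q => i (finSigmaFinEquiv ⟨s, q⟩))
    ((IsPart.fin i').comp (finCongr (sum_regroup i).symm)) (finSigmaFinEquiv_assoc j i)
  have e2 := Gen_ext_res D (kelly E F) (IsPart.fin i') ((IsPart.fin i').comp (finCongr (sum_regroup i).symm))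
    (fun s => Embedding.refl _) (finCongr (sum_regroup i)).toEmbedding fun s t => by
      simp
  have e3 : (utMap fun s => res (kelly E F).seq (Embedding.refl (Fin (i' s)))) = 𝟙 _ :=
    (congrArg (fun z => utMap z) (funext fun s => res_refl _)).trans (utMap_id _)
  have e4 := eqToHom_eq_res (kelly D (kelly E F)).seq (sum_regroup i).symm
  have e5 := shuffle_eq (D.obj k) (fun s => E.obj (j s)) (fun r => F.obj (i r))
  have e6 : (utMap fun s => Gen E F (IsPart.fin fun q => i (finSigmaFinEquiv ⟨s, q⟩))) =
      finTensorMap (fun s => kellyGen E F (fun q => i (finSigmaFinEquiv ⟨s, q⟩))) :=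
    congrArg (fun z => utMap z) (funext fun s => Gen_fin _ _ _)
  have aux : ∀ {A B C Q Z Y K L W : V} {g g' : A ⊗ B ⟶ Q} {H H' : Q ⊗ C ⟶ Z} {t : Z ⟶ Y} {s : B ⊗ C ⟶ K}
      {m m' : K ⟶ L} {G₁ : A ⊗ L ⟶ Y} {G G' : A ⊗ L ⟶ W} {c c' : W ⟶ Y} {i : L ⟶ L}
      {S : (A ⊗ B) ⊗ C ⟶ A ⊗ K} (hg : g = g') (hH : H = H') (hG : G = G') (hm : m = m') (hc : c = c') (hi : i = 𝟙 _)
      (e1 : (g ▷ C) ≫ H ≫ t = (α_ _ _ _).hom ≫ (A ◁ (s ≫ m)) ≫ G₁) (e2 : G ≫ c' = (A ◁ i) ≫ G₁)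
      (e5 : S = (α_ _ _ _).hom ≫ (A ◁ s)), (g' ▷ C) ≫ H' ≫ t = S ≫ (A ◁ m') ≫ G' ≫ c := by
    rintro A B C Q Z Y K L W g _ H _ t s m _ G₁ G _ c _ _ _ rfl rfl rfl rfl rfl rfl e1 e2 rfl
    rw [whiskerLeft_id, id_comp] at e2
    rw [e1, e2]
    simp
  exact aux (Gen_fin _ _ _) (Gen_fin _ _ _) (Gen_fin _ _ _) e6 e4 e3 e1 e2 e5

lemma luHom_gen (D : LambdaSeq V) (n : ℕ) :
    (kellyUnitGen V ▷ finTensor (fun _ => D.obj n)) ≫ kellyGen (kellyUnit V) D (fun _ : Fin 1 => n) ≫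
        (luHom D).hom.app (op ⟨∑ _ : Fin 1, n⟩) =
      (λ_ _).hom ≫ (finTensorOne (fun _ => D.obj n)).hom ≫ eqToHom (congrArg D.obj (by simp)) := by
  have h : n = ∑ _ : Fin 1, n := by simp
  let i : Fin 1 ↪ Fin 1 := Embedding.refl _
  have e1 := Gen_luHom D (IsPart.fin fun _ : Fin 1 => n) i
    (fun _ _ _ => (finCongr h.symm).toEmbedding) (fun t ht => absurd ⟨t, rfl⟩ ht)
    fun s s' h' m => Fin.ext (finSigmaFinEquiv_one _)
  have e2 := utSp_refl (S := Fin 1) (A := fun _ => ev D.seq (Fin n)) (B := fun _ => ev D.seq (Fin (∑ _ : Fin 1, n)))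
    (fun _ _ _ => res D.seq (finCongr h.symm).toEmbedding) fun t ht => bs D (absurd ⟨t, rfl⟩ ht)
  have e3 := finTensorOne_naturality (A := fun _ => ev D.seq (Fin n))
    (B := fun _ => ev D.seq (Fin (∑ _ : Fin 1, n))) fun _ => res D.seq (finCongr h.symm).toEmbedding
  have e4 := eqToHom_eq_res D.seq h
  have aux : ∀ {A X Y Z B C : V} {u u' : 𝟙_ V ⟶ A} {G G' : A ⊗ X ⟶ Z} {t : Z ⟶ B} {x x' : X ⟶ Y}
      {o : Y ⟶ B} {o' : X ⟶ C} {c c' : C ⟶ B} (hu : u = u') (hG : G = G')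
      (e1 : (u' ▷ X) ≫ G ≫ t = (λ_ _).hom ≫ x ≫ o) (e2 : x = x') (e3 : x' ≫ o = o' ≫ c')
      (e4 : c = c'), (u ▷ X) ≫ G' ≫ t = (λ_ _).hom ≫ o' ≫ c := by
    rintro A X Y Z B C u _ G _ t x _ o o' c _ rfl rfl e1 rfl e3 rfl
    rw [e1, e3]
  exact aux (kellyUnitGen_eq i) (Gen_fin _ _ _) e1 e2 e3 e4

lemma ruHom_gen (D : LambdaSeq V) (k : ℕ) :
    (D.obj k ◁ finTensorUnits (fun _ => kellyUnitGen V)) ≫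
        kellyGen D (kellyUnit V) (fun _ : Fin k => 1) ≫ (ruHom D).hom.app (op ⟨∑ _ : Fin k, 1⟩) =
      (ρ_ (D.obj k)).hom ≫ eqToHom (congrArg D.obj (by simp)) := by
  have h : k = ∑ _ : Fin k, 1 := by simp
  let i : Fin 1 ↪ Fin 1 := Embedding.refl _
  have e1 := Gen_ruHom D (IsPart.fin fun _ : Fin k => 1) (fun _ => i) (finCongr h.symm).toEmbedding
    fun s t => Fin.ext (by
      change (finSigmaFinEquiv (n := fun _ : Fin k => 1) ⟨s, t⟩ : ℕ) = s
      rw [finSigmaFinEquiv_apply]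
      simp)
  have e2 := eqToHom_eq_res D.seq h
  have e3 : finTensorUnits (fun _ : Fin k => kellyUnitGen V) = utUnits fun _ : Fin k => unitGen i :=
    congrArg (fun z => utUnits z) (funext fun _ : Fin k => kellyUnitGen_eq (V := V) i)
  have aux : ∀ {A X Z B : V} {u u' : 𝟙_ V ⟶ X} {G G' : A ⊗ X ⟶ Z} {t : Z ⟶ B} {c c' : A ⟶ B}
      (hu : u = u') (hG : G = G') (e1 : (A ◁ u') ≫ G ≫ t = (ρ_ _).hom ≫ c') (e2 : c = c'),
      (A ◁ u) ≫ G' ≫ t = (ρ_ _).hom ≫ c := by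
    rintro A X Z B u _ G _ t c _ rfl rfl e1 rfl
    exact e1
  exact aux e3 (Gen_fin _ _ _) e1 e2

variable (V) in
/-- The Kelly monoidal structure. -/
def kellyMonoidal : KellyMonoidal V where
  associator := ascIso
  leftUnitor := luIso
  rightUnitor := ruIso
  associator_gen := ascHom_gen
  leftUnitor_gen := luHom_gen
  rightUnitor_gen := ruHom_gen
  associator_naturality := ascHom_naturality
  leftUnitor_naturality := luHom_naturality
  rightUnitor_naturality := ruHom_naturality
  pentagon := asc_pentagon
  triangle := triangle_ascHom

end KellyMonoidal
section EnumeratedOperad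

variable (O : OperadData V)
  {S S' N N' M : Type} [Enum S] [Enum S'] [Enum N] [Enum N'] [Enum M]
  {T : S → Type} [∀ s, Enum (T s)] {T' : S' → Type} [∀ s, Enum (T' s)]
  {r : ∀ s, T s → N} {r' : ∀ s, T' s → N'}

/-- The value of an operad at an enumerated set. -/
abbrev oev (O : OperadData V) (S : Type) [Enum S] : V := O.seq.obj (op ⟨Enum.n S⟩)

/-- The map between the enumerating sets that corresponds to a bijection. -/
def toFinEquiv (x : S ≃ S') : Fin (Enum.n S) ≃ Fin (Enum.n S') := Enum.e.symm.trans (x.trans Enum.e)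

/-- The contravariant action of a bijection of enumerated sets. -/
def OperadData.actE (x : S ≃ S') : oev O S' ⟶ oev O S := O.act (toFinEquiv x)

lemma OperadData.act_comp {a b c : ℕ} {x : Fin a ≃ Fin b} {y : Fin b ≃ Fin c} {z : Fin a ≃ Fin c}
    (h : ∀ s, y (x s) = z s) : O.act y ≫ O.act x = O.act z := by
  obtain rfl : x.trans y = z := Equiv.ext h
  exact (O.seq.map_comp _ _).symm

lemma OperadData.act_refl {a : ℕ} {x : Fin a ≃ Fin a} (h : ∀ s, x s = s) : O.act x = 𝟙 _ := by
  obtain rfl : x = Equiv.refl _ := Equiv.ext h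
  exact O.seq.map_id _

lemma OperadData.actE_congr {x y : S ≃ S'} (h : ∀ s, x s = y s) : O.actE x = O.actE y := by
  rw [Equiv.ext h]

lemma OperadData.actE_comp {x : S ≃ S'} {y : S' ≃ N} {z : S ≃ N} (h : ∀ s, y (x s) = z s) :
    O.actE y ≫ O.actE x = O.actE z :=
  O.act_comp fun q => by
    change Enum.e (y (Enum.e.symm (Enum.e (x (Enum.e.symm q))))) = Enum.e (z (Enum.e.symm q))
    rw [Equiv.symm_apply_apply, h]

lemma OperadData.actE_refl {x : S ≃ S} (h : ∀ s, x s = s) : O.actE x = 𝟙 _ :=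
  O.act_refl fun q => by
    change Enum.e (x (Enum.e.symm q)) = q
    rw [h, Equiv.apply_symm_apply]

lemma OperadData.eqToHom_eq_actE {m n : ℕ} (h : m = n) :
    eqToHom (congrArg O.obj h) = O.actE (S := Fin n) (S' := Fin m) (finCongr h.symm) := by
  subst h
  exact (O.actE_refl (S := Fin m) (x := finCongr rfl) fun _ => rfl).symm

lemma OperadData.eqToHom_oev {U : N → Type} [∀ n, Enum (U n)] {n n' : N} (h : n = n') :
    eqToHom (congrArg (fun n => oev O (U n)) h) =
      O.actE (S := U n') (S' := U n) (Equiv.cast (congrArg U h.symm)) := by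
  subst h
  exact (O.actE_refl (x := Equiv.cast rfl) fun _ => rfl).symm

/-- The structure map `O S ⊗ ⨂ₛ O (T s) ⟶ O N` for a partition of `N` into the sets `T s`. -/
def OperadData.gam (hr : IsPart r) : oev O S ⊗ ut (fun s => oev O (T s)) ⟶ oev O N :=
  O.γ (fun q : Fin (Enum.n S) => Enum.n (T (Enum.e.symm q))) ≫
    O.actE (S := N) (S' := Σ s, T s) hr.equiv.symm

lemma OperadData.gam_fin {k : ℕ} (j : Fin k → ℕ) : O.gam (IsPart.fin j) = O.γ j := by
  have h : O.actE (IsPart.fin j).equiv.symm = 𝟙 (O.obj (∑ s, j s)) :=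
    O.act_refl fun i => by
      obtain ⟨⟨s, q⟩, rfl⟩ := finSigmaFinEquiv.surjective i
      exact (congrArg (Enum.e (S := Σ s, Fin (j s)))
        ((IsPart.fin j).equiv_symm s q)).trans (Enum.e_sigma_fin ⟨s, q⟩)
  exact (congrArg (fun z => O.γ j ≫ z) h).trans (comp_id _)

variable [SymmetricCategory V]

/-- The morphism `⨂ₛ O (T s) ⟶ ⨂ₛ O (T' s)` given by bijections `T' (σ s) ≃ T s`. -/
def OperadData.utAct (σ : S ≃ S') (f : ∀ s s', σ s = s' → (T' s' ≃ T s)) :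
    ut (fun s => oev O (T s)) ⟶ ut (fun s => oev O (T' s)) :=
  utSp σ.toEmbedding (fun s s' h => O.actE (f s s' h)) (fun s' hs' => absurd (σ.surjective s') hs')

variable {O}

lemma IsOperad.equivariant_fin (hO : IsOperad O) {k l : ℕ} (σ : Fin k ≃ Fin l) (j : Fin k → ℕ)
    (j' : Fin l → ℕ) (f : ∀ s t, σ s = t → (Fin (j' t) ≃ Fin (j s)))
    (x : Fin (∑ t, j' t) ≃ Fin (∑ s, j s))
    (hx : ∀ s q, x (finSigmaFinEquiv ⟨σ s, q⟩) = finSigmaFinEquiv ⟨s, f s (σ s) rfl q⟩) :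
    (O.act σ ▷ _) ≫ O.γ j ≫ O.act x =
      (_ ◁ utSp (S := Fin k) (S' := Fin l) (A := fun s => O.obj (j s)) (B := fun t => O.obj (j' t))
        σ.toEmbedding (fun s t h => O.act (f s t h))
        (fun t ht => absurd (σ.surjective t) ht)) ≫ O.γ j' := by
  obtain rfl : k = l := by simpa using Fintype.card_congr σ
  obtain rfl : j = fun s => j' (σ s) := by
    funext s
    simpa using (Fintype.card_congr (f s _ rfl)).symm
  have e1 := hO.equivariant_left σ j'
  have e2 := hO.equivariant_right (fun s => j' (σ s)) fun s => f s _ rfl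
  have e3 : permute σ (fun t => O.obj (j' t)) = utSpread (S := Fin k) (S' := Fin k) σ.toEmbedding
    (fun t => O.obj (j' t)) (fun t ht => absurd (σ.surjective t) ht) := spread_eq_utSpread _ _ _
  let y : Fin (∑ s, j' (σ s)) ≃ Fin (∑ s, j' (σ s)) :=
    blockEquiv (Equiv.refl (Fin k)) (j' := fun s => j' (σ s)) fun s => f s _ rfl
  let z : Fin (∑ s, j' (σ s)) ≃ Fin (∑ t, j' t) :=
    blockEquiv (j' := j') σ fun _ => Equiv.refl _
  have hy : ∀ s q, y (finSigmaFinEquiv ⟨s, q⟩) = finSigmaFinEquiv ⟨s, f s (σ s) rfl q⟩ := fun s q =>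
    congrArg finSigmaFinEquiv (congrArg (Equiv.sigmaCongr (β₂ := fun s => Fin (j' (σ s))) (Equiv.refl (Fin k))
      fun s => f s (σ s) rfl) (finSigmaFinEquiv.symm_apply_apply (⟨s, q⟩ : Σ s, Fin (j' (σ s)))))
  have hz : ∀ s q, z (finSigmaFinEquiv ⟨s, q⟩) = finSigmaFinEquiv ⟨σ s, q⟩ := fun s q =>
    congrArg finSigmaFinEquiv (congrArg (Equiv.sigmaCongr (β₂ := fun t => Fin (j' t)) σ fun _ => Equiv.refl _)
      (finSigmaFinEquiv.symm_apply_apply (⟨s, q⟩ : Σ s, Fin (j' (σ s)))))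
  have e4 : O.act x ≫ O.act z = O.act y := O.act_comp fun i => by
    obtain ⟨⟨s, q⟩, rfl⟩ := finSigmaFinEquiv.surjective i
    rw [hy, hz, hx]
  have e5 : O.act z ≫ O.act z.symm = 𝟙 _ := (O.act_comp fun i => z.apply_symm_apply i).trans
    (O.act_refl (x := Equiv.refl _) fun _ => rfl)
  have aux : ∀ {A B X Y P Q : V} {a : A ⟶ B} {g : B ⊗ X ⟶ P} {x : P ⟶ Q} {z : Q ⟶ P} {z' : P ⟶ Q}
      {y : P ⟶ P} {p p' : X ⟶ Y} {w : X ⟶ X} {g' : A ⊗ Y ⟶ Q} (e1 : (a ▷ X) ≫ g = (A ◁ p) ≫ g' ≫ z)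
      (e2 : (B ◁ w) ≫ g = g ≫ y) (e3 : p = p') (e4 : x ≫ z = y) (e5 : z ≫ z' = 𝟙 _) (e6 : z' ≫ z = 𝟙 _),
      (a ▷ X) ≫ g ≫ x = (A ◁ (w ≫ p')) ≫ g' := by
    rintro A B X Y P Q a g x z z' _ p _ w g' e1 e2 rfl rfl e5 e6
    have h : g ≫ x = (B ◁ w) ≫ g ≫ z' := by
      rw [reassoc_of% e2, e5, Category.comp_id]
    rw [h, ← whisker_exchange_assoc, reassoc_of% e1, e5]
    simp
  exact aux e1 e2 e3 e4 e5 ((O.act_comp fun i => z.symm_apply_apply i).trans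
    (O.act_refl (x := Equiv.refl _) fun _ => rfl))

/-- Equivariance of the structure maps of an operad. -/
lemma IsOperad.equivariant (hO : IsOperad O) (hr : IsPart r) (hr' : IsPart r') (σ : S ≃ S')
    (f : ∀ s s', σ s = s' → (T' s' ≃ T s)) (ψ : N' ≃ N)
    (hψ : ∀ s s' h t', ψ (r' s' t') = r s (f s s' h t')) :
    (O.actE σ ▷ _) ≫ O.gam hr ≫ O.actE ψ = (_ ◁ O.utAct σ f) ≫ O.gam hr' := by
  have h1 : ∀ {q q'}, toFin σ.toEmbedding q = q' → σ (Enum.e.symm q) = Enum.e.symm q' := by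
    rintro q _ rfl
    rw [toFin_apply, Equiv.symm_apply_apply]
    rfl
  let x : (Σ s, T' s) ≃ Σ s, T s := hr'.equiv.trans (ψ.trans hr.equiv.symm)
  have e1 := hO.equivariant_fin (toFinEquiv σ) (fun q => Enum.n (T (Enum.e.symm q)))
    (fun q => Enum.n (T' (Enum.e.symm q)))
    (fun q q' h => toFinEquiv (f (Enum.e.symm q) (Enum.e.symm q') (h1 h)))
    (toFinEquiv x) (by
      intro q p
      apply (Enum.e (S := Σ s, T s)).symm.injective
      refine ((Enum.e (S := Σ s, T s)).symm_apply_apply _).trans ?_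
      refine Eq.trans ?_ (Enum.e_sigma_symm (T := T) q _).symm
      refine (congrArg x (Enum.e_sigma_symm (T := T') (toFinEquiv σ q) p)).trans ?_
      refine (congrArg hr.equiv.symm (hψ _ _ (h1 rfl) _)).trans ((hr.equiv_symm _ _).trans ?_)
      refine congrArg (Sigma.mk _) ?_
      exact (Enum.e.symm_apply_apply _).symm)
  have e2 := utSp_eq_fin (φ := σ.toEmbedding) (A := fun s => oev O (T s)) (B := fun s => oev O (T' s))
    (fun s s' h => O.actE (f s s' h)) (fun s' hs' => absurd (σ.surjective s') hs') h1
    (fun {q'} h ⟨s, hs⟩ => h ⟨Enum.e s, by rw [toFin_apply, Equiv.symm_apply_apply, hs, Equiv.apply_symm_apply]⟩)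
  have e3 : O.actE hr.equiv.symm ≫ O.actE ψ = O.actE x ≫ O.actE hr'.equiv.symm :=
    (O.actE_comp (z := ψ.trans hr.equiv.symm) fun _ => rfl).trans (O.actE_comp fun i => by
      exact congrArg (fun i => hr.equiv.symm (ψ i)) (hr'.equiv.apply_symm_apply i)).symm
  have aux : ∀ {A B X Y P Q R R' : V} {a : A ⟶ B} {g : B ⊗ X ⟶ P} {x : P ⟶ Q} {c : P ⟶ R} {d : R ⟶ R'}
      {c' : Q ⟶ R'} {p p' : X ⟶ Y} {g' : A ⊗ Y ⟶ Q} (e1 : (a ▷ X) ≫ g ≫ x = (A ◁ p') ≫ g')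
      (e2 : p = p') (e3 : c ≫ d = x ≫ c'), (a ▷ X) ≫ (g ≫ c) ≫ d = (A ◁ p) ≫ g' ≫ c' := by
    rintro A B X Y P Q R R' a g x c d c' p _ g' e1 rfl e3
    rw [Category.assoc, e3, reassoc_of% e1]
  exact aux e1 e2 e3

end EnumeratedOperad
section EnumeratedOperad

variable {O : OperadData V}
  {S S' N N' M : Type} [Enum S] [Enum S'] [Enum N] [Enum N'] [Enum M]
  {T : S → Type} [∀ s, Enum (T s)] {T' : S' → Type} [∀ s, Enum (T' s)]
  {r : ∀ s, T s → N} {r' : ∀ s, T' s → N'}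

lemma IsPart.reindex (hr : IsPart r) : IsPart fun (q : Fin (Enum.n S)) t => r (Enum.e.symm q) t := by
  refine ⟨?_, fun n => ?_⟩
  · rintro ⟨q, t⟩ ⟨q', t'⟩ h
    obtain rfl := Enum.e.symm.injective (hr.inj' h)
    obtain rfl := hr.inj _ h
    rfl
  · obtain ⟨s, t, rfl⟩ := hr.exists n
    obtain ⟨q, rfl⟩ := Enum.e.symm.surjective s
    exact ⟨⟨q, t⟩, rfl⟩

lemma OperadData.gam_reindex (hr : IsPart r) : O.gam hr = O.gam hr.reindex := by
  refine congrArg (fun x => O.γ _ ≫ O.act x) (Equiv.ext fun i => ?_)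
  obtain ⟨n, rfl⟩ := Enum.e.surjective i
  obtain ⟨⟨q, t⟩, rfl⟩ := hr.reindex.equiv.surjective n
  obtain ⟨p, rfl⟩ := Enum.e.symm.surjective t
  have h1 : (Enum.e (S := Σ s, T s)) ⟨Enum.e.symm q, Enum.e.symm p⟩ = finSigmaFinEquiv ⟨q, p⟩ :=
    (Equiv.symm_apply_eq _).1 (Enum.e_sigma_symm (T := T) q p)|>.symm
  have h2 : (Enum.e (S := Σ q : Fin (Enum.n S), T (Enum.e.symm q))) ⟨q, Enum.e.symm p⟩ =
      finSigmaFinEquiv ⟨q, p⟩ :=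
    (Equiv.symm_apply_eq _).1 (Enum.e_sigma_symm (T := fun q : Fin (Enum.n S) => T (Enum.e.symm q)) q p)|>.symm
  have h3 : hr.equiv.symm (Enum.e.symm (Enum.e (hr.reindex.equiv ⟨q, Enum.e.symm p⟩))) =
      ⟨Enum.e.symm q, Enum.e.symm p⟩ := by
    rw [Equiv.symm_apply_apply]
    exact hr.equiv_symm _ _
  have h4 : hr.reindex.equiv.symm (Enum.e.symm (Enum.e (hr.reindex.equiv ⟨q, Enum.e.symm p⟩))) =
      ⟨q, Enum.e.symm p⟩ := by
    rw [Equiv.symm_apply_apply, Equiv.symm_apply_apply]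
  exact ((congrArg Enum.e h3).trans h1).trans ((congrArg Enum.e h4).trans h2).symm

variable [SymmetricCategory V]

lemma sh_reindex (hr : IsPart r) (A : S → V) (B : N → V) :
    (sh hr A B).hom = (sh (S := Fin (Enum.n S)) hr.reindex (fun q => A (Enum.e.symm q)) B).hom := by
  have hs := sep_atoms (S := S) (N := N)
  have hs' : Sep (Sum.elim (fun q : Fin (Enum.n S) => [(Sum.inl (Enum.e.symm q) : S ⊕ N)])
      (fun n : N => [Sum.inr n])) :=
    ⟨by rintro (s | n) <;> simp, by
      rintro (s | n) (s' | n') (i | i) <;> simp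
      · rintro rfl h; exact Enum.e.symm.injective h
      · rintro rfl h; exact h⟩
  exact IsCan.unique (f := fun _ (h : False) => h.elim) (IsCan.sh (a := canInl A B) (b := canInr A B) hs hr)
    (IsCan.sh (S := Fin (Enum.n S)) (a := fun q => canInl A B (Enum.e.symm q)) (b := canInr A B) hs'
      hr.reindex)

/-- Equivariance of the structure maps of an operad with respect to bijections of the parts. -/
lemma IsOperad.gam_act (hO : IsOperad O) {T' : S → Type} [∀ s, Enum (T' s)] {r' : ∀ s, T' s → N'}
    (hr : IsPart r) (hr' : IsPart r') (f : ∀ s, T' s ≃ T s) (ψ : N' ≃ N)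
    (hψ : ∀ s t', ψ (r' s t') = r s (f s t')) :
    O.gam hr ≫ O.actE ψ = (_ ◁ utMap fun s => O.actE (f s)) ≫ O.gam hr' := by
  have h := hO.equivariant hr hr' (Equiv.refl S) (fun s s' h => (Equiv.cast (congrArg T' h.symm)).trans (f s))
    ψ (by rintro s _ rfl t'; exact hψ s t')
  have h1 : O.utAct (Equiv.refl S) (fun s s' h => (Equiv.cast (congrArg T' h.symm)).trans (f s)) =
      utMap fun s => O.actE (f s) := utSp_refl _ _
  rw [h1, O.actE_refl (fun _ => rfl), id_whiskerRight, Category.id_comp] at h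
  exact h

lemma OperadData.actE_symm {x : S ≃ S'} : O.actE x ≫ O.actE x.symm = 𝟙 _ :=
  (O.actE_comp (z := Equiv.refl _) fun s => x.apply_symm_apply s).trans (O.actE_refl fun _ => rfl)

lemma OperadData.actE_symm' {x : S ≃ S'} : O.actE x.symm ≫ O.actE x = 𝟙 _ :=
  (O.actE_comp (z := Equiv.refl _) fun s => x.symm_apply_apply s).trans (O.actE_refl fun _ => rfl)

instance (x : S ≃ S') : IsIso (O.actE x) := ⟨O.actE x.symm, O.actE_symm, O.actE_symm'⟩

section Associativity

variable {U : N → Type} [∀ n, Enum (U n)] {w : ∀ n, U n → M}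

lemma IsOperad.gam_assoc_fin (hO : IsOperad O) {k : ℕ} {T : Fin k → Type} [∀ s, Enum (T s)]
    {r : ∀ s, T s → N} {L : Fin k → Type} [∀ s, Enum (L s)] {l : ∀ s, L s → M}
    {x : ∀ s (t : T s), U (r s t) → L s} (hr : IsPart r) (hw : IsPart w)
    (hx : ∀ s, IsPart (x s)) (hl : IsPart l) (h : ∀ s t u, l s (x s t u) = w (r s t) u) :
    (O.gam hr ▷ _) ≫ O.gam hw = (α_ _ _ _).hom ≫
      (_ ◁ ((sh hr (fun s => oev O (T s)) (fun n => oev O (U n))).hom ≫ utMap fun s => O.gam (hx s))) ≫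
        O.gam hl := by
  let j : Fin k → ℕ := fun s => Enum.n (T s)
  let σ : N ≃ Fin (∑ s, j s) := hr.equiv.symm.trans (Enum.e (S := Σ s, T s))
  have hσ : ∀ s t, σ (r s t) = finSigmaFinEquiv ⟨s, Enum.e t⟩ := fun s t =>
    (congrArg (Enum.e (S := Σ s, T s)) (hr.equiv_symm s t)).trans ((Equiv.symm_apply_eq _).1
      ((Enum.e_sigma_symm (T := T) s (Enum.e t)).trans (congrArg (Sigma.mk s) (Enum.e.symm_apply_apply t)))).symm
  let i : Fin (∑ s, j s) → ℕ := fun p => Enum.n (U (σ.symm p))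
  let fU : ∀ n p, σ n = p → (Fin (i p) ≃ U n) := fun n p hp =>
    (Enum.e (S := U (σ.symm p))).symm.trans (Equiv.cast (congrArg U ((Equiv.symm_apply_eq σ).2 hp.symm)))
  have hfU : ∀ n p hp u, w n (fU n p hp u) = w (σ.symm p) (Enum.e.symm u) := by
    rintro n _ rfl u
    exact apply_cast (w := w) (σ.symm_apply_apply n) _
  have hlx : ∀ s t p (hp : σ (r s t) = p) u, l s (x s t (fU (r s t) p hp u)) = w (σ.symm p) (Enum.e.symm u) :=
    fun s t p hp u => (h _ _ _).trans (hfU _ _ hp _)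
  let ψ : Fin (∑ p, i p) ≃ M := (IsPart.fin i).equiv.symm.trans ((Equiv.sigmaCongr σ.symm
    fun p => (Enum.e (S := U (σ.symm p))).symm).trans hw.equiv)
  have hψ : ∀ p u, ψ (finSigmaFinEquiv ⟨p, u⟩) = w (σ.symm p) (Enum.e.symm u) := fun p u =>
    congrArg (fun z => hw.equiv ((Equiv.sigmaCongr σ.symm fun p => (Enum.e (S := U (σ.symm p))).symm) z))
      ((IsPart.fin i).equiv_symm p u)
  have e1 := hO.equivariant hw (IsPart.fin i) σ fU ψ fun n p hp u => (hψ p u).trans (hfU n p hp u).symm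
  have e2 : (O.γ (fun q : Fin (Enum.n (Fin k)) => Enum.n (T (Enum.e.symm q))) ▷ ut fun p => oev O (Fin (i p))) ≫ O.γ i = _ :=
    hO.assoc j i
  have e3 := shuffle_eq (O.obj k) (fun s => O.obj (j s)) (fun r => O.obj (i r))
  have hh : ∀ s t p, (Enum.e (S := T s)).toEmbedding t = p → σ (r s t) = finSigmaFinEquiv ⟨s, p⟩ := by
    rintro s t _ rfl
    exact hσ s t
  have e4 := sh_utSp_right (ψ := σ.toEmbedding) (T' := fun s => Fin (j s))
    (fun s => (Enum.e (S := T s)).toEmbedding) hr (IsPart.fin j) (fun s => oev O (T s))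
    (B := fun n => oev O (U n)) (B' := fun p => oev O (Fin (i p))) (fun n p hp => O.actE (fU n p hp))
    (fun p hp => absurd (σ.surjective p) hp) hh
    (fun s t' ht' => absurd (Enum.e.surjective t') ht')
  let i' : Fin k → ℕ := fun s => ∑ q, i (finSigmaFinEquiv ⟨s, q⟩)
  have e5 : ∀ s, ∃ ψs : Fin (i' s) ≃ L s, (∀ q u, ψs (finSigmaFinEquiv ⟨q, u⟩) =
      x s (Enum.e.symm q) (fU _ _ (hh s _ q (Enum.e.apply_symm_apply q)) u)) := by
    intro s
    refine ⟨(IsPart.fin fun q => i (finSigmaFinEquiv ⟨s, q⟩)).equiv.symm.trans ((Equiv.sigmaCongr (β₂ := fun t =>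
      U (r s t)) (Enum.e (S := T s)).symm fun q => fU _ _ (hh s _ q (Enum.e.apply_symm_apply q))).trans
      (hx s).equiv), fun q u => ?_⟩
    exact congrArg (fun z => (hx s).equiv ((Equiv.sigmaCongr (β₂ := fun t =>
      U (r s t)) (Enum.e (S := T s)).symm fun q => fU _ _ (hh s _ q (Enum.e.apply_symm_apply q))) z))
      ((IsPart.fin fun q => i (finSigmaFinEquiv ⟨s, q⟩)).equiv_symm q u)
  choose ψs hψs using e5
  have e6 : ∀ s, (_ ◁ utSp (Enum.e (S := T s)).toEmbedding (B := fun p => oev O (Fin (i (finSigmaFinEquiv ⟨s, p⟩))))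
      (fun t p hp => O.actE (fU (r s t) _ (hh s t p hp))) fun t' ht' => absurd (Enum.e.surjective t') ht') ≫
      O.γ (fun q => i (finSigmaFinEquiv ⟨s, q⟩)) = O.gam (hx s) ≫ O.actE (ψs s) := by
    intro s
    have h1 := hO.equivariant (hx s) (IsPart.fin fun q => i (finSigmaFinEquiv ⟨s, q⟩)) Enum.e
      (fun t q hq => fU (r s t) _ (hh s t q hq)) (ψs s) (by
        rintro t _ rfl u
        rw [hψs]
        apply hl.inj s
        exact (hlx s _ _ (hh s _ _ (Enum.e.apply_symm_apply _)) u).trans (hlx s t _ (hh s t _ rfl) u).symm)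
    have h2 : O.actE (Enum.e (S := T s)) = 𝟙 _ := O.act_refl fun q => Enum.e.apply_symm_apply q
    have aux : ∀ {A X Y P Q : V} {a : A ⟶ A} {p : X ⟶ Y} {g : A ⊗ X ⟶ P} {b : P ⟶ Q} {g' g'' : A ⊗ Y ⟶ Q}
      (h1 : (a ▷ X) ≫ g ≫ b = (A ◁ p) ≫ g') (h2 : a = 𝟙 _) (h3 : g' = g''), (A ◁ p) ≫ g'' = g ≫ b := by
      rintro A X Y P Q _ p g b g' _ h1 rfl rfl
      rw [← h1]
      simp
    exact aux h1 h2 (O.gam_fin _)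
  have e7 : (utMap fun s => (oev O (T s) ◁ utSp (Enum.e (S := T s)).toEmbedding
      (A := fun t => oev O (U (r s t)))
      (B := fun p => oev O (Fin (i (finSigmaFinEquiv ⟨s, p⟩))))
      (fun t p hp => O.actE (fU (r s t) _ (hh s t p hp))) fun t' ht' => absurd (Enum.e.surjective t') ht')) ≫
      (utMap fun s => O.γ (fun q => i (finSigmaFinEquiv ⟨s, q⟩))) =
      (utMap fun s => O.gam (hx s)) ≫ utMap fun s => O.actE (ψs s) :=
    (utMap_comp _ _).trans ((congrArg (fun z => utMap z) (funext e6)).trans (utMap_comp _ _).symm)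
  have e8 := hO.gam_act hl (IsPart.fin i') ψs ((finCongr (sum_regroup i).symm).trans ψ) fun s => by
    intro y
    obtain ⟨⟨q, u⟩, rfl⟩ := finSigmaFinEquiv.surjective y
    rw [hψs, hlx _ _ _ (hh s _ q (Enum.e.apply_symm_apply q))]
    exact (congrArg ψ (finSigmaFinEquiv_assoc j i s q u)).trans (hψ _ _)
  have e9 : O.actE ((finCongr (sum_regroup i).symm).trans ψ) = O.actE ψ ≫
    O.actE (finCongr (sum_regroup i).symm) := (O.actE_comp fun _ => rfl).symm
  have e10 := O.eqToHom_eq_actE (sum_regroup i).symm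
  have e11 : O.actE (finCongr (sum_regroup i).symm) ≫ O.actE (finCongr (sum_regroup i)) = 𝟙 _ :=
    O.actE_symm
  have aux : ∀ {A B X X₁ C C₁ D D₁ P Q Q₁ Q₂ G : V} {γj : A ⊗ B ⟶ P} {a : P ⟶ Q} {gw : Q ⊗ X ⟶ G} {ps : G ⟶ Q₁} {ut : X ⟶ X₁}
      {γi γi' : P ⊗ X₁ ⟶ Q₁} {s : B ⊗ X ⟶ C} {s' : B ⊗ X₁ ⟶ C₁} {m : C₁ ⟶ D₁} {n : C ⟶ C₁} {m' : C ⟶ D}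
      {p : D ⟶ D₁} {γ₁ γ₁' : A ⊗ D₁ ⟶ Q₂} {gl : A ⊗ D ⟶ G} {c c₁ : Q₂ ⟶ Q₁} {c' : Q₁ ⟶ Q₂} {b : G ⟶ Q₂}
      {S : (A ⊗ B) ⊗ X₁ ⟶ A ⊗ C₁} (hps : IsIso ps)
      (e1 : (a ▷ X) ≫ gw ≫ ps = (P ◁ ut) ≫ γi') (hγi : γi' = γi)
      (e2 : (γj ▷ X₁) ≫ γi = S ≫ (A ◁ m) ≫ γ₁ ≫ c) (e3 : S = (α_ _ _ _).hom ≫ (A ◁ s'))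
      (e4 : (B ◁ ut) ≫ s' = s ≫ n) (e7 : n ≫ m = m' ≫ p) (e8 : gl ≫ b = (A ◁ p) ≫ γ₁') (hγ : γ₁' = γ₁)
      (e9 : b = ps ≫ c') (e10 : c = c₁) (e11 : c' ≫ c₁ = 𝟙 _),
      ((γj ≫ a) ▷ X) ≫ gw = (α_ _ _ _).hom ≫ (A ◁ (s ≫ m')) ≫ gl := by
    rintro A B X X₁ C C₁ D D₁ P Q Q₁ Q₂ G γj a gw ps ut γi _ s s' m n m' p _ γ₁ gl c _ c' _ _ hps e1 rfl e2 rfl e4 e7 e8 rfl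
      rfl rfl e11
    rw [← cancel_mono ps]
    simp only [Category.assoc, comp_whiskerRight]
    rw [e1, ← whisker_exchange_assoc, e2]
    simp only [Category.assoc]
    rw [associator_naturality_right_assoc, ← whiskerLeft_comp_assoc, ← whiskerLeft_comp_assoc]
    simp only [Category.assoc]
    rw [reassoc_of% e4, e7]
    have e12 : gl ≫ ps = (A ◁ p) ≫ γ₁ ≫ c := by
      rw [← reassoc_of% e8, e11, Category.comp_id]
    rw [e12]
    simp
  exact aux (inferInstanceAs (IsIso (O.actE ψ))) e1 (O.gam_fin _) e2 e3 e4 e7 e8 (O.gam_fin _) e9 e10 e11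

/-- Associativity of the structure maps of an operad. -/
lemma IsOperad.gam_assoc (hO : IsOperad O) {L : S → Type} [∀ s, Enum (L s)] {l : ∀ s, L s → M}
    {x : ∀ s (t : T s), U (r s t) → L s} (hr : IsPart r) (hw : IsPart w)
    (hx : ∀ s, IsPart (x s)) (hl : IsPart l) (h : ∀ s t u, l s (x s t u) = w (r s t) u) :
    (O.gam hr ▷ _) ≫ O.gam hw = (α_ _ _ _).hom ≫
      (_ ◁ ((sh hr (fun s => oev O (T s)) (fun n => oev O (U n))).hom ≫ utMap fun s => O.gam (hx s))) ≫
        O.gam hl := by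
  have e1 := hO.gam_assoc_fin hr.reindex hw (fun q => hx (Enum.e.symm q)) hl.reindex fun q => h _
  have e2 := sh_reindex hr (fun s => oev O (T s)) (fun n => oev O (U n))
  have e3 := O.gam_reindex hr
  have e4 := O.gam_reindex hl
  have aux : ∀ {A B X C D P Q : V} {g g' : A ⊗ B ⟶ P} {s s' : B ⊗ X ⟶ C} {m : C ⟶ D} {l l' : A ⊗ D ⟶ Q}
    {w : P ⊗ X ⟶ Q} (e1 : (g' ▷ X) ≫ w = (α_ _ _ _).hom ≫ (A ◁ (s' ≫ m)) ≫ l') (e2 : s = s') (e3 : g = g')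
    (e4 : l = l'), (g ▷ X) ≫ w = (α_ _ _ _).hom ≫ (A ◁ (s ≫ m)) ≫ l := by
    rintro A B X C D P Q g _ s _ m l _ w e1 rfl rfl rfl
    exact e1
  exact aux e1 e2 e3 e4

end Associativity

end EnumeratedOperad
section Points

variable (O : OperadData V)
  {S S' N N' M : Type} [Enum S] [Enum S'] [Enum N] [Enum N'] [Enum M]
  {T : S → Type} [∀ s, Enum (T s)] {r : ∀ s, T s → N}

/-- The base map of an operad at an empty set. -/
def OperadData.obs (hS : IsEmpty S) : 𝟙_ V ⟶ oev O S :=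
  O.base ≫ O.actE (S := S) (S' := Fin 0) (Equiv.equivOfIsEmpty _ _)

open Classical in
/-- The base map or the unit map of an operad at a set with at most one element. -/
def OperadData.pt (i : S ↪ Fin 1) : 𝟙_ V ⟶ oev O S :=
  if h : IsEmpty S then O.obs h else O.unit ≫ O.actE (S := S) (S' := Fin 1)
    (Equiv.ofBijective i ⟨i.injective, fun q => by
      obtain ⟨s⟩ := not_isEmpty_iff.1 h
      exact ⟨s, Subsingleton.elim _ _⟩⟩)

variable {O}

lemma OperadData.obs_act (hS : IsEmpty S) (hS' : IsEmpty S') (x : S ≃ S') :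
    O.obs hS' ≫ O.actE x = O.obs hS := by
  rw [OperadData.obs, assoc, O.actE_comp (z := Equiv.equivOfIsEmpty _ _) fun s => hS.elim s]
  rfl

lemma OperadData.obs_zero (h : IsEmpty (Fin 0)) : O.obs h = O.base := by
  exact (congrArg (O.base ≫ ·) (O.actE_refl fun s => h.elim s)).trans (comp_id _)

lemma OperadData.pt_of_isEmpty (hS : IsEmpty S) (i : S ↪ Fin 1) : O.pt i = O.obs hS := dif_pos hS

lemma OperadData.pt_of_equiv (e : S ≃ Fin 1) (i : S ↪ Fin 1) : O.pt i = O.unit ≫ O.actE e :=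
  (dif_neg (not_isEmpty_iff.2 ⟨e.symm 0⟩)).trans
    (congrArg (O.unit ≫ ·) (O.actE_congr fun s => Subsingleton.elim _ _))

lemma exists_equiv_one (i : S ↪ Fin 1) (h : ¬ IsEmpty S) : Nonempty (S ≃ Fin 1) := by
  obtain ⟨s⟩ := not_isEmpty_iff.1 h
  exact ⟨Equiv.ofBijective i ⟨i.injective, fun q => ⟨s, Subsingleton.elim _ _⟩⟩⟩

lemma OperadData.pt_one (i : Fin 1 ↪ Fin 1) : O.pt i = O.unit := by
  exact (O.pt_of_equiv (Equiv.refl _) i).trans ((congrArg (O.unit ≫ ·) (O.actE_refl fun s => rfl)).trans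
    (comp_id _))

lemma OperadData.pt_act (x : S ≃ S') (i : S' ↪ Fin 1) (j : S ↪ Fin 1) : O.pt i ≫ O.actE x = O.pt j := by
  by_cases h : IsEmpty S
  · have h' : IsEmpty S' := x.symm.isEmpty
    rw [O.pt_of_isEmpty h, O.pt_of_isEmpty h', O.obs_act]
  · obtain ⟨e⟩ := exists_equiv_one j h
    rw [O.pt_of_equiv e, O.pt_of_equiv (x.symm.trans e), assoc, O.actE_comp (z := e) (by simp)]

lemma isIso_utUnits (hS : IsEmpty S) {A : S → V} (u : ∀ s, 𝟙_ V ⟶ A s) : IsIso (utUnits u) := by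
  have h0 : ∀ (l : List (Fin (Enum.n S))), l = [] → IsIso (tensUnits (fun q => u (Enum.e.symm q)) l) := by
    rintro _ rfl
    exact inferInstanceAs (IsIso (𝟙 _))
  exact h0 _ (List.eq_nil_iff_forall_not_mem.2 fun q => (hS.elim (Enum.e.symm q)))

variable [SymmetricCategory V]

lemma IsOperad.gam_units_points (hO : IsOperad O) :
    (_ ◁ utUnits fun _ : N => O.unit) ≫ O.gam (IsPart.points (N := N)) = (ρ_ _).hom := by
  have e1 := hO.unit_right (Enum.n N)
  have h : Enum.n N = ∑ _ : Fin (Enum.n N), 1 := by simp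
  have e2 := O.eqToHom_eq_actE h
  have e3 : O.actE (S := Fin (∑ _ : Fin (Enum.n N), 1)) (S' := Fin (Enum.n N)) (finCongr h.symm) ≫
      O.actE (S := N) (S' := Σ _ : N, Fin 1) (IsPart.points (N := N)).equiv.symm = 𝟙 (oev O N) :=
    (O.act_comp (z := Equiv.refl _) fun q => by
      have h1 := Enum.e_sigma_symm (S := N) (T := fun _ => Fin 1) q 0
      have h2 : (Enum.e (S := Σ _ : N, Fin 1)) ((IsPart.points (N := N)).equiv.symm (Enum.e.symm q)) =
          finSigmaFinEquiv (n := fun _ : Fin (Enum.n N) => 1) ⟨q, 0⟩ :=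
        (Equiv.symm_apply_eq _).1 (h1.trans ((IsPart.points (N := N)).equiv_symm _ 0).symm)|>.symm
      refine (congrArg (finCongr h.symm) h2).trans (Fin.ext ?_)
      change (finSigmaFinEquiv (n := fun _ : Fin (Enum.n N) => 1) ⟨q, 0⟩ : ℕ) = q
      rw [finSigmaFinEquiv_apply]
      simp).trans (O.act_refl fun _ => rfl)
  have aux : ∀ {A X Q P : V} {u : 𝟙_ V ⟶ X} {g : A ⊗ X ⟶ Q} {c c' : A ⟶ Q} {d : Q ⟶ A}
      (e1 : (A ◁ u) ≫ g = (ρ_ _).hom ≫ c) (e2 : c = c') (e3 : c' ≫ d = 𝟙 _), (A ◁ u) ≫ g ≫ d = (ρ_ _).hom := by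
    rintro A X Q P u g c _ d e1 rfl e3
    rw [reassoc_of% e1, e3, Category.comp_id]
  exact aux (P := 𝟙_ V) e1 e2 e3

/-- The right unit law of an operad. -/
lemma IsOperad.gam_units (hO : IsOperad O) (hr : IsPart r) (i : ∀ s, T s ↪ Fin 1) (κ : N ≃ S)
    (hκ : ∀ s t, κ (r s t) = s) :
    (_ ◁ utUnits fun s => O.pt (i s)) ≫ O.gam hr = (ρ_ _).hom ≫ O.actE κ := by
  have h1 : ∀ s, ∃ f : Fin 1 ≃ T s, ∀ t', κ.symm s = r s (f t') := by
    intro s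
    obtain ⟨s', t, ht⟩ := hr.exists (κ.symm s)
    have h2 := hκ s' t
    rw [ht, κ.apply_symm_apply] at h2
    subst h2
    obtain ⟨e⟩ := exists_equiv_one (i s) fun h => h.elim t
    exact ⟨e.symm, fun t' => ht.symm.trans (congrArg (r s) (e.injective (Subsingleton.elim _ _)))⟩
  choose f hf using h1
  have e1 := hO.gam_act hr (IsPart.points (N := S)) f κ.symm hf
  have e2 := utUnits_utMap (fun s => O.pt (i s)) fun s => O.actE (f s)
  have e3 : (fun s => O.pt (i s) ≫ O.actE (f s)) = fun _ => O.unit :=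
    funext fun s => (O.pt_act _ _ (Embedding.refl _)).trans (O.pt_one _)
  have e5 : O.actE κ.symm ≫ O.actE κ = 𝟙 _ := O.actE_symm'
  have aux : ∀ {A X Y P : V} {u : 𝟙_ V ⟶ X} {v v' : 𝟙_ V ⟶ Y} {w : X ⟶ Y} {g : A ⊗ X ⟶ P} {k : P ⟶ A} {k' : A ⟶ P}
      {p : A ⊗ Y ⟶ A} (e1 : g ≫ k = (A ◁ w) ≫ p) (e2 : u ≫ w = v) (e3 : v = v')
      (e4 : (A ◁ v') ≫ p = (ρ_ _).hom) (e5 : k ≫ k' = 𝟙 _), (A ◁ u) ≫ g = (ρ_ _).hom ≫ k' := by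
    rintro A X Y P u _ _ w g k k' p e1 rfl rfl e4 e5
    rw [← e4, whiskerLeft_comp, Category.assoc, Category.assoc, ← reassoc_of% e1, e5, Category.comp_id]
  exact aux e1 e2 (congrArg (fun z => utUnits z) e3) hO.gam_units_points e5

lemma IsOperad.gam_unit_one (hO : IsOperad O) :
    (O.unit ▷ _) ≫ O.gam (IsPart.one (N := N)) = (λ_ _).hom ≫ (finTensorOne fun _ => oev O N).hom := by
  have e1 := hO.unit_left (Enum.n N)
  have h : Enum.n N = ∑ _ : Fin 1, Enum.n N := by simp
  have e2 := O.eqToHom_eq_actE h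
  have e3 : O.actE (S := Fin (∑ _ : Fin 1, Enum.n N)) (S' := Fin (Enum.n N)) (finCongr h.symm) ≫
      O.actE (S := N) (S' := Σ _ : Fin 1, N) (IsPart.one (N := N)).equiv.symm = 𝟙 (oev O N) :=
    (O.act_comp (z := Equiv.refl _) fun q => by
      have h1 := Enum.e_sigma_symm (S := Fin 1) (T := fun _ => N) 0 q
      have h2 : (Enum.e (S := Σ _ : Fin 1, N)) ((IsPart.one (N := N)).equiv.symm (Enum.e.symm q)) =
          finSigmaFinEquiv (n := fun _ : Fin 1 => Enum.n N) ⟨0, q⟩ :=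
        (Equiv.symm_apply_eq _).1 (h1.trans ((IsPart.one (N := N)).equiv_symm 0 _).symm)|>.symm
      refine (congrArg (finCongr h.symm) h2).trans (Fin.ext ?_)
      exact finSigmaFinEquiv_one _).trans (O.act_refl fun _ => rfl)
  have aux : ∀ {I A X Q C : V} {u : I ⟶ C} {g : C ⊗ X ⟶ Q} {o : I ⊗ X ⟶ A} {c c' : A ⟶ Q} {d : Q ⟶ A}
      (e1 : (u ▷ X) ≫ g = o ≫ c) (e2 : c = c') (e3 : c' ≫ d = 𝟙 _), (u ▷ X) ≫ g ≫ d = o := by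
    rintro I A X Q C u g o c _ d e1 rfl e3
    rw [reassoc_of% e1, e3, Category.comp_id]
  exact aux (e1.trans (Category.assoc _ _ _).symm) e2 e3

/-- The left unit law of an operad. -/
lemma IsOperad.gam_pt (hO : IsOperad O) (hr : IsPart r) (i : S ↪ Fin 1) (f : ∀ s s', i s = s' → (N ≃ T s))
    (he : ∀ s', s' ∉ range i → IsEmpty N) (hf : ∀ s s' h n, r s (f s s' h n) = n) :
    (O.pt i ▷ _) ≫ O.gam hr = (λ_ _).hom ≫ utSp i (A := fun s => oev O (T s)) (B := fun _ : Fin 1 => oev O N)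
      (fun s s' h => O.actE (f s s' h)) (fun s' hs' => O.obs (he s' hs')) ≫
        (finTensorOne fun _ => oev O N).hom := by
  by_cases hS : IsEmpty S
  · have hN : IsEmpty N := ⟨fun n => by obtain ⟨s, _⟩ := hr.exists n; exact hS.elim s⟩
    have e0 := isIso_utUnits hS (A := fun s => oev O (T s)) fun s => hS.elim s
    have e1 := hO.gam_units hr (fun s => hS.elim s) (Equiv.equivOfIsEmpty N S) fun s => hS.elim s
    have e1' : (utUnits fun s => O.pt (hS.elim s : T s ↪ Fin 1)) = utUnits fun s => hS.elim s :=
      congrArg (fun z => utUnits z) (funext fun s => hS.elim s)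
    have e2 := utUnits_utSp (φ := i) (u := fun s => hS.elim s) (A := fun s => oev O (T s)) (B := fun _ : Fin 1 => oev O N)
      (c := fun s s' h => O.actE (f s s' h)) (u' := fun s' hs' => O.obs (he s' hs')) (v := fun _ => O.obs hN)
      (fun s => hS.elim s) fun _ _ => rfl
    have e3 := finTensorUnits_one (A := fun _ : Fin 1 => oev O N) fun _ => O.obs hN
    have e4 := O.pt_of_isEmpty hS i
    have e5 := O.obs_act hN hS (Equiv.equivOfIsEmpty N S)
    have aux : ∀ {A X Y P : V} {p p' : 𝟙_ V ⟶ A} {u u' : 𝟙_ V ⟶ X} {v : 𝟙_ V ⟶ Y} {w : X ⟶ Y} {o : Y ⟶ P} {g : A ⊗ X ⟶ P}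
        {k : A ⟶ P} {b : 𝟙_ V ⟶ P} (e0 : IsIso u') (e1 : (A ◁ u) ≫ g = (ρ_ _).hom ≫ k) (e1' : u = u')
        (e2 : u' ≫ w = v) (e3 : v ≫ o = b) (e4 : p = p') (e5 : p' ≫ k = b),
        (p ▷ X) ≫ g = (λ_ _).hom ≫ w ≫ o := by
      rintro A X Y P p _ u _ v w o g k _ e0 e1 rfl rfl e3 rfl rfl
      rw [← cancel_epi (𝟙_ V ◁ u), whisker_exchange_assoc, e1, rightUnitor_naturality_assoc, ← e3,
        leftUnitor_naturality_assoc, unitors_equal, Category.assoc]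
    exact aux e0 e1 e1' e2 e3 e4 e5
  · obtain ⟨σ⟩ := exists_equiv_one i hS
    obtain rfl : i = σ.toEmbedding := Subsingleton.elim _ _
    have e1 := hO.equivariant hr (IsPart.one (N := N)) σ f (Equiv.refl _) fun s s' h n => (hf s s' h n).symm
    have e2 := O.actE_refl (x := Equiv.refl N) fun _ => rfl
    have e3 : O.utAct (T' := fun _ : Fin 1 => N) σ f = utSp σ.toEmbedding (B := fun _ : Fin 1 => oev O N)
      (fun s s' h => O.actE (f s s' h)) (fun s' hs' => O.obs (he s' hs')) :=
      utSp_congr rfl (fun _ _ _ _ => rfl) fun s' hs' => absurd (σ.surjective s') hs'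
    have aux : ∀ {A C X Y P : V} {p : 𝟙_ V ⟶ A} {u : 𝟙_ V ⟶ C} {x : C ⟶ A} {g : A ⊗ X ⟶ P} {i : P ⟶ P}
        {w w' : X ⟶ Y} {g' : C ⊗ Y ⟶ P} {o : Y ⟶ P} (e1 : (x ▷ X) ≫ g ≫ i = (C ◁ w) ≫ g') (e2 : i = 𝟙 _)
        (e3 : w = w') (e4 : p = u ≫ x) (e5 : (u ▷ Y) ≫ g' = (λ_ _).hom ≫ o),
        (p ▷ X) ≫ g = (λ_ _).hom ≫ w' ≫ o := by
      rintro A C X Y P _ u x g _ w _ g' o e1 rfl rfl rfl e5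
      rw [Category.comp_id] at e1
      rw [comp_whiskerRight, Category.assoc, e1, ← whisker_exchange_assoc, e5, leftUnitor_naturality_assoc]
    exact aux e1 e2 e3 (O.pt_of_equiv σ _) hO.gam_unit_one

end Points
section Restriction

variable [SymmetricCategory V] {O : OperadData V}
  {S S' N N' M : Type} [Enum S] [Enum S'] [Enum N] [Enum N'] [Enum M]
  {T T₁ : S → Type} [∀ s, Enum (T s)] [∀ s, Enum (T₁ s)] {T' : S' → Type} [∀ s, Enum (T' s)]
  {r : ∀ s, T s → N} {r₁ : ∀ s, T₁ s → N'} {r' : ∀ s, T' s → N'}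

/-- A fibre of an injection has at most one element. -/
def fibreEmb (x : M ↪ N) (n : N) : {m // x m = n} ↪ Fin 1 :=
  ⟨fun _ => 0, fun a b _ => Subtype.ext (x.injective (a.2.trans b.2.symm))⟩

variable (O) in
/-- The contravariant action of an injection on a based operad, given by the insertion of units and of the
base map. -/
def OperadData.opRes (x : M ↪ N) : oev O N ⟶ oev O M :=
  (ρ_ _).inv ≫ (_ ◁ utUnits fun n => O.pt (fibreEmb x n)) ≫ O.gam (IsPart.fibres x)

lemma IsOperad.gam_opRes (hO : IsOperad O) (hr : IsPart r) (i : ∀ s, T s ↪ Fin 1) (x : N ↪ S)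
    (hx : ∀ s t, x (r s t) = s) :
    (_ ◁ utUnits fun s => O.pt (i s)) ≫ O.gam hr = (ρ_ _).hom ≫ O.opRes x := by
  have h1 : ∀ s, ∃ f : {m // x m = s} ≃ T s, ∀ m, m.1 = r s (f m) := by
    intro s
    have h2 : ∀ m : {m // x m = s}, ∃ t, m.1 = r s t := by
      rintro ⟨m, hm⟩
      obtain ⟨s', t, rfl⟩ := hr.exists m
      obtain rfl := (hx s' t).symm.trans hm
      exact ⟨t, rfl⟩
    choose f hf using h2
    refine ⟨Equiv.ofBijective f ⟨fun a b h => Subtype.ext ((hf a).trans ((congrArg _ h).trans (hf b).symm)),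
      fun t => ⟨⟨r s t, hx s t⟩, hr.inj s (hf ⟨r s t, hx s t⟩).symm⟩⟩, hf⟩
  choose f hf using h1
  have e1 := hO.gam_act hr (IsPart.fibres x) f (Equiv.refl N) hf
  have e2 := utUnits_utMap (fun s => O.pt (i s)) fun s => O.actE (f s)
  have e3 : (fun s => O.pt (i s) ≫ O.actE (f s)) = fun s => O.pt (fibreEmb x s) :=
    funext fun s => O.pt_act _ _ _
  have e4 : O.actE (Equiv.refl N) = 𝟙 _ := O.actE_refl fun _ => rfl
  have aux : ∀ {A X Y P : V} {u : 𝟙_ V ⟶ X} {v v' : 𝟙_ V ⟶ Y} {w : X ⟶ Y} {g : A ⊗ X ⟶ P} {k : P ⟶ P}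
      {p : A ⊗ Y ⟶ P} (e1 : g ≫ k = (A ◁ w) ≫ p) (e2 : u ≫ w = v) (e3 : v = v') (e4 : k = 𝟙 _),
      (A ◁ u) ≫ g = (ρ_ _).hom ≫ (ρ_ A).inv ≫ (A ◁ v') ≫ p := by
    rintro A X Y P u _ _ w g _ p e1 rfl rfl rfl
    rw [Category.comp_id] at e1
    rw [Iso.hom_inv_id_assoc, whiskerLeft_comp, Category.assoc, e1]
  exact aux e1 e2 (congrArg (fun z => utUnits z) e3) e4

lemma IsOperad.opRes_equiv (hO : IsOperad O) (x : N ≃ S) : O.opRes x.toEmbedding = O.actE x := by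
  have e := hO.gam_units (IsPart.fibres x.toEmbedding) (fibreEmb x.toEmbedding) x fun s t => t.2
  rw [OperadData.opRes]
  have aux : ∀ {A X P : V} {u : A ⊗ 𝟙_ V ⟶ X} {g : X ⟶ P} {k : A ⟶ P} (e : u ≫ g = (ρ_ A).hom ≫ k),
      (ρ_ A).inv ≫ u ≫ g = k := by
    intros
    rename_i e
    rw [e, Iso.inv_hom_id_assoc]
  exact aux e

lemma utUnits_sh_right (hr : IsPart r) (A : S → V) {B : N → V} (u : ∀ n, 𝟙_ V ⟶ B n) :
    (ρ_ _).inv ≫ (ut A ◁ utUnits u) ≫ (sh hr A B).hom =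
      utMap fun s => (ρ_ _).inv ≫ (A s ◁ utUnits fun t => u (r s t)) := by
  have hs := sep_atoms (S := S) (N := N)
  let f : ∀ i, (Sum.elim (fun _ => False) (fun _ => True) i : Prop) → (𝟙_ V ⟶ Sum.elim A B i) := fun i => match i with
    | Sum.inl s => fun h => h.elim
    | Sum.inr n => fun _ => u n
  have hb : ∀ n, IsCan f (canUnit _) (canInr A B n) (u n) := fun n => IsCan.atom (f := f) (Sum.inr n) trivial
  refine IsCan.unique (f := f) (a := canUt (canInl A B)) ((IsCan.rightUnitor_inv hs.inl.nodup_utList).comp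
    (((IsCan.utUnits hs.inr hb).whiskerLeft _ hs.nodup_append).comp (IsCan.sh hs hr)))
    (IsCan.utMap (fun s => ?_) (hs.fibre hr))
  exact (IsCan.rightUnitor_inv (hs.inl.1 s)).comp ((IsCan.utUnits (hs.inr.comp (hr.inj s)) fun t => hb _).whiskerLeft _
    ((hs.fibre hr).1 s))

lemma IsOperad.gam_comp_opRes (hO : IsOperad O) (hr : IsPart r) (hr₁ : IsPart r₁) (f : ∀ s, T₁ s ↪ T s) (ψ : N' ↪ N)
    (hψ : ∀ s t, ψ (r₁ s t) = r s (f s t)) :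
    O.gam hr ≫ O.opRes ψ = (_ ◁ utMap fun s => O.opRes (f s)) ≫ O.gam hr₁ := by
  have h1 : ∀ s (t : T s) (u : {m // ψ m = r s t}), ∃ t' : T₁ s, r₁ s t' = u.1 := by
    rintro s t ⟨m, hm⟩
    obtain ⟨s', t', rfl⟩ := hr₁.exists m
    rw [hψ] at hm
    obtain rfl := hr.inj' hm
    exact ⟨t', rfl⟩
  choose x hx using h1
  have hfx : ∀ s t u, f s (x s t u) = t := fun s t u => hr.inj s (by rw [← hψ, hx, u.2])
  have hx' : ∀ s, IsPart (x s) := by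
    refine fun s => ⟨?_, fun t' => ⟨⟨f s t', r₁ s t', hψ s t'⟩, hr₁.inj s (hx _ _ _)⟩⟩
    rintro ⟨t, u⟩ ⟨t', u'⟩ h
    have h2 := (hfx s t u).symm.trans ((congrArg (f s) h).trans (hfx s t' u'))
    subst h2
    obtain rfl : u = u' := Subtype.ext ((hx s t u).symm.trans ((congrArg (r₁ s) h).trans (hx s t u')))
    rfl
  have e1 := hO.gam_assoc hr (IsPart.fibres ψ) hx' hr₁ hx
  have e2 := utUnits_sh_right hr (fun s => oev O (T s)) fun n => O.pt (fibreEmb ψ n)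
  have e3 : ∀ s, (_ ◁ utUnits fun t => O.pt (fibreEmb ψ (r s t))) ≫ O.gam (hx' s) = (ρ_ _).hom ≫ O.opRes (f s) :=
    fun s => hO.gam_opRes (hx' s) _ (f s) (hfx s)
  have e4 : (utMap fun s => (ρ_ _).inv ≫ (oev O (T s) ◁ utUnits fun t => O.pt (fibreEmb ψ (r s t)))) ≫
      (utMap fun s => O.gam (hx' s)) = utMap fun s => O.opRes (f s) := by
    refine (utMap_comp _ _).trans (congrArg (fun z => utMap z) (funext fun s => ?_))
    exact (Category.assoc _ _ _).trans ((whisker_eq _ (e3 s)).trans (Iso.inv_hom_id_assoc _ _))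
  have aux : ∀ {A B X P Q C D : V} {g : A ⊗ B ⟶ P} {u : 𝟙_ V ⟶ X} {w : P ⊗ X ⟶ Q} {s : B ⊗ X ⟶ C} {m : C ⟶ D}
      {l : A ⊗ D ⟶ Q} {k : B ⟶ C} {o : B ⟶ D} (e1 : (g ▷ X) ≫ w = (α_ _ _ _).hom ≫ (A ◁ (s ≫ m)) ≫ l)
      (e2 : (ρ_ _).inv ≫ (B ◁ u) ≫ s = k) (e4 : k ≫ m = o), g ≫ (ρ_ _).inv ≫ (P ◁ u) ≫ w = (A ◁ o) ≫ l := by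
    rintro A B X P Q C D g u w s m l _ _ e1 rfl rfl
    rw [rightUnitor_inv_naturality_assoc, ← whisker_exchange_assoc, e1]
    simp
  exact aux e1 e2 e4

/-- The parts of a partition of `N` indexed by a set with at most one element. -/
def IsPart.overOne (hr : IsPart r) (i : S ↪ Fin 1) (s : S) : N ≃ T s :=
  (Equiv.ofBijective (r s) ⟨hr.inj s, fun n => by
    obtain ⟨s', t, h⟩ := hr.exists n
    obtain rfl := i.injective (Subsingleton.elim (i s) (i s'))
    exact ⟨t, h⟩⟩).symm

lemma IsPart.apply_overOne (hr : IsPart r) (i : S ↪ Fin 1) (s : S) (n : N) : r s (hr.overOne i s n) = n :=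
  Equiv.apply_symm_apply (Equiv.ofBijective (r s) _) n

lemma IsPart.isEmpty_of_one (hr : IsPart r) (i : S ↪ Fin 1) (q : Fin 1) (hq : q ∉ range i) : IsEmpty N :=
  ⟨fun n => by
    obtain ⟨s, _⟩ := hr.exists n
    exact hq ⟨s, Subsingleton.elim _ _⟩⟩

lemma IsOperad.pt_opRes (hO : IsOperad O) (x : N ↪ S) (i : S ↪ Fin 1) (j : N ↪ Fin 1) :
    O.pt i ≫ O.opRes x = O.pt j := by
  have hr := IsPart.fibres x
  have e1 := hO.gam_pt hr i (fun s _ _ => hr.overOne i s) (hr.isEmpty_of_one i) fun s _ _ n => hr.apply_overOne i s n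
  have e2 := utUnits_utSp (φ := i) (u := fun s => O.pt (fibreEmb x s)) (B := fun _ : Fin 1 => oev O N)
      (c := fun s s' h => O.actE (hr.overOne i s)) (u' := fun s' hs' => O.obs (hr.isEmpty_of_one i s' hs'))
      (v := fun _ => O.pt j) (fun s _ _ => O.pt_act _ _ _) fun _ _ => (O.pt_of_isEmpty _ _).symm
  have e3 := finTensorUnits_one (A := fun _ : Fin 1 => oev O N) fun _ => O.pt j
  have aux : ∀ {A X Y P : V} {p : 𝟙_ V ⟶ A} {u : 𝟙_ V ⟶ X} {v : 𝟙_ V ⟶ Y} {w : X ⟶ Y} {o : Y ⟶ P} {g : A ⊗ X ⟶ P}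
      {b : 𝟙_ V ⟶ P} (e1 : (p ▷ X) ≫ g = (λ_ _).hom ≫ w ≫ o) (e2 : u ≫ w = v) (e3 : v ≫ o = b),
      p ≫ (ρ_ _).inv ≫ (A ◁ u) ≫ g = b := by
    rintro A X Y P p u _ w o g _ e1 rfl rfl
    rw [rightUnitor_inv_naturality_assoc, ← whisker_exchange_assoc, e1, leftUnitor_naturality_assoc, unitors_equal,
      Iso.inv_hom_id_assoc, Category.assoc]
  exact aux e1 e2 e3

lemma IsOperad.opRes_comp (hO : IsOperad O) (x : M ↪ N) (y : N ↪ S) (z : M ↪ S) (h : ∀ m, y (x m) = z m) :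
    O.opRes y ≫ O.opRes x = O.opRes z := by
  obtain ⟨T₁, _, r₁, f, hr₁, hf⟩ := (IsPart.fibres y).exists_restrict x
  have e1 := hO.gam_comp_opRes (IsPart.fibres y) hr₁ f x fun s t => (hf s t).symm
  have e2 := utUnits_utMap (fun s => O.pt (fibreEmb y s)) fun s => O.opRes (f s)
  have e3 : (fun s => O.pt (fibreEmb y s) ≫ O.opRes (f s)) = fun s => O.pt ((f s).trans (fibreEmb y s)) :=
    funext fun s => hO.pt_opRes _ _ _
  have e4 := hO.gam_opRes hr₁ (fun s => (f s).trans (fibreEmb y s)) z fun s t => by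
    rw [← h, ← hf]
    exact (f s t).2
  have aux : ∀ {A X Y P Q : V} {u : 𝟙_ V ⟶ X} {v v' : 𝟙_ V ⟶ Y} {w : X ⟶ Y} {g : A ⊗ X ⟶ P} {k : P ⟶ Q}
      {p : A ⊗ Y ⟶ Q} {z : A ⟶ Q} (e1 : g ≫ k = (A ◁ w) ≫ p) (e2 : u ≫ w = v) (e3 : v = v')
      (e4 : (A ◁ v') ≫ p = (ρ_ _).hom ≫ z), ((ρ_ _).inv ≫ (A ◁ u) ≫ g) ≫ k = z := by
    rintro A X Y P Q u _ _ w g k p z e1 rfl rfl e4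
    rw [Category.assoc, Category.assoc, e1, ← whiskerLeft_comp_assoc, e4, Iso.inv_hom_id_assoc]
  exact aux e1 e2 (congrArg (fun z => utUnits z) e3) e4

lemma notMem_range_of_fibreEmb (φ : S ↪ S') (s' : S') (q : Fin 1) (hq : q ∉ range (fibreEmb φ s')) :
    s' ∉ range φ :=
  fun ⟨s, hs⟩ => hq ⟨⟨s, hs⟩, Subsingleton.elim _ _⟩

lemma utUnits_sh_spread (φ : S ↪ S') (B : S' → V) (u : ∀ s', s' ∉ range φ → (𝟙_ V ⟶ B s')) :
    (utUnits (fun _ : S' => 𝟙 (𝟙_ V)) ▷ ut (fun s => B (φ s))) ≫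
      (sh (IsPart.fibres φ) (fun _ => 𝟙_ V) (fun s => B (φ s))).hom ≫
      (utMap fun s' => (λ_ _).hom ≫ utSp (fibreEmb φ s') (A := fun v => B (φ v.1)) (B := fun _ : Fin 1 => B s')
        (fun v _ _ => eqToHom (congrArg B v.2)) (fun q hq => u s' (notMem_range_of_fibreEmb φ s' q hq)) ≫
          (finTensorOne fun _ => B s').hom) =
    (λ_ _).hom ≫ utSpread φ B u := by
  have h1 : Sep (fun n : S' => [n]) := sep_singleton Function.injective_id
  have hφ : Sep (fun s : S => [φ s]) := sep_singleton φ.injective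
  have h0 : Sep (fun n : S' => ([] : List S')) := ⟨fun _ => List.nodup_nil, fun _ _ _ h => by simp at h⟩
  have h2 : Sep (Sum.elim (fun n : S' => ([] : List S')) fun s : S => [φ s]) :=
    ⟨by rintro (s | n) <;> simp, by
      rintro (s | n) (s' | n') i <;> simp
      rintro rfl h; exact φ.injective h⟩
  refine IsCan.unique (f := u) (X := B) (((IsCan.utUnits h0
    fun n => IsCan.id List.nodup_nil).whiskerRight (canUt fun s => canAtom B (φ s)) ?_).comp
      ((IsCan.sh h2 (IsPart.fibres φ)).comp (IsCan.utMap (b := fun n => canAtom B n) (fun s' => ?_) h1)))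
      ((IsCan.leftUnitor hφ.nodup_utList).comp (IsCan.utSpread φ (a := fun s => canAtom B s) h1 u
        fun t ht => IsCan.atom t ht))
  · have : utList (fun n : S' => ([] : List S')) = [] := List.eq_nil_iff_forall_not_mem.2 fun i hi => by
      obtain ⟨s, hs⟩ := mem_utList.1 hi
      simp at hs
    rw [this]
    exact hφ.nodup_utList
  · have h3 : Sep fun v : {s // φ s = s'} => [φ v.1] := sep_singleton (φ.injective.comp Subtype.val_injective)
    have h4 : Sep fun _ : Fin 1 => [s'] := ⟨fun _ => by simp, fun _ _ _ _ _ => Subsingleton.elim _ _⟩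
    refine (IsCan.leftUnitor h3.nodup_utList).comp ((IsCan.utSp h4 (b := fun _ => canAtom B s') (fun v _ _ =>
      IsCan.eqToHom (fun s => canAtom B s) v.2 (by simp)) fun q hq => IsCan.atom _ _).comp
      (isCan_finTensorOne (fun _ => canAtom B s') (by simp)))

lemma IsOperad.opRes_gam (hO : IsOperad O) (φ : S ↪ S') (hr' : IsPart r')
    (hr : IsPart fun s (t : T' (φ s)) => r' (φ s) t) (he : ∀ s', s' ∉ range φ → IsEmpty (T' s')) :
    (O.opRes φ ▷ _) ≫ O.gam hr =
      (_ ◁ utSpread φ (fun s' => oev O (T' s')) fun s' hs' => O.obs (he s' hs')) ≫ O.gam hr' := by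
  let x : ∀ s' (v : {s // φ s = s'}), T' (φ v.1) → T' s' := fun s' v => Equiv.cast (congrArg T' v.2)
  have hx : ∀ s', IsPart (x s') := by
    refine fun s' => ⟨?_, fun t => ?_⟩
    · rintro ⟨v, t⟩ ⟨v', t'⟩ h
      obtain rfl : v = v' := (fibreEmb φ s').injective (Subsingleton.elim _ _)
      exact congrArg (Sigma.mk v) ((Equiv.cast (congrArg T' v.2)).injective h)
    · by_cases hs : s' ∈ range φ
      · obtain ⟨s, rfl⟩ := hs
        exact ⟨⟨⟨s, rfl⟩, t⟩, rfl⟩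
      · exact (he s' hs).elim t
  have e1 := hO.gam_assoc (IsPart.fibres φ) hr hx hr' fun s' v t => apply_cast (w := r') v.2 t
  have e2 : ∀ s', (O.pt (fibreEmb φ s') ▷ _) ≫ O.gam (hx s') = (λ_ _).hom ≫ utSp (fibreEmb φ s')
      (A := fun v => oev O (T' (φ v.1))) (B := fun _ : Fin 1 => oev O (T' s'))
      (fun v _ _ => eqToHom (congrArg (fun s => oev O (T' s)) v.2))
      (fun q hq => O.obs (he s' (notMem_range_of_fibreEmb φ s' q hq))) ≫ (finTensorOne fun _ => oev O (T' s')).hom := by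
    intro s'
    have h1 := hO.gam_pt (hx s') (fibreEmb φ s') (fun v _ _ => Equiv.cast (congrArg T' v.2.symm))
      (fun q hq => he s' (notMem_range_of_fibreEmb φ s' q hq)) (by rintro ⟨s, rfl⟩ _ _ t; rfl)
    refine h1.trans (whisker_eq _ (eq_whisker ?_ _))
    exact utSp_congr rfl (fun v _ _ _ => (O.eqToHom_oev v.2).symm) fun _ _ _ => rfl
  have e3 := utUnits_sh_spread φ (fun s' => oev O (T' s')) fun s' hs' => O.obs (he s' hs')
  have e4 := sh_naturality (IsPart.fibres φ) (fun s' => O.pt (fibreEmb φ s')) fun s => 𝟙 (oev O (T' (φ s)))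
  have e5 : (utMap fun s => 𝟙 (oev O (T' (φ s)))) = 𝟙 _ := utMap_id _
  have e6 := (utUnits_utMap (fun _ => 𝟙 (𝟙_ V)) fun s' => O.pt (fibreEmb φ s')).trans
    (congrArg (fun z => utUnits z) (funext fun _ => Category.id_comp _))
  have e7 : (utMap fun s' => O.pt (fibreEmb φ s') ⊗ₘ utMap fun v : {s // φ s = s'} => 𝟙 (oev O (T' (φ v.1)))) ≫
      (utMap fun s' => O.gam (hx s')) = _ :=
    (utMap_comp _ _).trans (congrArg (fun z => utMap z) (funext fun s' => (eq_whisker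
      ((congrArg (O.pt (fibreEmb φ s') ⊗ₘ ·) (utMap_id _)).trans (tensorHom_id _ _)) _).trans (e2 s')))
  have aux : ∀ {A X X' P Q Y C C' D : V} {u : 𝟙_ V ⟶ X} {u' : 𝟙_ V ⟶ X'} {p : X' ⟶ X} {g : A ⊗ X ⟶ P}
      {w : P ⊗ Y ⟶ Q} {s : X ⊗ Y ⟶ C} {m : C ⟶ D} {l : A ⊗ D ⟶ Q} {s' : X' ⊗ Y ⟶ C'} {m' : C' ⟶ D} {o : Y ⟶ D}
      {i : Y ⟶ Y} {n : C' ⟶ C} (e1 : (g ▷ Y) ≫ w = (α_ _ _ _).hom ≫ (A ◁ (s ≫ m)) ≫ l)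
      (e3 : (u' ▷ Y) ≫ s' ≫ m' = (λ_ _).hom ≫ o) (e4 : (p ⊗ₘ i) ≫ s = s' ≫ n) (e5 : i = 𝟙 _) (e6 : u' ≫ p = u)
      (e7 : n ≫ m = m'), (((ρ_ A).inv ≫ (A ◁ u) ≫ g) ▷ Y) ≫ w = (A ◁ o) ≫ l := by
    rintro A X X' P Q Y C C' D _ u' p g w s m l s' _ o _ n e1 e3 e4 rfl rfl rfl
    rw [tensorHom_id] at e4
    have h : ((u' ≫ p) ▷ Y) ≫ s ≫ m = (λ_ _).hom ≫ o := by
      rw [comp_whiskerRight_assoc, reassoc_of% e4, e3]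
    rw [comp_whiskerRight, comp_whiskerRight, Category.assoc, Category.assoc, e1, associator_naturality_middle_assoc,
      ← whiskerLeft_comp_assoc, h]
    simp
  exact aux e1 e3 e4 e5 e6 e7

lemma IsOperad.law (hO : IsOperad O) (hr : IsPart r) (hr' : IsPart r') (φ : S ↪ S')
    (f : ∀ s s', φ s = s' → (T' s' ↪ T s)) (he : ∀ s', s' ∉ range φ → IsEmpty (T' s')) (ψ : N' ↪ N)
    (hψ : ∀ s s' h t', ψ (r' s' t') = r s (f s s' h t')) :
    (O.opRes φ ▷ _) ≫ O.gam hr ≫ O.opRes ψ = (_ ◁ utSp φ (B := fun s => oev O (T' s))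
      (fun s s' h => O.opRes (f s s' h)) fun s' hs' => O.obs (he s' hs')) ≫ O.gam hr' := by
  have hr₁ : IsPart fun s (t : T' (φ s)) => r' (φ s) t := by
    refine ⟨?_, fun n => ?_⟩
    · rintro ⟨s, t⟩ ⟨s', t'⟩ h
      obtain rfl := φ.injective (hr'.inj' h)
      obtain rfl := hr'.inj _ h
      rfl
    · obtain ⟨s', t, rfl⟩ := hr'.exists n
      by_cases hs : s' ∈ range φ
      · obtain ⟨s, rfl⟩ := hs
        exact ⟨⟨s, t⟩, rfl⟩
      · exact (he s' hs).elim t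
  have e1 := hO.gam_comp_opRes hr hr₁ (fun s => f s _ rfl) ψ fun s t => hψ _ _ rfl _
  have e2 := hO.opRes_gam φ hr' hr₁ he
  have aux : ∀ {A A' X Y Z P Q : V} {a : A' ⟶ A} {g : A ⊗ X ⟶ P} {p : P ⟶ Q} {m : X ⟶ Y} {g₁ : A ⊗ Y ⟶ Q} {s : Y ⟶ Z}
      {g' : A' ⊗ Z ⟶ Q} (e1 : g ≫ p = (A ◁ m) ≫ g₁) (e2 : (a ▷ Y) ≫ g₁ = (A' ◁ s) ≫ g'),
      (a ▷ X) ≫ g ≫ p = (A' ◁ (m ≫ s)) ≫ g' := by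
    intros
    rename_i e1 e2
    rw [e1, ← whisker_exchange_assoc, e2, whiskerLeft_comp, Category.assoc]
  exact aux e1 e2

end Restriction
section KellyGenerators

variable [SymmetricCategory V] [HasColimits V]
  [TensorCocts V] {S N : Type} [Enum S] [Enum N]
  {T : S → Type} [∀ s, Enum (T s)] {r : ∀ s, T s → N} {D E F G : LambdaSeq V}

lemma Gen_eq_kellyGen (D E : LambdaSeq V) (hr : IsPart r) :
    Gen D E hr = kellyGen D E (fun q : Fin (Enum.n S) => Enum.n (T (Enum.e.symm q))) ≫
      res (S := N) (T := Σ s, T s) (kelly D E).seq hr.equiv.symm.toEmbedding := by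
  have h : (kellyι D E (Enum.n S)).app (op ⟨Enum.n (Σ s, T s)⟩) ≫
      res (S := N) (T := Σ s, T s) (kelly D E).seq hr.equiv.symm.toEmbedding =
      (_ ◁ res _ hr.equiv.symm.toEmbedding) ≫ (kellyι D E (Enum.n S)).app (op ⟨Enum.n N⟩) :=
    ((kellyι D E (Enum.n S)).naturality _).symm
  have aux : ∀ {A X Y P Q : V} {d : X ⟶ Y} {x : Y ⟶ P} {i : A ⊗ Y ⟶ Q} {R : V} {p : Q ⟶ R} {i' : A ⊗ P ⟶ R}
      (h : i ≫ p = (A ◁ x) ≫ i'), (A ◁ (d ≫ x)) ≫ i' = ((A ◁ d) ≫ i) ≫ p := by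
    intros
    rename_i h
    rw [whiskerLeft_comp, assoc, assoc, h]
  exact aux h

lemma Gen_comp_app {H : Lamᵒᵖ ⥤ V} (hr : IsPart r) (f : (kelly D E).seq ⟶ H) :
    Gen D E hr ≫ f.app (op ⟨Enum.n N⟩) =
      (kellyGen D E (fun q : Fin (Enum.n S) => Enum.n (T (Enum.e.symm q))) ≫ f.app _) ≫
        res (S := N) (T := Σ s, T s) H hr.equiv.symm.toEmbedding := by
  refine (eq_whisker (Gen_eq_kellyGen D E hr) _).trans ?_
  exact (assoc _ _ _).trans (((whisker_eq _
    (res_naturality (S := N) (T := Σ s, T s) f hr.equiv.symm.toEmbedding)).trans (assoc _ _ _).symm))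

lemma kelly_hom_ext_kellyGen {f g : kelly D E ⟶ F}
    (h : ∀ {k : ℕ} (j : Fin k → ℕ), kellyGen D E j ≫ f.hom.app (op ⟨∑ s, j s⟩) =
      kellyGen D E j ≫ g.hom.app (op ⟨∑ s, j s⟩)) : f = g :=
  kelly_hom_ext fun hr => (Gen_comp_app hr f.hom).trans ((eq_whisker (h _) _).trans (Gen_comp_app hr g.hom).symm)

lemma kelly_hom_ext_kellyGen₃ {f g : kelly (kelly D E) F ⟶ G}
    (h : ∀ {k : ℕ} (j : Fin k → ℕ) (i : Fin (∑ s, j s) → ℕ),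
      (kellyGen D E j ▷ finTensor (fun n => F.obj (i n))) ≫ kellyGen (kelly D E) F i ≫ f.hom.app (op ⟨∑ n, i n⟩) =
        (kellyGen D E j ▷ finTensor (fun n => F.obj (i n))) ≫ kellyGen (kelly D E) F i ≫
          g.hom.app (op ⟨∑ n, i n⟩)) : f = g := by
  refine kelly_hom_ext_kellyGen fun {k'} i => Gen_hom_ext_right (N := Fin k') fun {k T} _ {r} hr => ?_
  let φ : Fin k' ≃ Fin (∑ s, Enum.n (T s)) := hr.equiv.symm.trans Enum.e
  have hr' : IsPart fun s (t : Fin (i (φ.symm s))) => (finSigmaFinEquiv ⟨φ.symm s, t⟩ : Fin (∑ n, i n)) :=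
    (finSigmaFinEquiv.bijective.comp (Equiv.sigmaCongrLeft (β := fun n => Fin (i n)) φ.symm).bijective)
  have hφ : ∀ s s', φ.toEmbedding s = s' → φ.symm s' = s := fun s s' h => φ.symm_apply_eq.2 h.symm
  have e1 := Gen_res (kelly D E) F (IsPart.fin i) hr' φ.toEmbedding
    (fun s s' h => (Equiv.cast (congrArg (fun n => Fin (i n)) (hφ s s' h))).toEmbedding)
    (fun s hs => absurd (φ.surjective s) hs) (Embedding.refl _) fun s s' h t =>
      (apply_cast (w := fun n (t : Fin (i n)) => (finSigmaFinEquiv ⟨n, t⟩ : Fin (∑ n, i n))) (hφ s s' h) t).symm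
  have e2 := res_refl (S := Fin (∑ n, i n)) (kelly (kelly D E) F).seq
  have e3 := Gen_comp_app hr' f.hom
  have e3' := Gen_comp_app hr' g.hom
  have e4 := Gen_eq_kellyGen D E hr
  have e5 := Gen_fin (kelly D E) F i
  have e6 := h (fun s => Enum.n (T s)) fun s => i (φ.symm s)
  have aux : ∀ {A B C P Q P' Z Z' : V} {p : A ⟶ C} {g : A ⟶ B} {x : B ⟶ C} {k k' : C ⊗ P ⟶ Q} {i : Q ⟶ Q}
      {u : P ⟶ P'} {l : B ⊗ P' ⟶ Q} {f f' : Q ⟶ Z} {m m' : B ⊗ P' ⟶ Z'} {w : Z' ⟶ Z}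
      (e1 : (x ▷ P) ≫ k ≫ i = (B ◁ u) ≫ l) (e2 : i = 𝟙 _) (e3 : l ≫ f = m ≫ w) (e3' : l ≫ f' = m' ≫ w)
      (e4 : p = g ≫ x) (e5 : k = k') (e6 : (g ▷ _) ≫ m = (g ▷ _) ≫ m'), (p ▷ P) ≫ k' ≫ f = (p ▷ P) ≫ k' ≫ f' := by
    rintro A B C P Q P' Z Z' _ g x k _ _ u l f f' m m' w e1 rfl e3 e3' rfl rfl e6
    rw [comp_id] at e1
    rw [comp_whiskerRight, assoc, assoc, reassoc_of% e1, reassoc_of% e1, e3, e3',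
      ← whisker_exchange_assoc, ← whisker_exchange_assoc, reassoc_of% e6]
  exact aux e1 e2 e3 e3' e4 e5 e6

lemma kellyUnit_kelly_hom_ext {f g : kelly (kellyUnit V) D ⟶ F}
    (h : ∀ n : ℕ, (kellyUnitGen V ▷ finTensor (fun _ => D.obj n)) ≫ kellyGen (kellyUnit V) D (fun _ : Fin 1 => n) ≫
      f.hom.app (op ⟨∑ _ : Fin 1, n⟩) = (kellyUnitGen V ▷ finTensor (fun _ => D.obj n)) ≫
      kellyGen (kellyUnit V) D (fun _ : Fin 1 => n) ≫ g.hom.app (op ⟨∑ _ : Fin 1, n⟩)) : f = g := by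
  refine kelly_hom_ext fun {k N} _ {T} _ {r} hr => unitGen_hom_ext_right fun i => ?_
  have e1 := Gen_res (kellyUnit V) D hr (IsPart.one (N := N)) i (fun s _ _ => (hr.overOne i s).toEmbedding)
    (hr.isEmpty_of_one i) (Embedding.refl _) fun s _ _ t => (hr.apply_overOne i s t).symm
  have e2 := res_refl (S := N) (kelly (kellyUnit V) D).seq
  have e3 := Gen_comp_app (IsPart.one (N := N)) f.hom
  have e3' := Gen_comp_app (IsPart.one (N := N)) g.hom
  have e5 := kellyUnitGen_eq (V := V) (Embedding.refl _)
  have e6 := h (Enum.n N)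
  have aux : ∀ {A B P P' Q Z Z' : V} {p : 𝟙_ V ⟶ B} {x x' : 𝟙_ V ⟶ A} {y : A ⟶ B} {k : B ⊗ P ⟶ Q} {i : Q ⟶ Q} {u : P ⟶ P'}
      {l : A ⊗ P' ⟶ Q} {f f' : Q ⟶ Z} {n n' : A ⊗ P' ⟶ Z'} {w : Z' ⟶ Z}
      (e1 : (y ▷ P) ≫ k ≫ i = (A ◁ u) ≫ l) (e2 : i = 𝟙 _) (e3 : l ≫ f = n ≫ w) (e3' : l ≫ f' = n' ≫ w)
      (e4 : x ≫ y = p) (e5 : x' = x) (e6 : (x' ▷ P') ≫ n = (x' ▷ P') ≫ n'), (p ▷ P) ≫ k ≫ f = (p ▷ P) ≫ k ≫ f' := by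
    rintro A B P P' Q Z Z' _ _ x y k _ u l f f' n n' w e1 rfl e3 e3' rfl rfl e6
    rw [comp_id] at e1
    rw [comp_whiskerRight, assoc, assoc, reassoc_of% e1, reassoc_of% e1, e3, e3',
      ← whisker_exchange_assoc, ← whisker_exchange_assoc, reassoc_of% e6]
  exact aux e1 e2 e3 e3' (unitGen_res i (Embedding.refl _) i) e5 e6

lemma kelly_kellyUnit_hom_ext {f g : kelly D (kellyUnit V) ⟶ F}
    (h : ∀ k : ℕ, (D.obj k ◁ finTensorUnits (fun _ => kellyUnitGen V)) ≫ kellyGen D (kellyUnit V) (fun _ : Fin k => 1) ≫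
      f.hom.app (op ⟨∑ _ : Fin k, 1⟩) = (D.obj k ◁ finTensorUnits (fun _ => kellyUnitGen V)) ≫
      kellyGen D (kellyUnit V) (fun _ : Fin k => 1) ≫ g.hom.app (op ⟨∑ _ : Fin k, 1⟩)) : f = g := by
  refine kelly_hom_ext fun {k N} _ {T} _ {r} hr => unitGens_hom_ext fun i => ?_
  let i₁ : Fin 1 ↪ Fin 1 := Embedding.refl _
  obtain ⟨κ, hκ⟩ := hr.exists_section i
  have e1 := Gen_ext_res D (kellyUnit V) (IsPart.points (N := Fin k)) hr i κ hκ
  have e2 := utUnits_utMap (fun _ : Fin k => unitGen (V := V) i₁) fun s => res _ (i s)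
  have e3 : (fun s => unitGen (V := V) i₁ ≫ res _ (i s)) = fun s => unitGen (i s) :=
    funext fun s => unitGen_res _ _ _
  have e4 := Gen_comp_app (IsPart.points (N := Fin k)) f.hom
  have e4' := Gen_comp_app (IsPart.points (N := Fin k)) g.hom
  have e5 : finTensorUnits (fun _ : Fin k => kellyUnitGen V) = utUnits fun _ : Fin k => unitGen i₁ :=
    congrArg (fun z => utUnits z) (funext fun _ : Fin k => kellyUnitGen_eq (V := V) i₁)
  have e7 := res_naturality f.hom κ
  have e7' := res_naturality g.hom κ
  have aux : ∀ {A X Y Q Q' Z Z' W : V} {u u' : 𝟙_ V ⟶ X} {v v' : 𝟙_ V ⟶ Y} {w : X ⟶ Y} {p : A ⊗ X ⟶ Q} {q : A ⊗ Y ⟶ Q'}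
      {κ : Q ⟶ Q'} {f f' : Q ⟶ Z} {g g' : Q' ⟶ Z'} {l : Z ⟶ Z'} {n n' : A ⊗ X ⟶ W} {m : W ⟶ Z}
      (e1 : p ≫ κ = (A ◁ w) ≫ q) (e2 : u ≫ w = v) (e3 : v = v') (e4 : p ≫ f = n ≫ m) (e4' : p ≫ f' = n' ≫ m)
      (e5 : u' = u) (e6 : (A ◁ u') ≫ n = (A ◁ u') ≫ n') (e7 : κ ≫ g = f ≫ l) (e7' : κ ≫ g' = f' ≫ l),
      (A ◁ v') ≫ q ≫ g = (A ◁ v') ≫ q ≫ g' := by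
    rintro A X Y Q Q' Z Z' W _ u _ _ w p q κ f f' g g' l n n' m e1 rfl rfl e4 e4' rfl e6 e7 e7'
    rw [whiskerLeft_comp, assoc, assoc, ← reassoc_of% e1, ← reassoc_of% e1, e7, e7',
      reassoc_of% e4, reassoc_of% e4', reassoc_of% e6]
  exact aux e1 e2 (congrArg (fun z => utUnits z) e3) e4 e4' e5 (h k) e7 e7'

end KellyGenerators
section MonoidOperad

variable [SymmetricCategory V] [HasColimits V]

/-- The operad data of a product and a unit on a `Λ`-sequence. -/
def monOperad (X : LambdaSeq V) (m : kelly X X ⟶ X) (e : kellyUnit V ⟶ X) : OperadData V where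
  seq := Sig.toLam.op ⋙ X.seq
  γ j := kellyGen X X j ≫ m.hom.app (op ⟨∑ s, j s⟩)
  unit := kellyUnitGen V ≫ e.hom.app (op ⟨1⟩)
  base := X.base

variable {X D D' E E' F : LambdaSeq V} {m : kelly X X ⟶ X} {e : kellyUnit V ⟶ X}

lemma kellyGen_kellyMap_comp (f : D ⟶ D') (g : E ⟶ E') (h : kelly D' E' ⟶ F) {k : ℕ} (j : Fin k → ℕ) :
    kellyGen D E j ≫ (kellyMap f g ≫ h).hom.app (op ⟨∑ s, j s⟩) =
      (f.hom.app (op ⟨k⟩) ⊗ₘ finTensorMap fun s => g.hom.app (op ⟨j s⟩)) ≫ kellyGen D' E' j ≫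
        h.hom.app (op ⟨∑ s, j s⟩) :=
  (assoc _ _ _).symm.trans ((eq_whisker (kellyGen_naturality f g j) _).trans (assoc _ _ _))

lemma kellyGen_whiskerRight_comp (f : D ⟶ D') (h : kelly D' E ⟶ F) {k : ℕ} (j : Fin k → ℕ) :
    kellyGen D E j ≫ (kellyMap f (𝟙 E) ≫ h).hom.app (op ⟨∑ s, j s⟩) =
      (f.hom.app (op ⟨k⟩) ▷ _) ≫ kellyGen D' E j ≫ h.hom.app (op ⟨∑ s, j s⟩) :=
  (kellyGen_kellyMap_comp f (𝟙 E) h j).trans (eq_whisker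
    ((congrArg (f.hom.app (op ⟨k⟩) ⊗ₘ ·) (tensMap_id _ _)).trans (tensorHom_id _ _)) _)

lemma kellyGen_whiskerLeft_comp (g : E ⟶ E') (h : kelly D E' ⟶ F) {k : ℕ} (j : Fin k → ℕ) :
    kellyGen D E j ≫ (kellyMap (𝟙 D) g ≫ h).hom.app (op ⟨∑ s, j s⟩) =
      (_ ◁ finTensorMap fun s => g.hom.app (op ⟨j s⟩)) ≫ kellyGen D E' j ≫ h.hom.app (op ⟨∑ s, j s⟩) :=
  (kellyGen_kellyMap_comp (𝟙 D) g h j).trans (eq_whisker (id_tensorHom _ _) _)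

lemma eqToHom_obj_app (f : D ⟶ E) {a b : ℕ} (h : a = b) :
    eqToHom (congrArg D.obj h) ≫ f.hom.app (op ⟨b⟩) = f.hom.app (op ⟨a⟩) ≫ eqToHom (congrArg E.obj h) := by
  subst h
  simp

lemma kellyGen_mul_assoc_left {k : ℕ} (j : Fin k → ℕ) (i : Fin (∑ s, j s) → ℕ) :
    (kellyGen X X j ▷ finTensor (fun r => X.obj (i r))) ≫ kellyGen (kelly X X) X i ≫
      (kellyMap m (𝟙 X) ≫ m).hom.app (op ⟨∑ r, i r⟩) =
    ((monOperad X m e).γ j ▷ _) ≫ (monOperad X m e).γ i := by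
  refine (whisker_eq _ (kellyGen_whiskerRight_comp m m i)).trans ?_
  exact (assoc _ _ _).symm.trans (eq_whisker (comp_whiskerRight _ _ _).symm _)

lemma kellyGen_mul_assoc_right (K : KellyMonoidal V) {k : ℕ} (j : Fin k → ℕ) (i : Fin (∑ s, j s) → ℕ) :
    (kellyGen X X j ▷ finTensor (fun r => X.obj (i r))) ≫ kellyGen (kelly X X) X i ≫
      ((K.associator X X X).hom ≫ kellyMap (𝟙 X) m ≫ m).hom.app (op ⟨∑ r, i r⟩) =
    shuffle ((monOperad X m e).obj k) (fun s => (monOperad X m e).obj (j s))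
      (fun r => (monOperad X m e).obj (i r)) ≫
      ((monOperad X m e).obj k ◁ finTensorMap
        (fun s => (monOperad X m e).γ (fun q => i (finSigmaFinEquiv ⟨s, q⟩)))) ≫
      (monOperad X m e).γ (fun s => ∑ q, i (finSigmaFinEquiv ⟨s, q⟩)) ≫
      eqToHom (congrArg (monOperad X m e).obj (sum_regroup i).symm) := by
  have e1 := K.associator_gen X X X j i
  have e2 := eqToHom_obj_app (kellyMap (𝟙 X) m ≫ m) (sum_regroup i).symm
  have e3 := kellyGen_whiskerLeft_comp (D := X) m m fun s => ∑ q, i (finSigmaFinEquiv ⟨s, q⟩)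
  have e4 := tensMap_comp (fun s => kellyGen X X (fun q => i (finSigmaFinEquiv ⟨s, q⟩)))
    (fun s => m.hom.app (op ⟨∑ q, i (finSigmaFinEquiv ⟨s, q⟩)⟩)) (List.finRange k)
  have aux : ∀ {A B C D A' B' C' X Y E E' Z : V} {a : A ⟶ B} {b : B ⟶ C} {c : C ⟶ D} {s : A ⟶ X ⊗ A'}
      {t : A' ⟶ B'} {u : X ⊗ B' ⟶ E} {q : E ⟶ D} {f : D ⟶ Z} {f' : E ⟶ E'} {q' : E' ⟶ Z} {n : B' ⟶ C'}
      {v : X ⊗ C' ⟶ Y} {g : Y ⟶ E'} {tn : A' ⟶ C'} (e1 : a ≫ b ≫ c = s ≫ (X ◁ t) ≫ u ≫ q)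
      (e2 : q ≫ f = f' ≫ q') (e3 : u ≫ f' = (X ◁ n) ≫ v ≫ g) (e4 : tn = t ≫ n),
      a ≫ b ≫ c ≫ f = s ≫ (X ◁ tn) ≫ (v ≫ g) ≫ q' := by
    rintro A B C D A' B' C' X Y E E' Z a b c s t u q f f' q' n v g _ e1 e2 e3 rfl
    rw [reassoc_of% e1, e2, reassoc_of% e3, whiskerLeft_comp]
    simp only [assoc]
  exact aux e1 e2 e3 e4

lemma kellyGen_one_mul_left (n : ℕ) :
    (kellyUnitGen V ▷ finTensor (fun _ => X.obj n)) ≫ kellyGen (kellyUnit V) X (fun _ : Fin 1 => n) ≫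
      (kellyMap e (𝟙 X) ≫ m).hom.app (op ⟨∑ _ : Fin 1, n⟩) =
    ((monOperad X m e).unit ▷ _) ≫ (monOperad X m e).γ (fun _ : Fin 1 => n) := by
  refine (whisker_eq _ (kellyGen_whiskerRight_comp e m fun _ : Fin 1 => n)).trans ?_
  exact (assoc _ _ _).symm.trans (eq_whisker (comp_whiskerRight _ _ _).symm _)

lemma kellyGen_mul_one_left (k : ℕ) :
    (X.obj k ◁ finTensorUnits (fun _ => kellyUnitGen V)) ≫ kellyGen X (kellyUnit V) (fun _ : Fin k => 1) ≫
      (kellyMap (𝟙 X) e ≫ m).hom.app (op ⟨∑ _ : Fin k, 1⟩) =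
    (_ ◁ finTensorUnits fun _ => (monOperad X m e).unit) ≫ (monOperad X m e).γ (fun _ : Fin k => 1) := by
  refine (whisker_eq _ (kellyGen_whiskerLeft_comp (D := X) e m fun _ : Fin k => 1)).trans ?_
  refine (assoc _ _ _).symm.trans (eq_whisker ((whiskerLeft_comp _ _ _).symm.trans ?_) _)
  exact congrArg (fun z => X.obj k ◁ z) (tensUnits_tensMap (fun _ : Fin k => kellyUnitGen V) (fun _ => e.hom.app (op ⟨1⟩)) _)

variable [TensorCocts V] {S N : Type} [Enum S] [Enum N]
  {T : S → Type} [∀ s, Enum (T s)] {r : ∀ s, T s → N}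

lemma KellyMonoidal.rightUnitor_eq (K : KellyMonoidal V) (D : LambdaSeq V) :
    (K.rightUnitor D).hom = ruHom D :=
  kelly_kellyUnit_hom_ext fun k => (K.rightUnitor_gen D k).trans (ruHom_gen D k).symm

lemma monOperad_gam (hr : IsPart r) :
    (monOperad X m e).gam hr = Gen X X hr ≫ m.hom.app (op ⟨Enum.n N⟩) :=
  (Gen_comp_app hr m.hom).symm

lemma monOperad_pt (i : S ↪ Fin 1) : (monOperad X m e).pt i = unitGen i ≫ e.hom.app (op ⟨Enum.n S⟩) := by
  by_cases h : IsEmpty S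
  · refine ((monOperad X m e).pt_of_isEmpty h i).trans ?_
    exact (bs_naturality e h).symm.trans (eq_whisker (bs_unit h i) _)
  · obtain ⟨x⟩ := exists_equiv_one i h
    let j : Fin 1 ↪ Fin 1 := Embedding.refl _
    refine ((monOperad X m e).pt_of_equiv x i).trans ?_
    have e1 := res_naturality e.hom x.toEmbedding
    have e2 := unitGen_res (V := V) x.toEmbedding j i
    have e3 := kellyUnitGen_eq (V := V) j
    have aux : ∀ {A B C D : V} {u u' : 𝟙_ V ⟶ A} {f : A ⟶ B} {x : B ⟶ C} {y : A ⟶ D} {g : D ⟶ C} {w : 𝟙_ V ⟶ D}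
        (e1 : y ≫ g = f ≫ x) (e2 : u' ≫ y = w) (e3 : u = u'), (u ≫ f) ≫ x = w ≫ g := by
      rintro A B C D u _ f x y g _ e1 rfl rfl
      rw [assoc, assoc, e1]
    exact aux e1 e2 e3

/-- The action of the injections on a monoid is determined by its operad. -/
lemma monOperad_opRes (h : kellyMap (𝟙 X) e ≫ m = ruHom X) (x : N ↪ S) :
    (monOperad X m e).opRes x = res X.seq x := by
  have hr := IsPart.fibres x
  have e1 : (fun s => (monOperad X m e).pt (fibreEmb x s)) = fun s => unitGen (fibreEmb x s) ≫ e.hom.app _ :=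
    funext fun s => monOperad_pt _
  have e2 := utUnits_utMap (fun s => unitGen (V := V) (fibreEmb x s)) fun s => e.hom.app (op ⟨Enum.n {n // x n = s}⟩)
  have e3 := monOperad_gam (X := X) (m := m) (e := e) hr
  have e4 := Gen_naturality (𝟙 X) e hr
  have e5 := Gen_ruHom X hr (fibreEmb x) x fun s t => t.2
  have e6 : (kellyMap (𝟙 X) e).hom.app (op ⟨Enum.n N⟩) ≫ m.hom.app (op ⟨Enum.n N⟩) = (ruHom X).hom.app (op ⟨Enum.n N⟩) :=
    congrArg (fun f => f.hom.app (op ⟨Enum.n N⟩)) h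
  have e7 : (𝟙 X : X ⟶ X).hom.app (op ⟨Enum.n S⟩) = 𝟙 _ := rfl
  have aux : ∀ {A P Y Z Z' W : V} {u : 𝟙_ V ⟶ P} {v v' : 𝟙_ V ⟶ Y} {w : P ⟶ Y} {g : A ⊗ Y ⟶ W} {G : A ⊗ Y ⟶ Z'}
      {n : Z' ⟶ W} {G₁ : A ⊗ P ⟶ Z} {k : Z ⟶ Z'} {l : Z ⟶ W} {p : A ⟶ W} {i : A ⟶ A} (e1 : v = v') (e2 : u ≫ w = v')
      (e3 : g = G ≫ n) (e4 : G₁ ≫ k = (i ⊗ₘ w) ≫ G) (e5 : (A ◁ u) ≫ G₁ ≫ l = (ρ_ _).hom ≫ p) (e6 : k ≫ n = l)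
      (e7 : i = 𝟙 _), (ρ_ A).inv ≫ (A ◁ v) ≫ g = p := by
    rintro A P Y Z Z' W u v _ w _ G n G₁ k _ p _ rfl rfl rfl e4 e5 rfl rfl
    rw [id_tensorHom] at e4
    rw [whiskerLeft_comp, assoc, ← reassoc_of% e4, e5, Iso.inv_hom_id_assoc]
  exact aux (congrArg (fun z => utUnits z) e1) e2 e3 e4 e5 e6 e7

lemma monOperad_isOperad (K : KellyMonoidal V)
    (ha : kellyMap m (𝟙 X) ≫ m = (K.associator X X X).hom ≫ kellyMap (𝟙 X) m ≫ m)
    (hl : kellyMap e (𝟙 X) ≫ m = (K.leftUnitor X).hom) (hu : kellyMap (𝟙 X) e ≫ m = (K.rightUnitor X).hom) :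
    IsOperad (monOperad X m e) where
  assoc {k} j i := (kellyGen_mul_assoc_left j i).symm.trans
    ((congrArg (fun f : kelly (kelly X X) X ⟶ X => (kellyGen X X j ▷ finTensor (fun r => X.obj (i r))) ≫
      kellyGen (kelly X X) X i ≫ f.hom.app (op ⟨∑ r, i r⟩)) ha).trans (kellyGen_mul_assoc_right K j i))
  unit_right k := (kellyGen_mul_one_left k).symm.trans
    ((congrArg (fun f : kelly X (kellyUnit V) ⟶ X => (X.obj k ◁ finTensorUnits (fun _ => kellyUnitGen V)) ≫
      kellyGen X (kellyUnit V) (fun _ : Fin k => 1) ≫ f.hom.app (op ⟨∑ _ : Fin k, 1⟩)) hu).trans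
        (K.rightUnitor_gen X k))
  unit_left n := (kellyGen_one_mul_left n).symm.trans
    ((congrArg (fun f : kelly (kellyUnit V) X ⟶ X => (kellyUnitGen V ▷ finTensor (fun _ => X.obj n)) ≫
      kellyGen (kellyUnit V) X (fun _ : Fin 1 => n) ≫ f.hom.app (op ⟨∑ _ : Fin 1, n⟩)) hl).trans
        (K.leftUnitor_gen X n))
  equivariant_left {k} σ j := by
    have e1 := Gen_res X X (IsPart.fin fun s => j (σ s)) (IsPart.fin j) σ.toEmbedding
      (fun s s' h => (Equiv.cast (congrArg (fun s => Fin (j s)) h.symm)).toEmbedding)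
      (fun s hs => absurd (σ.surjective s) hs) (blockEquiv σ fun _ => Equiv.refl _).symm.toEmbedding (by
        rintro s _ rfl t
        refine (Equiv.symm_apply_eq _).2 ?_
        exact (blockEmb_apply σ.toEmbedding (fun _ => Embedding.refl _) s t).symm)
    have e2 : utRes X σ.toEmbedding (T := fun s => Fin (j (σ s))) (T' := fun s => Fin (j s))
        (fun s s' h => (Equiv.cast (congrArg (fun s => Fin (j s)) h.symm)).toEmbedding)
        (fun s hs => absurd (σ.surjective s) hs) = permute σ fun s => X.obj (j s) := by
      refine (eq_whisker ((congrArg (fun z => utMap z) (funext fun s => res_refl' _ fun _ => rfl)).trans (utMap_id _)) _).trans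
        ((id_comp _).trans (Eq.trans ?_ (spread_eq_utSpread _ _ _).symm))
      exact congrArg (utSpread _ _) (funext fun s => funext fun hs => absurd (σ.surjective s) hs)
    have e3 := res_naturality m.hom (blockEquiv σ fun s => Equiv.refl (Fin (j (σ s)))).toEmbedding
    have e4 : res (kelly X X).seq (blockEquiv σ fun s => Equiv.refl (Fin (j (σ s)))).symm.toEmbedding ≫
        res _ (blockEquiv σ fun s => Equiv.refl (Fin (j (σ s)))).toEmbedding = 𝟙 _ :=
      (res_comp' (z := Embedding.refl _) _ fun i => Equiv.symm_apply_apply _ i).trans (res_refl _)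
    have aux : ∀ {A B P P' Q Q' R R' : V} {a : A ⟶ B} {g g₁ : B ⊗ P ⟶ Q} {p : Q ⟶ Q'} {u u' : P ⟶ P'} {g' g₁' : A ⊗ P' ⟶ Q'}
        {b : Q' ⟶ Q} {n : Q ⟶ R} {n' : Q' ⟶ R'} {b' : R' ⟶ R} (e1 : (a ▷ P) ≫ g ≫ p = (A ◁ u) ≫ g') (e2 : u = u')
        (e3 : b ≫ n = n' ≫ b') (e4 : p ≫ b = 𝟙 _) (e5 : g = g₁) (e6 : g' = g₁'),
        (a ▷ P) ≫ g₁ ≫ n = (A ◁ u') ≫ (g₁' ≫ n') ≫ b' := by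
      rintro A B P P' Q Q' R R' a g _ p u _ g' _ b n n' b' e1 rfl e3 e4 rfl rfl
      rw [assoc, ← e3, ← reassoc_of% e1, reassoc_of% e4]
    exact aux e1 e2 e3 e4 (Gen_fin _ _ _) (Gen_fin _ _ _)
  equivariant_right {k} j τ := by
    have e1 := Gen_ext_res X X (IsPart.fin j) (IsPart.fin j) (fun s => (τ s).toEmbedding)
      (blockEquiv (Equiv.refl _) τ).toEmbedding fun s t =>
        blockEmb_apply (Embedding.refl _) (fun s => (τ s).toEmbedding) s t
    have e2 := res_naturality m.hom (blockEquiv (Equiv.refl _) τ).toEmbedding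
    have e3 := Gen_fin X X j
    have aux : ∀ {A P Q : V} {g g' : A ⟶ P} {b : P ⟶ P} {t : A ⟶ A} {n : P ⟶ Q} {b' : Q ⟶ Q}
        (e1 : g ≫ b = t ≫ g) (e2 : b ≫ n = n ≫ b') (e3 : g = g'), t ≫ g' ≫ n = (g' ≫ n) ≫ b' := by
      rintro A P Q g _ b t n b' e1 e2 rfl
      rw [assoc, ← e2, reassoc_of% e1]
    exact aux e1 e2 e3

end MonoidOperad
section OperadHom

variable {O O' : OperadData V}
  {S S' N : Type} [Enum S] [Enum S'] [Enum N] {T : S → Type} [∀ s, Enum (T s)] {r : ∀ s, T s → N}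

lemma OperadData.actE_hom (f : O ⟶ O') (x : S ≃ S') :
    O.actE x ≫ f.hom.app (op ⟨Enum.n S⟩) = f.hom.app (op ⟨Enum.n S'⟩) ≫ O'.actE x :=
  f.hom.naturality _

lemma OperadData.gam_hom (f : O ⟶ O') (hr : IsPart r) :
    O.gam hr ≫ f.hom.app (op ⟨Enum.n N⟩) =
      (f.hom.app (op ⟨Enum.n S⟩) ⊗ₘ utMap fun s => f.hom.app (op ⟨Enum.n (T s)⟩)) ≫ O'.gam hr :=
  (assoc _ _ _).trans ((whisker_eq _ (OperadData.actE_hom (S := N) (S' := Σ s, T s) f _)).trans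
    ((assoc _ _ _).symm.trans ((eq_whisker (f.γ_hom _) _).trans (assoc _ _ _))))

lemma OperadData.pt_hom (f : O ⟶ O') (i : S ↪ Fin 1) : O.pt i ≫ f.hom.app (op ⟨Enum.n S⟩) = O'.pt i := by
  by_cases h : IsEmpty S
  · rw [O.pt_of_isEmpty h, O'.pt_of_isEmpty h, OperadData.obs, assoc, OperadData.actE_hom]
    exact (assoc _ _ _).symm.trans (eq_whisker f.base_hom _)
  · obtain ⟨e⟩ := exists_equiv_one i h
    rw [O.pt_of_equiv e, O'.pt_of_equiv e, assoc, OperadData.actE_hom]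
    exact (assoc _ _ _).symm.trans (eq_whisker f.unit_hom _)

lemma OperadData.opRes_hom [SymmetricCategory V] (f : O ⟶ O') (x : N ↪ S) :
    O.opRes x ≫ f.hom.app (op ⟨Enum.n N⟩) = f.hom.app (op ⟨Enum.n S⟩) ≫ O'.opRes x := by
  have e1 := OperadData.gam_hom f (IsPart.fibres x)
  have e2 := utUnits_utMap (fun s => O.pt (fibreEmb x s)) fun s => f.hom.app (op ⟨Enum.n {n // x n = s}⟩)
  have e3 : (fun s => O.pt (fibreEmb x s) ≫ f.hom.app (op ⟨Enum.n {n // x n = s}⟩)) = fun s => O'.pt (fibreEmb x s) :=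
    funext fun s => OperadData.pt_hom f _
  have aux : ∀ {A B X Y P Q : V} {u : 𝟙_ V ⟶ X} {v v' : 𝟙_ V ⟶ Y} {w : X ⟶ Y} {a : A ⟶ B} {g : A ⊗ X ⟶ P}
      {p : P ⟶ Q} {g' : B ⊗ Y ⟶ Q} (e1 : g ≫ p = (a ⊗ₘ w) ≫ g') (e2 : u ≫ w = v) (e3 : v = v'),
      ((ρ_ _).inv ≫ (A ◁ u) ≫ g) ≫ p = a ≫ (ρ_ _).inv ≫ (B ◁ v') ≫ g' := by
    rintro A B X Y P Q u _ _ w a g p g' e1 rfl rfl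
    rw [assoc, assoc, e1, tensorHom_def', rightUnitor_inv_naturality_assoc, whiskerLeft_comp,
      assoc, assoc, ← whisker_exchange_assoc, ← whisker_exchange_assoc]
  exact aux e1 e2 (congrArg (fun z => utUnits z) e3)

end OperadHom

section OperadMonoid

variable [SymmetricCategory V] {O : OperadData V}
  {S N : Type} [Enum S] [Enum N] {T : S → Type} [∀ s, Enum (T s)] {r : ∀ s, T s → N}

/-- The `Λ`-sequence of a based operad. -/
def IsOperad.toLambda (hO : IsOperad O) : LambdaSeq V where
  seq :=
    { obj n := O.obj n.unop.n
      map {a b} x := O.opRes (M := Fin b.unop.n) (N := Fin a.unop.n) x.unop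
      map_id a := (hO.opRes_equiv (N := Fin a.unop.n) (Equiv.refl _)).trans (O.actE_refl fun _ => rfl)
      map_comp {a b c} x y := (hO.opRes_comp (M := Fin c.unop.n) (N := Fin b.unop.n) (S := Fin a.unop.n) y.unop x.unop
        _ fun _ => rfl).symm }
  base := O.base

lemma IsOperad.opRes_e (hO : IsOperad O) :
    O.opRes (Enum.e (S := S)).toEmbedding = 𝟙 (oev O S) :=
  (hO.opRes_equiv _).trans (O.act_refl fun q => Equiv.apply_symm_apply _ _)

lemma IsOperad.res_toLambda (hO : IsOperad O) (x : N ↪ S) : res hO.toLambda.seq x = O.opRes x := by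
  have e1 := hO.opRes_comp Enum.e.toEmbedding (toFin x) (x.trans Enum.e.toEmbedding) fun n =>
    congrArg (fun n => Enum.e (x n)) (Enum.e.symm_apply_apply n)
  have e2 := hO.opRes_comp x Enum.e.toEmbedding (x.trans Enum.e.toEmbedding) fun n => rfl
  have aux : ∀ {A B : V} {f g h : A ⟶ B} {i : A ⟶ A} {j : B ⟶ B} (e1 : f ≫ j = h) (e2 : i ≫ g = h) (e3 : i = 𝟙 _)
      (e4 : j = 𝟙 _), f = g := by
    rintro A B f g _ _ _ rfl e2 rfl rfl
    simpa using e2.symm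
  exact aux e1 e2 hO.opRes_e hO.opRes_e

lemma IsOperad.bs_toLambda (hO : IsOperad O) (hS : IsEmpty S) : bs hO.toLambda hS = O.obs hS :=
  whisker_eq O.base ((hO.res_toLambda _).trans ((congrArg O.opRes (Embedding.ext fun s => hS.elim s)).trans
    (hO.opRes_equiv (N := S) (S := Fin 0) (Equiv.equivOfIsEmpty _ _))))

variable [HasColimits V] [TensorCocts V]

lemma IsOperad.exists_mul (hO : IsOperad O) : ∃ m : kelly hO.toLambda hO.toLambda ⟶ hO.toLambda,
    ∀ {k : ℕ} (j : Fin k → ℕ), kellyGen hO.toLambda hO.toLambda j ≫ m.hom.app (op ⟨∑ s, j s⟩) = O.γ j := by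
  let c : KellyFam hO.toLambda hO.toLambda hO.toLambda.seq :=
    { map := fun hr => O.gam hr
      law := fun {S S' N N'} _ _ _ _ {T} _ {T'} _ {r r'} hr hr' φ f he ψ hψ => by
        have e1 := hO.law hr hr' φ f he ψ hψ
        have e2 : utRes hO.toLambda φ f he = utSp φ (fun s s' h => O.opRes (f s s' h)) fun s' hs' => O.obs (he s' hs') :=
          utSp_congr rfl (fun s s' h _ => hO.res_toLambda _) fun s' hs' _ => hO.bs_toLambda _
        have aux : ∀ {A B X Y P Q : V} {a a' : A ⟶ B} {g : B ⊗ X ⟶ P} {p p' : P ⟶ Q} {u u' : X ⟶ Y} {g' : A ⊗ Y ⟶ Q}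
            (e1 : (a ▷ X) ≫ g ≫ p = (A ◁ u) ≫ g') (e2 : u' = u) (e3 : a' = a) (e4 : p' = p),
            (a' ▷ X) ≫ g ≫ p' = (A ◁ u') ≫ g' := by
          rintro A B X Y P Q a _ g p _ u _ g' e1 rfl rfl rfl
          exact e1
        exact aux e1 e2 (hO.res_toLambda φ) (hO.res_toLambda ψ) }
  obtain ⟨t, ht⟩ := c.exists_desc
  have h0 : IsEmpty (Fin 0) := Fin.isEmpty
  have hr : IsPart fun (s : Fin 0) (_ : Fin 1) => s := IsPart.points
  let i : Fin 1 ↪ Fin 1 := Embedding.refl _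
  have e1 := bs_Gen hO.toLambda hO.toLambda hr h0 h0 fun s => O.pt i
  have e2 := hO.gam_units hr (fun _ => i) (Equiv.refl _) fun s t => rfl
  have e3 := ht hr
  have e4 : O.actE (Equiv.refl (Fin 0)) = 𝟙 _ := O.actE_refl fun _ => rfl
  have hb : (kelly hO.toLambda hO.toLambda).base ≫ t.app (op ⟨0⟩) = O.base := by
    have aux : ∀ {A P X : V} {b b' : 𝟙_ V ⟶ A} {u : 𝟙_ V ⟶ P} {g : A ⊗ P ⟶ X} {k k' : 𝟙_ V ⟶ X} {t : X ⟶ A}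
        {g' : A ⊗ P ⟶ A} {i : A ⟶ A} (e1 : b ≫ (ρ_ _).inv ≫ (A ◁ u) ≫ g = k) (e2 : (A ◁ u) ≫ g' = (ρ_ _).hom ≫ i)
        (e3 : g ≫ t = g') (e4 : i = 𝟙 _) (e5 : k = k') (e6 : b = b'), k' ≫ t = b' := by
      rintro A P X b _ u g _ _ t _ _ rfl e2 rfl rfl rfl rfl
      rw [Category.assoc, Category.assoc, Category.assoc, e2]
      simp
    exact aux e1 e2 e3 e4 (bs_zero _ h0) (bs_zero _ h0)
  refine ⟨⟨t, hb⟩, fun {k} j => ?_⟩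
  have e5 := ht (IsPart.fin j)
  exact (eq_whisker (Gen_fin _ _ _).symm _).trans (e5.trans (O.gam_fin j))

lemma IsOperad.exists_one (hO : IsOperad O) : ∃ e : kellyUnit V ⟶ hO.toLambda,
    kellyUnitGen V ≫ e.hom.app (op ⟨1⟩) = O.unit := by
  let t : (kellyUnit V).seq ⟶ hO.toLambda.seq :=
    { app n := Sigma.desc fun x : Fin n.unop.n ↪ Fin 1 => O.pt x
      naturality a b x := by
        refine Sigma.hom_ext _ _ fun (i : Fin a.unop.n ↪ Fin 1) => ?_
        have e1 := unitGen_res (V := V) (S := Fin b.unop.n) (S' := Fin a.unop.n) x.unop i (x.unop.trans i)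
        have e2 : ∀ (n : ℕ) (i : Fin n ↪ Fin 1), unitGen i ≫ Sigma.desc (fun x : Fin n ↪ Fin 1 => O.pt x) = O.pt i :=
          fun n i => Sigma.ι_desc _ _
        have e3 := hO.pt_opRes (N := Fin b.unop.n) (S := Fin a.unop.n) x.unop i (x.unop.trans i)
        have aux : ∀ {A B C D : V} {u : 𝟙_ V ⟶ A} {r : A ⟶ B} {v : 𝟙_ V ⟶ B} {d : B ⟶ D} {d' : A ⟶ C} {p : 𝟙_ V ⟶ C}
            {q : 𝟙_ V ⟶ D} {z : C ⟶ D} (e1 : u ≫ r = v) (e2 : v ≫ d = q) (e2' : u ≫ d' = p) (e3 : p ≫ z = q),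
            u ≫ r ≫ d = u ≫ d' ≫ z := by
          rintro A B C D u r _ d d' _ _ z rfl e2 rfl rfl
          rwa [Category.assoc, Category.assoc] at e2
        exact aux e1 (e2 _ _) (e2 _ _) e3 }
  refine ⟨⟨t, ?_⟩, ?_⟩
  · exact (Sigma.ι_desc (fun x : Fin 0 ↪ Fin 1 => O.pt x) _).trans
      ((O.pt_of_isEmpty (S := Fin 0) inferInstance _).trans (O.obs_zero _))
  · exact (Sigma.ι_desc (fun x : Fin 1 ↪ Fin 1 => O.pt x) _).trans (O.pt_one _)

lemma OperadData.ext {O O' : OperadData V} (hs : O.seq = O'.seq) (hγ : ∀ {k : ℕ} (j : Fin k → ℕ), HEq (O.γ j) (O'.γ j))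
    (hu : HEq O.unit O'.unit) (hb : HEq O.base O'.base) : O = O' := by
  obtain ⟨s, γ, u, b⟩ := O
  obtain ⟨s', γ', u', b'⟩ := O'
  obtain rfl : s = s' := hs
  obtain rfl : u = u' := eq_of_heq hu
  obtain rfl : b = b' := eq_of_heq hb
  obtain rfl : @γ = @γ' := funext fun k => funext fun j => eq_of_heq (hγ j)
  rfl

/-- Every based operad is the operad of a product and a unit on a `Λ`-sequence. -/
lemma IsOperad.exists_monOperad_eq (hO : IsOperad O) :
    ∃ (X : LambdaSeq V) (m : kelly X X ⟶ X) (e : kellyUnit V ⟶ X), monOperad X m e = O := by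
  obtain ⟨m, hm⟩ := hO.exists_mul
  obtain ⟨e, he⟩ := hO.exists_one
  refine ⟨hO.toLambda, m, e, OperadData.ext (Functor.hext (fun _ => rfl) fun a b x => heq_of_eq ?_)
    (fun j => heq_of_eq (hm j)) (heq_of_eq he) HEq.rfl⟩
  exact hO.opRes_equiv (N := Fin b.unop.n) (S := Fin a.unop.n) x.unop

variable {X X' : LambdaSeq V} {m : kelly X X ⟶ X} {e : kellyUnit V ⟶ X} {m' : kelly X' X' ⟶ X'} {e' : kellyUnit V ⟶ X'}

lemma IsOperad.mul_assoc (K : KellyMonoidal V) (h : IsOperad (monOperad X m e)) :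
    kellyMap m (𝟙 X) ≫ m = (K.associator X X X).hom ≫ kellyMap (𝟙 X) m ≫ m :=
  kelly_hom_ext_kellyGen₃ fun j i =>
    (kellyGen_mul_assoc_left (e := e) j i).trans ((h.assoc j i).trans (kellyGen_mul_assoc_right K j i).symm)

lemma IsOperad.one_mul (K : KellyMonoidal V) (h : IsOperad (monOperad X m e)) :
    kellyMap e (𝟙 X) ≫ m = (K.leftUnitor X).hom :=
  kellyUnit_kelly_hom_ext fun n => (kellyGen_one_mul_left n).trans ((h.unit_left n).trans (K.leftUnitor_gen X n).symm)

lemma IsOperad.mul_one (K : KellyMonoidal V) (h : IsOperad (monOperad X m e)) :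
    kellyMap (𝟙 X) e ≫ m = (K.rightUnitor X).hom :=
  kelly_kellyUnit_hom_ext fun k => (kellyGen_mul_one_left k).trans ((h.unit_right k).trans (K.rightUnitor_gen X k).symm)

lemma seq_map_eq_opRes (h : kellyMap (𝟙 X) e ≫ m = ruHom X) {a b : Lamᵒᵖ} (x : a ⟶ b) :
    X.seq.map x = (monOperad X m e).opRes (M := Fin b.unop.n) (N := Fin a.unop.n) x.unop :=
  (monOperad_opRes (N := Fin b.unop.n) (S := Fin a.unop.n) h x.unop).symm

lemma kellyUnit_hom_ext {f g : kellyUnit V ⟶ X}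
    (h : kellyUnitGen V ≫ f.hom.app (op ⟨1⟩) = kellyUnitGen V ≫ g.hom.app (op ⟨1⟩)) : f = g := by
  refine LambdaSeq.hom_ext (NatTrans.ext (funext fun n => Sigma.hom_ext _ _ fun (i : Fin n.unop.n ↪ Fin 1) => ?_))
  have e1 := unitGen_res (V := V) (S := Fin n.unop.n) i (Embedding.refl _) i
  have e2 := res_naturality (S := Fin n.unop.n) f.hom i
  have e3 := res_naturality (S := Fin n.unop.n) g.hom i
  have aux : ∀ {A B C D : V} {u u' : 𝟙_ V ⟶ A} {v : 𝟙_ V ⟶ B} {r : A ⟶ B} {f g : B ⟶ C} {f' g' : A ⟶ D} {s : D ⟶ C}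
      (e1 : u ≫ r = v) (e2 : r ≫ f = f' ≫ s) (e3 : r ≫ g = g' ≫ s) (h : u' ≫ f' = u' ≫ g') (e4 : u' = u),
      v ≫ f = v ≫ g := by
    rintro A B C D u _ _ r f g f' g' s rfl e2 e3 h rfl
    rw [assoc, assoc, e2, e3, reassoc_of% h]
  exact aux e1 e2 e3 h (kellyUnitGen_eq _)

/-- The operad of a monoid determines the monoid. -/
lemma monOperad_injective (h : kellyMap (𝟙 X) e ≫ m = ruHom X) (h' : kellyMap (𝟙 X') e' ≫ m' = ruHom X')
    (heq : monOperad X m e = monOperad X' m' e') : X = X' ∧ HEq m m' ∧ HEq e e' := by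
  have h1 : X = X' := by
    have h2 : X.seq = X'.seq := by
      refine Functor.hext (fun n => congrArg (fun O => O.obj n.unop.n) heq) fun a b x => ?_
      rw [seq_map_eq_opRes h, seq_map_eq_opRes h']
      exact congr_arg_heq (fun O : OperadData V => O.opRes (M := Fin b.unop.n) (N := Fin a.unop.n) x.unop) heq
    have h3 : HEq X.base X'.base :=
      (congr_arg_heq OperadData.base heq : HEq (monOperad X m e).base (monOperad X' m' e').base)
    obtain ⟨s, b⟩ := X
    obtain ⟨s', b'⟩ := X'
    obtain rfl : s = s' := h2
    obtain rfl : b = b' := eq_of_heq h3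
    rfl
  subst h1
  have h4 : ∀ {k : ℕ} (j : Fin k → ℕ), HEq ((monOperad X m e).γ j) ((monOperad X m' e').γ j) := fun j => by rw [heq]
  have h5 : HEq (monOperad X m e).unit (monOperad X m' e').unit := by rw [heq]
  exact ⟨rfl, heq_of_eq (kelly_hom_ext_kellyGen fun j => eq_of_heq (h4 j)),
    heq_of_eq (kellyUnit_hom_ext (eq_of_heq h5))⟩

/-- The morphisms of operads underlie morphisms of monoids. -/
lemma exists_hom_of_operadHom (h : kellyMap (𝟙 X) e ≫ m = ruHom X) (h' : kellyMap (𝟙 X') e' ≫ m' = ruHom X')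
    (f : monOperad X m e ⟶ monOperad X' m' e') :
    ∃ g : X ⟶ X', (∀ n, g.hom.app (op ⟨n⟩) = f.hom.app (op ⟨n⟩)) ∧ m ≫ g = kellyMap g g ≫ m' ∧ e ≫ g = e' := by
  let t : X.seq ⟶ X'.seq :=
    { app n := f.hom.app (op ⟨n.unop.n⟩)
      naturality a b x := by
        rw [seq_map_eq_opRes h, seq_map_eq_opRes h']
        exact OperadData.opRes_hom (N := Fin b.unop.n) (S := Fin a.unop.n) f x.unop }
  let g : X ⟶ X' := ⟨t, f.base_hom⟩
  refine ⟨g, fun _ => rfl, kelly_hom_ext_kellyGen fun j => ?_, kellyUnit_hom_ext ?_⟩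
  · exact ((assoc _ _ _).symm.trans (f.γ_hom j)).trans (kellyGen_kellyMap_comp g g m' j).symm
  · exact (assoc _ _ _).symm.trans f.unit_hom

end OperadMonoid
section Isomorphism

variable [SymmetricCategory V] [HasColimits V]
  (K : KellyMonoidal V)

lemma KellyMonoidal.operadData_faithful : letI := K.monoidalCategory; K.operadData.Faithful := by
  let _ := K.monoidalCategory
  refine ⟨fun {C D f g} h => ?_⟩
  refine Mon.Hom.ext (LambdaSeq.hom_ext (NatTrans.ext (funext fun n => ?_)))
  exact congrArg (fun f : K.operadData.obj C ⟶ K.operadData.obj D => f.hom.app (op ⟨n.unop.n⟩)) h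

variable [TensorCocts V]

lemma KellyMonoidal.mul_one_eq : letI := K.monoidalCategory; ∀ C : Mon (LambdaSeq V),
    kellyMap (𝟙 C.X) (MonObj.one : kellyUnit V ⟶ C.X) ≫ (MonObj.mul : kelly C.X C.X ⟶ C.X) = ruHom C.X :=
  let _ := K.monoidalCategory
  fun C => (MonObj.mul_one C.X).trans (K.rightUnitor_eq C.X)

lemma KellyMonoidal.isOperad_operadData : letI := K.monoidalCategory; ∀ C : Mon (LambdaSeq V),
    IsOperad (K.operadData.obj C) :=
  let _ := K.monoidalCategory
  fun C => monOperad_isOperad K (MonObj.mul_assoc C.X) (MonObj.one_mul C.X) (MonObj.mul_one C.X)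

lemma KellyMonoidal.operadData_full : letI := K.monoidalCategory; K.operadData.Full := by
  let _ := K.monoidalCategory
  refine ⟨fun {C D} f => ?_⟩
  obtain ⟨g, hg, hm, he⟩ := exists_hom_of_operadHom (K.mul_one_eq C) (K.mul_one_eq D) f
  have : IsMonHom g := ⟨he, hm⟩
  exact ⟨⟨g⟩, OperadData.Hom.ext (NatTrans.ext (funext fun n => hg n.unop.n))⟩

lemma KellyMonoidal.operadData_injective : letI := K.monoidalCategory;
    Function.Injective K.operadData.obj := by
  let _ := K.monoidalCategory
  intro C D h
  obtain ⟨h1, h2, h3⟩ := monOperad_injective (K.mul_one_eq C) (K.mul_one_eq D) h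
  obtain @⟨X, ⟨one, mul, _, _, _⟩⟩ := C
  obtain @⟨X', ⟨one', mul', _, _, _⟩⟩ := D
  obtain rfl : X = X' := h1
  obtain rfl : mul = mul' := eq_of_heq h2
  obtain rfl : one = one' := eq_of_heq h3
  rfl

lemma KellyMonoidal.exists_operadData_eq : letI := K.monoidalCategory; ∀ {O : OperadData V}, IsOperad O →
    ∃ C : Mon (LambdaSeq V), K.operadData.obj C = O := by
  let _ := K.monoidalCategory
  intro O hO
  obtain ⟨X, m, e, rfl⟩ := hO.exists_monOperad_eq
  exact ⟨@Mon.mk _ _ _ X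
    { one := e
      mul := m
      one_mul := hO.one_mul K
      mul_one := hO.mul_one K
      mul_assoc := hO.mul_assoc K }, rfl⟩

/-- The category of monoids in `Λ`-sequences is isomorphic to the category of based operads. -/
theorem KellyMonoidal.isIso_lift_operadData : letI := K.monoidalCategory;
    ((isBasedOperad V).lift K.operadData K.isOperad_operadData).IsIso := by
  let _ := K.monoidalCategory
  have := K.operadData_faithful
  have := K.operadData_full
  refine ⟨ObjectProperty.instFaithfulFullSubcategoryLift _ _ _, ObjectProperty.instFullFullSubcategoryLift _ _ _, fun C D h => K.operadData_injective (congrArg (fun O => O.obj) h), fun O => ?_⟩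
  obtain ⟨C, hC⟩ := K.exists_operadData_eq O.property
  exact ⟨C, ObjectProperty.FullSubcategory.ext hC⟩

end Isomorphism
section Unital

variable {S S' N : Type} [Enum S] [Enum S'] [Enum N]
  {D E : LambdaSeq V}

lemma isIso_tensUnits {ι : Type} {A : ι → V} (u : ∀ i, 𝟙_ V ⟶ A i) (hu : ∀ i, IsIso (u i)) :
    ∀ l : List ι, IsIso (tensUnits u l)
  | [] => inferInstanceAs (IsIso (𝟙 _))
  | a :: l => by
    have := isIso_tensUnits u hu l
    exact inferInstanceAs (IsIso ((λ_ _).inv ≫ (u a ⊗ₘ tensUnits u l)))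

lemma bs_res_zero (D : LambdaSeq V) (hS : IsEmpty S) : bs D hS ≫ res D.seq (Embedding.ofIsEmpty : Fin 0 ↪ S) = D.base :=
  (bs_res D hS Fin.isEmpty _).trans (bs_zero _ _)

lemma isIso_bs (hD : IsIso D.base) (hS : IsEmpty S) : IsIso (bs D hS) := by
  have e1 : res D.seq (Embedding.ofIsEmpty : Fin 0 ↪ S) ≫ res D.seq (Embedding.ofIsEmpty : S ↪ Fin 0) = 𝟙 _ :=
    (res_comp _ _ _).trans (res_refl' _ fun s => hS.elim s)
  have e2 : res D.seq (Embedding.ofIsEmpty : S ↪ Fin 0) ≫ res D.seq (Embedding.ofIsEmpty : Fin 0 ↪ S) = 𝟙 _ :=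
    (res_comp _ _ _).trans (res_refl' _ fun s => s.elim0)
  have : IsIso (res D.seq (Embedding.ofIsEmpty : S ↪ Fin 0)) := ⟨_, e2, e1⟩
  exact IsIso.comp_isIso' hD this

/-- The augmentation `D S ⟶ D ∅ ≅ 𝟙_ V` of a unital `Λ`-sequence. -/
def aug (D : LambdaSeq V) [IsIso D.base] (S : Type) [Enum S] : ev D.seq S ⟶ 𝟙_ V :=
  res D.seq (Embedding.ofIsEmpty : Fin 0 ↪ S) ≫ inv D.base

lemma res_aug [IsIso D.base] (x : S ↪ S') : res D.seq x ≫ aug D S = aug D S' :=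
  (assoc _ _ _).symm.trans (eq_whisker (res_comp' _ fun s => s.elim0) _)

lemma bs_aug [IsIso D.base] (hS : IsEmpty S) : bs D hS ≫ aug D S = 𝟙 _ :=
  (assoc _ _ _).symm.trans ((eq_whisker (bs_res_zero D hS) _).trans (IsIso.hom_inv_id _))

variable [HasColimits V]

lemma isUnital_kellyUnit : isUnital V (kellyUnit V) := by
  refine ⟨Sigma.desc fun _ => 𝟙 _, Sigma.ι_desc _ _, Sigma.hom_ext _ _ fun i => ?_⟩
  obtain rfl : i = (Embedding.ofIsEmpty : Fin 0 ↪ Fin 1) := Subsingleton.elim (α := Fin 0 ↪ Fin 1) _ _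
  exact (Sigma.ι_desc_assoc _ _ _).trans ((id_comp _).trans (comp_id _).symm)

variable [SymmetricCategory V] [TensorCocts V]

lemma exists_augmentation [IsIso D.base] [IsIso E.base] :
    ∃ t : (kelly D E).obj 0 ⟶ 𝟙_ V, (kelly D E).base ≫ t = 𝟙 _ := by
  have hu : ∀ (S : Type) [Enum S], IsIso (utUnits fun _ : S => 𝟙 (𝟙_ V)) := fun S _ =>
    isIso_tensUnits _ (fun _ => inferInstance) _
  let c : KellyFam D E ((Functor.const _).obj (𝟙_ V)) :=
    { map := fun {S N} _ _ {T} _ {r} hr => (aug D S ⊗ₘ utMap fun s => aug E (T s)) ≫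
        (_ ◁ inv (utUnits fun _ : S => 𝟙 (𝟙_ V))) ≫ (λ_ _).hom
      law := fun {S S' N N'} _ _ _ _ {T} _ {T'} _ {r r'} hr hr' φ f he ψ hψ => by
        have e1 := (utSp_utMap φ (fun s' => aug E (T' s')) (fun s s' h => res E.seq (f s s' h)) fun s' hs' => bs E (he s' hs')).trans
          ((utSp_congr (c' := fun s s' h => aug E (T s) ≫ 𝟙 (𝟙_ V)) (u' := fun _ _ => 𝟙 (𝟙_ V)) rfl
            (fun s s' h _ => (res_aug _).trans (comp_id _).symm) fun s' h _ => bs_aug _).trans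
            (utMap_utSp φ (fun s => aug E (T s)) (fun _ _ _ => 𝟙 (𝟙_ V)) fun _ _ => 𝟙 (𝟙_ V)).symm)
        have e2 := utUnits_utSp (φ := φ) (u := fun _ => 𝟙 (𝟙_ V)) (c := fun _ _ _ => 𝟙 (𝟙_ V)) (u' := fun _ _ => 𝟙 (𝟙_ V))
          (v := fun _ => 𝟙 (𝟙_ V)) (fun _ _ _ => comp_id _) fun _ _ => rfl
        have aux : ∀ {A B X Y P Q : V} {a : A ⟶ B} {b : B ⟶ 𝟙_ V} {b' : A ⟶ 𝟙_ V} {x : X ⟶ P} {u : 𝟙_ V ⟶ P} {v : 𝟙_ V ⟶ Q}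
            {w : X ⟶ Y} {y : Y ⟶ Q} {z : P ⟶ Q} (hu : IsIso u) (hv : IsIso v) (e1 : w ≫ y = x ≫ z) (e2 : u ≫ z = v)
            (e3 : a ≫ b = b'), (a ▷ X) ≫ ((b ⊗ₘ x) ≫ (_ ◁ inv u) ≫ (λ_ _).hom) ≫ 𝟙 _ =
              (A ◁ w) ≫ (b' ⊗ₘ y) ≫ (_ ◁ inv v) ≫ (λ_ _).hom := by
          rintro A B X Y P Q a b _ x u v w y z hu hv e1 e2 rfl
          have h : z ≫ inv v = inv u := by
            rw [← cancel_epi u, reassoc_of% e2, IsIso.hom_inv_id, IsIso.hom_inv_id]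
          rw [comp_id, ← tensorHom_id, tensorHom_comp_tensorHom_assoc, ← id_tensorHom, ← id_tensorHom, ← id_tensorHom,
            tensorHom_comp_tensorHom_assoc, tensorHom_comp_tensorHom_assoc, tensorHom_comp_tensorHom_assoc, e1,
            assoc x z, h]
          simp
        exact aux (hu S) (hu S') e1 e2 (res_aug φ) }
  obtain ⟨t, ht⟩ := c.exists_desc
  refine ⟨t.app (op ⟨0⟩), ?_⟩
  have h0 : IsEmpty (Fin 0) := Fin.isEmpty
  have hr : IsPart fun (s : Fin 0) (_ : Fin 0) => s := ⟨fun x => x.1.elim0, fun s => s.elim0⟩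
  have e1 := bs_Gen D E hr h0 h0 fun _ => bs E h0
  have e2 := ht hr
  have e3 := (utUnits_utMap (fun _ : Fin 0 => bs E h0) fun _ => aug E (Fin 0)).trans
    (congrArg (fun z => utUnits z) (funext fun _ => bs_aug h0))
  have aux : ∀ {A X P Z : V} {b : 𝟙_ V ⟶ A} {u : 𝟙_ V ⟶ X} {g : A ⊗ X ⟶ Z} {k k' : 𝟙_ V ⟶ Z} {t : Z ⟶ 𝟙_ V}
      {a : A ⟶ 𝟙_ V} {x : X ⟶ P} {v : 𝟙_ V ⟶ P} (hv : IsIso v) (e1 : b ≫ (ρ_ _).inv ≫ (A ◁ u) ≫ g = k)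
      (e2 : g ≫ t = (a ⊗ₘ x) ≫ (_ ◁ inv v) ≫ (λ_ _).hom) (e3 : u ≫ x = v) (e4 : b ≫ a = 𝟙 _) (e5 : k = k'),
      k' ≫ t = 𝟙 _ := by
    rintro A X P Z b u g _ _ t a x v hv rfl e2 e3 e4 rfl
    rw [assoc, assoc, assoc, e2, ← id_tensorHom, ← id_tensorHom,
      tensorHom_comp_tensorHom_assoc, tensorHom_comp_tensorHom_assoc, e3, IsIso.hom_inv_id,
      rightUnitor_inv_naturality_assoc, ← tensorHom_id, tensorHom_comp_tensorHom_assoc]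
    have h : b ≫ (𝟙 A ≫ a) ≫ 𝟙 _ = 𝟙 _ := by simpa using e4
    rw [h]
    simp [unitors_equal]
  exact aux (hu (Fin 0)) e1 e2 e3 (bs_aug h0) (bs_zero _ h0)

lemma isUnital_kelly (hD : isUnital V D) (hE : isUnital V E) : isUnital V (kelly D E) := by
  have : IsIso D.base := hD
  have : IsIso E.base := hE
  obtain ⟨t, ht⟩ := exists_augmentation (D := D) (E := E)
  refine ⟨t, ht, Gen_hom_ext (N := Fin 0) fun {k T} _ {r} hr => ?_⟩
  have h0 : IsEmpty (Fin 0) := Fin.isEmpty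
  have hT : ∀ s, IsEmpty (T s) := fun s => ⟨fun x => (r s x).elim0⟩
  have hr₀ : IsPart fun (s : Fin 0) (_ : Fin 0) => s := ⟨fun x => x.1.elim0, fun s => s.elim0⟩
  let φ : Fin 0 ↪ Fin k := Embedding.ofIsEmpty
  have e1 := Gen_res D E hr₀ hr φ (fun s _ _ => s.elim0) (fun s _ => hT s) (Embedding.refl _) fun s => s.elim0
  have e2 := bs_Gen D E hr₀ h0 h0 fun _ => bs E h0
  have e3 := utUnits_utSp (φ := φ) (u := fun _ => bs E h0) (v := fun s => bs E (hT s))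
    (c := fun s s' h => res E.seq ((fun s _ _ => s.elim0 : ∀ s s', φ s = s' → (T s' ↪ Fin 0)) s s' h))
    (u' := fun s' _ => bs E (hT s')) (fun s => s.elim0) fun _ _ => rfl
  have e4 : IsIso (utUnits fun s => bs E (hT s)) := isIso_tensUnits _ (fun s => isIso_bs hE _) _
  have e5 : IsIso (utUnits fun _ : Fin 0 => bs E h0) := isIso_tensUnits _ (fun s => isIso_bs hE _) _
  have aux : ∀ {A B X Y Z : V} {a : B ⟶ A} {u : 𝟙_ V ⟶ X} {v : 𝟙_ V ⟶ Y} {w : X ⟶ Y} {g₀ : A ⊗ X ⟶ Z} {i : Z ⟶ Z}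
      {g : B ⊗ Y ⟶ Z} {b : 𝟙_ V ⟶ A} {k k' : 𝟙_ V ⟶ Z} {t : Z ⟶ 𝟙_ V} (e1 : (a ▷ X) ≫ g₀ ≫ i = (B ◁ w) ≫ g) (ei : i = 𝟙 _)
      (e2 : b ≫ (ρ_ _).inv ≫ (A ◁ u) ≫ g₀ = k) (e3 : u ≫ w = v) (e4 : IsIso v) (e5 : IsIso u) (e6 : k = k') (hb : IsIso b)
      (ht : k' ≫ t = 𝟙 _), g ≫ t ≫ k' = g ≫ 𝟙 _ := by
    rintro A B X Y Z a u v w g₀ _ g b k _ t e1 rfl e2 e3 e4 e5 rfl hb ht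
    have hw : IsIso w := by
      rw [← e3] at e4
      exact IsIso.of_isIso_comp_left u w
    have h : g₀ ≫ t ≫ k = g₀ := by
      rw [← cancel_epi (A ◁ u), ← cancel_epi (ρ_ A).inv, ← cancel_epi b, reassoc_of% e2, e2, reassoc_of% ht]
    rw [comp_id] at e1 ⊢
    rw [← cancel_epi (B ◁ w), ← reassoc_of% e1, h, e1]
  exact aux e1 (res_refl _) e2 e3 e4 e5 (bs_zero _ h0) (isIso_bs hD h0) ht

lemma KellyMonoidal.isMonoidal_isUnital (K : KellyMonoidal V) : letI := K.monoidalCategory; (isUnital V).IsMonoidal :=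
  letI := K.monoidalCategory
  { prop_unit := isUnital_kellyUnit
    prop_tensor := fun _ _ h h' => isUnital_kelly h h' }

/-- The category of monoids in unital `Λ`-sequences is isomorphic to the category of unital operads. -/
theorem KellyMonoidal.isIso_lift_operadData_unital (K : KellyMonoidal V) : letI := K.monoidalCategory;
    letI := K.isMonoidal_isUnital
    ∃ h : ∀ C : Mon (isUnital V).FullSubcategory, isUnitalOperad V (((isUnital V).ι.mapMon ⋙ K.operadData).obj C),
      ((isUnitalOperad V).lift ((isUnital V).ι.mapMon ⋙ K.operadData) h).IsIso := by
  let _ := K.monoidalCategory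
  let _ := K.isMonoidal_isUnital
  have := K.operadData_faithful
  have := K.operadData_full
  refine ⟨fun C => ⟨K.isOperad_operadData _, C.X.property⟩, ?_⟩
  have h1 : ((isUnital V).ι.mapMon ⋙ K.operadData).Faithful := inferInstance
  have h2 : ((isUnital V).ι.mapMon ⋙ K.operadData).Full := inferInstance
  refine ⟨ObjectProperty.instFaithfulFullSubcategoryLift _ _ _, ObjectProperty.instFullFullSubcategoryLift _ _ _,
    fun C D h => ?_, fun O => ?_⟩
  · have h3 : (isUnital V).ι.mapMon.obj C = (isUnital V).ι.mapMon.obj D :=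
      K.operadData_injective (congrArg (fun O => O.obj) h)
    obtain @⟨⟨X, hX⟩, i⟩ := C
    obtain @⟨⟨X', hX'⟩, i'⟩ := D
    obtain rfl : X = X' := congrArg Mon.X h3
    have h4 : HEq _ _ := congr_arg_heq (fun C : Mon (LambdaSeq V) => (MonObj.mul : C.X ⊗ C.X ⟶ C.X)) h3
    refine congrArg (fun i => @Mon.mk _ _ _ _ i) (MonObj.ext i i' (InducedCategory.Hom.ext ?_))
    exact (id_comp _).symm.trans ((eq_of_heq h4).trans (id_comp _))
  · obtain ⟨C, hC⟩ := K.exists_operadData_eq O.property.1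
    have h3 : isUnital V C.X := by
      have h4 := O.property.2
      rw [← hC] at h4
      exact h4
    let C' : Mon (isUnital V).FullSubcategory := @Mon.mk _ _ _ ⟨C.X, h3⟩
      { one := ObjectProperty.homMk MonObj.one
        mul := ObjectProperty.homMk MonObj.mul
        one_mul := InducedCategory.Hom.ext (MonObj.one_mul C.X)
        mul_one := InducedCategory.Hom.ext (MonObj.mul_one C.X)
        mul_assoc := InducedCategory.Hom.ext (MonObj.mul_assoc C.X) }
    refine ⟨C', ObjectProperty.FullSubcategory.ext ((congrArg K.operadData.obj ?_).trans hC)⟩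
    exact congrArg (fun i => @Mon.mk _ _ _ C.X i) (MonObj.ext _ _ (id_comp _))

end Unital
end LambdaOperad
end

theorem mainTheorem1 {V : Type u} [Category.{v} V] [MonoidalCategory V] [SymmetricCategory V]
    [HasColimits V] [∀ X : V, PreservesFiniteColimits (tensorLeft X)]
    [∀ X : V, PreservesColimitsOfShape (Discrete ℕ) (tensorLeft X)] :
    Nonempty (LambdaOperad.KellyMonoidal V) ∧
    ∀ K : LambdaOperad.KellyMonoidal V,
      letI := K.monoidalCategory
      (∃ h : ∀ C : Mon (LambdaOperad.LambdaSeq V),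
          LambdaOperad.isBasedOperad V (K.operadData.obj C),
        ((LambdaOperad.isBasedOperad V).lift K.operadData h :
          Mon (LambdaOperad.LambdaSeq V) ⥤ LambdaOperad.BasedOperad V).IsIso) ∧
      ∃ (_ : (LambdaOperad.isUnital V).IsMonoidal)
        (h : ∀ C : Mon (LambdaOperad.isUnital V).FullSubcategory,
          LambdaOperad.isUnitalOperad V
            (((LambdaOperad.isUnital V).ι.mapMon ⋙ K.operadData).obj C)),
        ((LambdaOperad.isUnitalOperad V).lift
            ((LambdaOperad.isUnital V).ι.mapMon ⋙ K.operadData) h :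
          Mon (LambdaOperad.isUnital V).FullSubcategory ⥤ LambdaOperad.UnitalOperad V).IsIso :=
  have : LambdaOperad.TensorCocts V := ⟨‹_›, ‹_›⟩
  ⟨⟨LambdaOperad.kellyMonoidal V⟩, fun K => ⟨⟨K.isOperad_operadData, K.isIso_lift_operadData⟩,
    K.isMonoidal_isUnital, K.isIso_lift_operadData_unital⟩⟩
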